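/- Let $\mathbb K$ be a field of characteristic zero and let $n$ be a natural number. **Graphs.** An admissible internally connected graph has external vertices $1,\dots,n$, finitely many unlabelled internal vertices, and linearly ordered edges; it has no double edges and no edge from a vertex to itself, every internal vertex is at least trivalent and is connected to an external vertex by a path, and the graph is non-empty and connected after cutting off the external vertices. Let $\mathsf{ICG}(n)$ be the space of (possibly infinite) $\mathbb K$-linear combinations of such graphs modulo $\Gamma^\sigma=\operatorname{sgn}(\sigma)\Gamma$ for permutations $\sigma$ of the order of the edges, graded by $\deg\Gamma=1-\#\text{edges}+2\,\#\text{internal vertices}$. The differential $d$ is vertex splitting: external vertices are split into an external and an internal vertex, internal vertices into two internal ones, joined by a new edge (placed last), summing over all ways to reconnect the edges and keeping only admissible graphs. An internal loop is a loop that contains no external vertex. **Special derivations.** Let $\mathrm{Ass}_n$ be the completed free associative algebra on $x_1,\dots,x_n$ and $\mathfrak{lie}_n\subset\mathrm{Ass}_n$ the completed free Lie algebra. Let $\mathfrak{sder}_n$ be the Lie algebra of derivations $u$ of $\mathfrak{lie}_n$ such that $u(x_i)=[x_i,a_i]$ for some $a_1,\dots,a_n\in\mathfrak{lie}_n$, and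 $u(\sum_i x_i)=0$. Let $\mathfrak{tr}_n=\mathrm{Ass}_n^+/\langle ab-ba\rangle$, where $\mathrm{Ass}_n^+$ is the augmentation ideal, and let $\operatorname{div}(u)=\sum_k \operatorname{tr}(x_k\,\partial_k a_k)\in\mathfrak{tr}_n$, where $a_i$ is normalized to contain no linear term in $x_i$ and $a=a_0+\sum_k(\partial_k a)x_k$ for $a\in\mathrm{Ass}_n$. Put $\mathfrak{krv}_n=\{u\in\mathfrak{sder}_n : \operatorname{div}(u)=0\}$. **Trees and derivations.** The degree $0$ graphs without internal loops are the internally trivalent trees; modulo the IHX relation (images of the loop-preserving part $d_0$ of $d$) they form $E_1^{0,0}$. The standard identification $E_1^{0,0}\cong\mathfrak{sder}_n$ sends a tree $T$ to the derivation $x_i\mapsto[x_i,a_i]$, where $a_i$ is the sum, over all edges of $T$ at the external vertex $i$, of the Lie word read off the binary tree obtained by cutting this edge and making it the root, with the sign of the permutation from the given order of the edges to the order "root edge, edges of the left subtree, edges of the right subtree" (recursively). For $k\ge1$ let $\mathfrak{krv}_n^{(k)}\subset\mathfrak{sder}_n\cong E_1^{0,0}$ be the set of those elements that are represented by the tree part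 $x_0$ of some degree $0$ element $X=x_0+x_1+x_2+\cdots\in\mathsf{ICG}(n)$, with $x_i$ a combination of graphs with exactly $i$ internal loops, such that $dX=0$ modulo $k+1$ internal loops (that is, only graphs with at least $k+1$ internal loops occur in $dX$). **Proposition.** For every $n$ and every $k\ge 1$, $\mathfrak{krv}_n^{(k)}$ is a Lie subalgebra of $\mathfrak{sder}_n$. Moreover $\mathfrak{krv}_n^{(1)}=\mathfrak{krv}_n$ and $\mathfrak{krv}_n^{(k+1)}\subset\mathfrak{krv}_n^{(k)}$ for all $k\ge1$. -/

import Mathlib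

namespace KRV

/-! ### The completed free associative algebra and the completed free Lie algebra -/

/-- The completed free associative algebra `Ass_n` over `K` on `x_1, …, x_n`: formal power series
in non-commuting variables, a series being the family of its coefficients, indexed by words. -/
def Ass (K : Type*) (n : ℕ) : Type _ := List (Fin n) → K

namespace Ass

@[ext] theorem ext {K : Type*} {n : ℕ} {f g : Ass K n} (h : ∀ w, f w = g w) : f = g := funext h

variable {K : Type*} [Field K] {n : ℕ}

instance : AddCommGroup (Ass K n) := inferInstanceAs (AddCommGroup (List (Fin n) → K))

instance : Module K (Ass K n) := inferInstanceAs (Module K (List (Fin n) → K))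

/-- The product of series: the coefficient at `w` sums over all ways to cut `w` in two. -/
instance : Mul (Ass K n) :=
  ⟨fun f g w => ∑ i ∈ Finset.range (w.length + 1), f (w.take i) * g (w.drop i)⟩

instance : One (Ass K n) := ⟨fun w => if w = [] then 1 else 0⟩

theorem add_apply (f g : Ass K n) (w : List (Fin n)) : (f + g) w = f w + g w := rfl

theorem sub_apply (f g : Ass K n) (w : List (Fin n)) : (f - g) w = f w - g w := rfl

theorem zero_apply (w : List (Fin n)) : (0 : Ass K n) w = 0 := rfl

theorem smul_apply (c : K) (f : Ass K n) (w : List (Fin n)) : (c • f) w = c * f w := rfl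

theorem one_apply (w : List (Fin n)) : (1 : Ass K n) w = if w = [] then 1 else 0 := rfl

theorem mul_apply (f g : Ass K n) (w : List (Fin n)) :
    (f * g) w = ∑ i ∈ Finset.range (w.length + 1), f (w.take i) * g (w.drop i) := rfl

theorem mul_nil (f g : Ass K n) : (f * g) [] = f [] * g [] := by
  simp [mul_apply]

/-- The series of coefficients of `f` at the words that begin with `a`. -/
def shift (a : Fin n) (f : Ass K n) : Ass K n := fun w => f (a :: w)

theorem mul_cons (f g : Ass K n) (a : Fin n) (w : List (Fin n)) :
    (f * g) (a :: w) =
      f [] * g (a :: w) + (shift a f * g) w := by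
  rw [mul_apply, mul_apply, List.length_cons, Finset.sum_range_succ', add_comm]
  simp [shift]

theorem mul_assoc' (f g h : Ass K n) : f * g * h = f * (g * h) := by
  ext w
  induction w generalizing f with
  | nil => simp only [mul_nil, mul_assoc]
  | cons a w ih =>
    have key : shift a (f * g) = f [] • shift a g + shift a f * g := by
      ext v
      rw [shift, mul_cons]; rfl
    rw [mul_cons, mul_cons f, key, mul_nil, mul_cons g, ← ih]
    simp only [mul_apply, add_apply, smul_apply, add_mul, Finset.sum_add_distrib, mul_add,
      Finset.mul_sum, mul_assoc]
    ring

instance : Ring (Ass K n) :=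
  { (inferInstance : AddCommGroup (Ass K n)) with
    mul := (· * ·)
    one := 1
    mul_assoc := mul_assoc'
    one_mul := fun f => by
      ext w
      cases w with
      | nil => simp [mul_nil, one_apply]
      | cons a w => 
        have h : shift a (1 : Ass K n) = 0 := by ext v; simp [shift, one_apply, zero_apply]
        rw [mul_cons, h]; simp [mul_apply, one_apply, zero_apply]
    mul_one := fun f => by
      ext w
      induction w generalizing f with
      | nil => simp [mul_nil, one_apply]
      | cons a w ih => rw [mul_cons, ih]; simp [one_apply, shift]
    left_distrib := fun f g h => by
      ext w; simp [mul_apply, add_apply, mul_add, Finset.sum_add_distrib]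
    right_distrib := fun f g h => by
      ext w; simp [mul_apply, add_apply, add_mul, Finset.sum_add_distrib]
    zero_mul := fun f => by ext w; simp [mul_apply, zero_apply]
    mul_zero := fun f => by ext w; simp [mul_apply, zero_apply] }

instance : Algebra K (Ass K n) :=
  Algebra.ofModule
    (fun c f g => by ext w; simp [mul_apply, smul_apply, Finset.mul_sum, mul_assoc])
    (fun c f g => by ext w; simp [mul_apply, smul_apply, Finset.mul_sum, mul_left_comm])

/-- The commutator bracket. -/
instance : LieRing (Ass K n) := LieRing.ofAssociativeRing

instance : LieAlgebra K (Ass K n) := LieAlgebra.ofAssociativeAlgebra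

/-- The generator `x_i`. -/
def X (i : Fin n) : Ass K n := fun w => if w = [i] then 1 else 0

/-- The homogeneous component of degree `m` of a series. -/
def homog (m : ℕ) : Ass K n →ₗ[K] Ass K n where
  toFun f := fun w => if w.length = m then f w else 0
  map_add' f g := by
    ext w
    change (if w.length = m then f w + g w else 0) =
      (if w.length = m then f w else 0) + (if w.length = m then g w else 0)
    split_ifs <;> simp
  map_smul' c f := by
    ext w
    change (if w.length = m then c * f w else 0) = c * (if w.length = m then f w else 0)
    split_ifs <;> simp

theorem homog_apply (m : ℕ) (f : Ass K n) (w : List (Fin n)) :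
    homog m f w = if w.length = m then f w else 0 := rfl

theorem homog_mul (m : ℕ) (f g : Ass K n) :
    homog m (f * g) = ∑ p ∈ Finset.HasAntidiagonal.antidiagonal m, homog p.1 f * homog p.2 g := by
  ext w
  have hsum : (∑ p ∈ Finset.HasAntidiagonal.antidiagonal m, homog p.1 f * homog p.2 g) w =
      ∑ p ∈ Finset.HasAntidiagonal.antidiagonal m, (homog p.1 f * homog p.2 g) w :=
    Finset.sum_apply (M := fun _ => K) w _ _
  rw [hsum, homog_apply]
  simp only [mul_apply, homog_apply]
  rw [Finset.sum_comm]
  by_cases h : w.length = m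
  · rw [if_pos h]
    refine Finset.sum_congr rfl fun i hi => ?_
    have hi' : i ≤ w.length := by simpa [Nat.lt_succ_iff] using hi
    rw [Finset.sum_eq_single (i, m - i)]
    · rw [if_pos (by rw [List.length_take, min_eq_left hi']),
        if_pos (by rw [List.length_drop, h])]
    · rintro ⟨p, q⟩ hpq hne
      rw [Finset.HasAntidiagonal.mem_antidiagonal] at hpq
      simp only at hpq
      rw [if_neg, zero_mul]
      rw [List.length_take]
      rintro rfl
      apply hne
      simp only [Prod.mk.injEq]
      omega
    · intro hn
      exact absurd (Finset.HasAntidiagonal.mem_antidiagonal.2 (by simp only; omega)) hn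
  · rw [if_neg h]
    symm
    refine Finset.sum_eq_zero fun i hi => Finset.sum_eq_zero fun p hp => ?_
    have hi' : i ≤ w.length := by simpa [Nat.lt_succ_iff] using hi
    rw [Finset.HasAntidiagonal.mem_antidiagonal] at hp
    by_cases h1 : (w.take i).length = p.1
    · rw [if_neg (c := (w.drop i).length = p.2), mul_zero]
      rw [List.length_take] at h1
      rw [List.length_drop]
      omega
    · rw [if_neg h1, zero_mul]

theorem homog_lie (m : ℕ) (f g : Ass K n) :
    homog m ⁅f, g⁆ = ∑ p ∈ Finset.HasAntidiagonal.antidiagonal m, ⁅homog p.1 f, homog p.2 g⁆ := by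
  simp only [LieRing.of_associative_ring_bracket, map_sub, homog_mul, Finset.sum_sub_distrib]
  congr 1
  exact (Finset.Nat.sum_antidiagonal_swap).symm

end Ass

/-- The Lie polynomials: the free Lie algebra generated by `x_1, …, x_n` inside `Ass_n`. -/
def liePolynomials (K : Type*) [Field K] (n : ℕ) : LieSubalgebra K (Ass K n) :=
  LieSubalgebra.lieSpan K (Ass K n) (Set.range Ass.X)

/-- The completed free Lie algebra `lie_n`: the series all of whose homogeneous components are
Lie polynomials. -/
def lie (K : Type*) [Field K] (n : ℕ) : LieSubalgebra K (Ass K n) where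
  carrier := {f | ∀ m, Ass.homog m f ∈ liePolynomials K n}
  zero_mem' m := by simp
  add_mem' hf hg m := by rw [map_add]; exact add_mem (hf m) (hg m)
  smul_mem' c f hf m := by rw [map_smul]; exact (liePolynomials K n).smul_mem c (hf m)
  lie_mem' := fun {f g} hf hg m => by
    rw [Ass.homog_lie]
    exact sum_mem fun p _ => (liePolynomials K n).lie_mem (hf p.1) (hg p.2)

/-- The generator `x_i` as an element of `lie_n`. -/
def lieX (K : Type*) [Field K] {n : ℕ} (i : Fin n) : lie K n :=
  ⟨Ass.X i, fun m => by
    have h : Ass.homog m (Ass.X i : Ass K n) = if m = 1 then Ass.X i else 0 := by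
      ext w
      by_cases hw : w = [i]
      · subst hw
        by_cases hm : m = 1
        · simp [Ass.homog_apply, hm]
        · simp [Ass.homog_apply, hm, Ne.symm hm, Ass.zero_apply]
      · by_cases hm : m = 1 <;> simp [Ass.homog_apply, Ass.X, hw, hm, Ass.zero_apply]
    rw [h]
    split_ifs
    · exact LieSubalgebra.subset_lieSpan ⟨i, rfl⟩
    · exact zero_mem _⟩

/-! ### Tangential and special derivations, divergence -/

/-- The Lie algebra `tder_n` of tangential derivations of `lie_n`: the derivations `u` with
`u(x_i) = [x_i, a_i]` for some `a_1, …, a_n ∈ lie_n`. -/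
def tder (K : Type*) [Field K] (n : ℕ) : LieSubalgebra K (LieDerivation K (lie K n) (lie K n)) where
  carrier := {u | ∃ a : Fin n → lie K n, ∀ i, u (lieX K i) = ⁅lieX K i, a i⁆}
  zero_mem' := ⟨0, fun i => by simp⟩
  add_mem' := by
    rintro u v ⟨a, ha⟩ ⟨b, hb⟩
    exact ⟨a + b, fun i => by rw [LieDerivation.add_apply, ha, hb, Pi.add_apply, lie_add]⟩
  smul_mem' := by
    rintro c u ⟨a, ha⟩
    exact ⟨c • a, fun i => by rw [LieDerivation.smul_apply, ha, Pi.smul_apply, lie_smul]⟩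
  lie_mem' := by
    rintro u v ⟨a, ha⟩ ⟨b, hb⟩
    refine ⟨fun i => u (b i) - v (a i) + ⁅a i, b i⁆, fun i => ?_⟩
    rw [LieDerivation.lie_apply, hb, ha, LieDerivation.apply_lie_eq_add,
      LieDerivation.apply_lie_eq_add, ha, hb, lie_add, lie_sub, leibniz_lie (lieX K i) (a i) (b i),
      ← lie_skew (a i) ⁅lieX K i, b i⁆]
    abel

/-- The Lie algebra `sder_n` of special derivations: the tangential derivations that kill
`x_1 + ⋯ + x_n`. -/
def sder (K : Type*) [Field K] (n : ℕ) : LieSubalgebra K (LieDerivation K (lie K n) (lie K n)) where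
  carrier := {u | u ∈ tder K n ∧ u (∑ i, lieX K i) = 0}
  zero_mem' := ⟨zero_mem _, by simp⟩
  add_mem' := by
    rintro u v ⟨hu, hu'⟩ ⟨hv, hv'⟩
    exact ⟨add_mem hu hv, by rw [LieDerivation.add_apply, hu', hv', add_zero]⟩
  smul_mem' := by
    rintro c u ⟨hu, hu'⟩
    exact ⟨(tder K n).smul_mem c hu, by rw [LieDerivation.smul_apply, hu', smul_zero]⟩
  lie_mem' := by
    rintro u v ⟨hu, hu'⟩ ⟨hv, hv'⟩
    exact ⟨(tder K n).lie_mem hu hv, by rw [LieDerivation.lie_apply, hu', hv']; simp⟩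

/-- The augmentation ideal `Ass_n⁺`: the series without constant term. -/
def AssPlus (K : Type*) [Field K] (n : ℕ) : Submodule K (Ass K n) where
  carrier := {f | f [] = 0}
  zero_mem' := rfl
  add_mem' {f g} hf hg := by
    change (f + g) [] = 0
    rw [Ass.add_apply, show f [] = 0 from hf, show g [] = 0 from hg, add_zero]
  smul_mem' c f hf := by
    change (c • f) [] = 0
    rw [Ass.smul_apply, show f [] = 0 from hf, mul_zero]

/-- The space `tr_n = Ass_n⁺ / ⟨ab - ba | a, b ∈ Ass_n⟩` of cyclic words. -/
def CyclicWords (K : Type*) [Field K] (n : ℕ) : Type _ :=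
  AssPlus K n ⧸ (Submodule.span K {c : Ass K n | ∃ a b : Ass K n, c = a * b - b * a}).comap
    (AssPlus K n).subtype

variable {K : Type*} [Field K] {n : ℕ}

instance : AddCommGroup (CyclicWords K n) := inferInstanceAs (AddCommGroup (_ ⧸ _))

instance : Module K (CyclicWords K n) := inferInstanceAs (Module K (_ ⧸ _))

/-- The projection `tr : Ass_n⁺ → tr_n`. -/
def tr : AssPlus K n →ₗ[K] CyclicWords K n := Submodule.mkQ _

/-- The operator `∂_k` in the decomposition `a = a_0 + ∑_k (∂_k a) x_k`. -/
def partialRight (k : Fin n) (f : Ass K n) : Ass K n := fun w => f (w ++ [k])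

/-- The divergence `∑_k tr(x_k (∂_k a_k))` of a tuple `(a_1, …, a_n)`. -/
def divergence (a : Fin n → lie K n) : CyclicWords K n :=
  ∑ k, tr ⟨Ass.X k * partialRight k (a k), by
    change (Ass.X k * partialRight k (a k : Ass K n) : Ass K n) [] = 0
    rw [Ass.mul_nil]; simp [Ass.X]⟩

/-- The Kashiwara-Vergne Lie algebra `krv_n`: the special derivations of divergence zero. The
derivation `x_i ↦ [x_i, a_i]` determines `a_i` up to a multiple of `x_i`; as usual the tuple used
to compute the divergence is the one in which `x_i` does not occur linearly in `a_i`. -/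
def krv (K : Type*) [Field K] (n : ℕ) : Set (sder K n) :=
  {u | ∃ a : Fin n → lie K n, (∀ i, u.1 (lieX K i) = ⁅lieX K i, a i⁆) ∧
    (∀ i, (a i).1 [i] = 0) ∧ divergence a = 0}


/-! ### Internally connected graphs -/

/-- The vertices: `inl j` is the external vertex `j`, `inr a` is an internal vertex. -/
abbrev Vertex (n v : ℕ) : Type := Fin n ⊕ Fin v

/-- A graph with `n` external vertices, `v` internal vertices (numbered for the time being) and
`e` linearly ordered edges. -/
abbrev Graph (n v e : ℕ) : Type := Fin e → Sym2 (Vertex n v)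

namespace Graph

variable {n v e : ℕ}

/-- The underlying simple graph, on all vertices. -/
def simple (Γ : Graph n v e) : SimpleGraph (Vertex n v) := SimpleGraph.fromEdgeSet (Set.range Γ)

/-- The edges incident to a vertex. -/
noncomputable def incident (Γ : Graph n v e) (x : Vertex n v) : Finset (Fin e) :=
  Finset.univ.filter fun i => x ∈ Γ i

/-- Two edges share an internal vertex. -/
def ShareInternal (Γ : Graph n v e) (i j : Fin e) : Prop := ∃ a : Fin v, .inr a ∈ Γ i ∧ .inr a ∈ Γ j

/-- Admissible, internally connected graphs. -/
structure IsICG (Γ : Graph n v e) : Prop where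
  /-- no double edges -/
  injective : Function.Injective Γ
  /-- no edge connects a vertex with itself -/
  not_isDiag : ∀ i, ¬ (Γ i).IsDiag
  /-- internal vertices are at least trivalent -/
  trivalent : ∀ a : Fin v, 3 ≤ (Γ.incident (.inr a)).card
  /-- every internal vertex is connected with an external vertex by a path -/
  reachable : ∀ a : Fin v, ∃ j : Fin n, Γ.simple.Reachable (.inr a) (.inl j)
  /-- the graph is non-empty -/
  nonempty : 0 < e
  /-- the graph is connected after cutting off the external vertices: any two edges are joined by a
  chain of edges in which successive edges share an internal vertex -/
  connected : ∀ i j, Relation.ReflTransGen Γ.ShareInternal i j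

/-- Reorder the edges by `σ` and renumber the internal vertices by `τ`. -/
def relabel (σ : Equiv.Perm (Fin e)) (τ : Equiv.Perm (Fin v)) (Γ : Graph n v e) : Graph n v e :=
  fun i => (Γ (σ i)).map (Equiv.sumCongr (Equiv.refl (Fin n)) τ)

/-- The graph formed by the internal vertices and the edges between them. -/
def internal (Γ : Graph n v e) : SimpleGraph (Fin v) := Γ.simple.comap Sum.inr

/-- The number of internal loops: the first Betti number of the internal part. -/
noncomputable def loops (Γ : Graph n v e) : ℕ :=
  Γ.internal.edgeSet.ncard + Nat.card Γ.internal.ConnectedComponent - v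

/-- Split the vertex `x`: a new internal vertex (the last one) is joined to `x` by a new edge (the
last one), and the edges in `S`, formerly incident to `x`, are reconnected to the new vertex. -/
noncomputable def split (Γ : Graph n v e) (x : Vertex n v) (S : Finset (Fin e)) :
    Graph n (v + 1) (e + 1) :=
  Fin.snoc (α := fun _ => Sym2 (Vertex n (v + 1)))
    (fun i => (Γ i).map fun y =>
      if i ∈ S ∧ y = x then .inr (Fin.last v) else Sum.map id Fin.castSucc y)
    s(Sum.map id Fin.castSucc x, .inr (Fin.last v))

/-- Relabelling as an equivalence of vertices. -/
def vertexPerm (n : ℕ) (τ : Equiv.Perm (Fin v)) : Equiv.Perm (Vertex n v) :=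
  Equiv.sumCongr (Equiv.refl (Fin n)) τ

theorem mem_relabel (σ : Equiv.Perm (Fin e)) (τ : Equiv.Perm (Fin v)) (Γ : Graph n v e)
    (i : Fin e) (x : Vertex n v) :
    vertexPerm n τ x ∈ relabel σ τ Γ i ↔ x ∈ Γ (σ i) := by
  unfold relabel
  rw [Sym2.mem_map]
  constructor
  · rintro ⟨y, hy, h⟩
    exact (vertexPerm n τ).injective h ▸ hy
  · exact fun h => ⟨x, h, rfl⟩

theorem incident_relabel (σ : Equiv.Perm (Fin e)) (τ : Equiv.Perm (Fin v)) (Γ : Graph n v e)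
    (x : Vertex n v) :
    (Γ.relabel σ τ).incident (vertexPerm n τ x) = (Γ.incident x).map σ.symm.toEmbedding := by
  ext i
  simp [incident, mem_relabel, Finset.mem_map_equiv]

theorem IsICG.relabel {Γ : Graph n v e} (h : Γ.IsICG) (σ : Equiv.Perm (Fin e))
    (τ : Equiv.Perm (Fin v)) : (Γ.relabel σ τ).IsICG where
  injective := fun i j hij =>
    σ.injective (h.injective (Sym2.map.injective (vertexPerm n τ).injective hij))
  not_isDiag i hi := h.not_isDiag (σ i)
    ((Sym2.isDiag_map (vertexPerm n τ).injective).1 hi)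
  trivalent a := by
    have := incident_relabel σ τ Γ (.inr (τ.symm a))
    have h2 : vertexPerm n τ (.inr (τ.symm a)) = .inr a := by simp [vertexPerm]
    rw [h2] at this
    rw [this, Finset.card_map]
    exact h.trivalent _
  reachable a := by
    obtain ⟨j, hj⟩ := h.reachable (τ.symm a)
    refine ⟨j, ?_⟩
    let f : Γ.simple →g (Γ.relabel σ τ).simple :=
      { toFun := vertexPerm n τ
        map_rel' := by
          rintro x y hxy
          rw [simple, SimpleGraph.fromEdgeSet_adj] at hxy ⊢
          obtain ⟨⟨i, hi⟩, hne⟩ := hxy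
          refine ⟨⟨σ.symm i, ?_⟩, (vertexPerm n τ).injective.ne hne⟩
          unfold Graph.relabel
          rw [Equiv.apply_symm_apply, hi]
          rfl }
    simpa [f, vertexPerm] using hj.map f
  nonempty := h.nonempty
  connected i j := by
    have key : ∀ p q, Relation.ReflTransGen Γ.ShareInternal p q →
        Relation.ReflTransGen (Γ.relabel σ τ).ShareInternal (σ.symm p) (σ.symm q) := by
      intro p q hpq
      refine Relation.ReflTransGen.lift σ.symm (fun p q => ?_) p q hpq
      rintro ⟨a, hp, hq⟩
      refine ⟨τ a, ?_, ?_⟩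
      · exact (mem_relabel σ τ Γ (σ.symm p) (.inr a)).2 (by simpa using hp)
      · exact (mem_relabel σ τ Γ (σ.symm q) (.inr a)).2 (by simpa using hq)
    simpa using key _ _ (h.connected (σ i) (σ j))

/-- The extension of a permutation to one more element, which is fixed. -/
def extendPerm {m : ℕ} (σ : Equiv.Perm (Fin m)) : Equiv.Perm (Fin (m + 1)) :=
  finSuccEquivLast.symm.permCongr (Equiv.optionCongr σ)

theorem extendPerm_castSucc {m : ℕ} (σ : Equiv.Perm (Fin m)) (i : Fin m) :
    extendPerm σ i.castSucc = (σ i).castSucc := by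
  simp [extendPerm, Equiv.permCongr_apply]

theorem extendPerm_last {m : ℕ} (σ : Equiv.Perm (Fin m)) :
    extendPerm σ (Fin.last m) = Fin.last m := by
  simp [extendPerm, Equiv.permCongr_apply]

theorem sign_extendPerm {m : ℕ} (σ : Equiv.Perm (Fin m)) :
    Equiv.Perm.sign (extendPerm σ) = Equiv.Perm.sign σ := by
  rw [extendPerm, Equiv.Perm.sign_permCongr, Equiv.optionCongr_sign]

theorem split_relabel (σ : Equiv.Perm (Fin e)) (τ : Equiv.Perm (Fin v)) (Γ : Graph n v e)
    (x : Vertex n v) (S : Finset (Fin e)) :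
    (Γ.relabel σ τ).split (vertexPerm n τ x) (S.map σ.symm.toEmbedding) =
      (Γ.split x S).relabel (extendPerm σ) (extendPerm τ) := by
  have hv : ∀ y : Vertex n v, Sum.map id Fin.castSucc (vertexPerm n τ y) =
      vertexPerm n (extendPerm τ) (Sum.map id Fin.castSucc y) := by
    rintro (y | y) <;> simp [vertexPerm, extendPerm_castSucc]
  have hl : (.inr (Fin.last v) : Vertex n (v + 1)) =
      vertexPerm n (extendPerm τ) (.inr (Fin.last v)) := by
    simp [vertexPerm, extendPerm_last]
  funext i
  refine Fin.lastCases ?_ (fun i => ?_) i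
  · unfold relabel split
    rw [extendPerm_last, Fin.snoc_last, Fin.snoc_last, Sym2.map_mk, hv]
    conv_lhs => rw [hl]
    rfl
  · unfold relabel split
    rw [extendPerm_castSucc, Fin.snoc_castSucc, Fin.snoc_castSucc, Sym2.map_map, Sym2.map_map]
    congr 1
    funext y
    change (if i ∈ S.map σ.symm.toEmbedding ∧ vertexPerm n τ y = vertexPerm n τ x then _
      else Sum.map id Fin.castSucc (vertexPerm n τ y)) = vertexPerm n (extendPerm τ) _
    dsimp only
    by_cases hy : σ i ∈ S ∧ y = x
    · rw [if_pos hy, if_pos ⟨by simpa using hy.1, by rw [hy.2]⟩]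
      exact hl
    · rw [if_neg hy, if_neg fun h' => hy ⟨by simpa using h'.1, (vertexPerm n τ).injective h'.2⟩, hv]

theorem isICG_relabel_iff (σ : Equiv.Perm (Fin e)) (τ : Equiv.Perm (Fin v)) (Γ : Graph n v e) :
    (Γ.relabel σ τ).IsICG ↔ Γ.IsICG := by
  refine ⟨fun h => ?_, fun h => h.relabel σ τ⟩
  have h2 := h.relabel σ.symm τ.symm
  have h3 : (Γ.relabel σ τ).relabel σ.symm τ.symm = Γ := by
    funext i
    unfold relabel
    rw [Sym2.map_map, Equiv.apply_symm_apply]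
    conv_rhs => rw [← id_eq (Γ i), ← Sym2.map_id']
    congr 1
    funext y
    rcases y with y | y <;> simp
  rwa [h3] at h2

end Graph

/-- Admissible, internally connected graphs with `n` external vertices, `v` internal vertices and
`e` ordered edges. -/
abbrev ICGraph (n v e : ℕ) : Type := {Γ : Graph n v e // Γ.IsICG}

/-- The relations: internal vertices are unlabelled, and `Γ^σ = sgn(σ) Γ` for a permutation `σ` of
the order of the edges. -/
noncomputable def relations (K : Type*) [Field K] (n v e : ℕ) : Submodule K (ICGraph n v e →₀ K) :=
  Submodule.span K {x | ∃ (Γ : ICGraph n v e) (σ : Equiv.Perm (Fin e)) (τ : Equiv.Perm (Fin v)),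
    x = Finsupp.single ⟨Γ.1.relabel σ τ, Γ.2.relabel σ τ⟩ 1 -
      Finsupp.single Γ (((Equiv.Perm.sign σ : ℤˣ) : ℤ) : K)}

/-- The part of `ICG(n)` spanned by the graphs with `v` internal vertices and `e` edges. -/
abbrev ICGPart (K : Type*) [Field K] (n v e : ℕ) : Type _ :=
  (ICGraph n v e →₀ K) ⧸ relations K n v e

section

variable (K : Type*) [Field K] {n v e : ℕ}

open Classical in
/-- The class of a graph; it is zero if the graph is not admissible or not internally connected. -/
noncomputable def cls (Γ : Graph n v e) : ICGPart K n v e :=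
  if h : Γ.IsICG then Submodule.Quotient.mk (Finsupp.single ⟨Γ, h⟩ 1) else 0

/-- The sum over all vertex splittings of a graph. The first sum splits an external vertex `j` into
`j` and an internal vertex. The second one splits an internal vertex into two; the factor `1 / 2` is
there because the two new vertices are not distinguished. -/
noncomputable def splitSum (Γ : Graph n v e) : ICGPart K n (v + 1) (e + 1) :=
  ∑ j : Fin n, ∑ S ∈ (Γ.incident (.inl j)).powerset, cls K (Γ.split (.inl j) S) +
  (1 / 2 : K) • ∑ a : Fin v, ∑ S ∈ (Γ.incident (.inr a)).powerset, cls K (Γ.split (.inr a) S)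

theorem cls_relabel (Γ : Graph n v e) (σ : Equiv.Perm (Fin e)) (τ : Equiv.Perm (Fin v)) :
    cls K (Γ.relabel σ τ) = (((Equiv.Perm.sign σ : ℤˣ) : ℤ) : K) • cls K Γ := by
  unfold cls
  by_cases h : Γ.IsICG
  · rw [dif_pos h, dif_pos (h.relabel σ τ), ← Submodule.Quotient.mk_smul, Submodule.Quotient.eq,
      Finsupp.smul_single, smul_eq_mul, mul_one]
    exact Submodule.subset_span ⟨⟨Γ, h⟩, σ, τ, rfl⟩
  · rw [dif_neg h, dif_neg fun h' => h ((Graph.isICG_relabel_iff σ τ Γ).1 h'), smul_zero]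

theorem sum_split_relabel (Γ : Graph n v e) (σ : Equiv.Perm (Fin e)) (τ : Equiv.Perm (Fin v))
    (x : Vertex n v) :
    ∑ S ∈ ((Γ.relabel σ τ).incident (Graph.vertexPerm n τ x)).powerset,
        cls K ((Γ.relabel σ τ).split (Graph.vertexPerm n τ x) S) =
      (((Equiv.Perm.sign σ : ℤˣ) : ℤ) : K) •
        ∑ S ∈ (Γ.incident x).powerset, cls K (Γ.split x S) := by
  rw [Graph.incident_relabel, Finset.smul_sum]
  symm
  refine Finset.sum_bij (fun S _ => S.map σ.symm.toEmbedding) ?_ ?_ ?_ ?_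
  · intro S hS
    rw [Finset.mem_powerset] at hS ⊢
    exact Finset.map_subset_map.2 hS
  · intro S _ T _ h
    exact Finset.map_injective _ h
  · intro T hT
    rw [Finset.mem_powerset] at hT
    obtain ⟨S, hS, rfl⟩ := Finset.subset_map_iff.1 hT
    exact ⟨S, Finset.mem_powerset.2 hS, rfl⟩
  · intro S _
    rw [Graph.split_relabel, cls_relabel, Graph.sign_extendPerm]

theorem splitSum_relabel (Γ : Graph n v e) (σ : Equiv.Perm (Fin e)) (τ : Equiv.Perm (Fin v)) :
    splitSum K (Γ.relabel σ τ) = (((Equiv.Perm.sign σ : ℤˣ) : ℤ) : K) • splitSum K Γ := by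
  unfold splitSum
  rw [smul_add, smul_comm _ (1 / 2 : K)]
  congr 1
  · rw [Finset.smul_sum]
    exact Finset.sum_congr rfl fun j _ => sum_split_relabel K Γ σ τ (.inl j)
  · congr 1
    rw [Finset.smul_sum, ← Equiv.sum_comp τ]
    exact Finset.sum_congr rfl fun a _ => sum_split_relabel K Γ σ τ (.inr a)

/-- The differential of `ICG(n)`, vertex splitting, on graphs with `v` internal vertices and `e`
edges. -/
noncomputable def dPart (n v e : ℕ) : ICGPart K n v e →ₗ[K] ICGPart K n (v + 1) (e + 1) :=
  (relations K n v e).liftQ (Finsupp.linearCombination K fun Γ : ICGraph n v e => splitSum K Γ.1) <| by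
    rw [relations, Submodule.span_le]
    rintro _ ⟨Γ, σ, τ, rfl⟩
    simp [splitSum_relabel]

/-- The complex `ICG(n)`: the (possibly infinite) linear combinations of admissible internally
connected graphs with `n` external vertices, modulo the sign relations. -/
abbrev ICG (n : ℕ) : Type _ := ∀ v e : ℕ, ICGPart K n v e

/-- The differential of `ICG(n)`. -/
noncomputable def d {n : ℕ} (x : ICG K n) : ICG K n
  | 0, _ => 0
  | _ + 1, 0 => 0
  | v + 1, e + 1 => dPart K n v e (x v e)

variable {K}

/-- `x` is homogeneous of degree `q`, where `deg Γ = 1 - #edges + 2 #internal vertices`. -/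
def HasDegree {n : ℕ} (x : ICG K n) (q : ℤ) : Prop :=
  ∀ v e : ℕ, x v e ≠ 0 → 1 - (e : ℤ) + 2 * (v : ℤ) = q

variable (K) in
/-- The span of the graphs with at least `p` internal loops, for fixed numbers of vertices and
edges. -/
noncomputable def filtrationPart (p n v e : ℕ) : Submodule K (ICGPart K n v e) :=
  Submodule.span K {y | ∃ Γ : ICGraph n v e, p ≤ Γ.1.loops ∧ y = cls K Γ.1}

/-- `x` lies in `F^p ICG(n)`: all graphs in `x` have at least `p` internal loops. In other words,
`x = 0` modulo `p` internal loops. -/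
def InFiltration {n : ℕ} (p : ℕ) (x : ICG K n) : Prop :=
  ∀ v e : ℕ, x v e ∈ filtrationPart K p n v e

end

/-! ### From internally trivalent trees to special derivations -/

/-- Rooted planar binary trees; every node and every leaf carries the number of the edge that leads
to it from the side of the root, and every leaf carries an external vertex. -/
inductive PlanarTree (n e : ℕ) : Type
  | leaf (r : Fin e) (j : Fin n) : PlanarTree n e
  | node (r : Fin e) (left right : PlanarTree n e) : PlanarTree n e

namespace PlanarTree

variable {n e : ℕ}

/-- The edges: first the root edge, then those of the left subtree, then those of the right one. -/
def edges : PlanarTree n e → List (Fin e)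
  | leaf r _ => [r]
  | node r s t => r :: (s.edges ++ t.edges)

/-- The Lie word of a tree. -/
noncomputable def lieWord (K : Type*) [Field K] : PlanarTree n e → Ass K n
  | leaf _ j => Ass.X j
  | node _ s t => ⁅s.lieWord K, t.lieWord K⁆

end PlanarTree

/-- The sign of a list of distinct elements: `-1` to the number of inversions. -/
def listSign {e : ℕ} : List (Fin e) → ℤ
  | [] => 1
  | a :: l => (-1) ^ (l.countP fun b => b < a) * listSign l

namespace Graph

variable {n v e : ℕ}

open Classical in
/-- The endpoint of the edge `r` that is different from `x`. -/
noncomputable def otherEnd (Γ : Graph n v e) (r : Fin e) (x : Vertex n v) : Vertex n v :=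
  if h : x ∈ Γ r then Sym2.Mem.other h else x

/-- Cut the edge `r` and read the part of the graph on the side of its endpoint `x` as a rooted
planar binary tree with root edge `r`. External vertices are leaves; at an internal vertex, which
has to be trivalent, the two remaining edges lead to the left and to the right subtree. The first
argument bounds the height. -/
noncomputable def readTree (Γ : Graph n v e) : ℕ → Fin e → Vertex n v → Option (PlanarTree n e)
  | 0, _, _ => none
  | _ + 1, r, .inl j => some (.leaf r j)
  | h + 1, r, .inr a =>
    match ((Γ.incident (.inr a)).erase r).sort with
    | [p, q] =>
      match Γ.readTree h p (Γ.otherEnd p (.inr a)), Γ.readTree h q (Γ.otherEnd q (.inr a)) with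
      | some s, some t => some (.node r s t)
      | _, _ => none
    | _ => none

/-- The `i`-th component of the tuple of Lie series attached to an internally trivalent tree: sum
over all edges `r` at the external vertex `i` the Lie word of the tree rooted at `r`, with the sign
that compares the order of its edges with the given one. -/
noncomputable def lieSeries (K : Type*) [Field K] (Γ : Graph n v e) (i : Fin n) : Ass K n :=
  ∑ r ∈ Γ.incident (.inl i),
    match Γ.readTree e r (Γ.otherEnd r (.inl i)) with
    | some t => ((listSign t.edges : ℤ) : K) • t.lieWord K
    | none => 0

end Graph

section

variable {K : Type*} [Field K] {n : ℕ}

/-- Families of linear combinations of graphs of degree `0`, one for every number `v` of internal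
vertices (so that there are `2 v + 1` edges): representatives of degree `0` elements of `ICG(n)`. -/
abbrev Degree0Rep (K : Type*) [Field K] (n : ℕ) : Type _ := ∀ v : ℕ, ICGraph n v (2 * v + 1) →₀ K

/-- Only trees, i.e. graphs without internal loops, occur. In degree `0` they are automatically
internally trivalent. -/
def Degree0Rep.IsTree (t : Degree0Rep K n) : Prop := ∀ v, ∀ Γ ∈ (t v).support, Γ.1.loops = 0

/-- The `i`-th component of the tuple of Lie series attached to a combination of trees. The part
with `v` internal vertices contributes in degree `v + 1`. -/
noncomputable def Degree0Rep.lieSeries (t : Degree0Rep K n) (i : Fin n) : Ass K n := fun w =>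
  match w.length with
  | 0 => 0
  | v + 1 => ((t v).sum fun Γ c => c • Γ.1.lieSeries K i : Ass K n) w

/-- `t` represents the tree part `x_0` in the decomposition `x = x_0 + x_1 + x_2 + ⋯` of a degree `0`
element `x` by the number of internal loops. -/
def Degree0Rep.IsTreePartOf (t : Degree0Rep K n) (x : ICG K n) : Prop :=
  t.IsTree ∧ ∀ v, x v (2 * v + 1) - Submodule.Quotient.mk (t v) ∈
    filtrationPart K 1 n v (2 * v + 1)

/-- The isomorphism between `E_1^{0,0}`, the internally trivalent trees modulo the `IHX` relation,
and `sder_n`: the class of `t` corresponds to the derivation `x_i ↦ [x_i, a_i]`, where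
`(a_1, …, a_n)` is the tuple of Lie series attached to `t`. -/
def Degree0Rep.Represents (t : Degree0Rep K n) (u : sder K n) : Prop :=
  ∀ i, ((u.1 (lieX K i) : lie K n) : Ass K n) = ⁅(Ass.X i : Ass K n), t.lieSeries i⁆

/-- `krv_n^{(k)} ⊆ sder_n ≅ E_1^{0,0}`: the classes of those tree combinations `x_0` which extend to
an element `x = x_0 + x_1 + x_2 + ⋯` of degree `0` of `ICG(n)`, with `x_i` having exactly `i` internal
loops, such that `d x = 0` modulo `k + 1` internal loops. -/
def krvLevel (K : Type*) [Field K] (n k : ℕ) : Set (sder K n) :=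
  {u | ∃ (x : ICG K n) (t : Degree0Rep K n), HasDegree x 0 ∧ InFiltration (k + 1) (d K x) ∧
    t.IsTreePartOf x ∧ t.Represents u}

end

end KRV

/-!
The level sets are first described without representatives (`mem_krvLevel_iff`): a special derivation
belongs to the level `k` if it is given by the tree part of a degree zero element `x` all of whose
boundary lies in the part of `ICG(n)` with at least `k + 1` internal loops. The inclusion of each
level in the preceding one is then the monotonicity of the loop filtration.

*Special derivations.* If `∑ [x_i, a_i] = 0` with Lie series `a_i`, then `∂_j a_i` is the image of
`∂_i a_j` under the antipode (`partialRight_eq_antipode`). A derivation acts on Lie series through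
these partial derivatives, so that the bracket of special derivations becomes an explicit operation on
tuples (`sder_bracket`). On the side of graphs, moving the root of a tree to another leaf is also
given by the antipode of a partial derivative of its Lie word (`LTree.reroot_eq`), so the Lie word at
one root determines the Lie series at all external vertices (`graft`,
`LTree.TreeAt.lieSeries_eq_graft`).

*Lie subalgebras.* The differential squares to zero even for graphs that need not be admissible
(`Graph.sum_splitSum_split`). Applied to the disjoint product of two graphs, whose splittings are
admissible only if they connect the two factors, this produces a bracket (`Graph.bra`) for which the
differential is a derivation (`Graph.dPart_bra`). The bracket respects the number of internal loops,
and on trees it is the bracket of special derivations (`totalSeries_braZero`). Hence the level sets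
are closed under brackets.

*Level one.* The differential of a trivalent tree has exactly one loop in those terms which split off
two edges at an external vertex `j`. The result is a loop with hairs: the path between the two
edges, with the subtrees along it and a new hair labelled `j`. The product of the Lie words of the
hairs is a term of `x_j ∂_j a_j`, and summing over all pairs of edges gives half the divergence
(`sum_split_pair_eq`, `dPart_eq`).

If the boundary of `x` vanishes modulo two loops, the part of `x` with one loop must compensate this.
The cyclic word of a loop with hairs, antisymmetrized because the loop has no preferred direction, is
well defined up to the order of the edges, and it vanishes on boundaries of graphs with loops by the
Jacobi identity (`Graph.sum_loopValue_split`). So the antisymmetrized divergence vanishes. By the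
symmetry of special derivations nothing is lost in the antisymmetrization
(`dihedralSum_divergenceSeries`), and the divergence itself is zero.

Conversely, every special derivation comes from trees: by the Euler relation Lie series are
combinations of iterated brackets, and the sum over all roots counts each tree with `v` internal
vertices `v + 2` times (`exists_treeSeries_eq`). Modulo two loops and boundaries of graphs with loops,
the IHX relation resolves hairs until they are single edges, so a graph with one loop is determined
by its cyclic word (`HairyChain.LoopAt.map_cls_eq`). If the divergence is zero, the boundary of the
trees is therefore cancelled by the boundary of graphs with loops (`exists_dPart_sub_mem`).
-/

namespace KRV

/-! ### Series in non-commuting variables -/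

namespace Ass

variable {K : Type*} [Field K] {n : ℕ}

theorem neg_apply (f : Ass K n) (w : List (Fin n)) : (-f) w = -f w := rfl

theorem sum_apply {ι : Type*} (s : Finset ι) (f : ι → Ass K n) (w : List (Fin n)) :
    (∑ i ∈ s, f i) w = ∑ i ∈ s, f i w :=
  Finset.sum_apply (M := fun _ => K) w s f

/-- `shift` as a linear map. -/
def shiftL (i : Fin n) : Ass K n →ₗ[K] Ass K n where
  toFun f := shift i f
  map_add' _ _ := rfl
  map_smul' _ _ := rfl

theorem shiftL_apply (i : Fin n) (f : Ass K n) : shiftL i f = shift i f := rfl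

theorem shift_apply (i : Fin n) (f : Ass K n) (w : List (Fin n)) : shift i f w = f (i :: w) := rfl

/-- `partialRight` as a linear map. -/
def partialRightL (i : Fin n) : Ass K n →ₗ[K] Ass K n where
  toFun f := partialRight i f
  map_add' _ _ := rfl
  map_smul' _ _ := rfl

theorem partialRightL_apply (i : Fin n) (f : Ass K n) : partialRightL i f = partialRight i f := rfl

theorem partialRight_apply (i : Fin n) (f : Ass K n) (w : List (Fin n)) :
    partialRight i f w = f (w ++ [i]) := rfl

theorem X_nil (i : Fin n) : (X i : Ass K n) [] = 0 := by simp [X]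

theorem shift_X (i j : Fin n) : shift j (X i : Ass K n) = if j = i then 1 else 0 := by
  ext w
  by_cases h : j = i
  · simp [shift, X, one_apply, h]
  · simp [shift, X, h, zero_apply]

theorem shift_one (j : Fin n) : shift j (1 : Ass K n) = 0 := by
  ext w; simp [shift, one_apply, zero_apply]

theorem shift_mul (j : Fin n) (f g : Ass K n) :
    shift j (f * g) = f [] • shift j g + shift j f * g := by
  ext w
  rw [shift, mul_cons]; rfl

theorem X_mul_nil (i : Fin n) (f : Ass K n) : (X i * f : Ass K n) [] = 0 := by simp [mul_nil, X_nil]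

theorem mul_X_nil (i : Fin n) (f : Ass K n) : (f * X i : Ass K n) [] = 0 := by simp [mul_nil, X_nil]

theorem X_mul_cons (i j : Fin n) (f : Ass K n) (w : List (Fin n)) :
    (X i * f : Ass K n) (j :: w) = if j = i then f w else 0 := by
  rw [mul_cons, X_nil, zero_mul, zero_add, shift_X]
  split_ifs
  · rw [one_mul]
  · rw [zero_mul, zero_apply]

theorem shift_X_mul (i j : Fin n) (f : Ass K n) :
    shift j (X i * f) = if j = i then f else 0 := by
  ext w
  rw [shift, X_mul_cons]
  split_ifs <;> rfl

theorem partialRight_mul (k : Fin n) (f g : Ass K n) :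
    partialRight k (f * g) = f * partialRight k g + g [] • partialRight k f := by
  ext w
  rw [partialRight_apply, mul_apply, List.length_append, List.length_singleton,
    Finset.sum_range_succ, add_apply, smul_apply, mul_apply]
  congr 1
  · refine Finset.sum_congr rfl fun i hi => ?_
    have hi' : i ≤ w.length := by simpa [Nat.lt_succ_iff] using hi
    rw [List.take_append_of_le_length hi', List.drop_append_of_le_length hi', partialRight_apply]
  · rw [List.take_of_length_le (by simp), List.drop_of_length_le (by simp), mul_comm]; rfl

theorem partialRight_X (i j : Fin n) : partialRight j (X i : Ass K n) = if j = i then 1 else 0 := by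
  ext w
  by_cases h : j = i
  · subst h; cases w <;> simp [partialRight, X, one_apply]
  · cases w <;> simp [partialRight, X, h, zero_apply]

theorem mul_X_append (i j : Fin n) (f : Ass K n) (w : List (Fin n)) :
    (f * X i : Ass K n) (w ++ [j]) = if j = i then f w else 0 := by
  have h := congrFun (partialRight_mul j f (X i)) w
  rw [partialRight_apply] at h
  rw [h, X_nil, zero_smul, add_zero, partialRight_X]
  split_ifs
  · rw [mul_one]
  · rw [mul_zero, zero_apply]

/-! ### Agreement of series up to a given length -/

/-- The series agree at all words of length at most `L`. -/
def AgreeTo (L : ℕ) (f g : Ass K n) : Prop := ∀ w : List (Fin n), w.length ≤ L → f w = g w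

theorem AgreeTo.symm {L : ℕ} {f g : Ass K n} (h : AgreeTo L f g) : AgreeTo L g f :=
  fun w hw => (h w hw).symm

theorem AgreeTo.refl (L : ℕ) (f : Ass K n) : AgreeTo L f f := fun _ _ => rfl

theorem AgreeTo.mul {L : ℕ} {f f' g g' : Ass K n} (hf : AgreeTo L f f') (hg : AgreeTo L g g') :
    AgreeTo L (f * g) (f' * g') := by
  intro w hw
  rw [mul_apply, mul_apply]
  refine Finset.sum_congr rfl fun i _ => ?_
  rw [hf (w.take i) (by rw [List.length_take]; omega),
    hg (w.drop i) (by rw [List.length_drop]; omega)]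

theorem AgreeTo.sub {L : ℕ} {f f' g g' : Ass K n} (hf : AgreeTo L f f') (hg : AgreeTo L g g') :
    AgreeTo L (f - g) (f' - g') := by
  intro w hw
  rw [sub_apply, sub_apply, hf w hw, hg w hw]

theorem AgreeTo.sum {ι : Type*} {s : Finset ι} {L : ℕ} {f g : ι → Ass K n}
    (h : ∀ i ∈ s, AgreeTo L (f i) (g i)) : AgreeTo L (∑ i ∈ s, f i) (∑ i ∈ s, g i) := by
  intro w hw
  rw [sum_apply, sum_apply]
  exact Finset.sum_congr rfl fun i hi => h i hi w hw

theorem AgreeTo.lie {L : ℕ} {f f' g g' : Ass K n} (hf : AgreeTo L f f') (hg : AgreeTo L g g') :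
    AgreeTo L ⁅f, g⁆ ⁅f', g'⁆ := by
  rw [LieRing.of_associative_ring_bracket, LieRing.of_associative_ring_bracket]
  exact (hf.mul hg).sub (hg.mul hf)

theorem AgreeTo.mul_succ {L : ℕ} {f g g' : Ass K n} (hf : f [] = 0) (hg : AgreeTo L g g') :
    AgreeTo (L + 1) (f * g) (f * g') := by
  intro w hw
  cases w with
  | nil => rw [mul_nil, mul_nil, hf, zero_mul, zero_mul]
  | cons a w =>
    rw [mul_cons, mul_cons, hf, zero_mul, zero_mul]
    rw [((AgreeTo.refl w.length _).mul fun u hu => hg u (by simp at hw; omega)) w le_rfl]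

theorem AgreeTo.succ_mul {L : ℕ} {f g g' : Ass K n} (hf : f [] = 0) (hg : AgreeTo L g g') :
    AgreeTo (L + 1) (g * f) (g' * f) := by
  intro w hw
  rw [mul_apply, mul_apply]
  refine Finset.sum_congr rfl fun i hi => ?_
  by_cases h : i ≤ L
  · rw [hg (w.take i) (by rw [List.length_take]; omega)]
  · rw [List.drop_of_length_le (by omega), hf, mul_zero, mul_zero]

theorem AgreeTo.lie_succ {L : ℕ} {f g g' : Ass K n} (hf : f [] = 0) (hg : AgreeTo L g g') :
    AgreeTo (L + 1) ⁅f, g⁆ ⁅f, g'⁆ := by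
  rw [LieRing.of_associative_ring_bracket, LieRing.of_associative_ring_bracket]
  exact (AgreeTo.mul_succ hf hg).sub (AgreeTo.succ_mul hf hg)

/-- The sum of the homogeneous components of degree at most `L`. -/
def truncate (L : ℕ) (f : Ass K n) : Ass K n := ∑ m ∈ Finset.range (L + 1), homog m f

theorem agreeTo_truncate (L : ℕ) (f : Ass K n) : AgreeTo L f (truncate L f) := by
  intro w hw
  rw [truncate, sum_apply, Finset.sum_eq_single w.length]
  · rw [homog_apply, if_pos rfl]
  · intro m _ hm
    rw [homog_apply, if_neg hm.symm]
  · intro h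
    exact absurd (Finset.mem_range.2 (by omega)) h

/-! ### The antipode -/

/-- The antipode of `Ass_n`: reverse the words and multiply with `-1` to the length. -/
def antipode : Ass K n →ₗ[K] Ass K n where
  toFun f := fun w => (-1) ^ w.length * f w.reverse
  map_add' f g := by
    ext w
    change (-1) ^ w.length * (f w.reverse + g w.reverse) = _ * f w.reverse + _ * g w.reverse
    ring
  map_smul' c f := by
    ext w
    change (-1) ^ w.length * (c * f w.reverse) = c * (_ * f w.reverse)
    ring

theorem antipode_apply (f : Ass K n) (w : List (Fin n)) :
    antipode f w = (-1) ^ w.length * f w.reverse := rfl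

theorem antipode_antipode (f : Ass K n) : antipode (antipode f) = f := by
  ext w
  rw [antipode_apply, antipode_apply, List.reverse_reverse, List.length_reverse, ← mul_assoc,
    ← mul_pow]
  simp

theorem antipode_mul (f g : Ass K n) : antipode (f * g) = antipode g * antipode f := by
  ext w
  rw [antipode_apply, mul_apply, mul_apply, List.length_reverse, ← Finset.sum_range_reflect,
    Finset.mul_sum]
  refine Finset.sum_congr rfl fun i hi => ?_
  have hi' : i ≤ w.length := by simpa [Nat.lt_succ_iff] using hi
  rw [antipode_apply, antipode_apply, List.length_take, List.length_drop, min_eq_left hi',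
    List.reverse_take, List.reverse_drop, show w.length + 1 - 1 - i = w.length - i by omega]
  have h : ((-1 : K)) ^ w.length = (-1) ^ i * (-1) ^ (w.length - i) := by
    rw [← pow_add]; congr 1; omega
  rw [h]; ring

theorem antipode_X (i : Fin n) : antipode (X i : Ass K n) = -X i := by
  ext w
  rw [antipode_apply, neg_apply]
  by_cases h : w = [i]
  · subst h; simp [X]
  · have h2 : w.reverse ≠ [i] := fun h' => h (by rw [← w.reverse_reverse, h']; rfl)
    simp [X, h, h2]

theorem antipode_lie (f g : Ass K n) : antipode ⁅f, g⁆ = -⁅antipode f, antipode g⁆ := by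
  rw [LieRing.of_associative_ring_bracket, LieRing.of_associative_ring_bracket, map_sub,
    antipode_mul, antipode_mul]
  abel

end Ass

open Ass

variable {K : Type*} [Field K] {n : ℕ}

theorem antipode_of_mem_liePolynomials {p : Ass K n} (hp : p ∈ liePolynomials K n) :
    antipode p = -p := by
  refine LieSubalgebra.lieSpan_induction (R := K) (p := fun (p : Ass K n) _ => antipode p = -p) ?_ ?_ ?_ ?_ ?_ hp
  · rintro _ ⟨i, rfl⟩
    exact antipode_X i
  · simp
  · intro x y _ _ hx hy
    rw [map_add, hx, hy]; abel
  · intro c x _ hx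
    rw [map_smul, hx, smul_neg]
  · intro x y _ _ hx hy
    rw [antipode_lie, hx, hy, neg_lie, lie_neg, neg_neg]

theorem truncate_mem {f : Ass K n} (hf : f ∈ lie K n) (L : ℕ) :
    truncate L f ∈ liePolynomials K n :=
  sum_mem fun m _ => hf m

theorem antipode_of_mem_lie {p : Ass K n} (hp : p ∈ lie K n) : antipode p = -p := by
  ext w
  have h := congrFun (antipode_of_mem_liePolynomials (truncate_mem hp w.length)) w
  rw [Ass.neg_apply, ← agreeTo_truncate _ _ _ le_rfl] at h
  rw [Ass.neg_apply, ← h, antipode_apply, antipode_apply,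
    agreeTo_truncate w.length p _ (by simp)]

theorem liePolynomials_nil {p : Ass K n} (hp : p ∈ liePolynomials K n) : p [] = 0 := by
  refine LieSubalgebra.lieSpan_induction (R := K) (p := fun (p : Ass K n) _ => p [] = 0) ?_ ?_ ?_ ?_ ?_ hp
  · rintro _ ⟨i, rfl⟩
    exact X_nil i
  · rfl
  · intro x y _ _ hx hy
    rw [Ass.add_apply, hx, hy, add_zero]
  · intro c x _ hx
    rw [Ass.smul_apply, hx, mul_zero]
  · intro x y _ _ hx hy
    rw [LieRing.of_associative_ring_bracket, Ass.sub_apply, mul_nil, mul_nil, hx, hy]; simp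

theorem lie_nil {p : Ass K n} (hp : p ∈ lie K n) : p [] = 0 := by
  rw [agreeTo_truncate 0 p [] le_rfl]
  exact liePolynomials_nil (truncate_mem hp 0)

theorem liePolynomials_le_lie {p : Ass K n} (hp : p ∈ liePolynomials K n) : p ∈ lie K n := by
  have h : liePolynomials K n ≤ lie K n :=
    LieSubalgebra.lieSpan_le.2 (by rintro _ ⟨i, rfl⟩; exact (lieX K i).2)
  exact h hp

theorem X_mem_liePolynomials (i : Fin n) : (X i : Ass K n) ∈ liePolynomials K n :=
  LieSubalgebra.subset_lieSpan ⟨i, rfl⟩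

/-! ### The adjoint action of series -/

namespace Ass

/-- The adjoint action of the homogeneous component of degree `l` of `P`: the sum of
`P w • ⁅x_{w_1}, ⁅x_{w_2}, …, y⁆⁆` over the words `w` of length `l`. -/
def adPart : ℕ → Ass K n → Ass K n → Ass K n
  | 0, P, y => P [] • y
  | l + 1, P, y => ∑ i, ⁅(X i : Ass K n), adPart l (shift i P) y⁆

theorem adPart_add_left (l : ℕ) (P Q y : Ass K n) :
    adPart l (P + Q) y = adPart l P y + adPart l Q y := by
  induction l generalizing P Q with
  | zero => rw [adPart, add_apply, add_smul]; rfl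
  | succ l ih =>
    simp only [adPart]
    rw [← Finset.sum_add_distrib]
    refine Finset.sum_congr rfl fun i _ => ?_
    rw [← lie_add, ← ih]; rfl

theorem adPart_smul_left (l : ℕ) (c : K) (P y : Ass K n) :
    adPart l (c • P) y = c • adPart l P y := by
  induction l generalizing P with
  | zero => rw [adPart, smul_apply, mul_smul]; rfl
  | succ l ih =>
    simp only [adPart]
    rw [Finset.smul_sum]
    refine Finset.sum_congr rfl fun i _ => ?_
    rw [← lie_smul, ← ih]; rfl

theorem adPart_add_right (l : ℕ) (P y z : Ass K n) :
    adPart l P (y + z) = adPart l P y + adPart l P z := by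
  induction l generalizing P with
  | zero => rw [adPart, smul_add]; rfl
  | succ l ih =>
    simp only [adPart]
    rw [← Finset.sum_add_distrib]
    exact Finset.sum_congr rfl fun i _ => by rw [← lie_add, ← ih]

theorem adPart_smul_right (l : ℕ) (c : K) (P y : Ass K n) :
    adPart l P (c • y) = c • adPart l P y := by
  induction l generalizing P with
  | zero => rw [adPart, smul_comm]; rfl
  | succ l ih =>
    simp only [adPart]
    rw [Finset.smul_sum]
    exact Finset.sum_congr rfl fun i _ => by rw [← lie_smul, ← ih]

theorem adPart_vanish (l : ℕ) (P y : Ass K n) (w : List (Fin n)) (h : w.length < l) :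
    adPart l P y w = 0 := by
  induction l generalizing P w with
  | zero => omega
  | succ l ih =>
    simp only [adPart]
    rw [sum_apply]
    refine Finset.sum_eq_zero fun i _ => ?_
    rcases l with _ | l
    · obtain rfl : w = [] := List.length_eq_zero_iff.1 (by omega)
      rw [LieRing.of_associative_ring_bracket, sub_apply, X_mul_nil, mul_X_nil, sub_zero]
    · have h0 : AgreeTo l (adPart (l + 1) (shift i P) y) (0 : Ass K n) := fun u hu => ih _ u (by omega)
      rw [AgreeTo.lie_succ (X_nil i) h0 w (by omega), lie_zero, zero_apply]

theorem adPart_agree (l L : ℕ) {P Q : Ass K n} (y : Ass K n) (h : AgreeTo L P Q) (hl : l ≤ L) :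
    adPart l P y = adPart l Q y := by
  induction l generalizing P Q L with
  | zero => rw [adPart, adPart, h [] (by simp)]
  | succ l ih =>
    simp only [adPart]
    refine Finset.sum_congr rfl fun i _ => ?_
    rw [ih (P := shift i P) (Q := shift i Q) (L - 1)
      (fun w hw => h (i :: w) (by simp; omega)) (by omega)]

theorem adPart_agree_right (l L : ℕ) (P : Ass K n) {y z : Ass K n} (h : AgreeTo L y z) :
    AgreeTo L (adPart l P y) (adPart l P z) := by
  induction l generalizing P with
  | zero => intro w hw; simp only [adPart]; rw [smul_apply, smul_apply, h w hw]
  | succ l ih =>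
    simp only [adPart]
    exact AgreeTo.sum fun i _ => (AgreeTo.refl _ _).lie (ih _)

/-- The adjoint action of a series: the sum of `P w • ⁅x_{w_1}, ⁅x_{w_2}, …, y⁆⁆` over all
words `w`. Only the words `w` of length at most `u.length` contribute to the coefficient at `u`. -/
def adop (P y : Ass K n) : Ass K n :=
  fun u => ∑ l ∈ Finset.range (u.length + 1), adPart l P y u

theorem adop_eq (P y : Ass K n) (N : ℕ) (u : List (Fin n)) (h : u.length < N) :
    adop P y u = (∑ l ∈ Finset.range N, adPart l P y) u := by
  rw [sum_apply, adop]
  refine Finset.sum_subset (fun x hx => ?_) fun l _ hl => ?_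
  · simp only [Finset.mem_range] at hx ⊢; omega
  · simp only [Finset.mem_range] at hl
    exact adPart_vanish l P y u (by omega)

theorem adop_agreeTo_sum (P y : Ass K n) (N : ℕ) :
    AgreeTo N (adop P y) (∑ l ∈ Finset.range (N + 1), adPart l P y) :=
  fun u hu => adop_eq P y _ u (by omega)

/-- The adjoint action as a bilinear map. -/
def adopL : Ass K n →ₗ[K] Ass K n →ₗ[K] Ass K n :=
  LinearMap.mk₂ K adop
    (fun P Q y => by
      ext u
      rw [add_apply]
      simp only [adop, adPart_add_left, add_apply, Finset.sum_add_distrib])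
    (fun c P y => by
      ext u
      rw [smul_apply]
      simp only [adop, adPart_smul_left, smul_apply, Finset.mul_sum])
    (fun P y z => by
      ext u
      rw [add_apply]
      simp only [adop, adPart_add_right, add_apply, Finset.sum_add_distrib])
    (fun c P y => by
      ext u
      rw [smul_apply]
      simp only [adop, adPart_smul_right, smul_apply, Finset.mul_sum])

theorem adopL_apply (P y : Ass K n) : adopL P y = adop P y := rfl

theorem adop_add_left (P Q y : Ass K n) : adop (P + Q) y = adop P y + adop Q y :=
  LinearMap.map_add₂ adopL P Q y

theorem adop_sub_left (P Q y : Ass K n) : adop (P - Q) y = adop P y - adop Q y :=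
  LinearMap.map_sub₂ adopL P Q y

theorem adop_neg_left (P y : Ass K n) : adop (-P) y = -adop P y :=
  LinearMap.map_neg₂ adopL P y

theorem adop_smul_left (c : K) (P y : Ass K n) : adop (c • P) y = c • adop P y :=
  LinearMap.map_smul₂ adopL c P y

theorem adop_zero_left (y : Ass K n) : adop 0 y = 0 :=
  LinearMap.map_zero₂ adopL y

theorem adop_agree {L : ℕ} {P Q y z : Ass K n} (h : AgreeTo L P Q) (h' : AgreeTo L y z) :
    AgreeTo L (adop P y) (adop Q z) := by
  intro u hu
  refine Finset.sum_congr rfl fun l hl => ?_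
  rw [adPart_agree l L y h (by simp only [Finset.mem_range] at hl; omega)]
  exact adPart_agree_right l L Q h' u hu

theorem adop_one (y : Ass K n) : adop 1 y = y := by
  ext u
  rw [adop, Finset.sum_range_succ']
  have h : ∀ l, adPart (l + 1) (1 : Ass K n) y u = 0 := by
    intro l
    simp only [adPart, shift_one]
    rw [Finset.sum_eq_zero fun i _ => ?_]; rfl
    have : adPart l (0 : Ass K n) y = 0 := by
      simpa using adPart_smul_left l (0 : K) 0 y
    rw [this, lie_zero]
  rw [Finset.sum_eq_zero fun l _ => h l, zero_add, adPart, one_apply, if_pos rfl, one_smul]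

theorem adop_expand (P y : Ass K n) :
    adop P y = P [] • y + ∑ i, ⁅(X i : Ass K n), adop (shift i P) y⁆ := by
  ext u
  rw [adop, Finset.sum_range_succ', add_apply, add_comm]
  congr 1
  rw [← sum_apply]
  have : ∀ l, adPart (l + 1) P y = ∑ i, ⁅(X i : Ass K n), adPart l (shift i P) y⁆ := fun _ => rfl
  simp only [this]
  rw [Finset.sum_comm, sum_apply, sum_apply]
  refine Finset.sum_congr rfl fun i _ => ?_
  rw [← lie_sum]
  rcases hL : u.length with _ | L
  · obtain rfl : u = [] := List.length_eq_zero_iff.1 hL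
    rw [LieRing.of_associative_ring_bracket, LieRing.of_associative_ring_bracket, sub_apply,
      X_mul_nil, mul_X_nil, sub_apply, X_mul_nil, mul_X_nil]
  · exact (AgreeTo.lie_succ (X_nil i) (adop_agreeTo_sum (shift i P) y L).symm) u (by omega)

theorem adop_X_mul (i : Fin n) (P y : Ass K n) : adop (X i * P) y = ⁅(X i : Ass K n), adop P y⁆ := by
  rw [adop_expand, X_mul_nil, zero_smul, zero_add, Finset.sum_eq_single i]
  · rw [shift_X_mul, if_pos rfl]
  · intro j _ hj
    rw [shift_X_mul, if_neg hj, ← adopL_apply, map_zero, LinearMap.zero_apply, lie_zero]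
  · simp

end Ass

theorem adop_mul_of_mem_liePolynomials {p : Ass K n} (hp : p ∈ liePolynomials K n)
    (Q y : Ass K n) : adop (p * Q) y = ⁅p, adop Q y⁆ := by
  refine LieSubalgebra.lieSpan_induction (R := K)
    (p := fun p _ => ∀ Q y : Ass K n, adop (p * Q) y = ⁅p, adop Q y⁆) ?_ ?_ ?_ ?_ ?_ hp Q y
  · rintro _ ⟨i, rfl⟩ Q y
    exact adop_X_mul i Q y
  · intro Q y
    rw [zero_mul, zero_lie, ← adopL_apply, map_zero, LinearMap.zero_apply]
  · intro x x' _ _ hx hx' Q y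
    rw [add_mul, ← adopL_apply, map_add, LinearMap.add_apply, adopL_apply, adopL_apply, hx, hx',
      add_lie]
  · intro c x _ hx Q y
    rw [smul_mul_assoc, ← adopL_apply, map_smul, LinearMap.smul_apply, adopL_apply, hx, smul_lie]
  · intro x x' _ _ hx hx' Q y
    rw [LieRing.of_associative_ring_bracket, sub_mul, mul_assoc, mul_assoc, ← adopL_apply, map_sub,
      LinearMap.sub_apply, adopL_apply, adopL_apply, hx, hx', hx', hx, ← lie_lie,
      LieRing.of_associative_ring_bracket x x']

theorem adop_mul_of_mem_lie {p : Ass K n} (hp : p ∈ lie K n) (Q y : Ass K n) :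
    adop (p * Q) y = ⁅p, adop Q y⁆ := by
  ext u
  have h := agreeTo_truncate u.length p
  rw [adop_agree (h.mul (AgreeTo.refl _ Q)) (AgreeTo.refl _ y) u le_rfl,
    adop_mul_of_mem_liePolynomials (truncate_mem hp _),
    (h.lie (AgreeTo.refl _ _)) u le_rfl]

theorem partialRight_lie {p q : Ass K n} (hp : p [] = 0) (hq : q [] = 0) (j : Fin n) :
    partialRight j ⁅p, q⁆ = p * partialRight j q - q * partialRight j p := by
  rw [LieRing.of_associative_ring_bracket, ← partialRightL_apply, map_sub, partialRightL_apply,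
    partialRightL_apply, partialRight_mul, partialRight_mul, hp, hq]
  simp

/-- A derivation from the Lie polynomials to `Ass_n` is determined by its values on the
generators: replace the last letter of every word by its image, and let the other ones act by
the adjoint action. -/
theorem derivation_liePolynomials (v : lie K n →ₗ[K] Ass K n)
    (hv : ∀ p q : lie K n, v ⁅p, q⁆ = ⁅(p : Ass K n), v q⁆ - ⁅(q : Ass K n), v p⁆)
    {p : Ass K n} (hp : p ∈ liePolynomials K n) (hp' : p ∈ lie K n) :
    v ⟨p, hp'⟩ = ∑ j, adop (partialRight j p) (v (lieX K j)) := by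
  refine LieSubalgebra.lieSpan_induction (R := K)
    (p := fun p _ => ∀ hp' : p ∈ lie K n,
      v ⟨p, hp'⟩ = ∑ j, adop (partialRight j p) (v (lieX K j))) ?_ ?_ ?_ ?_ ?_ hp hp'
  · rintro _ ⟨i, rfl⟩ _
    rw [Finset.sum_eq_single i]
    · rw [partialRight_X, if_pos rfl, adop_one]; rfl
    · intro j _ hj
      rw [partialRight_X, if_neg hj, ← adopL_apply, map_zero, LinearMap.zero_apply]
    · simp
  · intro h
    have : (⟨0, h⟩ : lie K n) = 0 := rfl
    rw [this, map_zero]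
    symm
    refine Finset.sum_eq_zero fun j _ => ?_
    rw [← partialRightL_apply, map_zero, ← adopL_apply, map_zero, LinearMap.zero_apply]
  · intro x y hx hy ihx ihy h
    have : (⟨x + y, h⟩ : lie K n) =
      ⟨x, liePolynomials_le_lie hx⟩ + ⟨y, liePolynomials_le_lie hy⟩ := rfl
    rw [this, map_add, ihx, ihy, ← Finset.sum_add_distrib]
    refine Finset.sum_congr rfl fun j _ => ?_
    exact (adop_add_left (partialRight j x) (partialRight j y) _).symm
  · intro c x hx ihx h
    have : (⟨c • x, h⟩ : lie K n) = c • ⟨x, liePolynomials_le_lie hx⟩ := rfl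
    rw [this, map_smul, ihx, Finset.smul_sum]
    refine Finset.sum_congr rfl fun j _ => ?_
    exact (adop_smul_left c (partialRight j x) _).symm
  · intro x y hx hy ihx ihy h
    have : (⟨⁅x, y⁆, h⟩ : lie K n) =
      ⁅(⟨x, liePolynomials_le_lie hx⟩ : lie K n), ⟨y, liePolynomials_le_lie hy⟩⁆ := rfl
    rw [this, hv, ihx, ihy, lie_sum, lie_sum, ← Finset.sum_sub_distrib]
    refine Finset.sum_congr rfl fun j _ => ?_
    rw [partialRight_lie (liePolynomials_nil hx) (liePolynomials_nil hy), adop_sub_left, adop_mul_of_mem_liePolynomials hx,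
      adop_mul_of_mem_liePolynomials hy]

theorem derivation_lie (v : lie K n →ₗ[K] Ass K n)
    (hv : ∀ p q : lie K n, v ⁅p, q⁆ = ⁅(p : Ass K n), v q⁆ - ⁅(q : Ass K n), v p⁆)
    (hc : ∀ (L : ℕ) (p : lie K n), AgreeTo L (p : Ass K n) (0 : Ass K n) → AgreeTo L (v p) (0 : Ass K n)) (p : lie K n) :
    v p = ∑ j, adop (partialRight j p) (v (lieX K j)) := by
  ext u
  set L := u.length + 1
  have hm := truncate_mem p.2 L
  have hA := agreeTo_truncate L (p : Ass K n)
  have h1 : v p u = v ⟨_, liePolynomials_le_lie hm⟩ u := by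
    have := hc L (p - ⟨_, liePolynomials_le_lie hm⟩) (fun w hw => by
      change (p : Ass K n) w - _ = 0
      rw [hA w hw, sub_self]) u (by omega)
    rwa [map_sub, Ass.sub_apply, Ass.zero_apply, sub_eq_zero] at this
  rw [h1, derivation_liePolynomials v hv hm]
  refine (AgreeTo.sum fun j _ => adop_agree (fun w hw => ?_) (AgreeTo.refl _ _)) u le_rfl
  exact (hA (w ++ [j]) (by simp; omega)).symm

end KRV

namespace KRV

open Ass

variable {K : Type*} [Field K] {n : ℕ}

/-! ### Derivations of the completed free Lie algebra -/

namespace Ass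

/-- The Euler operator, which multiplies every word with its length. -/
def euler : Ass K n →ₗ[K] Ass K n where
  toFun f := fun w => w.length * f w
  map_add' f g := by ext w; exact mul_add _ _ _
  map_smul' c f := by ext w; exact mul_left_comm _ _ _

theorem euler_apply (f : Ass K n) (w : List (Fin n)) : euler f w = w.length * f w := rfl

theorem euler_mul (f g : Ass K n) : euler (f * g) = euler f * g + f * euler g := by
  ext w
  rw [euler_apply, add_apply, mul_apply, mul_apply, mul_apply, Finset.mul_sum,
    ← Finset.sum_add_distrib]
  refine Finset.sum_congr rfl fun i hi => ?_
  have hi' : i ≤ w.length := by simpa [Nat.lt_succ_iff] using hi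
  rw [euler_apply, euler_apply, List.length_take, List.length_drop, min_eq_left hi',
    Nat.cast_sub hi']
  ring

theorem euler_lie (f g : Ass K n) : euler ⁅f, g⁆ = ⁅f, euler g⁆ - ⁅g, euler f⁆ := by
  simp only [LieRing.of_associative_ring_bracket, map_sub, euler_mul]
  abel

theorem euler_X (i : Fin n) : euler (X i : Ass K n) = X i := by
  ext w
  rw [euler_apply, X]
  split_ifs with h <;> simp [h]

/-- Divide the coefficient of every word by its length plus one. -/
def divLengthSucc (f : Ass K n) : Ass K n := fun w => f w / (w.length + 1)

theorem divLengthSucc_apply (f : Ass K n) (w : List (Fin n)) :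
    divLengthSucc f w = f w / (w.length + 1) := rfl

theorem X_lie_divLengthSucc (i : Fin n) (f : Ass K n) (w : List (Fin n)) :
    ⁅(X i : Ass K n), divLengthSucc f⁆ w = ⁅(X i : Ass K n), f⁆ w / w.length := by
  rw [LieRing.of_associative_ring_bracket, LieRing.of_associative_ring_bracket, sub_apply,
    sub_apply, sub_div]
  congr 1
  · cases w with
    | nil => rw [X_mul_nil, X_mul_nil, zero_div]
    | cons a w =>
      rw [X_mul_cons, X_mul_cons]
      split_ifs
      · rw [divLengthSucc_apply, List.length_cons]; push_cast; rfl
      · rw [zero_div]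
  · rcases List.eq_nil_or_concat w with rfl | ⟨w, a, rfl⟩
    · rw [mul_X_nil, mul_X_nil, zero_div]
    · rw [List.concat_eq_append, mul_X_append, mul_X_append]
      split_ifs
      · rw [divLengthSucc_apply, List.length_append, List.length_singleton]; push_cast; rfl
      · rw [zero_div]

theorem adop_vanish (L : ℕ) (P y : Ass K n) (hy : y [] = 0) (hP : ∀ w, w.length < L → P w = 0)
    (u : List (Fin n)) (hu : u.length < L + 1) : adop P y u = 0 := by
  induction L generalizing P u with
  | zero =>
    obtain rfl : u = [] := List.length_eq_zero_iff.1 (by omega)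
    simp [adop, adPart, smul_apply, hy]
  | succ L ih =>
    rw [adop_expand, hP [] (by simp), zero_smul, zero_add, sum_apply]
    refine Finset.sum_eq_zero fun i _ => ?_
    have h0 : AgreeTo L (adop (shift i P) y) (0 : Ass K n) := fun w hw =>
      ih (shift i P) (fun w' hw' => hP (i :: w') (by simpa using hw')) w (by omega)
    rw [AgreeTo.lie_succ (X_nil i) h0 u (by omega), lie_zero, zero_apply]

end Ass

theorem mem_lie_of_agreeTo {f : Ass K n}
    (h : ∀ L, ∃ p ∈ lie K n, AgreeTo L f p) : f ∈ lie K n := by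
  intro m
  obtain ⟨p, hp, h⟩ := h m
  have : homog m f = homog m p := by
    ext w
    rw [homog_apply, homog_apply]
    split_ifs with hw
    · exact h w hw.le
    · rfl
  rw [this]
  exact hp m

theorem adPart_mem_lie (l : ℕ) (P : Ass K n) {y : Ass K n} (hy : y ∈ lie K n) :
    adPart l P y ∈ lie K n := by
  induction l generalizing P with
  | zero => exact (lie K n).smul_mem _ hy
  | succ l ih => exact sum_mem fun i _ => (lie K n).lie_mem (lieX K i).2 (ih _)

theorem adop_mem_lie (P : Ass K n) {y : Ass K n} (hy : y ∈ lie K n) : adop P y ∈ lie K n :=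
  mem_lie_of_agreeTo fun L => ⟨_, sum_mem fun l _ => adPart_mem_lie l P hy, adop_agreeTo_sum P y L⟩

theorem divLengthSucc_mem_lie {f : Ass K n} (hf : f ∈ lie K n) : divLengthSucc f ∈ lie K n := by
  intro m
  have : homog m (divLengthSucc f) = ((m : K) + 1)⁻¹ • homog m f := by
    ext w
    rw [Ass.smul_apply, homog_apply, homog_apply]
    split_ifs with hw
    · rw [divLengthSucc_apply, hw, div_eq_inv_mul]
    · rw [mul_zero]
  rw [this]
  exact (liePolynomials K n).smul_mem _ (hf m)

/-- The Dynkin-Specht-Wever identity: for Lie series the Euler operator is given by the right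
normed bracketing of words. -/
theorem euler_of_mem_lie {p : Ass K n} (hp : p ∈ lie K n) :
    euler p = ∑ j, adop (partialRight j p) (X j) := by
  have h := derivation_lie (euler.comp (lie K n).toSubmodule.subtype)
    (fun p q => euler_lie (p : Ass K n) q)
    (fun L p h w hw => by
      change (w.length : K) * (p : Ass K n) w = 0
      rw [h w hw, Ass.zero_apply, mul_zero]) ⟨p, hp⟩
  refine h.trans (Finset.sum_congr rfl fun j _ => ?_)
  congr 1
  exact euler_X j

variable [CharZero K]

/-- A Lie series without linear part is a sum of brackets `⁅x_i, g_i⁆`, and the `g_i` start one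
degree earlier. -/
theorem exists_bracket_decomposition (L : ℕ) (p : lie K n)
    (hp : AgreeTo (L + 1) (p : Ass K n) (0 : Ass K n)) :
    ∃ g : Fin n → lie K n, (∀ i, AgreeTo L (g i : Ass K n) (0 : Ass K n)) ∧
      p = ∑ i, ⁅lieX K i, g i⁆ := by
  refine ⟨fun i => ⟨divLengthSucc (∑ j, adop (shift i (partialRight j (p : Ass K n))) (X j)),
    divLengthSucc_mem_lie (sum_mem fun j _ => adop_mem_lie _ (lieX K j).2)⟩, ?_, ?_⟩
  · intro i w hw
    change _ / _ = (0 : K)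
    rw [Ass.sum_apply, Finset.sum_eq_zero, zero_div]
    intro j _
    refine adop_vanish L _ _ (X_nil j) (fun u hu => ?_) w (by omega)
    exact hp (i :: (u ++ [j])) (by simp; omega)
  · apply Subtype.ext
    have hcoe : ((∑ i, ⁅lieX K i, (⟨divLengthSucc (∑ j, adop (shift i (partialRight j
        (p : Ass K n))) (X j)), divLengthSucc_mem_lie (sum_mem fun j _ =>
        adop_mem_lie _ (lieX K j).2)⟩ : lie K n)⁆ : lie K n) : Ass K n) =
        ∑ i, ⁅(X i : Ass K n), divLengthSucc (∑ j, adop (shift i (partialRight j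
        (p : Ass K n))) (X j))⁆ := by
      rw [← LieSubalgebra.coe_incl, map_sum]; rfl
    rw [hcoe]
    ext w
    rw [Ass.sum_apply]
    simp only [X_lie_divLengthSucc]
    rw [← Finset.sum_div, ← Ass.sum_apply]
    have h := congrFun (euler_of_mem_lie p.2) w
    have h2 : ∑ j, adop (partialRight j (p : Ass K n)) (X j) =
        ∑ i, ⁅(X i : Ass K n), ∑ j, adop (shift i (partialRight j (p : Ass K n))) (X j)⁆ := by
      simp only [lie_sum]
      rw [Finset.sum_comm]
      refine Finset.sum_congr rfl fun j _ => ?_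
      rw [adop_expand, partialRight_apply, hp _ (by simp), Ass.zero_apply, zero_smul, zero_add]
    rw [h2, euler_apply] at h
    rw [← h]
    rcases w with _ | ⟨a, w⟩
    · rw [lie_nil p.2]; simp
    · rw [List.length_cons, mul_div_cancel_left₀]
      exact Nat.cast_ne_zero.2 (by omega)

/-- Derivations of the completed free Lie algebra are automatically continuous. -/
theorem lieDerivation_agreeTo (u : LieDerivation K (lie K n) (lie K n)) (L : ℕ) (p : lie K n)
    (hp : AgreeTo L (p : Ass K n) (0 : Ass K n)) :
    AgreeTo L (u p : Ass K n) (0 : Ass K n) := by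
  induction L generalizing p with
  | zero =>
    intro w hw
    obtain rfl : w = [] := List.length_eq_zero_iff.1 (by omega)
    rw [lie_nil (u p).2]; rfl
  | succ L ih =>
    obtain ⟨g, hg, h⟩ := exists_bracket_decomposition L p hp
    have h' : (u p : Ass K n) = ∑ i, (⁅(X i : Ass K n), (u (g i) : Ass K n)⁆ -
        ⁅(g i : Ass K n), (u (lieX K i) : Ass K n)⁆) := by
      conv_lhs => rw [h]
      rw [map_sum, ← LieSubalgebra.coe_incl, map_sum]
      refine Finset.sum_congr rfl fun i _ => ?_
      rw [LieDerivation.apply_lie_eq_sub]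
      rfl
    rw [h']
    intro w hw
    rw [Ass.sum_apply, Ass.zero_apply]
    refine Finset.sum_eq_zero fun i _ => ?_
    rw [Ass.sub_apply, (AgreeTo.lie_succ (X_nil i) (ih (g i) (hg i))) w hw,
      ← lie_skew (g i : Ass K n), Ass.neg_apply,
      (AgreeTo.lie_succ (lie_nil (u (lieX K i)).2) (hg i)) w hw, lie_zero, lie_zero]
    simp [Ass.zero_apply]

theorem lieDerivation_apply (u : LieDerivation K (lie K n) (lie K n)) (p : lie K n) :
    (u p : Ass K n) = ∑ j, adop (partialRight j (p : Ass K n)) (u (lieX K j) : Ass K n) :=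
  derivation_lie ((lie K n).toSubmodule.subtype.comp u.toLinearMap)
    (fun p q => by
      change ((u ⁅p, q⁆ : lie K n) : Ass K n) = _
      rw [LieDerivation.apply_lie_eq_sub]
      rfl)
    (fun L p h => lieDerivation_agreeTo u L p h) p

omit [CharZero K] in
/-- The symmetry of the tuple `(a_1, …, a_n)` of a special derivation. -/
theorem partialRight_eq_antipode {a : Fin n → Ass K n} (ha : ∀ i, a i ∈ lie K n)
    (h : ∑ i, ⁅(X i : Ass K n), a i⁆ = 0) (i j : Fin n) :
    partialRight j (a i) = antipode (partialRight i (a j)) := by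
  have h1 : ∀ j, a j = ∑ k, X k * partialRight j (a k) := by
    intro j
    have h' := congrArg (partialRightL j) h
    simp only [LieRing.of_associative_ring_bracket, Finset.sum_sub_distrib, map_sub, map_sum,
      partialRightL_apply, partialRight_mul, lie_nil (ha _), zero_smul, add_zero, map_zero,
      X_nil, partialRight_X] at h'
    rw [sub_eq_zero] at h'
    rw [h']
    simp
  have h2 : ∀ i j, shift i (a j) = partialRight j (a i) := by
    intro i j
    conv_lhs => rw [h1 j]
    rw [← shiftL_apply, map_sum, Finset.sum_eq_single i]
    · rw [shiftL_apply, shift_X_mul, if_pos rfl]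
    · intro k _ hk
      rw [shiftL_apply, shift_X_mul, if_neg hk.symm]
    · simp
  rw [← h2]
  ext w
  rw [shift_apply, antipode_apply, partialRight_apply]
  have h3 := congrFun (antipode_of_mem_lie (ha j)) (i :: w)
  rw [antipode_apply, Ass.neg_apply, List.length_cons, List.reverse_cons, pow_succ] at h3
  linear_combination h3

omit [CharZero K] in
theorem sum_X_lie_eq_zero (u : sder K n) (a : Fin n → Ass K n)
    (h : ∀ i, (u.1 (lieX K i) : Ass K n) = ⁅(X i : Ass K n), a i⁆) :
    ∑ i, ⁅(X i : Ass K n), a i⁆ = 0 := by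
  have h' := congrArg (Subtype.val) u.2.2
  rw [map_sum, ← LieSubalgebra.coe_incl, map_sum] at h'
  rw [← Finset.sum_congr rfl fun i _ => h i]
  exact h'

/-- The bracket of special derivations in the form in which it arises from graphs. -/
def tupleBracket (a b : Fin n → Ass K n) (i : Fin n) : Ass K n :=
  ⁅a i, b i⁆ + ∑ j, (adop (antipode (partialRight i (a j))) ⁅b j, X j⁆ +
    adop (antipode (partialRight i (b j))) ⁅(X j : Ass K n), a j⁆)

/-- The Lie bracket of derivations is `tupleBracket` on the tuples `(a_1, …, a_n)`: a derivation
acts on a Lie series `c` through `∑ j, adop (∂_j c) (u x_j)`, and `partialRight_eq_antipode`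
exchanges the two indices. -/
theorem sder_bracket (u v : sder K n) {a b : Fin n → Ass K n}
    (ha : ∀ i, a i ∈ lie K n) (hb : ∀ i, b i ∈ lie K n)
    (hua : ∀ i, (u.1 (lieX K i) : Ass K n) = ⁅(X i : Ass K n), a i⁆)
    (hvb : ∀ i, (v.1 (lieX K i) : Ass K n) = ⁅(X i : Ass K n), b i⁆) (i : Fin n) :
    (⁅u, v⁆.1 (lieX K i) : Ass K n) = ⁅(X i : Ass K n), tupleBracket a b i⁆ := by
  have key : tupleBracket a b i = (u.1 ⟨b i, hb i⟩ : Ass K n) - (v.1 ⟨a i, ha i⟩ : Ass K n) +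
      ⁅a i, b i⁆ := by
    rw [tupleBracket, Finset.sum_add_distrib, lieDerivation_apply, lieDerivation_apply]
    simp only [hua, hvb, ← partialRight_eq_antipode ha (sum_X_lie_eq_zero u a hua) i,
      ← partialRight_eq_antipode hb (sum_X_lie_eq_zero v b hvb) i]
    have : ∑ j, adop (partialRight j (a i)) ⁅b j, X j⁆ =
        -∑ j, adop (partialRight j (a i)) ⁅(X j : Ass K n), b j⁆ := by
      rw [← Finset.sum_neg_distrib]
      refine Finset.sum_congr rfl fun j _ => ?_
      rw [← lie_skew, ← adopL_apply, map_neg]; rfl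
    rw [this]
    abel
  set A : lie K n := ⟨a i, ha i⟩ with hA
  set B : lie K n := ⟨b i, hb i⟩ with hB
  have hu : u.1 (lieX K i) = ⁅lieX K i, A⁆ := Subtype.ext (hua i)
  have hv : v.1 (lieX K i) = ⁅lieX K i, B⁆ := Subtype.ext (hvb i)
  have h : ⁅u, v⁆.1 (lieX K i) = ⁅lieX K i, u.1 B - v.1 A + ⁅A, B⁆⁆ := by
    have h1 := leibniz_lie (lieX K i) A B
    have h2 := lie_skew A ⁅lieX K i, B⁆
    rw [LieSubalgebra.coe_bracket, LieDerivation.lie_apply, hv, hu,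
      LieDerivation.apply_lie_eq_add, LieDerivation.apply_lie_eq_add, hu, hv, lie_add, lie_sub,
      h1, ← h2]
    abel
  rw [h, key]
  rfl

end KRV

namespace KRV

open Ass

variable {K : Type*} [Field K] {n : ℕ}

/-! ### Cyclic words -/

namespace Ass

/-- The sum of the coefficients of a series over all rotations of a word. -/
def cycSum : Ass K n →ₗ[K] Ass K n where
  toFun f := fun w => ∑ k ∈ Finset.range w.length, f (w.rotate k)
  map_add' f g := by ext w; exact Finset.sum_add_distrib
  map_smul' c f := by ext w; exact (Finset.mul_sum _ _ _).symm

theorem cycSum_apply (f : Ass K n) (w : List (Fin n)) :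
    cycSum f w = ∑ k ∈ Finset.range w.length, f (w.rotate k) := rfl

end Ass

theorem sum_rotate_rotate {M : Type*} [AddCommGroup M] {α : Type*} (F : List α → M) (w : List α)
    (i : ℕ) : ∑ k ∈ Finset.range w.length, F ((w.rotate k).rotate i) =
      ∑ k ∈ Finset.range w.length, F (w.rotate k) := by
  induction i with
  | zero => simp
  | succ i ih =>
    rw [← ih]
    simp only [List.rotate_rotate]
    have h1 := Finset.sum_range_succ (fun k => F (w.rotate (k + i))) w.length
    rw [Finset.sum_range_succ'] at h1
    have h2 : w.rotate (w.length + i) = w.rotate (0 + i) := by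
      rw [← List.rotate_rotate, List.rotate_length, zero_add]
    rw [h2] at h1
    have h3 := add_right_cancel h1
    rw [← h3]
    exact Finset.sum_congr rfl fun k _ => by rw [show k + (i + 1) = k + 1 + i by ring]

namespace Ass

theorem cycSum_mul_comm (f g : Ass K n) : cycSum (f * g) = cycSum (g * f) := by
  ext w
  rw [cycSum_apply, cycSum_apply]
  have h : ∀ f g : Ass K n, ∀ k, (f * g) (w.rotate k) = ∑ i ∈ Finset.range (w.length + 1),
      f ((w.rotate k).take i) * g ((w.rotate k).drop i) := fun f g k => by
    rw [mul_apply, List.length_rotate]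
  simp only [h]
  rw [Finset.sum_comm]
  conv_rhs => rw [Finset.sum_comm, ← Finset.sum_range_reflect]
  refine Finset.sum_congr rfl fun i hi => ?_
  have hi' : i ≤ w.length := by simpa [Nat.lt_succ_iff] using hi
  rw [← sum_rotate_rotate (fun u => g (u.take (w.length + 1 - 1 - i)) *
    f (u.drop (w.length + 1 - 1 - i))) w i]
  refine Finset.sum_congr rfl fun k _ => ?_
  have hl : (w.rotate k).length = w.length := List.length_rotate _ _
  generalize w.rotate k = u at hl ⊢
  have hd : (u.drop i).length = w.length + 1 - 1 - i := by rw [List.length_drop]; omega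
  rw [List.rotate_eq_drop_append_take (by omega), List.take_left' hd, List.drop_left' hd, mul_comm]

/-- The coefficients of cyclic words, up to reflection: the sum over all rotations, antisymmetrized
by the antipode. -/
def dihedralSum : Ass K n →ₗ[K] Ass K n := cycSum.comp (LinearMap.id - antipode)

theorem dihedralSum_apply (f : Ass K n) :
    dihedralSum f = cycSum f - cycSum (antipode f) := by
  rw [dihedralSum, LinearMap.comp_apply, LinearMap.sub_apply, LinearMap.id_apply, map_sub]

theorem dihedralSum_mul_comm (f g : Ass K n) : dihedralSum (f * g) = dihedralSum (g * f) := by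
  rw [dihedralSum_apply, dihedralSum_apply, cycSum_mul_comm f g, antipode_mul, antipode_mul,
    cycSum_mul_comm (antipode g)]

theorem dihedralSum_antipode (f : Ass K n) : dihedralSum (antipode f) = -dihedralSum f := by
  rw [dihedralSum_apply, dihedralSum_apply, antipode_antipode, neg_sub]

end Ass

theorem cycSum_eq_zero_of_mem_span {f : Ass K n}
    (hf : f ∈ Submodule.span K {c : Ass K n | ∃ a b : Ass K n, c = a * b - b * a}) :
    cycSum f = 0 := by
  have h : Submodule.span K {c : Ass K n | ∃ a b : Ass K n, c = a * b - b * a} ≤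
      LinearMap.ker (cycSum : Ass K n →ₗ[K] Ass K n) := by
    rw [Submodule.span_le]
    rintro _ ⟨a, b, rfl⟩
    rw [SetLike.mem_coe, LinearMap.mem_ker, map_sub, cycSum_mul_comm, sub_self]
  exact h hf

/-- A series without constant term all of whose cyclic sums vanish is a finite sum of commutators
`x_i g_i - g_i x_i`. -/
theorem mem_span_of_cycSum_eq_zero [CharZero K] {f : Ass K n} (h0 : f [] = 0)
    (hf : cycSum f = 0) :
    f ∈ Submodule.span K {c : Ass K n | ∃ a b : Ass K n, c = a * b - b * a} := by
  -- `G` solves `f w = G w - G w'` where `w'` is `w` with its last letter moved to the front.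
  let G : Ass K n := fun w => (∑ k ∈ Finset.range w.length, (k : K) * f (w.rotate (k + 1))) / w.length
  have hG : ∀ (u : List (Fin n)) (i : Fin n), G (u ++ [i]) - G (i :: u) = f (u ++ [i]) := by
    intro u i
    have hr : (i :: u).rotate 1 = u ++ [i] := by simp
    have hc := congrFun hf (i :: u)
    rw [cycSum_apply, Ass.zero_apply] at hc
    have hF : ∀ k, (u ++ [i]).rotate k = (i :: u).rotate (k + 1) := fun k => by
      rw [← hr, List.rotate_rotate, add_comm]
    change (∑ k ∈ Finset.range (u ++ [i]).length, (k : K) * f ((u ++ [i]).rotate (k + 1))) /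
      (u ++ [i]).length - (∑ k ∈ Finset.range (i :: u).length, (k : K) *
        f ((i :: u).rotate (k + 1))) / (i :: u).length = _
    rw [← hr]
    simp only [hF, hr]
    set L := (i :: u).length with hL
    have hL0 : (L : K) ≠ 0 := Nat.cast_ne_zero.2 (by simp [hL])
    have e1 := Finset.sum_range_succ (fun k => ((k : K)) * f ((i :: u).rotate (k + 1))) L
    rw [Finset.sum_range_succ'] at e1
    have e2 : (i :: u).rotate (L + 1) = u ++ [i] := by
      rw [← List.rotate_rotate, hL, List.rotate_length, hr]
    have e3 := Finset.sum_range_succ (fun k => f ((i :: u).rotate k)) L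
    rw [Finset.sum_range_succ', hc, hL, List.rotate_length, List.rotate_zero, zero_add,
      ← hL] at e3
    have e3' : ∑ k ∈ Finset.range L, f ((i :: u).rotate (k + 1)) = 0 := by
      simpa using e3
    have e5 := Finset.sum_range_succ (fun k => f ((i :: u).rotate (k + 1))) L
    rw [Finset.sum_range_succ', e3', zero_add, e2] at e5
    simp only [zero_add, hr] at e5
    have e4 : ∑ k ∈ Finset.range L, f ((i :: u).rotate (k + 1 + 1)) = 0 := by
      simpa using e5
    rw [e2] at e1
    simp only [Nat.cast_add, Nat.cast_one, add_mul, one_mul, Finset.sum_add_distrib, Nat.cast_zero,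
      zero_mul, add_zero, e4] at e1
    have hlen : (u ++ [i]).length = L := by simp [hL]
    rw [hlen, e1]
    field_simp
    ring
  have key : f = ∑ i, ((-shift i G) * X i - X i * (-shift i G)) := by
    ext w
    rcases List.eq_nil_or_concat w with rfl | ⟨u, a, rfl⟩
    · rw [Ass.sum_apply, h0]
      symm
      exact Finset.sum_eq_zero fun i _ => by
        rw [Ass.sub_apply, mul_X_nil, X_mul_nil, sub_zero]
    · rw [List.concat_eq_append, ← hG, Ass.sum_apply]
      simp only [Ass.sub_apply, Finset.sum_sub_distrib]
      have e1 : ∑ i, ((-shift i G) * X i : Ass K n) (u ++ [a]) = -G (a :: u) := by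
        rw [Finset.sum_eq_single a]
        · rw [mul_X_append, if_pos rfl]; rfl
        · intro b _ hb
          rw [mul_X_append, if_neg hb.symm]
        · simp
      have e2 : ∑ i, (X i * (-shift i G) : Ass K n) (u ++ [a]) = -G (u ++ [a]) := by
        rcases hw : u ++ [a] with _ | ⟨b, v⟩
        · simp at hw
        · rw [Finset.sum_eq_single b]
          · rw [X_mul_cons, if_pos rfl]; rfl
          · intro c _ hc
            rw [X_mul_cons, if_neg hc.symm]
          · simp
      rw [e1, e2]
      ring
  rw [key]
  exact sum_mem fun i _ => Submodule.subset_span ⟨_, _, rfl⟩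

/-- The series `∑_j x_j (∂_j a_j)` whose class is the divergence. -/
def divergenceSeries (a : Fin n → Ass K n) : Ass K n := ∑ j, X j * partialRight j (a j)

theorem divergenceSeries_nil (a : Fin n → Ass K n) : divergenceSeries a [] = 0 := by
  rw [divergenceSeries, Ass.sum_apply]
  exact Finset.sum_eq_zero fun j _ => X_mul_nil _ _

theorem divergence_eq_zero_iff [CharZero K] (a : Fin n → lie K n) :
    divergence a = 0 ↔ cycSum (divergenceSeries fun j => (a j : Ass K n)) = 0 := by
  have h : divergence a = tr ⟨divergenceSeries fun j => (a j : Ass K n),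
      divergenceSeries_nil _⟩ := by
    rw [divergence, ← map_sum]
    congr 1
    apply Subtype.ext
    rw [AddSubmonoidClass.coe_finsetSum]
    rfl
  rw [h]
  refine (Submodule.Quotient.mk_eq_zero _).trans ⟨fun h => cycSum_eq_zero_of_mem_span h,
    fun h => ?_⟩
  exact mem_span_of_cycSum_eq_zero (divergenceSeries_nil _) h

/-- The divergence of a special derivation is symmetric under reflection of cyclic words. -/
theorem dihedralSum_divergenceSeries {a : Fin n → Ass K n} (ha : ∀ i, a i ∈ lie K n)
    (h : ∑ i, ⁅(X i : Ass K n), a i⁆ = 0) :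
    dihedralSum (divergenceSeries a) = (2 : K) • cycSum (divergenceSeries a) := by
  have : cycSum (antipode (divergenceSeries a)) = -cycSum (divergenceSeries a) := by
    rw [divergenceSeries, map_sum, map_sum, map_sum, ← Finset.sum_neg_distrib]
    refine Finset.sum_congr rfl fun j _ => ?_
    rw [antipode_mul, antipode_X, ← partialRight_eq_antipode ha h, mul_neg, map_neg,
      cycSum_mul_comm]
  rw [dihedralSum_apply, this, two_smul, sub_neg_eq_add]

/-! ### Signs of lists -/

section Signs

variable {e : ℕ}

theorem listSign_swap_adjacent (A B : List (Fin e)) {a b : Fin e} (h : a ≠ b) :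
    listSign (A ++ a :: b :: B) = -listSign (A ++ b :: a :: B) := by
  induction A with
  | nil =>
    simp only [List.nil_append, listSign, List.countP_cons]
    rcases lt_or_gt_of_ne h with h' | h'
    · simp only [h', not_lt_of_gt h', decide_true, decide_false]
      simp [pow_succ]; ring
    · simp only [h', not_lt_of_gt h', decide_true, decide_false]
      simp [pow_succ]; ring
  | cons c A ih =>
    simp only [List.cons_append, listSign]
    rw [ih, (List.Perm.append_left A (List.Perm.swap b a B)).countP_eq]
    ring

/-- The sign of a list of edges; it is zero if there are repetitions. -/
def sgn (L : List (Fin e)) : ℤ := if L.Nodup then listSign L else 0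

theorem sgn_of_nodup {L : List (Fin e)} (h : L.Nodup) : sgn L = listSign L := if_pos h

theorem sgn_swap_adjacent (A B : List (Fin e)) (a b : Fin e) :
    sgn (A ++ a :: b :: B) = -sgn (A ++ b :: a :: B) := by
  have hp : (A ++ a :: b :: B).Perm (A ++ b :: a :: B) :=
    List.Perm.append_left A (List.Perm.swap b a B)
  unfold sgn
  by_cases h : (A ++ a :: b :: B).Nodup
  · rw [if_pos h, if_pos (hp.nodup_iff.1 h)]
    refine listSign_swap_adjacent A B ?_
    rintro rfl
    have := (List.nodup_append.1 h).2.1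
    simp at this
  · rw [if_neg h, if_neg fun h' => h (hp.nodup_iff.2 h'), neg_zero]

/-- Replacing the segment `L'` by `L` multiplies the sign of a list with `ε`. -/
def SignRel (ε : ℤ) (L L' : List (Fin e)) : Prop :=
  ∀ A B : List (Fin e), sgn (A ++ (L ++ B)) = ε * sgn (A ++ (L' ++ B))

theorem SignRel.refl (L : List (Fin e)) : SignRel 1 L L := fun _ _ => (one_mul _).symm

theorem SignRel.trans {ε δ : ℤ} {L M N : List (Fin e)} (h : SignRel ε L M) (h' : SignRel δ M N) :
    SignRel (ε * δ) L N := fun A B => by rw [h, h', mul_assoc]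

theorem SignRel.append {ε δ : ℤ} {L L' M M' : List (Fin e)} (h : SignRel ε L L')
    (h' : SignRel δ M M') : SignRel (ε * δ) (L ++ M) (L' ++ M') := fun A B => by
  rw [List.append_assoc, h, ← List.append_assoc, h', List.append_assoc, List.append_assoc,
    mul_assoc]

theorem SignRel.cons {ε : ℤ} {L L' : List (Fin e)} (r : Fin e) (h : SignRel ε L L') :
    SignRel ε (r :: L) (r :: L') := by
  have := (SignRel.refl [r]).append h
  rwa [one_mul] at this

theorem SignRel.symm {ε : ℤ} {L L' : List (Fin e)} (hε : ε * ε = 1) (h : SignRel ε L L') :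
    SignRel ε L' L := fun A B => by rw [h, ← mul_assoc, hε, one_mul]

theorem SignRel.sgn_eq {ε : ℤ} {L L' : List (Fin e)} (h : SignRel ε L L') :
    sgn L = ε * sgn L' := by simpa using h [] []

/-- Koszul sign for moving one block of edges past another. -/
theorem signRel_swap (L M : List (Fin e)) :
    SignRel ((-1) ^ (L.length * M.length)) (L ++ M) (M ++ L) := by
  have h1 : ∀ (a : Fin e) (M : List (Fin e)), SignRel ((-1) ^ M.length) (a :: M) (M ++ [a]) := by
    intro a M
    induction M with
    | nil => intro A B; simp
    | cons b M ih =>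
      intro A B
      have := sgn_swap_adjacent A (M ++ B) a b
      have h2 := (ih.cons b) A B
      simp only [List.cons_append, List.append_assoc, List.length_cons] at this h2 ⊢
      rw [this, h2, pow_succ]
      ring
  induction L with
  | nil => intro A B; simp
  | cons a L ih =>
    have h2 := (ih.cons a).trans ((h1 a M).append (SignRel.refl L))
    rw [List.length_cons]
    intro A B
    have h3 := h2 A B
    simp only [List.cons_append, List.append_assoc, List.nil_append] at h3 ⊢
    rw [h3]
    ring

theorem signRel_swap_of_odd {L M : List (Fin e)} (hL : Odd L.length) (hM : Odd M.length) :
    SignRel (-1) (L ++ M) (M ++ L) := by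
  have := signRel_swap L M
  rwa [(hL.mul hM).neg_one_pow] at this

theorem signRel_swap_of_even {L M : List (Fin e)} (h : Even (L.length * M.length)) :
    SignRel 1 (L ++ M) (M ++ L) := by
  have := signRel_swap L M
  rwa [h.neg_one_pow] at this

theorem sgn_map_perm (σ : Equiv.Perm (Fin e)) {L : List (Fin e)} (hL : ∀ i, i ∈ L) :
    sgn (L.map σ) = (Equiv.Perm.sign σ : ℤ) * sgn L := by
  by_cases hn : L.Nodup
  swap
  · rw [sgn, if_neg fun h => hn (List.Nodup.of_map _ h), sgn, if_neg hn, mul_zero]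
  revert L
  induction σ using Equiv.Perm.swap_induction_on with
  | one => intro L _ _; simp
  | swap_mul σ x y hxy ih =>
    intro L hL hn
    rw [Equiv.Perm.sign_mul, Equiv.Perm.sign_swap hxy]
    have e1 : L.map (Equiv.swap x y * σ) = (L.map σ).map (Equiv.swap x y) := by
      rw [List.map_map]; rfl
    have hM : ∀ i, i ∈ L.map σ := fun i => List.mem_map.2 ⟨σ.symm i, hL _, by simp⟩
    have hMn : (L.map σ).Nodup := hn.map σ.injective
    rw [e1]
    have key : ∀ M : List (Fin e), M.Nodup → (∀ i, i ∈ M) →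
        sgn (M.map (Equiv.swap x y)) = -sgn M := by
      have key' : ∀ (A B C : List (Fin e)) (x y : Fin e), (A ++ x :: (B ++ y :: C)).Nodup →
          sgn ((A ++ x :: (B ++ y :: C)).map (Equiv.swap x y)) =
            -sgn (A ++ x :: (B ++ y :: C)) := by
        intro A B C x y hnd
        have hfix : ∀ D : List (Fin e), x ∉ D → y ∉ D → D.map (Equiv.swap x y) = D := by
          intro D hx hy
          conv_rhs => rw [← List.map_id D]
          refine List.map_congr_left fun d hd => ?_
          exact Equiv.swap_apply_of_ne_of_ne (fun h => hx (h ▸ hd)) (fun h => hy (h ▸ hd))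
        simp only [List.nodup_append, List.nodup_cons, List.mem_append, List.mem_cons] at hnd
        have hA := hfix A (fun h => hnd.2.2 _ h _ (Or.inl rfl) rfl)
          (fun h => hnd.2.2 _ h _ (Or.inr (Or.inr (Or.inl rfl))) rfl)
        have hB := hfix B (fun h => hnd.2.1.1 (Or.inl h))
          (fun h => hnd.2.1.2.2.2 _ h _ (Or.inl rfl) rfl)
        have hC := hfix C (fun h => hnd.2.1.1 (Or.inr (Or.inr h))) hnd.2.1.2.2.1.1
        rw [List.map_append, List.map_cons, List.map_append, List.map_cons, hA, hB, hC,
          Equiv.swap_apply_left, Equiv.swap_apply_right]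
        have h1 := (signRel_swap [y] (B ++ [x])) A C
        have h2 := (signRel_swap B [x]) A (y :: C)
        simp only [List.singleton_append, List.cons_append, List.append_assoc, List.length_append,
          List.length_singleton, List.nil_append] at h1 h2 ⊢
        rw [h1, h2]
        have : ((-1 : ℤ)) ^ (1 * (B.length + 1)) * ((-1) ^ (B.length * 1)) = -1 := by
          rw [← pow_add]
          exact Odd.neg_one_pow ⟨B.length, by ring⟩
        rw [← mul_assoc, this, neg_one_mul]
      intro M hMn hM
      obtain ⟨A, D, rfl⟩ := List.append_of_mem (hM x)
      rcases List.mem_append.1 (hM y) with hy | hy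
      · obtain ⟨A, C, rfl⟩ := List.append_of_mem hy
        rw [Equiv.swap_comm]
        simpa using key' A C D y x (by simpa using hMn)
      · obtain hy | hy := List.mem_cons.1 hy
        · exact absurd hy.symm hxy
        · obtain ⟨B, C, rfl⟩ := List.append_of_mem hy
          exact key' A B C x y hMn
    rw [key _ hMn hM, ih hL hn]
    simp

theorem listSign_append {A B : List (Fin e)} (h : ∀ a ∈ A, ∀ b ∈ B, a < b) :
    listSign (A ++ B) = listSign A * listSign B := by
  induction A with
  | nil => simp [listSign]
  | cons a A ih =>
    have h0 : B.countP (fun b => b < a) = 0 := List.countP_eq_zero.2 fun b hb => by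
      simpa using (h a List.mem_cons_self b hb).le
    rw [List.cons_append, listSign, listSign, ih fun a' ha' => h a' (List.mem_cons_of_mem _ ha'),
      List.countP_append, h0, add_zero, mul_assoc]

theorem listSign_map {e' : ℕ} {f : Fin e → Fin e'} (hf : StrictMono f) (L : List (Fin e)) :
    listSign (L.map f) = listSign L := by
  induction L with
  | nil => rfl
  | cons a L ih =>
    rw [List.map_cons, listSign, listSign, ih, List.countP_map]
    congr 3
    funext b
    simp [hf.lt_iff_lt]

end Signs


/-- `adop` is an action of the associative algebra of series, not only of its Lie elements. -/
theorem adop_mul (P Q y : Ass K n) : adop (P * Q) y = adop P (adop Q y) := by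
  have key : ∀ (L : ℕ) (P : Ass K n), AgreeTo L (adop (P * Q) y) (adop P (adop Q y)) := by
    have h : ∀ P : Ass K n, adop (P * Q) y =
        P [] • adop Q y + ∑ i, ⁅(X i : Ass K n), adop (shift i P * Q) y⁆ := by
      intro P
      rw [adop_expand (P * Q), adop_expand Q, mul_nil, mul_smul, smul_add, add_assoc,
        Finset.smul_sum, ← Finset.sum_add_distrib]
      congr 1
      refine Finset.sum_congr rfl fun i _ => ?_
      rw [shift_mul, adop_add_left, adop_smul_left, lie_add, lie_smul]
    intro L
    induction L with
    | zero =>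
      intro P w hw
      obtain rfl : w = [] := List.length_eq_zero_iff.1 (by omega)
      rw [h, adop_expand P, Ass.add_apply, Ass.add_apply, Ass.sum_apply, Ass.sum_apply]
      congr 1
      refine Finset.sum_congr rfl fun i _ => ?_
      simp only [LieRing.of_associative_ring_bracket, Ass.sub_apply, X_mul_nil, mul_X_nil]
    | succ L ih =>
      intro P w hw
      rw [h, adop_expand P, Ass.add_apply, Ass.add_apply, Ass.sum_apply, Ass.sum_apply]
      congr 1
      exact Finset.sum_congr rfl fun i _ => AgreeTo.lie_succ (X_nil i) (ih _) w hw
  ext w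
  exact key w.length P w le_rfl

theorem adop_of_mem_lie {p : Ass K n} (hp : p ∈ lie K n) (y : Ass K n) : adop p y = ⁅p, y⁆ := by
  have := adop_mul_of_mem_lie hp 1 y
  rwa [mul_one, adop_one] at this

/-! ### Labelled binary trees -/

/-- Binary trees whose edges, leaves and nodes are labelled by the edges, the external vertices and
the internal vertices of a graph. The label `r` of a node or a leaf is the edge that leads to it
from the side of the root. -/
inductive LTree (n v e : ℕ) : Type
  | leaf (r : Fin e) (j : Fin n) : LTree n v e
  | node (r : Fin e) (a : Fin v) (s t : LTree n v e) : LTree n v e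

namespace LTree

/-- The root edge. -/
def root : LTree n v e → Fin e
  | leaf r _ => r
  | node r _ _ _ => r

/-- The vertex at the far end of the root edge. -/
def top : LTree n v e → Vertex n v
  | leaf _ j => .inl j
  | node _ a _ _ => .inr a

/-- The edges below the root edge. -/
def innerEdges : LTree n v e → List (Fin e)
  | leaf _ _ => []
  | node _ _ s t => s.root :: s.innerEdges ++ t.root :: t.innerEdges

/-- The edges, the root edge being the first one. -/
def edges (P : LTree n v e) : List (Fin e) := P.root :: P.innerEdges

/-- The nodes. -/
def verts : LTree n v e → List (Fin v)
  | leaf _ _ => []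
  | node _ a s t => a :: (s.verts ++ t.verts)

/-- The Lie word of a tree. -/
def lw (K : Type*) [Field K] : LTree n v e → Ass K n
  | leaf _ j => X j
  | node _ _ s t => ⁅s.lw K, t.lw K⁆

/-- The edges that lead to leaves with label `j`. -/
def leafEdges (j : Fin n) : LTree n v e → List (Fin e)
  | leaf r k => if k = j then [r] else []
  | node _ _ s t => s.leafEdges j ++ t.leafEdges j

/-- Relabel edges and nodes. -/
def map {v' e' : ℕ} (σ : Fin e → Fin e') (τ : Fin v → Fin v') : LTree n v e → LTree n v' e'
  | leaf r j => leaf (σ r) j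
  | node r a s t => node (σ r) (τ a) (s.map σ τ) (t.map σ τ)

/-- The edges of the tree are edges of the graph `Γ`, where the root edge starts at `y`. -/
def Fits (Γ : Graph n v e) : Vertex n v → LTree n v e → Prop
  | y, leaf r j => Γ r = s(y, .inl j)
  | y, node r a s t => Γ r = s(y, .inr a) ∧ s.Fits Γ (.inr a) ∧ t.Fits Γ (.inr a)

/-- The tree is the part of the graph `Γ` that one sees from `y` through the root edge. -/
def Reads (Γ : Graph n v e) : Vertex n v → LTree n v e → Prop
  | y, leaf r j => Γ r = s(y, .inl j)
  | y, node r a s t => Γ r = s(y, .inr a) ∧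
      (∀ f, .inr a ∈ Γ f ↔ f = r ∨ f = s.root ∨ f = t.root) ∧
      (r ≠ s.root ∧ r ≠ t.root ∧ s.root ≠ t.root) ∧
      s.Reads Γ (.inr a) ∧ t.Reads Γ (.inr a)

theorem edges_leaf (r : Fin e) (j : Fin n) : (leaf r j : LTree n v e).edges = [r] := rfl

theorem edges_node (r : Fin e) (a : Fin v) (s t : LTree n v e) :
    (node r a s t).edges = r :: (s.edges ++ t.edges) := rfl

theorem innerEdges_node (r : Fin e) (a : Fin v) (s t : LTree n v e) :
    (node r a s t).innerEdges = s.edges ++ t.edges := rfl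

theorem edges_eq (P : LTree n v e) : P.edges = P.root :: P.innerEdges := rfl

theorem root_mem (P : LTree n v e) : P.root ∈ P.edges := List.mem_cons_self

theorem edges_length (P : LTree n v e) : P.edges.length = 2 * P.verts.length + 1 := by
  induction P with
  | leaf r j => rfl
  | node r a s t hs ht =>
    rw [edges_node, verts, List.length_cons, List.length_append, hs, ht, List.length_cons,
      List.length_append]
    ring

theorem odd_edges (P : LTree n v e) : Odd P.edges.length := ⟨_, P.edges_length⟩

theorem lw_mem_liePolynomials (P : LTree n v e) : P.lw K ∈ liePolynomials K n := by
  induction P with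
  | leaf r j => exact X_mem_liePolynomials j
  | node r a s t hs ht => exact (liePolynomials K n).lie_mem hs ht

theorem lw_mem_lie (P : LTree n v e) : P.lw K ∈ lie K n :=
  liePolynomials_le_lie P.lw_mem_liePolynomials

theorem lw_eq_zero_of_length (P : LTree n v e) (w : List (Fin n))
    (h : w.length ≠ P.verts.length + 1) : P.lw K w = 0 := by
  induction P generalizing w with
  | leaf r j =>
    rw [lw, X, if_neg]
    rintro rfl
    exact h rfl
  | node r a s t hs ht =>
    have key : ∀ f g : Ass K n, ∀ p q : ℕ, (∀ w : List (Fin n), w.length ≠ p → f w = 0) →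
        (∀ w : List (Fin n), w.length ≠ q → g w = 0) → w.length ≠ p + q → (f * g) w = 0 := by
      intro f g p q hf hg hpq
      rw [mul_apply]
      refine Finset.sum_eq_zero fun i hi => ?_
      have hi' : i ≤ w.length := by simpa [Nat.lt_succ_iff] using hi
      by_cases hp : i = p
      · rw [hg (w.drop i) (by rw [List.length_drop]; omega), mul_zero]
      · rw [hf (w.take i) (by rw [List.length_take]; omega), zero_mul]
    simp only [verts, List.length_cons, List.length_append] at h
    rw [lw, LieRing.of_associative_ring_bracket, Ass.sub_apply, key _ _ _ _ hs ht (by omega),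
      key _ _ _ _ ht hs (by omega), sub_zero]

/-! #### Relabelling -/

variable {v' e' : ℕ} (σ : Fin e → Fin e') (τ : Fin v → Fin v')

theorem edges_map (P : LTree n v e) : (P.map σ τ).edges = P.edges.map σ := by
  induction P with
  | leaf r j => rfl
  | node r a s t hs ht => rw [map, edges_node, edges_node, hs, ht, List.map_cons, List.map_append]

theorem verts_map (P : LTree n v e) : (P.map σ τ).verts = P.verts.map τ := by
  induction P with
  | leaf r j => rfl
  | node r a s t hs ht => rw [map, verts, verts, hs, ht, List.map_cons, List.map_append]

theorem lw_map (P : LTree n v e) : (P.map σ τ).lw K = P.lw K := by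
  induction P with
  | leaf r j => rfl
  | node r a s t hs ht => rw [map, lw, lw, hs, ht]

theorem top_map (P : LTree n v e) : (P.map σ τ).top = P.top.map id τ := by cases P <;> rfl

theorem Fits.map {Γ : Graph n v e} {Γ' : Graph n v' e'} {y : Vertex n v} {P : LTree n v e}
    (h : P.Fits Γ y) (hΓ : ∀ f ∈ P.edges, Γ' (σ f) = (Γ f).map (Sum.map id τ)) :
    (P.map σ τ).Fits Γ' (y.map id τ) := by
  induction P generalizing y with
  | leaf r j =>
    have h' : Γ r = s(y, .inl j) := h
    change Γ' (σ r) = s(_, .inl j)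
    rw [hΓ r List.mem_cons_self, h', Sym2.map_mk]; rfl
  | node r a s t hs ht =>
    rw [edges_node] at hΓ
    refine ⟨?_, hs h.2.1 fun f hf => hΓ f (by simp [hf]), ht h.2.2 fun f hf => hΓ f (by simp [hf])⟩
    rw [hΓ r List.mem_cons_self, h.1, Sym2.map_mk]; rfl

/-! #### Reading a tree off a graph -/

variable {Γ : Graph n v e}

theorem Fits.root_eq {y : Vertex n v} {P : LTree n v e} (h : P.Fits Γ y) :
    Γ P.root = s(y, P.top) := by
  cases P with
  | leaf r j => exact h
  | node r a s t => exact h.1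

theorem Fits.congr {Γ' : Graph n v e} {y : Vertex n v} {P : LTree n v e} (h : P.Fits Γ y)
    (hΓ : ∀ f ∈ P.edges, Γ' f = Γ f) : P.Fits Γ' y := by
  induction P generalizing y with
  | leaf r j => exact (hΓ r List.mem_cons_self).trans h
  | node r a s t hs ht =>
    rw [edges_node] at hΓ
    exact ⟨(hΓ r List.mem_cons_self).trans h.1, hs h.2.1 fun f hf => hΓ f (by simp [hf]),
      ht h.2.2 fun f hf => hΓ f (by simp [hf])⟩

theorem Reads.fits {y : Vertex n v} {P : LTree n v e} (h : P.Reads Γ y) : P.Fits Γ y := by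
  induction P generalizing y with
  | leaf r j => exact h
  | node r a s t hs ht => exact ⟨h.1, hs h.2.2.2.1, ht h.2.2.2.2⟩

theorem Fits.eq_root {y : Vertex n v} {P : LTree n v e} (h : P.Fits Γ y) {a : Fin v}
    (ha : a ∉ P.verts) {f : Fin e} (hf : f ∈ P.edges) (haf : .inr a ∈ Γ f) :
    f = P.root ∧ y = .inr a := by
  induction P generalizing y with
  | leaf r j =>
    obtain rfl : f = r := by simpa [edges_leaf] using hf
    have h' : Γ f = s(y, .inl j) := h
    rw [h', Sym2.mem_iff] at haf
    refine ⟨rfl, ?_⟩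
    rcases haf with h | h
    · exact h.symm
    · cases h
  | node r b s t hs ht =>
    simp only [verts, List.mem_cons, List.mem_append, not_or] at ha
    rw [edges_node, List.mem_cons, List.mem_append] at hf
    rcases hf with rfl | hf | hf
    · rw [h.1, Sym2.mem_iff] at haf
      rcases haf with h | h
      · exact ⟨rfl, h.symm⟩
      · exact absurd (Sum.inr.inj h) ha.1
    · exact absurd (Sum.inr.inj (hs h.2.1 ha.2.1 hf).2).symm ha.1
    · exact absurd (Sum.inr.inj (ht h.2.2 ha.2.2 hf).2).symm ha.1

/-- A tree of distinct vertices and edges is what the recursion `Graph.readTree` sees, once no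
further edges of the graph are attached to its nodes. -/
theorem Fits.reads {y : Vertex n v} {P : LTree n v e} (h : P.Fits Γ y) (hv : P.verts.Nodup)
    (he : P.edges.Nodup) (hout : ∀ a ∈ P.verts, ∀ f ∉ P.edges, .inr a ∉ Γ f)
    (hy : ∀ a ∈ P.verts, y ≠ .inr a) : P.Reads Γ y := by
  induction P generalizing y with
  | leaf r j => exact h
  | node r a s t hs ht =>
    simp only [verts, List.nodup_cons, List.mem_append, not_or, List.nodup_append] at hv
    simp only [edges_node, List.nodup_cons, List.mem_append, not_or, List.nodup_append] at he
    simp only [verts, List.mem_cons, List.mem_append, edges_node] at hout hy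
    obtain ⟨⟨has, hat⟩, hsv, htv, hst⟩ := hv
    obtain ⟨⟨hrs, hrt⟩, hse, hte, hste⟩ := he
    refine ⟨h.1, fun f => ⟨fun hf => ?_, ?_⟩, ⟨?_, ?_, ?_⟩, hs h.2.1 hsv hse ?_ ?_,
      ht h.2.2 htv hte ?_ ?_⟩
    · by_cases hm : f = r ∨ f ∈ s.edges ∨ f ∈ t.edges
      · rcases hm with hm | hm | hm
        · exact Or.inl hm
        · exact Or.inr (Or.inl (h.2.1.eq_root has hm hf).1)
        · exact Or.inr (Or.inr (h.2.2.eq_root hat hm hf).1)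
      · exact absurd hf (hout a (Or.inl rfl) f hm)
    · rintro (rfl | rfl | rfl)
      · rw [h.1]; simp
      · rw [h.2.1.root_eq]; simp
      · rw [h.2.2.root_eq]; simp
    · rintro rfl; exact hrs s.root_mem
    · rintro rfl; exact hrt t.root_mem
    · exact hste _ s.root_mem _ t.root_mem
    · intro b hb f hf hbf
      by_cases hm : f = r ∨ f ∈ t.edges
      · rcases hm with rfl | hm
        · rw [h.1, Sym2.mem_iff] at hbf
          rcases hbf with hbf | hbf
          · exact hy b (Or.inr (Or.inl hb)) hbf.symm
          · exact has (Sum.inr.inj hbf ▸ hb)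
        · have := (h.2.2.eq_root (fun hb' => hst _ hb _ hb' rfl) hm hbf).2
          exact has (Sum.inr.inj this ▸ hb)
      · exact hout b (Or.inr (Or.inl hb)) f (by tauto) hbf
    · rintro b hb hab
      exact has (Sum.inr.inj hab ▸ hb)
    · intro b hb f hf hbf
      by_cases hm : f = r ∨ f ∈ s.edges
      · rcases hm with rfl | hm
        · rw [h.1, Sym2.mem_iff] at hbf
          rcases hbf with hbf | hbf
          · exact hy b (Or.inr (Or.inr hb)) hbf.symm
          · exact hat (Sum.inr.inj hbf ▸ hb)
        · have := (h.2.1.eq_root (fun hb' => hst _ hb' _ hb rfl) hm hbf).2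
          exact hat (Sum.inr.inj this ▸ hb)
      · exact hout b (Or.inr (Or.inr hb)) f (by tauto) hbf
    · rintro b hb hab
      exact hat (Sum.inr.inj hab ▸ hb)

theorem otherEnd_eq {r : Fin e} {x z : Vertex n v} (h : Γ r = s(x, z)) : Γ.otherEnd r x = z := by
  have hx : x ∈ Γ r := by rw [h]; simp
  rw [Graph.otherEnd, dif_pos hx]
  have := Sym2.other_spec hx
  conv_rhs at this => rw [h]
  exact Sym2.congr_right.1 this

theorem sort_pair {e : ℕ} {p q : Fin e} (h : p < q) : ({p, q} : Finset (Fin e)).sort = [p, q] := by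
  rw [Finset.sort_insert, Finset.sort_singleton]
  · simpa using h.le
  · simpa using h.ne

/-- `Graph.readTree` finds the tree, up to the order of the subtrees at the nodes. Exchanging the
two subtrees at a node changes both the sign of the Lie word and the sign of the list of edges. -/
theorem Reads.readTree {y : Vertex n v} {P : LTree n v e} (h : P.Reads Γ y) {k : ℕ}
    (hk : P.verts.length < k) :
    ∃ (T : PlanarTree n e) (ε : ℤ), Γ.readTree k P.root P.top = some T ∧ ε * ε = 1 ∧
      T.lieWord K = (ε : K) • P.lw K ∧ SignRel ε T.edges P.edges := by
  induction P generalizing y k with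
  | leaf r j =>
    obtain ⟨k, rfl⟩ : ∃ k', k = k' + 1 := ⟨k - 1, by omega⟩
    exact ⟨.leaf r j, 1, rfl, rfl, by simp [PlanarTree.lieWord, lw], SignRel.refl _⟩
  | node r a s t hs ht =>
    obtain ⟨k, rfl⟩ : ∃ k', k = k' + 1 := ⟨k - 1, by omega⟩
    obtain ⟨h1, h2, ⟨h3, h4, h5⟩, h6, h7⟩ := h
    simp only [verts, List.length_cons, List.length_append] at hk
    obtain ⟨S, ε, hS, hε, hSw, hSe⟩ := hs h6 (k := k) (by omega)
    obtain ⟨T, δ, hT, hδ, hTw, hTe⟩ := ht h7 (k := k) (by omega)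
    have hinc : (Γ.incident (.inr a)).erase r = {s.root, t.root} := by
      ext f
      simp only [Graph.incident, Finset.mem_erase, Finset.mem_filter, Finset.mem_univ, true_and,
        h2, Finset.mem_insert, Finset.mem_singleton]
      constructor
      · rintro ⟨hne, h | h | h⟩
        · exact absurd h hne
        · exact Or.inl h
        · exact Or.inr h
      · rintro (rfl | rfl)
        · exact ⟨h3.symm, by simp⟩
        · exact ⟨h4.symm, by simp⟩
    have ho1 := otherEnd_eq h6.fits.root_eq
    have ho2 := otherEnd_eq h7.fits.root_eq
    rcases lt_or_gt_of_ne h5 with hlt | hlt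
    · refine ⟨.node r S T, ε * δ, ?_, by rw [mul_mul_mul_comm, hε, hδ, one_mul], ?_, ?_⟩
      · change Γ.readTree (k + 1) r (.inr a) = _
        simp only [Graph.readTree, hinc, sort_pair hlt, ho1, ho2, hS, hT]
      · rw [PlanarTree.lieWord, lw, hSw, hTw, smul_lie, lie_smul, smul_smul]; push_cast; rfl
      · rw [edges_node]
        exact (hSe.append hTe).cons r
    · refine ⟨.node r T S, -1 * (ε * δ), ?_, by linear_combination ε * ε * hδ + hε, ?_, ?_⟩
      · rw [Finset.pair_comm] at hinc
        change Γ.readTree (k + 1) r (.inr a) = _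
        simp only [Graph.readTree, hinc, sort_pair hlt, ho1, ho2, hS, hT]
      · rw [PlanarTree.lieWord, lw, hSw, hTw, ← lie_skew, smul_lie, lie_smul, smul_smul,
          ← neg_smul]
        push_cast
        rw [neg_one_mul]
      · rw [edges_node]
        have h8 := (hTe.append hSe).trans (signRel_swap_of_odd t.odd_edges s.odd_edges)
        have h9 := h8.cons r
        rwa [show δ * ε * -1 = -1 * (ε * δ) by ring] at h9

theorem listSign_mul_self {e : ℕ} (L : List (Fin e)) : listSign L * listSign L = 1 := by
  induction L with
  | nil => rfl
  | cons a L ih =>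
    rw [listSign, mul_mul_mul_comm, ih, mul_one, ← pow_add, ← two_mul, pow_mul]; simp

/-- The sum of the Lie words that one gets by moving the root to the leaves with label `j`, where
`y` is the Lie word of what lies beyond the root. -/
def reroot (j : Fin n) : Ass K n → LTree n v e → Ass K n
  | y, leaf _ k => if k = j then y else 0
  | y, node _ _ s t => s.reroot j ⁅t.lw K, y⁆ + t.reroot j ⁅y, s.lw K⁆

/-- Reading a tree from its leaves with label `j` instead of its root is given by a formula that
involves its Lie word only. -/
theorem reroot_eq (j : Fin n) (P : LTree n v e) (y : Ass K n) :
    P.reroot j y = adop (antipode (partialRight j (P.lw K))) y := by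
  induction P generalizing y with
  | leaf r k =>
    rw [reroot, lw, partialRight_X]
    by_cases h : k = j
    · have h1 : antipode (1 : Ass K n) = 1 := by
        ext w
        cases w <;> simp [antipode_apply, one_apply]
      rw [if_pos h, if_pos h.symm, h1, adop_one]
    · rw [if_neg h, if_neg (Ne.symm h), map_zero, adop_zero_left]
  | node r a s t hs ht =>
    rw [reroot, hs, ht, lw, partialRight_lie (lie_nil s.lw_mem_lie) (lie_nil t.lw_mem_lie), map_sub,
      antipode_mul, antipode_mul, antipode_of_mem_lie s.lw_mem_lie,
      antipode_of_mem_lie t.lw_mem_lie, adop_sub_left, adop_mul, adop_mul, adop_neg_left,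
      adop_neg_left, adop_of_mem_lie s.lw_mem_lie, adop_of_mem_lie t.lw_mem_lie, lie_skew,
      ← lie_skew (t.lw K) y, add_comm, sub_eq_add_neg, neg_neg]
    congr 1
    rw [← adopL_apply, ← adopL_apply, map_neg]

end LTree


theorem Graph.relabel_swap {Γ : Graph n v e} {a b : Fin e} (h : Γ a = Γ b) :
    Γ.relabel (Equiv.swap a b) 1 = Γ := by
  funext f
  unfold Graph.relabel
  have h2 : Γ (Equiv.swap a b f) = Γ f := by
    rw [Equiv.swap_apply_def]
    split_ifs with h3 h3
    · rw [h3, h]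
    · rw [h3, h]
    · rfl
  have h3 : ⇑(Equiv.sumCongr (Equiv.refl (Fin n)) (1 : Equiv.Perm (Fin v))) = id := by
    funext x
    rcases x with x | x <;> rfl
  rw [h2, h3, Sym2.map_id]
  rfl

namespace LTree

variable {Γ : Graph n v e}

/-- The contribution of the edge `r` at the external vertex `i` to `Graph.lieSeries`. -/
noncomputable def rootTerm (K : Type*) [Field K] (Γ : Graph n v e) (i : Fin n) (r : Fin e) :
    Ass K n :=
  match Γ.readTree e r (Γ.otherEnd r (.inl i)) with
  | some t => ((listSign t.edges : ℤ) : K) • t.lieWord K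
  | none => 0

theorem lieSeries_eq (i : Fin n) :
    Γ.lieSeries K i = ∑ r ∈ Γ.incident (.inl i), rootTerm K Γ i r := by
  unfold Graph.lieSeries rootTerm
  refine Finset.sum_congr rfl fun r _ => ?_
  cases Γ.readTree e r (Γ.otherEnd r (.inl i)) <;> rfl

/-- The recursion with fuel `e` in `Graph.lieSeries` terminates, since a tree has fewer nodes than
edges, and up to the sign of the edges its result does not depend on the chosen planar structure. -/
theorem Reads.rootTerm {i : Fin n} {P : LTree n v e} (h : P.Reads Γ (.inl i))
    (hn : P.edges.Nodup) :
    rootTerm K Γ i P.root = ((sgn P.edges : ℤ) : K) • P.lw K := by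
  have hl : P.verts.length < e := by
    have h1 := hn.length_le_card
    rw [P.edges_length, Fintype.card_fin] at h1
    omega
  obtain ⟨T, ε, hT, hε, hw, hs⟩ := h.readTree (K := K) hl
  rw [LTree.rootTerm, otherEnd_eq h.fits.root_eq, hT]
  have h1 := hs.sgn_eq
  have h2 : T.edges.Nodup := by
    by_contra h3
    rw [sgn, if_neg h3, sgn_of_nodup hn] at h1
    have h4 := listSign_mul_self P.edges
    have h5 : (ε * listSign P.edges) * (ε * listSign P.edges) = 1 := by
      linear_combination ε * ε * h4 + hε
    rw [← h1] at h5
    simp at h5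
  rw [sgn_of_nodup h2] at h1
  change ((listSign T.edges : ℤ) : K) • T.lieWord K = _
  rw [h1, hw, smul_smul]
  congr 1
  push_cast
  have : (ε : K) * ε = 1 := by rw [← Int.cast_mul, hε, Int.cast_one]
  linear_combination ((sgn P.edges : ℤ) : K) * this

/-- Moving the root from one leaf of a tree to the other ones: `Q` and `Q'` are the two parts of
the tree, seen from the two ends of an edge. -/
theorem sum_rootTerm_leafEdges (j : Fin n) (Q Q' : LTree n v e) (hr : Q.root = Q'.root)
    (hQ : Q.Reads Γ Q'.top) (hQ' : Q'.Reads Γ Q.top)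
    (hn : (Q.edges ++ Q'.innerEdges).Nodup) :
    ((Q.leafEdges j).map (LTree.rootTerm K Γ j)).sum =
      ((sgn (Q.edges ++ Q'.innerEdges) : ℤ) : K) • Q.reroot j (Q'.lw K) := by
  induction Q generalizing Q' with
  | leaf r k =>
    rw [leafEdges, reroot]
    split_ifs with h
    · subst h
      have h1 : ([r] ++ Q'.innerEdges) = Q'.edges := by rw [edges_eq, ← hr]; rfl
      rw [edges_leaf, h1] at hn ⊢
      rw [List.map_singleton, List.sum_singleton, show r = Q'.root from hr]
      exact Reads.rootTerm hQ' hn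
    · simp
  | node f a s t hs ht =>
    obtain ⟨h1, h2, ⟨h3, h4, h5⟩, h6, h7⟩ := hQ
    have hf : f = Q'.root := hr
    have hs' := hs (node s.root a t Q') rfl h6
      ⟨by rw [h6.fits.root_eq, Sym2.eq_swap], fun g => by rw [h2, ← hf]; tauto,
        ⟨h5, by rw [← hf]; exact h3.symm, by rw [← hf]; exact h4.symm⟩, h7, hQ'⟩
    have ht' := ht (node t.root a Q' s) rfl h7
      ⟨by rw [h7.fits.root_eq, Sym2.eq_swap], fun g => by rw [h2, ← hf]; tauto,
        ⟨by rw [← hf]; exact h4.symm, h5.symm, by rw [← hf]; exact h3⟩, hQ', h6⟩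
    rw [innerEdges_node] at hs' ht'
    rw [edges_node] at hn
    have p1 : (s.edges ++ (t.edges ++ Q'.edges)).Perm
        (f :: (s.edges ++ t.edges) ++ Q'.innerEdges) := by
      rw [edges_eq Q', ← hf, ← List.append_assoc]
      exact (List.perm_middle).trans (by simp)
    have p2 : (t.edges ++ (Q'.edges ++ s.edges)).Perm
        (f :: (s.edges ++ t.edges) ++ Q'.innerEdges) := by
      refine List.Perm.trans ?_ p1
      rw [← List.append_assoc]
      exact List.perm_append_comm
    have e1 : sgn (s.edges ++ (t.edges ++ Q'.edges)) =
        sgn (f :: (s.edges ++ t.edges) ++ Q'.innerEdges) := by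
      have := signRel_swap_of_even (L := s.edges ++ t.edges) (M := [f])
        (by rw [List.length_append]; exact (s.odd_edges.add_odd t.odd_edges).mul_right _)
        [] Q'.innerEdges
      rw [edges_eq Q', ← hf]
      simpa using this
    have e2 : sgn (t.edges ++ (Q'.edges ++ s.edges)) =
        sgn (f :: (s.edges ++ t.edges) ++ Q'.innerEdges) := by
      rw [← e1]
      have := signRel_swap_of_even (L := t.edges ++ Q'.edges) (M := s.edges)
        (by rw [List.length_append]; exact (t.odd_edges.add_odd Q'.odd_edges).mul_right _) [] []
      simpa using this
    rw [leafEdges, List.map_append, List.sum_append, hs' (p1.nodup_iff.2 hn),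
      ht' (p2.nodup_iff.2 hn), e1, e2, reroot, smul_add]
    rfl

theorem leafEdges_sublist (j : Fin n) (P : LTree n v e) : (P.leafEdges j).Sublist P.edges := by
  induction P with
  | leaf r k =>
    rw [leafEdges, edges_leaf]
    split_ifs
    · exact List.Sublist.refl _
    · exact List.nil_sublist _
  | node r a s t hs ht =>
    rw [leafEdges, edges_node]
    exact (hs.append ht).cons r

theorem Fits.mem_leafEdges {y : Vertex n v} {P : LTree n v e} (h : P.Fits Γ y) {j : Fin n}
    {f : Fin e} (hf : f ∈ P.edges) (hj : .inl j ∈ Γ f) :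
    f ∈ P.leafEdges j ∨ (f = P.root ∧ y = .inl j) := by
  induction P generalizing y with
  | leaf r k =>
    obtain rfl : f = r := by simpa [edges_leaf] using hf
    have h' : Γ f = s(y, .inl k) := h
    rw [h', Sym2.mem_iff] at hj
    rcases hj with hj | hj
    · exact Or.inr ⟨rfl, hj.symm⟩
    · left
      rw [leafEdges, if_pos (Sum.inl.inj hj).symm]
      exact List.mem_singleton_self _
  | node r b s t hs ht =>
    rw [leafEdges, List.mem_append]
    rw [edges_node, List.mem_cons, List.mem_append] at hf
    rcases hf with rfl | hf | hf
    · rw [h.1, Sym2.mem_iff] at hj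
      rcases hj with hj | hj
      · exact Or.inr ⟨rfl, hj.symm⟩
      · cases hj
    · rcases hs h.2.1 hf with h | h
      · exact Or.inl (Or.inl h)
      · exact absurd h.2 (by simp)
    · rcases ht h.2.2 hf with h | h
      · exact Or.inl (Or.inr h)
      · exact absurd h.2 (by simp)

theorem Fits.of_mem_leafEdges {y : Vertex n v} {P : LTree n v e} (h : P.Fits Γ y) {j : Fin n}
    {f : Fin e} (hf : f ∈ P.leafEdges j) : .inl j ∈ Γ f := by
  induction P generalizing y with
  | leaf r k =>
    rw [leafEdges] at hf
    split_ifs at hf with hk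
    · obtain rfl : f = r := by simpa using hf
      have h' : Γ f = s(y, .inl k) := h
      rw [h', hk]; simp
    · simp at hf
  | node r b s t hs ht =>
    rw [leafEdges, List.mem_append] at hf
    rcases hf with hf | hf
    · exact hs h.2.1 hf
    · exact ht h.2.2 hf

/-- The graph `Γ` is a tree, read off from the external vertex `i` as the labelled tree `P`. -/
structure TreeAt (Γ : Graph n v e) (i : Fin n) (P : LTree n v e) : Prop where
  fits : P.Fits Γ (.inl i)
  top_ne : P.top ≠ .inl i
  edges_nodup : P.edges.Nodup
  mem_edges : ∀ f, f ∈ P.edges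
  verts_nodup : P.verts.Nodup
  mem_verts : ∀ a, a ∈ P.verts

namespace TreeAt

variable {i : Fin n} {P : LTree n v e}

theorem reads (h : TreeAt Γ i P) : P.Reads Γ (.inl i) :=
  h.fits.reads h.verts_nodup h.edges_nodup (fun _ _ f hf => absurd (h.mem_edges f) hf)
    fun _ _ => by simp

theorem edges_length (h : TreeAt Γ i P) : P.edges.length = e := by
  have := List.Nodup.length_le_card h.edges_nodup
  refine le_antisymm (by simpa using this) ?_
  have h2 : (Finset.univ : Finset (Fin e)) ⊆ P.edges.toFinset := fun f _ => by
    simpa using h.mem_edges f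
  simpa using (Finset.card_le_card h2).trans (List.toFinset_card_le _)

theorem verts_length (h : TreeAt Γ i P) : P.verts.length = v := by
  have := List.Nodup.length_le_card h.verts_nodup
  refine le_antisymm (by simpa using this) ?_
  have h2 : (Finset.univ : Finset (Fin v)) ⊆ P.verts.toFinset := fun f _ => by
    simpa using h.mem_verts f
  simpa using (Finset.card_le_card h2).trans (List.toFinset_card_le _)

theorem root_notMem_leafEdges (h : TreeAt Γ i P) : P.root ∉ P.leafEdges i := by
  intro hr
  have h3 := h.top_ne
  have h4 := h.edges_nodup
  cases P with
  | leaf r k =>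
    rw [leafEdges] at hr
    split_ifs at hr with hk
    · exact h3 (by rw [hk]; rfl)
    · simp at hr
  | node r a s t =>
    rw [edges_node, List.nodup_cons] at h4
    rw [leafEdges] at hr
    exact h4.1 (((leafEdges_sublist i s).append (leafEdges_sublist i t)).subset hr)

theorem incident_eq (h : TreeAt Γ i P) :
    Γ.incident (.inl i) = insert P.root (P.leafEdges i).toFinset := by
  ext f
  simp only [Graph.incident, Finset.mem_filter, Finset.mem_univ, true_and, Finset.mem_insert,
    List.mem_toFinset]
  constructor
  · intro hf
    rcases h.fits.mem_leafEdges (h.mem_edges f) hf with h | h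
    · exact Or.inr h
    · exact Or.inl h.1
  · rintro (rfl | hf)
    · rw [h.fits.root_eq]; simp
    · exact h.fits.of_mem_leafEdges hf

/-- The Lie series of a tree, expressed in terms of its Lie word with respect to one root. -/
theorem lieSeries (h : TreeAt Γ i P) (j : Fin n) :
    Γ.lieSeries K j = ((sgn P.edges : ℤ) : K) •
      ((if i = j then P.lw K else 0) + adop (antipode (partialRight j (P.lw K))) (X i)) := by
  have h1 := sum_rootTerm_leafEdges (K := K) (Γ := Γ) j P (leaf P.root i) rfl h.reads
    (show Γ P.root = s(P.top, .inl i) by rw [h.fits.root_eq, Sym2.eq_swap])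
    (by simpa [innerEdges] using h.edges_nodup)
  simp only [innerEdges, List.append_nil] at h1
  have hnd := h.edges_nodup.sublist (leafEdges_sublist j P)
  rw [← List.sum_toFinset _ hnd, reroot_eq] at h1
  rw [lieSeries_eq, smul_add]
  have hsub : ∀ f, f ∈ P.leafEdges j → .inl j ∈ Γ f := fun f hf => h.fits.of_mem_leafEdges hf
  by_cases hij : i = j
  · subst hij
    rw [h.incident_eq, Finset.sum_insert (by simpa using h.root_notMem_leafEdges), h1,
      h.reads.rootTerm h.edges_nodup, if_pos rfl]
    rfl
  · have hinc : Γ.incident (.inl j) = (P.leafEdges j).toFinset := by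
      ext f
      simp only [Graph.incident, Finset.mem_filter, Finset.mem_univ, true_and, List.mem_toFinset]
      constructor
      · intro hf
        rcases h.fits.mem_leafEdges (h.mem_edges f) hf with h | h
        · exact h
        · exact absurd (Sum.inl.inj h.2) hij
      · exact hsub f
    rw [hinc, h1, if_neg hij, smul_zero, zero_add]
    rfl

theorem rootTerm (h : TreeAt Γ i P) :
    rootTerm K Γ i P.root = ((sgn P.edges : ℤ) : K) • P.lw K := h.reads.rootTerm h.edges_nodup

theorem relabel (h : TreeAt Γ i P) (σ : Equiv.Perm (Fin e)) (τ : Equiv.Perm (Fin v)) :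
    TreeAt (Γ.relabel σ τ) i (P.map σ.symm τ) where
  fits := h.fits.map σ.symm τ fun f _ => by
    unfold Graph.relabel
    rw [Equiv.apply_symm_apply]
    rfl
  top_ne := by
    rw [top_map]
    intro h'
    apply h.top_ne
    cases hP : P.top with
    | inl k => rw [hP] at h'; exact h'
    | inr a => rw [hP] at h'; cases h'
  edges_nodup := by rw [edges_map]; exact h.edges_nodup.map σ.symm.injective
  mem_edges f := by rw [edges_map]; exact List.mem_map.2 ⟨σ f, h.mem_edges _, by simp⟩
  verts_nodup := by rw [verts_map]; exact h.verts_nodup.map τ.injective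
  mem_verts a := by rw [verts_map]; exact List.mem_map.2 ⟨τ.symm a, h.mem_verts _, by simp⟩

theorem lieSeries_relabel (h : TreeAt Γ i P) (σ : Equiv.Perm (Fin e)) (τ : Equiv.Perm (Fin v))
    (j : Fin n) : (Γ.relabel σ τ).lieSeries K j =
      (((Equiv.Perm.sign σ : ℤˣ) : ℤ) : K) • Γ.lieSeries K j := by
  rw [(h.relabel σ τ).lieSeries, h.lieSeries, lw_map, edges_map, sgn_map_perm _ h.mem_edges,
    Equiv.Perm.sign_symm, smul_smul]
  push_cast
  rfl

/-- If a tree has a double edge then exchanging the two edges shows that its Lie series vanish. -/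
theorem lieSeries_eq_zero [CharZero K] (h : TreeAt Γ i P) (hΓ : ¬ Function.Injective Γ)
    (j : Fin n) : Γ.lieSeries K j = 0 := by
  rw [Function.Injective] at hΓ
  push Not at hΓ
  obtain ⟨a, b, hab, hne⟩ := hΓ
  have h2 := h.lieSeries_relabel (K := K) (Equiv.swap a b) 1 j
  rw [Graph.relabel_swap hab, Equiv.Perm.sign_swap hne] at h2
  have h3 : (2 : K) • Γ.lieSeries K j = 0 := by
    rw [two_smul]
    nth_rewrite 1 [h2]
    simp
  exact (smul_eq_zero.1 h3).resolve_left two_ne_zero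

end TreeAt

end LTree


namespace Graph

/-! ### Counting internal loops -/

variable {Γ : Graph n v e}

theorem mem_incident {x : Vertex n v} {i : Fin e} : i ∈ Γ.incident x ↔ x ∈ Γ i := by
  simp [incident]

theorem ShareInternal.symm {i j : Fin e} (h : Γ.ShareInternal i j) : Γ.ShareInternal j i :=
  let ⟨a, h1, h2⟩ := h
  ⟨a, h2, h1⟩

theorem IsICG.exists_incident (h : Γ.IsICG) (a : Fin v) : ∃ i, .inr a ∈ Γ i := by
  obtain ⟨i, hi⟩ := Finset.card_pos.1 (lt_of_lt_of_le (by norm_num) (h.trivalent a))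
  exact ⟨i, mem_incident.1 hi⟩

theorem internal_adj {a b : Fin v} (hab : a ≠ b) {i : Fin e} (hi : Γ i = s(.inr a, .inr b)) :
    Γ.internal.Adj a b := by
  rw [internal, SimpleGraph.comap_adj, simple, SimpleGraph.fromEdgeSet_adj]
  exact ⟨⟨i, hi⟩, fun h => hab (Sum.inr.inj h)⟩

theorem reachable_of_mem {a b : Fin v} {i : Fin e} (ha : .inr a ∈ Γ i) (hb : .inr b ∈ Γ i) :
    Γ.internal.Reachable a b := by
  by_cases hab : a = b
  · rw [hab]
  · exact (internal_adj hab ((Sym2.mem_and_mem_iff fun h => hab (Sum.inr.inj h)).1 ⟨ha, hb⟩)).reachable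

theorem IsICG.preconnected (h : Γ.IsICG) : Γ.internal.Preconnected := by
  have key : ∀ i j, Relation.ReflTransGen Γ.ShareInternal i j → ∀ a b, .inr a ∈ Γ i →
      .inr b ∈ Γ j → Γ.internal.Reachable a b := by
    intro i j hij
    induction hij using Relation.ReflTransGen.head_induction_on with
    | refl => exact fun a b ha hb => reachable_of_mem ha hb
    | head hs _ ih =>
      intro a b ha hb
      obtain ⟨c, hc, hc'⟩ := hs
      exact (reachable_of_mem ha hc).trans (ih c b hc' hb)
  intro a b
  obtain ⟨i, hi⟩ := h.exists_incident a
  obtain ⟨j, hj⟩ := h.exists_incident b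
  exact key i j (h.connected i j) a b hi hj

/-- If there are internal vertices then no edge connects two external vertices. -/
theorem IsICG.exists_internal_end (h : Γ.IsICG) (hv : 0 < v) (i : Fin e) :
    ∃ a : Fin v, .inr a ∈ Γ i := by
  obtain ⟨j, hj⟩ := h.exists_incident ⟨0, hv⟩
  rcases Relation.ReflTransGen.cases_head (h.connected i j) with rfl | ⟨k, ⟨a, ha, _⟩, _⟩
  · exact ⟨_, hj⟩
  · exact ⟨a, ha⟩

theorem IsICG.edges_eq_one (h : Γ.IsICG) (hv : v = 0) : e = 1 := by
  subst hv
  have h1 : ∀ i j : Fin e, i = j := fun i j => by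
    rcases Relation.ReflTransGen.cases_head (h.connected i j) with rfl | ⟨k, ⟨a, _⟩, _⟩
    · rfl
    · exact a.elim0
  have := h.nonempty
  by_contra hne
  have := h1 ⟨0, by omega⟩ ⟨1, by omega⟩
  simp at this

open Classical in
/-- The edges between internal vertices. -/
noncomputable def internalEdges (Γ : Graph n v e) : Finset (Fin e) :=
  Finset.univ.filter fun i => ∀ j : Fin n, .inl j ∉ Γ i

theorem mem_internalEdges {i : Fin e} : i ∈ Γ.internalEdges ↔ ∀ j : Fin n, .inl j ∉ Γ i := by
  classical
  simp [internalEdges]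

theorem IsICG.ncard_edgeSet (h : Γ.IsICG) :
    Γ.internal.edgeSet.ncard = Γ.internalEdges.card := by
  classical
  rw [← Set.ncard_coe_finset]
  symm
  refine Set.ncard_congr' ?_
  have hpair : ∀ i ∈ Γ.internalEdges, ∃ z : Sym2 (Fin v), z.map Sum.inr = Γ i := by
    intro i hi
    rw [mem_internalEdges] at hi
    induction hx : Γ i using Sym2.ind with
    | _ x y =>
      rw [hx] at hi
      rcases x with x | x
      · exact absurd (Sym2.mem_mk_left _ _) (hi x)
      · rcases y with y | y
        · exact absurd (Sym2.mem_mk_right _ _) (hi y)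
        · exact ⟨s(x, y), rfl⟩
  have hinj : Function.Injective (Sym2.map (Sum.inr : Fin v → Vertex n v)) :=
    Sym2.map.injective Sum.inr_injective
  choose g hg using hpair
  have hmem : ∀ i (hi : i ∈ Γ.internalEdges), g i hi ∈ Γ.internal.edgeSet := by
    intro i hi
    have h1 := hg i hi
    have h2 := h.not_isDiag i
    rw [← h1] at h2
    induction hz : g i hi using Sym2.ind with
    | _ a b =>
      rw [hz] at h1 h2
      rw [SimpleGraph.mem_edgeSet]
      refine internal_adj (fun hab => h2 (by rw [hab]; simp)) (i := i) ?_
      rw [← h1, Sym2.map_mk]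
  refine Equiv.ofBijective (fun i => ⟨g i.1 i.2, hmem i.1 i.2⟩) ⟨?_, ?_⟩
  · rintro ⟨i, hi⟩ ⟨j, hj⟩ hij
    have : g i hi = g j hj := congrArg Subtype.val hij
    apply Subtype.ext
    apply h.injective
    rw [← hg i hi, ← hg j hj, this]
  · rintro ⟨z, hz⟩
    induction z using Sym2.ind with
    | _ a b =>
      rw [SimpleGraph.mem_edgeSet, internal, SimpleGraph.comap_adj, simple,
        SimpleGraph.fromEdgeSet_adj] at hz
      obtain ⟨⟨i, hi⟩, _⟩ := hz
      have hI : i ∈ Γ.internalEdges := by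
        rw [mem_internalEdges]
        intro j hj
        rw [hi, Sym2.mem_iff] at hj
        rcases hj with hj | hj <;> cases hj
      refine ⟨⟨i, hI⟩, Subtype.ext (hinj ?_)⟩
      change (g i hI).map _ = _
      rw [hg i hI, hi, Sym2.map_mk]

/-- If there are internal vertices, every edge has an internal end, and the internal edges have two.
-/
theorem IsICG.sum_valence (h : Γ.IsICG) (hv : 0 < v) :
    ∑ a : Fin v, (Γ.incident (.inr a)).card = e + Γ.internalEdges.card := by
  classical
  have h1 := Finset.sum_card_bipartiteAbove_eq_sum_card_bipartiteBelow
    (s := (Finset.univ : Finset (Fin v))) (t := (Finset.univ : Finset (Fin e)))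
    (fun a i => (.inr a : Vertex n v) ∈ Γ i)
  have h2 : ∀ i : Fin e, (Finset.univ.filter fun a : Fin v => (.inr a : Vertex n v) ∈ Γ i).card =
      1 + if i ∈ Γ.internalEdges then 1 else 0 := by
    intro i
    obtain ⟨a, ha⟩ := h.exists_internal_end hv i
    obtain ⟨y, hy⟩ := ha
    have hd := h.not_isDiag i
    rw [hy] at hd
    rcases y with j | b
    · rw [if_neg, add_zero, Finset.card_eq_one]
      · refine ⟨a, ?_⟩
        ext b
        simp [hy]
      · rw [mem_internalEdges]
        push Not
        exact ⟨j, by rw [hy]; simp⟩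
    · rw [if_pos, Finset.card_eq_two.2 ⟨a, b, ?_, ?_⟩]
      · rintro rfl
        exact hd (by simp)
      · ext c
        simp [hy]
      · rw [mem_internalEdges]
        intro j
        rw [hy]; simp
  calc ∑ a : Fin v, (Γ.incident (.inr a)).card
      = ∑ i : Fin e, (Finset.univ.filter fun a : Fin v => (.inr a : Vertex n v) ∈ Γ i).card := by
        refine Eq.trans (Finset.sum_congr rfl fun a _ => congrArg Finset.card ?_) h1
        ext i
        simp [incident, Finset.bipartiteAbove]
    _ = e + Γ.internalEdges.card := by
        simp only [h2, Finset.sum_add_distrib]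
        simp

/-- The number of internal loops in terms of the valences. -/
theorem IsICG.loops_add (h : Γ.IsICG) :
    Γ.loops + e + v = 1 + ∑ a : Fin v, (Γ.incident (.inr a)).card := by
  rcases Nat.eq_zero_or_pos v with hv | hv
  · have he := h.edges_eq_one hv
    subst hv
    have h1 : Γ.internal.edgeSet.ncard = 0 := by
      rw [Set.ncard_eq_zero, Set.eq_empty_iff_forall_notMem]
      intro z
      induction z using Sym2.ind with
      | _ a b => exact a.elim0
    have h2 : Nat.card Γ.internal.ConnectedComponent = 0 := by
      rw [Nat.card_eq_zero]
      left
      constructor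
      intro c
      induction c using SimpleGraph.ConnectedComponent.ind with
      | _ a => exact a.elim0
    rw [loops, h1, h2]
    simp [he]
  · have : Nonempty (Fin v) := ⟨⟨0, hv⟩⟩
    have h0 : Γ.internal.Connected := { preconnected := h.preconnected }
    have h1 : Nat.card Γ.internal.ConnectedComponent = 1 := by
      rw [Nat.card_eq_one_iff_unique]
      exact ⟨h.preconnected.subsingleton_connectedComponent,
        ⟨Γ.internal.connectedComponentMk ⟨0, hv⟩⟩⟩
    have h2 := h0.card_vert_le_card_edgeSet_add_one
    rw [Nat.card_coe_set_eq, h.ncard_edgeSet, Nat.card_fin] at h2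
    rw [loops, h1, h.sum_valence hv, h.ncard_edgeSet]
    omega

end Graph


namespace LTree

variable {Γ : Graph n v e}

/-! ### Trees are the trivalent graphs without internal loops -/

theorem Fits.not_isDiag {y : Vertex n v} {P : LTree n v e} (h : P.Fits Γ y) (hn : P.verts.Nodup)
    (hy : ∀ a ∈ P.verts, y ≠ .inr a) (ht : P.top ≠ y) : ∀ f ∈ P.edges, ¬ (Γ f).IsDiag := by
  induction P generalizing y with
  | leaf r j =>
    intro f hf
    obtain rfl : f = r := by simpa [edges_leaf] using hf
    have h' : Γ f = s(y, .inl j) := h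
    rw [h', Sym2.mk_isDiag_iff]
    exact fun h => ht h.symm
  | node r a s t hs ht' =>
    intro f hf
    rw [verts, List.nodup_cons, List.nodup_append] at hn
    simp only [List.mem_append, not_or] at hn
    rw [edges_node, List.mem_cons, List.mem_append] at hf
    have key : ∀ p : LTree n v e, a ∉ p.verts → p.top ≠ .inr a ∧ ∀ b ∈ p.verts,
        (.inr a : Vertex n v) ≠ .inr b := by
      intro p hp
      refine ⟨?_, fun b hb hab => hp (Sum.inr.inj hab ▸ hb)⟩
      cases p with
      | leaf r j => simp [top]
      | node r b s t =>
        intro hab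
        obtain rfl : b = a := Sum.inr.inj hab
        exact hp (by simp [verts])
    rcases hf with rfl | hf | hf
    · rw [h.1, Sym2.mk_isDiag_iff]
      exact hy a (by simp [verts])
    · exact hs h.2.1 hn.2.1 (key s hn.1.1).2 (key s hn.1.1).1 f hf
    · exact ht' h.2.2 hn.2.2.1 (key t hn.1.2).2 (key t hn.1.2).1 f hf

theorem Reads.valence {y : Vertex n v} {P : LTree n v e} (h : P.Reads Γ y) {a : Fin v}
    (ha : a ∈ P.verts) : (Γ.incident (.inr a)).card = 3 := by
  induction P generalizing y with
  | leaf r j => simp [verts] at ha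
  | node r b s t hs ht =>
    obtain ⟨-, h2, ⟨h3, h4, h5⟩, h6, h7⟩ := h
    rw [verts, List.mem_cons, List.mem_append] at ha
    rcases ha with rfl | ha | ha
    · rw [Finset.card_eq_three]
      exact ⟨r, s.root, t.root, h3, h4, h5, by ext f; simp [Graph.mem_incident, h2]⟩
    · exact hs h6 ha
    · exact ht h7 ha

theorem simple_reachable {x y : Vertex n v} {f : Fin e} (h : Γ f = s(x, y)) :
    Γ.simple.Reachable x y := by
  by_cases hxy : x = y
  · rw [hxy]
  · refine SimpleGraph.Adj.reachable ?_
    rw [Graph.simple, SimpleGraph.fromEdgeSet_adj]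
    exact ⟨⟨f, h⟩, hxy⟩

theorem Fits.reachable {y : Vertex n v} {P : LTree n v e} (h : P.Fits Γ y) {a : Fin v}
    (ha : a ∈ P.verts) : Γ.simple.Reachable y (.inr a) := by
  induction P generalizing y with
  | leaf r j => simp [verts] at ha
  | node r b s t hs ht =>
    rw [verts, List.mem_cons, List.mem_append] at ha
    rcases ha with rfl | ha | ha
    · exact simple_reachable h.1
    · exact (simple_reachable h.1).trans (hs h.2.1 ha)
    · exact (simple_reachable h.1).trans (ht h.2.2 ha)

theorem Fits.connected {y : Vertex n v} {P : LTree n v e} (h : P.Fits Γ y) {f : Fin e}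
    (hf : f ∈ P.edges) : Relation.ReflTransGen Γ.ShareInternal P.root f := by
  induction P generalizing y with
  | leaf r j =>
    obtain rfl : f = r := by simpa [edges_leaf] using hf
    exact .refl
  | node r b s t hs ht =>
    rw [edges_node, List.mem_cons, List.mem_append] at hf
    have hr : .inr b ∈ Γ r := by rw [h.1]; simp
    rcases hf with rfl | hf | hf
    · exact .refl
    · exact .head ⟨b, hr, by rw [h.2.1.root_eq]; simp⟩ (hs h.2.1 hf)
    · exact .head ⟨b, hr, by rw [h.2.2.root_eq]; simp⟩ (ht h.2.2 hf)

theorem reflTransGen_shareInternal_symm {i j : Fin e}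
    (h : Relation.ReflTransGen Γ.ShareInternal i j) :
    Relation.ReflTransGen Γ.ShareInternal j i :=
  haveI : Std.Symm Γ.ShareInternal := ⟨fun _ _ h => h.symm⟩
  Std.Symm.symm _ _ h

namespace TreeAt

variable {i : Fin n} {P : LTree n v e}

theorem isICG (h : TreeAt Γ i P) (hΓ : Function.Injective Γ) : Γ.IsICG where
  injective := hΓ
  not_isDiag f := h.fits.not_isDiag h.verts_nodup (fun _ _ => by simp) h.top_ne f (h.mem_edges f)
  trivalent a := (h.reads.valence (h.mem_verts a)).ge
  reachable a := ⟨i, (h.fits.reachable (h.mem_verts a)).symm⟩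
  nonempty := Fin.pos P.root
  connected f g := (reflTransGen_shareInternal_symm (h.fits.connected (h.mem_edges f))).trans
    (h.fits.connected (h.mem_edges g))

theorem edges_eq (h : TreeAt Γ i P) : e = 2 * v + 1 := by
  rw [← h.edges_length, P.edges_length, h.verts_length]

theorem loops_eq_zero (h : TreeAt Γ i P) (hΓ : Function.Injective Γ) : Γ.loops = 0 := by
  have h1 := (h.isICG hΓ).loops_add
  rw [Finset.sum_congr rfl fun a _ => h.reads.valence (h.mem_verts a)] at h1
  have h2 := h.edges_eq
  simp at h1
  omega

end TreeAt

/-- Construction of the part of a graph beyond a vertex `z` as a tree, when each internal vertex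
`z` has an edge `up z` towards a root and all other edges at `z` lead to leaves or to vertices one
level up. -/
theorem exists_fits_of_levels (up : Fin v → Fin e) (y : Fin v → Vertex n v) (w : Fin v → Fin v)
    (h : Fin v → ℕ) (h1 : ∀ z, Γ (up z) = s(y z, .inr z))
    (h3 : ∀ z, (Γ.incident (.inr z)).card = 3)
    (h2 : ∀ z f, .inr z ∈ Γ f → f ≠ up z → (∃ j, Γ f = s(.inr z, .inl j)) ∨
      ∃ z', f = up z' ∧ y z' = .inr z ∧ w z' = z ∧ h z' = h z + 1) (N : ℕ) (hN : ∀ z, h z < N)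
    (z : Fin v) : ∃ P : LTree n v e, P.root = up z ∧ P.top = .inr z ∧ P.Fits Γ (y z) ∧
      P.verts.Nodup ∧ (∀ b ∈ P.verts, ∃ k, w^[k] b = z ∧ h b = h z + k) ∧
      ∀ b ∈ P.verts, ∀ f, .inr b ∈ Γ f → f ∈ P.edges := by
  classical
  induction hm : N - h z generalizing z with
  | zero => exact absurd (hN z) (by omega)
  | succ m ih =>
    have hup : up z ∈ Γ.incident (.inr z) := Graph.mem_incident.2 (by rw [h1]; simp)
    have hc : ((Γ.incident (.inr z)).erase (up z)).card = 2 := by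
      rw [Finset.card_erase_of_mem hup, h3]
    obtain ⟨p, q, hpq, he⟩ := Finset.card_eq_two.1 hc
    have hmem : ∀ f, .inr z ∈ Γ f → f = up z ∨ f = p ∨ f = q := by
      intro f hf
      by_cases hfu : f = up z
      · exact Or.inl hfu
      · have : f ∈ (Γ.incident (.inr z)).erase (up z) :=
          Finset.mem_erase.2 ⟨hfu, Graph.mem_incident.2 hf⟩
        rw [he] at this
        simpa using Or.inr this
    have key : ∀ f ∈ (Γ.incident (.inr z)).erase (up z), ∃ P : LTree n v e, P.root = f ∧
        P.Fits Γ (.inr z) ∧ P.verts.Nodup ∧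
        (∀ b ∈ P.verts, ∃ k, w^[k + 1] b = z ∧ h b = h z + (k + 1) ∧ up (w^[k] b) = f) ∧
        ∀ b ∈ P.verts, ∀ g, .inr b ∈ Γ g → g ∈ P.edges := by
      intro f hf
      rw [Finset.mem_erase, Graph.mem_incident] at hf
      rcases h2 z f hf.2 hf.1 with ⟨j, hj⟩ | ⟨z', rfl, hy', hw, hh⟩
      · exact ⟨leaf f j, rfl, hj, List.nodup_nil, fun b hb => by simp [verts] at hb,
          fun b hb => by simp [verts] at hb⟩
      · obtain ⟨P, p1, -, p2, p3, p4, p5⟩ := ih z' (by have := hN z'; omega)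
        refine ⟨P, p1, hy' ▸ p2, p3, fun b hb => ?_, p5⟩
        obtain ⟨k, hk, hk'⟩ := p4 b hb
        refine ⟨k, ?_, by omega, by rw [hk]⟩
        rw [Function.iterate_succ_apply', hk, hw]
    obtain ⟨s, s1, s2, s3, s4, s5⟩ := key p (by rw [he]; simp)
    obtain ⟨t, t1, t2, t3, t4, t5⟩ := key q (by rw [he]; simp)
    refine ⟨node (up z) z s t, rfl, rfl, ⟨h1 z, s2, t2⟩, ?_, ?_, ?_⟩
    · rw [verts, List.nodup_cons, List.nodup_append, List.mem_append, not_or]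
      refine ⟨⟨fun hz => ?_, fun hz => ?_⟩, s3, t3, fun b hb c hc hbc => ?_⟩
      · obtain ⟨k, -, hk, -⟩ := s4 z hz
        omega
      · obtain ⟨k, -, hk, -⟩ := t4 z hz
        omega
      · subst hbc
        obtain ⟨k, -, hk, hk'⟩ := s4 b hb
        obtain ⟨l, -, hl, hl'⟩ := t4 b hc
        obtain rfl : k = l := by omega
        exact hpq (hk'.symm.trans hl')
    · intro b hb
      rw [verts, List.mem_cons, List.mem_append] at hb
      rcases hb with rfl | hb | hb
      · exact ⟨0, rfl, rfl⟩
      · obtain ⟨k, hk, hk', -⟩ := s4 b hb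
        exact ⟨k + 1, hk, hk'⟩
      · obtain ⟨k, hk, hk', -⟩ := t4 b hb
        exact ⟨k + 1, hk, hk'⟩
    · intro b hb f hf
      rw [edges_node, List.mem_cons, List.mem_append]
      rw [verts, List.mem_cons, List.mem_append] at hb
      rcases hb with rfl | hb | hb
      · rcases hmem f hf with rfl | rfl | rfl
        · exact Or.inl rfl
        · exact Or.inr (Or.inl (s1 ▸ s.root_mem))
        · exact Or.inr (Or.inr (t1 ▸ t.root_mem))
      · exact Or.inr (Or.inl (s5 b hb f hf))
      · exact Or.inr (Or.inr (t5 b hb f hf))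

theorem Fits.mem_verts {y : Vertex n v} {P : LTree n v e} (h : P.Fits Γ y) {f : Fin e}
    (hf : f ∈ P.edges) {a : Fin v} (ha : .inr a ∈ Γ f) (hy : y ≠ .inr a) : a ∈ P.verts := by
  by_contra hn
  exact hy (h.eq_root hn hf ha).2

end LTree

open LTree in
/-- In degree `0`, a graph without internal loops is a tree, which can be rooted at any edge
incident to an external vertex. -/
theorem Graph.IsICG.exists_treeAt {Γ : Graph n v e} (h : Γ.IsICG) (he : e = 2 * v + 1)
    (hl : Γ.loops = 0) {r : Fin e} {i : Fin n} (hr : .inl i ∈ Γ r) :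
    ∃ P, TreeAt Γ i P ∧ P.root = r := by
  classical
  have hd := h.not_isDiag r
  obtain ⟨x, hx⟩ := hr
  rw [hx, Sym2.mk_isDiag_iff] at hd
  rcases Nat.eq_zero_or_pos v with hv | hv
  · subst hv
    rcases x with j | a
    · refine ⟨leaf r j, ⟨hx, Ne.symm hd, by simp [edges_leaf], fun f => ?_, List.nodup_nil,
        fun a => a.elim0⟩, rfl⟩
      rw [edges_leaf, List.mem_singleton, Fin.ext_iff]
      omega
    · exact a.elim0
  have hval := h.loops_add
  rw [hl] at hval
  have hval3 : ∀ a, (Γ.incident (.inr a)).card = 3 := by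
    have h1 : ∑ a : Fin v, 3 = ∑ a : Fin v, (Γ.incident (.inr a)).card := by
      simp; omega
    intro a
    exact ((Finset.sum_eq_sum_iff_of_le fun a _ => h.trivalent a).1 h1 a (Finset.mem_univ a)).symm
  have hI : Γ.internalEdges.card + 1 = v := by
    have := h.sum_valence hv
    simp only [hval3] at this
    simp at this
    omega
  obtain ⟨a, ha⟩ : ∃ a, x = .inr a := by
    obtain ⟨b, hb⟩ := h.exists_internal_end hv r
    rw [hx, Sym2.mem_iff] at hb
    rcases hb with hb | hb
    · cases hb
    · exact ⟨b, hb.symm⟩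
  subst ha
  have hpre := h.preconnected
  let dist : Fin v → ℕ := fun z => Γ.internal.dist z a
  have hpar : ∀ z : Fin v, ∃ (f : Fin e) (w : Fin v), z ≠ a → Γ f = s(.inr w, .inr z) ∧
      dist z = dist w + 1 := by
    intro z
    by_cases hz : z = a
    · exact ⟨r, a, fun h => absurd hz h⟩
    obtain ⟨p, hp⟩ := (hpre z a).exists_walk_length_eq_dist
    cases p with
    | nil => exact absurd rfl hz
    | @cons _ w _ hadj p =>
      have hadj' := hadj
      rw [Graph.internal, SimpleGraph.comap_adj, Graph.simple, SimpleGraph.fromEdgeSet_adj]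
        at hadj'
      obtain ⟨⟨f, hf⟩, -⟩ := hadj'
      refine ⟨f, w, fun _ => ⟨hf.trans Sym2.eq_swap, ?_⟩⟩
      rw [SimpleGraph.Walk.length_cons] at hp
      have h1 : Γ.internal.dist w a ≤ p.length := SimpleGraph.dist_le p
      obtain ⟨q, hq⟩ := (hpre w a).exists_walk_length_eq_dist
      have h2 : Γ.internal.dist z a ≤ (SimpleGraph.Walk.cons hadj q).length :=
        SimpleGraph.dist_le _
      rw [SimpleGraph.Walk.length_cons] at h2
      change Γ.internal.dist z a = Γ.internal.dist w a + 1
      omega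
  choose up w hpar using hpar
  have hup : ∀ z ≠ a, Γ (up z) = s(.inr (w z), .inr z) := fun z hz => (hpar z hz).1
  have hdist : ∀ z ≠ a, dist z = dist (w z) + 1 := fun z hz => (hpar z hz).2
  -- The parent edges are all the internal edges, since there are `v - 1` of both.
  have hinj : ∀ z ≠ a, ∀ z' ≠ a, up z = up z' → z = z' := by
    intro z hz z' hz' hzz
    have h1 := hup z hz
    rw [hzz, hup z' hz', Sym2.eq_iff] at h1
    rcases h1 with h1 | h1
    · exact (Sum.inr.inj h1.2).symm
    · have h2 : w z' = z := Sum.inr.inj h1.1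
      have h3 : z' = w z := Sum.inr.inj h1.2
      have h4 := hdist z hz
      have h5 := hdist z' hz'
      rw [← h3] at h4
      rw [h2] at h5
      omega
  have hsurj : ∀ f ∈ Γ.internalEdges, ∃ z ≠ a, up z = f := by
    intro f hf
    have himg : (Finset.univ.erase a).image up = Γ.internalEdges := by
      refine Finset.eq_of_subset_of_card_le (fun g hg => ?_) ?_
      · obtain ⟨z, hz, rfl⟩ := Finset.mem_image.1 hg
        rw [Graph.mem_internalEdges]
        intro j
        rw [hup z (Finset.mem_erase.1 hz).1]
        simp
      · rw [Finset.card_image_of_injOn]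
        · rw [Finset.card_erase_of_mem (Finset.mem_univ a), Finset.card_univ, Fintype.card_fin]
          omega
        · intro z hz z' hz' hzz
          exact hinj z (Finset.mem_erase.1 hz).1 z' (Finset.mem_erase.1 hz').1 hzz
    rw [← himg] at hf
    obtain ⟨z, hz, rfl⟩ := Finset.mem_image.1 hf
    exact ⟨z, (Finset.mem_erase.1 hz).1, rfl⟩
  obtain ⟨P, hP1, hP2, hP3, hP4, -, hP5⟩ := exists_fits_of_levels (Γ := Γ)
    (fun z => if z = a then r else up z) (fun z => if z = a then .inl i else .inr (w z)) w dist
    (fun z => by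
      by_cases hz : z = a
      · subst hz; simpa using hx
      · simpa [hz] using hup z hz)
    hval3 (fun z f hf hfu => by
      by_cases hfi : f ∈ Γ.internalEdges
      · right
        obtain ⟨z', hz', rfl⟩ := hsurj f hfi
        have hw : w z' = z := by
          rw [hup z' hz', Sym2.mem_iff] at hf
          rcases hf with hf | hf
          · exact (Sum.inr.inj hf).symm
          · obtain rfl : z = z' := Sum.inr.inj hf
            simp [hz'] at hfu
        exact ⟨z', by simp [hz'], by simp [hz', hw], hw, by rw [hdist z' hz', hw]⟩
      · left
        rw [Graph.mem_internalEdges] at hfi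
        push Not at hfi
        obtain ⟨j, hj⟩ := hfi
        exact ⟨j, (Sym2.mem_and_mem_iff (by simp)).1 ⟨hf, hj⟩⟩)
    (∑ z, (dist z + 1)) (fun z => lt_of_lt_of_le (Nat.lt_succ_self _)
      (Finset.single_le_sum (f := fun z => dist z + 1) (fun _ _ => Nat.zero_le _)
        (Finset.mem_univ z))) a
  simp only [if_true] at hP1 hP3
  have hedges : ∀ f, f ∈ P.edges := by
    intro f
    induction h.connected r f with
    | refl => exact hP1 ▸ P.root_mem
    | tail _ hs ih =>
      obtain ⟨b, hb, hb'⟩ := hs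
      exact hP5 b (hP3.mem_verts ih hb (by simp)) _ hb'
  have hverts : ∀ b, b ∈ P.verts := by
    intro b
    obtain ⟨f, hf⟩ := h.exists_incident b
    exact hP3.mem_verts (hedges f) hf (by simp)
  refine ⟨P, ⟨hP3, by rw [hP2]; simp, ?_, hedges, hP4, hverts⟩, hP1⟩
  have h1 : P.edges.toFinset = Finset.univ := by
    ext f; simp [hedges f]
  have h2 := hP4.length_le_card
  rw [Fintype.card_fin] at h2
  have h3 := P.edges_length
  refine Multiset.coe_nodup.1 (Multiset.dedup_card_eq_card_iff_nodup.1 ?_)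
  have h4 : P.edges.toFinset.card = e := by rw [h1]; simp
  rw [List.card_toFinset] at h4
  have h5 := P.edges.dedup_sublist.length_le
  simp
  omega


namespace Graph

/-! ### Splitting twice -/

/-- The weight of a vertex in the differential. -/
def weight (K : Type*) [Field K] : Vertex n v → K
  | .inl _ => 1
  | .inr _ => 1 / 2

/-- A vertex of a graph as a vertex of the graph after a splitting. -/
def old (x : Vertex n v) : Vertex n (v + 1) := Sum.map id Fin.castSucc x

/-- The vertex created by a splitting. -/
def new (n v : ℕ) : Vertex n (v + 1) := .inr (Fin.last v)

theorem old_injective : Function.Injective (old : Vertex n v → Vertex n (v + 1)) :=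
  Function.Injective.sumMap Function.injective_id (Fin.castSucc_injective v)

theorem old_ne_new (x : Vertex n v) : old x ≠ new n v := by
  rcases x with j | a
  · simp [old, new]
  · simpa [old, new] using (Fin.castSucc_lt_last a).ne

theorem weight_old (x : Vertex n v) : weight K (old x) = weight K x := by
  rcases x with j | a <;> rfl

theorem splitSum_eq (Γ : Graph n v e) : splitSum K Γ =
    ∑ x : Vertex n v, weight K x • ∑ S ∈ (Γ.incident x).powerset, cls K (Γ.split x S) := by
  rw [Fintype.sum_sum_type, splitSum, Finset.smul_sum]
  simp [weight]

theorem sum_vertex_succ {M : Type*} [AddCommMonoid M] (f : Vertex n (v + 1) → M) :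
    ∑ y, f y = ∑ x : Vertex n v, f (old x) + f (new n v) := by
  rw [Fintype.sum_sum_type, Fintype.sum_sum_type, Fin.sum_univ_castSucc, ← add_assoc]
  rfl

theorem split_castSucc (Γ : Graph n v e) (x : Vertex n v) (S : Finset (Fin e)) (i : Fin e) :
    Γ.split x S i.castSucc = (Γ i).map fun y => if i ∈ S ∧ y = x then new n v else old y := by
  rw [split, Fin.snoc_castSucc]
  rfl

theorem split_last (Γ : Graph n v e) (x : Vertex n v) (S : Finset (Fin e)) :
    Γ.split x S (Fin.last e) = s(old x, new n v) := by
  rw [split, Fin.snoc_last]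
  rfl

theorem old_mem_split_castSucc {Γ : Graph n v e} {x z : Vertex n v} {S : Finset (Fin e)}
    {i : Fin e} : old z ∈ Γ.split x S i.castSucc ↔ z ∈ Γ i ∧ ¬ (i ∈ S ∧ z = x) := by
  rw [split_castSucc, Sym2.mem_map]
  constructor
  · rintro ⟨y, hy, h⟩
    split_ifs at h with hc
    · exact absurd h.symm (old_ne_new z)
    · obtain rfl := old_injective h
      exact ⟨hy, hc⟩
  · rintro ⟨h1, h2⟩
    exact ⟨z, h1, by rw [if_neg h2]⟩

theorem new_mem_split_castSucc {Γ : Graph n v e} {x : Vertex n v} {S : Finset (Fin e)}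
    {i : Fin e} : new n v ∈ Γ.split x S i.castSucc ↔ i ∈ S ∧ x ∈ Γ i := by
  rw [split_castSucc, Sym2.mem_map]
  constructor
  · rintro ⟨y, hy, h⟩
    split_ifs at h with hc
    · exact ⟨hc.1, hc.2 ▸ hy⟩
    · exact absurd h (old_ne_new y)
  · rintro ⟨h1, h2⟩
    exact ⟨x, h2, by rw [if_pos ⟨h1, rfl⟩]⟩

theorem incident_split_old {Γ : Graph n v e} {x z : Vertex n v} (hz : z ≠ x)
    (S : Finset (Fin e)) :
    (Γ.split x S).incident (old z) = (Γ.incident z).map Fin.castSuccEmb := by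
  ext i
  induction i using Fin.lastCases with
  | last =>
    rw [mem_incident, split_last, Sym2.mem_iff]
    simp [old_injective.eq_iff, hz, old_ne_new z, (Fin.castSucc_lt_last _).ne]
  | cast i => simp [mem_incident, old_mem_split_castSucc, hz]

theorem incident_split_self (Γ : Graph n v e) (x : Vertex n v) (S : Finset (Fin e)) :
    (Γ.split x S).incident (old x) =
      insert (Fin.last e) ((Γ.incident x \ S).map Fin.castSuccEmb) := by
  ext i
  induction i using Fin.lastCases with
  | last => simp [mem_incident, split_last]
  | cast i => simp [mem_incident, old_mem_split_castSucc, (Fin.castSucc_lt_last _).ne]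

theorem incident_split_new {Γ : Graph n v e} {x : Vertex n v} {S : Finset (Fin e)}
    (hS : S ⊆ Γ.incident x) :
    (Γ.split x S).incident (new n v) = insert (Fin.last e) (S.map Fin.castSuccEmb) := by
  ext i
  induction i using Fin.lastCases with
  | last => simp [mem_incident, split_last]
  | cast i =>
    simp [mem_incident, new_mem_split_castSucc, (Fin.castSucc_lt_last _).ne]
    exact fun hi => mem_incident.1 (hS hi)

/-- The graph with two new vertices and two new edges, which arises from `Γ` by moving the ends of
the edges. -/
def two (Γ : Graph n v e) (φ : Fin e → Vertex n v → Vertex n (v + 2))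
    (f g : Sym2 (Vertex n (v + 2))) : Graph n (v + 2) (e + 2) :=
  Fin.snoc (α := fun _ => Sym2 (Vertex n (v + 2)))
    (Fin.snoc (α := fun _ => Sym2 (Vertex n (v + 2))) (fun i => (Γ i).map (φ i)) f) g

theorem split_split (Γ : Graph n v e) (x : Vertex n v) (S : Finset (Fin e)) (y : Vertex n (v + 1))
    (T : Finset (Fin (e + 1))) : (Γ.split x S).split y T = Γ.two
      (fun i z => if i.castSucc ∈ T ∧ (if i ∈ S ∧ z = x then new n v else old z) = y
        then new n (v + 1) else old (if i ∈ S ∧ z = x then new n v else old z))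
      (s(old x, new n v).map fun z => if Fin.last e ∈ T ∧ z = y then new n (v + 1) else old z)
      s(old y, new n (v + 1)) := by
  funext i
  induction i using Fin.lastCases with
  | last => rw [split_last, two, Fin.snoc_last]
  | cast i =>
    rw [split_castSucc, two, Fin.snoc_castSucc]
    induction i using Fin.lastCases with
    | last => rw [split_last, Fin.snoc_last]
    | cast i => rw [split_castSucc, Fin.snoc_castSucc, Sym2.map_map]; rfl

theorem two_congr {Γ : Graph n v e} {φ ψ : Fin e → Vertex n v → Vertex n (v + 2)}
    (h : ∀ i, ∀ x ∈ Γ i, φ i x = ψ i x) (f g : Sym2 (Vertex n (v + 2))) :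
    Γ.two φ f g = Γ.two ψ f g := by
  have : (fun i => (Γ i).map (φ i)) = fun i => (Γ i).map (ψ i) :=
    funext fun i => Sym2.map_congr (h i)
  rw [two, this, two]

theorem relabel_two (Γ : Graph n v e) (φ : Fin e → Vertex n v → Vertex n (v + 2))
    (f g : Sym2 (Vertex n (v + 2))) (τ : Equiv.Perm (Fin (v + 2))) :
    (Γ.two φ f g).relabel 1 τ = Γ.two (fun i x => vertexPerm n τ (φ i x))
      (f.map (vertexPerm n τ)) (g.map (vertexPerm n τ)) := by
  funext i
  induction i using Fin.lastCases with
  | last => simp [relabel, two, vertexPerm]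
  | cast i =>
    induction i using Fin.lastCases with
    | last => simp [relabel, two, vertexPerm]
    | cast i =>
      simp only [relabel, two, vertexPerm, Equiv.Perm.coe_one, id, Fin.snoc_castSucc, Sym2.map_map]
      rfl

theorem relabel_two_swap (Γ : Graph n v e) (φ : Fin e → Vertex n v → Vertex n (v + 2))
    (f g : Sym2 (Vertex n (v + 2))) :
    (Γ.two φ f g).relabel (Equiv.swap (Fin.last e).castSucc (Fin.last (e + 1))) 1 =
      Γ.two φ g f := by
  have h1 : ⇑(Equiv.sumCongr (Equiv.refl (Fin n)) (1 : Equiv.Perm (Fin (v + 2)))) = id := by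
    funext x
    rcases x with x | x <;> rfl
  funext i
  rw [relabel, h1, Sym2.map_id, id]
  induction i using Fin.lastCases with
  | last => rw [Equiv.swap_apply_right]; simp [two]
  | cast i =>
    induction i using Fin.lastCases with
    | last => rw [Equiv.swap_apply_left]; simp [two]
    | cast i =>
      rw [Equiv.swap_apply_of_ne_of_ne]
      · simp [two]
      · simpa using (Fin.castSucc_lt_last i).ne
      · exact (Fin.castSucc_lt_last _).ne

theorem cls_two_swap (Γ : Graph n v e) (φ : Fin e → Vertex n v → Vertex n (v + 2))
    (f g : Sym2 (Vertex n (v + 2))) : cls K (Γ.two φ g f) = -cls K (Γ.two φ f g) := by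
  rw [← relabel_two_swap, cls_relabel, Equiv.Perm.sign_swap]
  · simp
  · exact (Fin.castSucc_lt_last _).ne

theorem cls_two_perm (Γ : Graph n v e) (φ : Fin e → Vertex n v → Vertex n (v + 2))
    (f g : Sym2 (Vertex n (v + 2))) (τ : Equiv.Perm (Fin (v + 2))) :
    cls K (Γ.two (fun i x => vertexPerm n τ (φ i x))
      (f.map (vertexPerm n τ)) (g.map (vertexPerm n τ))) = cls K (Γ.two φ f g) := by
  rw [← relabel_two, cls_relabel, Equiv.Perm.sign_one]
  simp

/-- Attach the ends at `x` of the edges in `A` and `B` to two new vertices. -/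
def part (x : Vertex n v) (A B : Finset (Fin e)) (i : Fin e) (z : Vertex n v) : Vertex n (v + 2) :=
  if i ∈ A ∧ z = x then old (new n v) else if i ∈ B ∧ z = x then new n (v + 1) else old (old z)

/-- Attach the ends at `x` of the edges in `A`, and those at `y` of the edges in `B`, to two new
vertices. -/
def part₂ (x y : Vertex n v) (A B : Finset (Fin e)) (i : Fin e) (z : Vertex n v) :
    Vertex n (v + 2) :=
  if i ∈ A ∧ z = x then old (new n v) else if i ∈ B ∧ z = y then new n (v + 1) else old (old z)

variable (Γ : Graph n v e) (x : Vertex n v)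

theorem split_split_old (z : Vertex n v) (S T : Finset (Fin e)) :
    (Γ.split x S).split (old z) (T.map Fin.castSuccEmb) = Γ.two (part₂ x z S T)
      s(old (old x), old (new n v)) s(old (old z), new n (v + 1)) := by
  rw [split_split]
  have h1 : Fin.last e ∉ T.map Fin.castSuccEmb := by simp [(Fin.castSucc_lt_last _).ne]
  simp only [h1, false_and, if_false, Sym2.map_mk]
  refine two_congr (fun i y _ => ?_) _ _
  rw [part₂]
  by_cases hS : i ∈ S ∧ y = x
  · simp [hS, (old_ne_new z).symm]
  · simp only [hS, if_false, old_injective.eq_iff]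
    simp

theorem split_split_self (S T : Finset (Fin e)) :
    (Γ.split x S).split (old x) (T.map Fin.castSuccEmb) = Γ.two (part x S T)
      s(old (old x), old (new n v)) s(old (old x), new n (v + 1)) := by
  rw [split_split]
  have h1 : Fin.last e ∉ T.map Fin.castSuccEmb := by simp [(Fin.castSucc_lt_last _).ne]
  simp only [h1, false_and, if_false, Sym2.map_mk]
  refine two_congr (fun i y _ => ?_) _ _
  rw [part]
  by_cases hS : i ∈ S ∧ y = x
  · simp [hS, (old_ne_new x).symm]
  · simp only [hS, if_false, old_injective.eq_iff]
    simp

theorem split_split_self_insert (S T : Finset (Fin e)) :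
    (Γ.split x S).split (old x) (insert (Fin.last e) (T.map Fin.castSuccEmb)) =
      Γ.two (part x S T) s(old (new n v), new n (v + 1)) s(old (old x), new n (v + 1)) := by
  rw [split_split]
  have h2 : s(old x, new n v).map (fun z =>
      if Fin.last e ∈ insert (Fin.last e) (T.map Fin.castSuccEmb) ∧ z = old x then new n (v + 1)
      else old z) = s(old (new n v), new n (v + 1)) := by
    simp [Sym2.map_mk, (old_ne_new x).symm, Sym2.eq_swap]
  rw [h2]
  refine two_congr (fun i y _ => ?_) _ _
  rw [part]
  by_cases hS : i ∈ S ∧ y = x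
  · simp [hS, (old_ne_new x).symm]
  · simp only [hS, if_false, old_injective.eq_iff]
    simp [(Fin.castSucc_lt_last _).ne]

theorem split_split_new (S : Finset (Fin e)) {T : Finset (Fin e)} (h : T ⊆ S) :
    (Γ.split x S).split (new n v) (T.map Fin.castSuccEmb) = Γ.two (part x (S \ T) T)
      s(old (old x), old (new n v)) s(old (new n v), new n (v + 1)) := by
  rw [split_split]
  have h1 : Fin.last e ∉ T.map Fin.castSuccEmb := by simp [(Fin.castSucc_lt_last _).ne]
  simp only [h1, false_and, if_false, Sym2.map_mk]
  refine two_congr (fun i y _ => ?_) _ _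
  rw [part]
  by_cases hy : y = x
  · subst hy
    by_cases hS : i ∈ S <;> by_cases hT : i ∈ T
    · simp [hS, hT]
    · simp [hS, hT]
    · exact absurd (h hT) hS
    · simp [hS, hT, old_ne_new y]
  · simp [hy, old_ne_new y]

theorem split_split_new_insert (S : Finset (Fin e)) {T : Finset (Fin e)} (h : T ⊆ S) :
    (Γ.split x S).split (new n v) (insert (Fin.last e) (T.map Fin.castSuccEmb)) =
      Γ.two (part x (S \ T) T)
        s(old (old x), new n (v + 1)) s(old (new n v), new n (v + 1)) := by
  rw [split_split]
  have h2 : s(old x, new n v).map (fun z =>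
      if Fin.last e ∈ insert (Fin.last e) (T.map Fin.castSuccEmb) ∧ z = new n v then new n (v + 1)
      else old z) = s(old (old x), new n (v + 1)) := by
    have := old_ne_new x
    simp [Sym2.map_mk, this]
  rw [h2]
  refine two_congr (fun i y _ => ?_) _ _
  rw [part]
  have h3 : i.castSucc ∈ insert (Fin.last e) (T.map Fin.castSuccEmb) ↔ i ∈ T := by
    simp [(Fin.castSucc_lt_last _).ne]
  simp only [h3]
  by_cases hy : y = x
  · subst hy
    by_cases hS : i ∈ S <;> by_cases hT : i ∈ T
    · simp [hS, hT]
    · simp [hS, hT]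
    · exact absurd (h hT) hS
    · simp [hS, hT, old_ne_new y]
  · simp [hy, old_ne_new y]

/-- The exchange of the two new vertices. -/
def swapNew (v : ℕ) : Equiv.Perm (Fin (v + 2)) :=
  Equiv.swap (Fin.last v).castSucc (Fin.last (v + 1))

theorem swapNew_new : vertexPerm n (swapNew v) (new n (v + 1)) = old (new n v) := by
  simp [vertexPerm, swapNew, old, new]

theorem swapNew_old_new : vertexPerm n (swapNew v) (old (new n v)) = new n (v + 1) := by
  simp [vertexPerm, swapNew, old, new]

theorem swapNew_old_old (y : Vertex n v) :
    vertexPerm n (swapNew v) (old (old y)) = old (old y) := by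
  rcases y with j | a
  · simp [vertexPerm, old]
  · simp only [vertexPerm, swapNew, old, Sum.map_inr, Equiv.sumCongr_apply]
    rw [Equiv.swap_apply_of_ne_of_ne]
    · simpa using (Fin.castSucc_lt_last a).ne
    · exact (Fin.castSucc_lt_last _).ne

theorem cls_part₂ {z : Vertex n v} (hz : z ≠ x) (S T : Finset (Fin e)) :
    cls K (Γ.two (part₂ x z S T) s(old (old x), old (new n v)) s(old (old z), new n (v + 1))) =
      -cls K (Γ.two (part₂ z x T S) s(old (old z), old (new n v)) s(old (old x), new n (v + 1))) := by
  rw [← cls_two_perm _ _ _ _ (swapNew v), ← cls_two_swap]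
  simp only [Sym2.map_mk, swapNew_new, swapNew_old_new, swapNew_old_old]
  refine congrArg _ (two_congr (fun i y _ => ?_) _ _)
  rw [part₂, part₂]
  by_cases hx : y = x
  · subst hx
    by_cases hS : i ∈ S <;> simp [hS, hz.symm, swapNew_new, swapNew_old_new, swapNew_old_old]
  · by_cases hT : i ∈ T ∧ y = z
    · simp [hx, hT, swapNew_new, hz]
    · simp only [hx, hT, and_false, if_false, swapNew_old_old]

theorem map_swapNew_part {A B : Finset (Fin e)} (h : Disjoint A B) (i : Fin e) (y : Vertex n v) :
    vertexPerm n (swapNew v) (part x A B i y) = part x B A i y := by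
  rw [part, part]
  by_cases hx : y = x
  · subst hx
    by_cases hA : i ∈ A
    · simp [hA, Finset.disjoint_left.1 h hA, swapNew_old_new]
    · by_cases hB : i ∈ B
      · simp [hA, hB, swapNew_new]
      · simp [hA, hB, swapNew_old_old]
  · simp [hx, swapNew_old_old]

/-- The two new vertices are both joined to `x`; exchanging them together with their edges is an odd
permutation of the edges. -/
theorem cls_star {A B : Finset (Fin e)} (h : Disjoint A B) :
    cls K (Γ.two (part x A B) s(old (old x), old (new n v)) s(old (old x), new n (v + 1))) =
      -cls K (Γ.two (part x B A)
        s(old (old x), old (new n v)) s(old (old x), new n (v + 1))) := by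
  rw [← cls_two_perm _ _ _ _ (swapNew v), ← cls_two_swap]
  simp only [Sym2.map_mk, swapNew_new, swapNew_old_new, swapNew_old_old]
  exact congrArg _ (two_congr (fun i y _ => map_swapNew_part x h i y) _ _)

/-- The class of the graph in which `x` is replaced by a chain of three vertices; the edges in `B`
are attached to the middle one, those in `A` to the far end. -/
noncomputable def chain (K : Type*) [Field K] (Γ : Graph n v e) (x : Vertex n v)
    (A B : Finset (Fin e)) : ICGPart K n (v + 2) (e + 2) :=
  cls K (Γ.two (part x A B) s(old (new n v), new n (v + 1)) s(old (old x), new n (v + 1)))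

theorem cls_chain_swap {A B : Finset (Fin e)} (h : Disjoint A B) :
    cls K (Γ.two (part x A B) s(old (old x), old (new n v)) s(old (new n v), new n (v + 1))) =
      -chain K Γ x B A := by
  rw [← cls_two_perm _ _ _ _ (swapNew v), chain, ← cls_two_swap]
  simp only [Sym2.map_mk, swapNew_new, swapNew_old_new, swapNew_old_old]
  rw [Sym2.eq_swap (a := new n (v + 1)) (b := old (new n v))]
  exact congrArg _ (two_congr (fun i y _ => map_swapNew_part x h i y) _ _)

/-- Reversing a chain that replaces an internal vertex exchanges the two new edges. -/
theorem chain_reverse (a : Fin v) {A B : Finset (Fin e)} (h : Disjoint A B) :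
    chain K Γ (.inr a) A B = -chain K Γ (.inr a) (Γ.incident (.inr a) \ (A ∪ B)) B := by
  set τ : Equiv.Perm (Fin (v + 2)) := Equiv.swap a.castSucc.castSucc (Fin.last v).castSucc with hτ
  have ne1 : a.castSucc.castSucc ≠ (Fin.last (v + 1)) := (Fin.castSucc_lt_last _).ne
  have ne2 : (Fin.last v).castSucc ≠ (Fin.last (v + 1)) := (Fin.castSucc_lt_last _).ne
  have t1 : vertexPerm n τ (new n (v + 1)) = new n (v + 1) := by
    simp only [vertexPerm, hτ, new, Equiv.sumCongr_apply, Sum.map_inr]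
    rw [Equiv.swap_apply_of_ne_of_ne ne1.symm ne2.symm]
  have t2 : vertexPerm n τ (old (new n v)) = old (old (.inr a)) := by
    simp [vertexPerm, hτ, old, new]
  have t3 : vertexPerm n τ (old (old (.inr a))) = old (new n v) := by
    simp [vertexPerm, hτ, old, new]
  have t4 : ∀ y : Vertex n v, y ≠ .inr a → vertexPerm n τ (old (old y)) = old (old y) := by
    rintro (j | b) hb
    · simp [vertexPerm, old]
    · simp only [vertexPerm, hτ, old, Equiv.sumCongr_apply, Sum.map_inr]
      rw [Equiv.swap_apply_of_ne_of_ne]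
      · simpa using hb
      · simpa using (Fin.castSucc_lt_last b).ne
  rw [chain, ← cls_two_perm _ _ _ _ τ, chain, ← cls_two_swap]
  simp only [Sym2.map_mk, t1, t2, t3]
  refine congrArg _ (two_congr (fun i y hy => ?_) _ _)
  rw [part, part]
  by_cases hx : y = .inr a
  · subst hx
    have hi : i ∈ Γ.incident (.inr a) := mem_incident.2 hy
    by_cases hA : i ∈ A
    · simp [hA, Finset.disjoint_left.1 h hA, t2]
    · by_cases hB : i ∈ B
      · simp [hA, hB, t1]
      · simp [hA, hB, hi, t3]
  · simp [hx, t4 _ hx]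

end Graph


section Sums

variable {α M : Type*} [DecidableEq α] [AddCommMonoid M]

theorem sum_disjoint_comm (I : Finset α) (g : Finset α → Finset α → M) :
    ∑ A ∈ I.powerset, ∑ B ∈ (I \ A).powerset, g A B =
      ∑ A ∈ I.powerset, ∑ B ∈ (I \ A).powerset, g B A := by
  refine Finset.sum_comm' fun A B => ?_
  simp only [Finset.mem_powerset, Finset.subset_sdiff]
  constructor
  · rintro ⟨h1, h2, h3⟩; exact ⟨⟨h1, h3.symm⟩, h2⟩
  · rintro ⟨⟨h1, h2⟩, h3⟩; exact ⟨h1, h3, h2.symm⟩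

theorem sum_subset_eq_sum_disjoint (I : Finset α) (g : Finset α → Finset α → M) :
    ∑ S ∈ I.powerset, ∑ T ∈ S.powerset, g (S \ T) T =
      ∑ A ∈ I.powerset, ∑ B ∈ (I \ A).powerset, g A B := by
  rw [sum_disjoint_comm, Finset.sum_comm' (s' := fun T => I.powerset.filter fun S => T ⊆ S)
    (t' := I.powerset)]
  · refine Finset.sum_congr rfl fun T hT => ?_
    rw [Finset.mem_powerset] at hT
    refine Finset.sum_bij (fun S _ => S \ T) ?_ ?_ ?_ ?_
    · intro S hS
      rw [Finset.mem_filter, Finset.mem_powerset] at hS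
      exact Finset.mem_powerset.2 (Finset.sdiff_subset_sdiff hS.1 le_rfl)
    · intro S hS S' hS' h
      rw [Finset.mem_filter] at hS hS'
      rw [← Finset.sdiff_union_of_subset hS.2, ← Finset.sdiff_union_of_subset hS'.2, h]
    · intro A hA
      rw [Finset.mem_powerset, Finset.subset_sdiff] at hA
      refine ⟨A ∪ T, ?_, ?_⟩
      · rw [Finset.mem_filter, Finset.mem_powerset]
        exact ⟨Finset.union_subset hA.1 hT, Finset.subset_union_right⟩
      · rw [Finset.union_sdiff_right, Finset.sdiff_eq_self_of_disjoint hA.2]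
    · exact fun _ _ => rfl
  · intro S T
    simp only [Finset.mem_powerset, Finset.mem_filter]
    exact ⟨fun h => ⟨h, h.2.trans h.1⟩, fun h => h.1⟩

theorem sum_disjoint_reverse (I : Finset α) (g : Finset α → Finset α → M) :
    ∑ A ∈ I.powerset, ∑ B ∈ (I \ A).powerset, g (I \ (A ∪ B)) B =
      ∑ A ∈ I.powerset, ∑ B ∈ (I \ A).powerset, g A B := by
  rw [sum_disjoint_comm, sum_disjoint_comm (g := g)]
  refine Finset.sum_congr rfl fun B hB => ?_
  refine Finset.sum_bij' (fun A _ => I \ (A ∪ B)) (fun A _ => I \ (A ∪ B)) ?_ ?_ ?_ ?_ ?_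
  · intro A _
    exact Finset.mem_powerset.2 (Finset.sdiff_subset_sdiff le_rfl Finset.subset_union_right)
  · intro A _
    exact Finset.mem_powerset.2 (Finset.sdiff_subset_sdiff le_rfl Finset.subset_union_right)
  · intro A hA
    rw [Finset.mem_powerset, Finset.subset_sdiff] at hA
    ext i
    have : i ∈ A → i ∉ B := fun h => Finset.disjoint_left.1 hA.2 h
    have h2 : i ∈ A → i ∈ I := fun h => hA.1 h
    simp only [Finset.mem_sdiff, Finset.mem_union]
    tauto
  · intro A hA
    rw [Finset.mem_powerset, Finset.subset_sdiff] at hA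
    ext i
    have : i ∈ A → i ∉ B := fun h => Finset.disjoint_left.1 hA.2 h
    have h2 : i ∈ A → i ∈ I := fun h => hA.1 h
    simp only [Finset.mem_sdiff, Finset.mem_union]
    tauto
  · exact fun _ _ => rfl

theorem sum_powerset_map_castSucc {m : ℕ} (I : Finset (Fin m)) (g : Finset (Fin (m + 1)) → M) :
    ∑ T ∈ (I.map Fin.castSuccEmb).powerset, g T = ∑ T ∈ I.powerset, g (T.map Fin.castSuccEmb) := by
  symm
  refine Finset.sum_bij (fun T _ => T.map Fin.castSuccEmb) ?_ ?_ ?_ ?_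
  · intro T hT
    rw [Finset.mem_powerset] at hT ⊢
    exact Finset.map_subset_map.2 hT
  · exact fun T _ T' _ h => Finset.map_injective _ h
  · intro T hT
    obtain ⟨S, hS, rfl⟩ := Finset.subset_map_iff.1 (Finset.mem_powerset.1 hT)
    exact ⟨S, Finset.mem_powerset.2 hS, rfl⟩
  · exact fun _ _ => rfl

theorem sum_powerset_insert_last {m : ℕ} (I : Finset (Fin m)) (g : Finset (Fin (m + 1)) → M) :
    ∑ T ∈ (insert (Fin.last m) (I.map Fin.castSuccEmb)).powerset, g T =
      ∑ T ∈ I.powerset, g (T.map Fin.castSuccEmb) +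
        ∑ T ∈ I.powerset, g (insert (Fin.last m) (T.map Fin.castSuccEmb)) := by
  rw [Finset.sum_powerset_insert, sum_powerset_map_castSucc, sum_powerset_map_castSucc]
  simp [(Fin.castSucc_lt_last _).ne]

end Sums

namespace Graph

theorem eq_zero_of_eq_neg [CharZero K] {M : Type*} [AddCommGroup M] [Module K M] {x : M}
    (h : x = -x) : x = 0 := by
  have h2 : (2 : K) • x = 0 := by
    rw [two_smul]
    nth_rewrite 1 [h]
    simp
  exact (smul_eq_zero.1 h2).resolve_left two_ne_zero

/-- The chains cancel: for an external vertex because its weight is `1`, for an internal one because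
every chain occurs together with its reverse. -/
theorem smul_self_sub [CharZero K] (Γ : Graph n v e) (x : Vertex n v) :
    (weight K x * weight K x - weight K x) • (∑ A ∈ (Γ.incident x).powerset,
      ∑ B ∈ (Γ.incident x \ A).powerset, chain K Γ x A B) = 0 := by
  rcases x with j | a
  · simp [weight]
  · rw [eq_zero_of_eq_neg (K := K) (x := ∑ A ∈ (Γ.incident (.inr a)).powerset, _), smul_zero]
    conv_rhs => rw [← sum_disjoint_reverse, ← Finset.sum_neg_distrib]
    refine Finset.sum_congr rfl fun A _ => ?_
    rw [← Finset.sum_neg_distrib]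
    refine Finset.sum_congr rfl fun B hB => ?_
    rw [Finset.mem_powerset, Finset.subset_sdiff] at hB
    exact chain_reverse Γ a hB.2.symm

/-- Splitting a vertex and then one of its two parts. -/
theorem sum_split_split_same [CharZero K] (Γ : Graph n v e) (x : Vertex n v) :
    ∑ S ∈ (Γ.incident x).powerset,
      (weight K x • ∑ T ∈ ((Γ.split x S).incident (old x)).powerset,
          cls K ((Γ.split x S).split (old x) T) +
        (1 / 2 : K) • ∑ T ∈ ((Γ.split x S).incident (new n v)).powerset,
          cls K ((Γ.split x S).split (new n v) T)) = 
      (weight K x - 1) • ∑ A ∈ (Γ.incident x).powerset,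
        ∑ B ∈ (Γ.incident x \ A).powerset, chain K Γ x A B := by
  have hstar : ∑ S ∈ (Γ.incident x).powerset, ∑ T ∈ (Γ.incident x \ S).powerset,
      cls K ((Γ.split x S).split (old x) (T.map Fin.castSuccEmb)) = 0 := by
    apply eq_zero_of_eq_neg (K := K)
    conv_rhs => rw [sum_disjoint_comm, ← Finset.sum_neg_distrib]
    refine Finset.sum_congr rfl fun A _ => ?_
    rw [← Finset.sum_neg_distrib]
    refine Finset.sum_congr rfl fun B hB => ?_
    rw [Finset.mem_powerset, Finset.subset_sdiff] at hB
    rw [split_split_self Γ x, split_split_self Γ x, cls_star Γ x hB.2.symm]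
  have h1 : ∑ S ∈ (Γ.incident x).powerset,
      ∑ T ∈ ((Γ.split x S).incident (old x)).powerset, cls K ((Γ.split x S).split (old x) T) =
      ∑ A ∈ (Γ.incident x).powerset, ∑ B ∈ (Γ.incident x \ A).powerset, chain K Γ x A B := by
    simp only [incident_split_self, sum_powerset_insert_last, Finset.sum_add_distrib]
    rw [hstar, zero_add]
    refine Finset.sum_congr rfl fun A _ => Finset.sum_congr rfl fun B hB => ?_
    rw [Finset.mem_powerset, Finset.subset_sdiff] at hB
    rw [split_split_self_insert Γ x, chain]
  have h2 : ∑ S ∈ (Γ.incident x).powerset,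
      ∑ T ∈ ((Γ.split x S).incident (new n v)).powerset, cls K ((Γ.split x S).split (new n v) T) =
      (-2 : K) • ∑ A ∈ (Γ.incident x).powerset,
        ∑ B ∈ (Γ.incident x \ A).powerset, chain K Γ x A B := by
    have : ∀ S ∈ (Γ.incident x).powerset,
        ∑ T ∈ ((Γ.split x S).incident (new n v)).powerset,
          cls K ((Γ.split x S).split (new n v) T) =
        ∑ T ∈ S.powerset, -(chain K Γ x T (S \ T) + chain K Γ x (S \ T) T) := by
      intro S hS
      rw [incident_split_new (Finset.mem_powerset.1 hS), sum_powerset_insert_last,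
        ← Finset.sum_add_distrib]
      refine Finset.sum_congr rfl fun T hT => ?_
      rw [Finset.mem_powerset] at hT
      rw [split_split_new Γ x S hT, split_split_new_insert Γ x S hT,
        cls_chain_swap Γ x Finset.sdiff_disjoint, cls_two_swap, chain, chain, neg_add]
    rw [Finset.sum_congr rfl this,
      sum_subset_eq_sum_disjoint _ fun A B => -(chain K Γ x B A + chain K Γ x A B)]
    simp only [neg_add, Finset.sum_add_distrib, Finset.sum_neg_distrib]
    rw [sum_disjoint_comm _ fun A B => chain K Γ x B A]
    rw [neg_smul, two_smul, neg_add]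
  rw [Finset.sum_add_distrib, ← Finset.smul_sum, ← Finset.smul_sum, h1, h2, smul_smul, ← add_smul]
  congr 1
  ring

/-- The differential squares to zero, at the level of graphs that need not be admissible. -/
theorem sum_splitSum_split [CharZero K] (Γ : Graph n v e) :
    ∑ x, weight K x • ∑ S ∈ (Γ.incident x).powerset, splitSum K (Γ.split x S) = 0 := by
  have h1 : ∀ x, weight K x • ∑ S ∈ (Γ.incident x).powerset, splitSum K (Γ.split x S) =
      ∑ z, if z = x then 0 else (weight K x * weight K z) • ∑ S ∈ (Γ.incident x).powerset,
        ∑ T ∈ (Γ.incident z).powerset, cls K (Γ.two (part₂ x z S T)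
          s(old (old x), old (new n v)) s(old (old z), new n (v + 1))) := by
    intro x
    have h2 : ∀ S ∈ (Γ.incident x).powerset, splitSum K (Γ.split x S) =
        (∑ z, if z = x then 0 else weight K z • ∑ T ∈ (Γ.incident z).powerset,
          cls K (Γ.two (part₂ x z S T)
            s(old (old x), old (new n v)) s(old (old z), new n (v + 1)))) +
        (weight K x • ∑ T ∈ ((Γ.split x S).incident (old x)).powerset,
          cls K ((Γ.split x S).split (old x) T) +
        (1 / 2 : K) • ∑ T ∈ ((Γ.split x S).incident (new n v)).powerset,
          cls K ((Γ.split x S).split (new n v) T)) := by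
      intro S _
      rw [splitSum_eq, sum_vertex_succ, ← add_assoc]
      congr 1
      rw [← Finset.add_sum_erase _ _ (Finset.mem_univ x), weight_old]
      refine (add_comm _ _).trans (congrArg₂ _ ?_ rfl)
      rw [← Finset.add_sum_erase _ _ (Finset.mem_univ x), if_pos rfl, zero_add]
      refine Finset.sum_congr rfl fun z hz => ?_
      have hz' := (Finset.mem_erase.1 hz).1
      rw [if_neg hz', weight_old, incident_split_old hz', sum_powerset_map_castSucc]
      congr 1
      exact Finset.sum_congr rfl fun T _ => by rw [split_split_old Γ x]
    rw [Finset.sum_congr rfl h2, Finset.sum_add_distrib, sum_split_split_same, smul_add, smul_smul,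
      mul_sub, mul_one, smul_self_sub, add_zero, Finset.sum_comm, Finset.smul_sum]
    refine Finset.sum_congr rfl fun z _ => ?_
    split_ifs
    · simp
    · rw [← Finset.smul_sum, smul_smul]
  rw [Finset.sum_congr rfl fun x _ => h1 x]
  apply eq_zero_of_eq_neg (K := K)
  conv_rhs => rw [Finset.sum_comm, ← Finset.sum_neg_distrib]
  refine Finset.sum_congr rfl fun x _ => ?_
  rw [← Finset.sum_neg_distrib]
  refine Finset.sum_congr rfl fun z _ => ?_
  by_cases hz : z = x
  · rw [if_pos hz, if_pos hz.symm, neg_zero]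
  · rw [if_neg hz, if_neg (Ne.symm hz), ← smul_neg, mul_comm, Finset.sum_comm,
      ← Finset.sum_neg_distrib]
    congr 1
    refine Finset.sum_congr rfl fun T _ => ?_
    rw [← Finset.sum_neg_distrib]
    exact Finset.sum_congr rfl fun S _ => cls_part₂ Γ x hz S T

end Graph

end KRV

namespace KRV

open Ass

variable {K : Type*} [Field K] {n v e v₁ v₂ e₁ e₂ : ℕ}

namespace Graph

/-! ### Splittings of connected graphs -/

/-- There are no double edges, and internal vertices are at least trivalent. -/
def IsSound (Γ : Graph n v e) : Prop :=
  Function.Injective Γ ∧ ∀ a : Fin v, 3 ≤ (Γ.incident (.inr a)).card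

theorem IsICG.isSound {Γ : Graph n v e} (h : Γ.IsICG) : Γ.IsSound := ⟨h.injective, h.trivalent⟩

theorem cls_of_isICG {Γ : Graph n v e} (h : Γ.IsICG) :
    cls K Γ = Submodule.Quotient.mk (Finsupp.single ⟨Γ, h⟩ 1) := dif_pos h

theorem cls_of_not_isICG {Γ : Graph n v e} (h : ¬ Γ.IsICG) : cls K Γ = 0 := dif_neg h

theorem dPart_cls {Γ : Graph n v e} (h : Γ.IsICG) : dPart K n v e (cls K Γ) = splitSum K Γ := by
  rw [cls_of_isICG h, dPart, Submodule.liftQ_apply, Finsupp.linearCombination_single, one_smul]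

theorem card_incident_split_old {Γ : Graph n v e} {x z : Vertex n v} (hz : z ≠ x)
    (S : Finset (Fin e)) : ((Γ.split x S).incident (old z)).card = (Γ.incident z).card := by
  rw [incident_split_old hz, Finset.card_map]

theorem card_incident_split_self (Γ : Graph n v e) {x : Vertex n v} {S : Finset (Fin e)}
    (hS : S ⊆ Γ.incident x) :
    ((Γ.split x S).incident (old x)).card + S.card = (Γ.incident x).card + 1 := by
  rw [incident_split_self, Finset.card_insert_of_notMem (by simp [(Fin.castSucc_lt_last _).ne]),
    Finset.card_map, Finset.card_sdiff_of_subset hS]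
  have := Finset.card_le_card hS
  omega

theorem card_incident_split_new {Γ : Graph n v e} {x : Vertex n v} {S : Finset (Fin e)}
    (hS : S ⊆ Γ.incident x) : ((Γ.split x S).incident (new n v)).card = S.card + 1 := by
  rw [incident_split_new hS, Finset.card_insert_of_notMem (by simp [(Fin.castSucc_lt_last _).ne]),
    Finset.card_map]

/-- Splittings of an unsound graph do not contribute. A vertex of valence less than three cannot be
split into two vertices of valence at least three; exchanging the edges of a double edge is odd. -/
theorem splitSum_eq_zero [CharZero K] {Γ : Graph n v e} (h : ¬ Γ.IsSound) : splitSum K Γ = 0 := by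
  by_cases hi : Function.Injective Γ
  · have h2 : ∃ a : Fin v, (Γ.incident (.inr a)).card < 3 := by
      by_contra h2
      push Not at h2
      exact h ⟨hi, h2⟩
    obtain ⟨a, ha⟩ := h2
    rw [splitSum_eq]
    refine Finset.sum_eq_zero fun x _ => ?_
    rw [Finset.sum_eq_zero, smul_zero]
    intro S hS
    rw [Finset.mem_powerset] at hS
    refine cls_of_not_isICG fun hG => ?_
    have h1 : 3 ≤ ((Γ.split x S).incident (old (.inr a))).card := hG.trivalent a.castSucc
    by_cases hx : (.inr a : Vertex n v) = x
    · subst hx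
      have h2 : 3 ≤ ((Γ.split (.inr a) S).incident (new n v)).card := hG.trivalent (Fin.last v)
      rw [card_incident_split_new hS] at h2
      have h3 := Γ.card_incident_split_self hS
      omega
    · rw [card_incident_split_old hx] at h1
      omega
  · rw [Function.Injective] at hi
    push Not at hi
    obtain ⟨a, b, hab, hne⟩ := hi
    have h2 := splitSum_relabel K Γ (Equiv.swap a b) 1
    rw [relabel_swap hab, Equiv.Perm.sign_swap hne] at h2
    exact eq_zero_of_eq_neg (K := K) (by simpa using h2)

theorem IsSound.two_le_card {Γ : Graph n v e} {x : Vertex n v} {S : Finset (Fin e)}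
    (hS : S ⊆ Γ.incident x) (h : (Γ.split x S).IsSound) : 2 ≤ S.card := by
  have h2 : 3 ≤ ((Γ.split x S).incident (new n v)).card := h.2 (Fin.last v)
  rw [card_incident_split_new hS] at h2
  omega

/-- Edges which are connected by a chain of edges are still so after a splitting. -/
theorem reflTransGen_split {Γ : Graph n v e} (x : Vertex n v) (S : Finset (Fin e)) {i j : Fin e}
    (h : Relation.ReflTransGen Γ.ShareInternal i j) :
    Relation.ReflTransGen (Γ.split x S).ShareInternal i.castSucc j.castSucc := by
  have key : ∀ i j, Γ.ShareInternal i j →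
      Relation.ReflTransGen (Γ.split x S).ShareInternal i.castSucc j.castSucc := by
    rintro i j ⟨a, hi, hj⟩
    by_cases hx : (.inr a : Vertex n v) = x
    · have hl : ∀ k, .inr a ∈ Γ k → (Γ.split x S).ShareInternal k.castSucc (Fin.last e) := by
        intro k hk
        by_cases hkS : k ∈ S
        · exact ⟨Fin.last v, new_mem_split_castSucc.2 ⟨hkS, hx ▸ hk⟩,
            by rw [split_last]; exact Sym2.mem_mk_right _ _⟩
        · exact ⟨a.castSucc, old_mem_split_castSucc.2 ⟨hk, fun h => hkS h.1⟩,
            by rw [split_last, ← hx]; exact Sym2.mem_mk_left _ _⟩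
      exact .head (hl i hi) (.single (hl j hj).symm)
    · exact .single ⟨a.castSucc, old_mem_split_castSucc.2 ⟨hi, fun h => hx h.2⟩,
        old_mem_split_castSucc.2 ⟨hj, fun h => hx h.2⟩⟩
  induction h with
  | refl => exact .refl
  | tail _ hs ih => exact ih.trans (key _ _ hs)

theorem reachable_split {Γ : Graph n v e} (x : Vertex n v) (S : Finset (Fin e)) {y z : Vertex n v}
    (h : Γ.simple.Reachable y z) : (Γ.split x S).simple.Reachable (old y) (old z) := by
  have hx : (Γ.split x S).simple.Reachable (old x) (new n v) :=
    LTree.simple_reachable (split_last Γ x S)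
  have key : ∀ y z, Γ.simple.Adj y z → (Γ.split x S).simple.Reachable (old y) (old z) := by
    intro y z hyz
    rw [simple, SimpleGraph.fromEdgeSet_adj] at hyz
    obtain ⟨⟨i, hi⟩, -⟩ := hyz
    have h1 := split_castSucc Γ x S i
    rw [hi, Sym2.map_mk] at h1
    have h2 := LTree.simple_reachable h1
    have h3 : ∀ w, (Γ.split x S).simple.Reachable (old w)
        (if i ∈ S ∧ w = x then new n v else old w) := by
      intro w
      split_ifs with hw
      · rw [hw.2]; exact hx
      · rfl
    exact (h3 y).trans (h2.trans (h3 z).symm)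
  obtain ⟨p⟩ := h
  induction p with
  | nil => rfl
  | cons hadj _ ih => exact (key _ _ hadj).trans ih

/-- A splitting is connected if every edge is connected to one of the edges that are moved to the
new vertex. -/
theorem isICG_split {Γ : Graph n v e} {x : Vertex n v} {S : Finset (Fin e)}
    (hd : ∀ i, ¬ (Γ i).IsDiag) (hr : ∀ a : Fin v, ∃ j : Fin n, Γ.simple.Reachable (.inr a) (.inl j))
    (hS : S ⊆ Γ.incident x) (hs : (Γ.split x S).IsSound)
    (hc : ∀ i, ∃ k ∈ S, Relation.ReflTransGen Γ.ShareInternal i k) : (Γ.split x S).IsICG := by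
  have hl : ∀ i : Fin (e + 1),
      Relation.ReflTransGen (Γ.split x S).ShareInternal i (Fin.last e) := by
    intro i
    induction i using Fin.lastCases with
    | last => exact .refl
    | cast i =>
      obtain ⟨k, hk, hik⟩ := hc i
      refine (reflTransGen_split x S hik).trans (.single ⟨Fin.last v, ?_, ?_⟩)
      · exact new_mem_split_castSucc.2 ⟨hk, mem_incident.1 (hS hk)⟩
      · rw [split_last]; exact Sym2.mem_mk_right _ _
  have hold : ∀ y : Vertex n v, (∃ j : Fin n, Γ.simple.Reachable y (.inl j)) →
      ∃ j : Fin n, (Γ.split x S).simple.Reachable (old y) (.inl j) :=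
    fun y ⟨j, hj⟩ => ⟨j, reachable_split x S hj⟩
  refine ⟨hs.1, fun i => ?_, hs.2, fun a => ?_, Nat.succ_pos _, fun i j =>
    (hl i).trans (LTree.reflTransGen_shareInternal_symm (hl j))⟩
  · induction i using Fin.lastCases with
    | last =>
      rw [split_last, Sym2.mk_isDiag_iff]
      exact old_ne_new x
    | cast i =>
      have h1 := hd i
      rw [split_castSucc]
      induction hΓ : Γ i using Sym2.ind with
      | _ y z =>
        rw [hΓ, Sym2.mk_isDiag_iff] at h1
        rw [Sym2.map_mk, Sym2.mk_isDiag_iff]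
        split_ifs with h2 h3 h3
        · exact fun _ => h1 (h2.2.trans h3.2.symm)
        · exact (old_ne_new z).symm
        · exact old_ne_new y
        · exact fun h => h1 (old_injective h)
  · induction a using Fin.lastCases with
    | last =>
      have h1 : ∃ j : Fin n, Γ.simple.Reachable x (.inl j) := by
        rcases x with j | a
        · exact ⟨j, .refl _⟩
        · exact hr a
      obtain ⟨j, hj⟩ := hold x h1
      exact ⟨j, (LTree.simple_reachable (split_last Γ x S)).symm.trans hj⟩
    | cast a => exact hold _ (hr a)

theorem IsICG.split {Γ : Graph n v e} (h : Γ.IsICG) {x : Vertex n v} {S : Finset (Fin e)}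
    (hS : S ⊆ Γ.incident x) (hs : (Γ.split x S).IsSound) : (Γ.split x S).IsICG := by
  obtain ⟨k, hk⟩ := Finset.card_pos.1 (lt_of_lt_of_le Nat.zero_lt_two (hs.two_le_card hS))
  exact isICG_split h.not_isDiag h.reachable hS hs fun i => ⟨k, hk, h.connected i k⟩

/-! ### The product of two graphs -/

/-- Two graphs side by side, with common external vertices. The bijections `α` and `β` number the
edges and the internal vertices. -/
def mul (α : Fin e₁ ⊕ Fin e₂ ≃ Fin e) (β : Fin v₁ ⊕ Fin v₂ ≃ Fin v) (Γ₁ : Graph n v₁ e₁)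
    (Γ₂ : Graph n v₂ e₂) : Graph n v e := fun i =>
  match α.symm i with
  | .inl i => (Γ₁ i).map (Sum.map id fun a => β (.inl a))
  | .inr i => (Γ₂ i).map (Sum.map id fun a => β (.inr a))

variable (α : Fin e₁ ⊕ Fin e₂ ≃ Fin e) (β : Fin v₁ ⊕ Fin v₂ ≃ Fin v) (Γ₁ : Graph n v₁ e₁)
  (Γ₂ : Graph n v₂ e₂)

theorem mul_inl (i : Fin e₁) :
    mul α β Γ₁ Γ₂ (α (.inl i)) = (Γ₁ i).map (Sum.map id fun a => β (.inl a)) := by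
  rw [mul, Equiv.symm_apply_apply]

theorem mul_inr (i : Fin e₂) :
    mul α β Γ₁ Γ₂ (α (.inr i)) = (Γ₂ i).map (Sum.map id fun a => β (.inr a)) := by
  rw [mul, Equiv.symm_apply_apply]

theorem mul_swap : mul ((Equiv.sumComm _ _).trans α) ((Equiv.sumComm _ _).trans β) Γ₂ Γ₁ =
    mul α β Γ₁ Γ₂ := by
  funext i
  obtain ⟨i | i, rfl⟩ := α.surjective i
  · rw [mul_inl]
    exact mul_inr ((Equiv.sumComm _ _).trans α) ((Equiv.sumComm _ _).trans β) Γ₂ Γ₁ i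
  · rw [mul_inr]
    exact mul_inl ((Equiv.sumComm _ _).trans α) ((Equiv.sumComm _ _).trans β) Γ₂ Γ₁ i

/-- The extension of a numbering by a last element that belongs to the second summand. -/
def extendRight {p q r : ℕ} (α : Fin p ⊕ Fin q ≃ Fin r) : Fin p ⊕ Fin (q + 1) ≃ Fin (r + 1) where
  toFun := Sum.elim (fun i => (α (.inl i)).castSucc)
    (Fin.lastCases (Fin.last r) fun i => (α (.inr i)).castSucc)
  invFun := Fin.lastCases (.inr (Fin.last q)) fun i => Sum.map id Fin.castSucc (α.symm i)
  left_inv := by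
    rintro (i | i)
    · simp
    · induction i using Fin.lastCases with
      | last => simp
      | cast i => simp
  right_inv := by
    intro i
    induction i using Fin.lastCases with
    | last => simp
    | cast i =>
      obtain ⟨i | i, rfl⟩ := α.surjective i <;> simp

/-- The extension of a numbering by a last element that belongs to the first summand. -/
def extendLeft {p q r : ℕ} (α : Fin p ⊕ Fin q ≃ Fin r) : Fin (p + 1) ⊕ Fin q ≃ Fin (r + 1) :=
  (Equiv.sumComm _ _).trans (extendRight ((Equiv.sumComm _ _).trans α))

section

variable {p q r : ℕ} (γ : Fin p ⊕ Fin q ≃ Fin r)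

theorem extendRight_inl (i : Fin p) : extendRight γ (.inl i) = (γ (.inl i)).castSucc := rfl

theorem extendRight_castSucc (i : Fin q) :
    extendRight γ (.inr i.castSucc) = (γ (.inr i)).castSucc := by
  simp [extendRight]

theorem extendRight_last : extendRight γ (.inr (Fin.last q)) = Fin.last r := by
  simp [extendRight]

end

/-- A vertex of the second factor as a vertex of the product. -/
def right (β : Fin v₁ ⊕ Fin v₂ ≃ Fin v) (x : Vertex n v₂) : Vertex n v :=
  Sum.map id (fun a => β (.inr a)) x

theorem right_injective : Function.Injective (right (n := n) β) :=
  Function.Injective.sumMap Function.injective_id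
    fun _ _ h => Sum.inr_injective (β.injective h)

theorem split_mul (x : Vertex n v₂) (S : Finset (Fin e₂)) :
    (mul α β Γ₁ Γ₂).split (right β x) ((Finset.disjSum ∅ S).map α.toEmbedding) =
      mul (extendRight α) (extendRight β) Γ₁ (Γ₂.split x S) := by
  funext i
  induction i using Fin.lastCases with
  | last =>
    rw [split_last, ← extendRight_last α, mul_inr, split_last, Sym2.map_mk]
    refine congrArg₂ (fun y z => s(y, z)) ?_ ?_
    · rcases x with j | a
      · rfl
      · simp [old, right, extendRight_castSucc]
    · simp [new, extendRight_last]
  | cast i =>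
    rw [split_castSucc]
    obtain ⟨i | i, rfl⟩ := α.surjective i
    · rw [← extendRight_inl, mul_inl, mul_inl, Sym2.map_map]
      refine Sym2.map_congr fun y _ => ?_
      rcases y with j | a
      · simp [old]
      · simp [old, extendRight_inl]
    · rw [← extendRight_castSucc, mul_inr, mul_inr, split_castSucc, Sym2.map_map, Sym2.map_map]
      refine Sym2.map_congr fun y _ => ?_
      have h1 : (Sum.map id (fun a => β (.inr a)) y = right β x) ↔ y = x :=
        (right_injective β).eq_iff
      simp only [Function.comp, h1]
      by_cases h : i ∈ S ∧ y = x
      · simp [h, new, extendRight_last]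
      · have h2 : ¬ (α (.inr i) ∈ (Finset.disjSum ∅ S).map α.toEmbedding ∧ y = x) := by
          simpa using h
        rw [if_neg h2, if_neg h]
        rcases y with j | a
        · rfl
        · simp [old, extendRight_castSucc]

theorem incident_mul_inl (j : Fin n) : (mul α β Γ₁ Γ₂).incident (.inl j) =
    ((Γ₁.incident (.inl j)).disjSum (Γ₂.incident (.inl j))).map α.toEmbedding := by
  ext i
  obtain ⟨i | i, rfl⟩ := α.surjective i
  · rw [mem_incident, mul_inl]
    simp [Sym2.mem_map, mem_incident]
  · rw [mem_incident, mul_inr]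
    simp [Sym2.mem_map, mem_incident]

theorem incident_mul_inr (a : Fin v₂) : (mul α β Γ₁ Γ₂).incident (.inr (β (.inr a))) =
    ((∅ : Finset (Fin e₁)).disjSum (Γ₂.incident (.inr a))).map α.toEmbedding := by
  ext i
  obtain ⟨i | i, rfl⟩ := α.surjective i
  · rw [mem_incident, mul_inl]
    simp [Sym2.mem_map]
  · rw [mem_incident, mul_inr]
    simp [Sym2.mem_map, mem_incident]

end Graph

end KRV

namespace KRV

open Ass

variable {K : Type*} [Field K] {n v e v₁ v₂ e₁ e₂ : ℕ}

namespace Graph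

variable (α : Fin e₁ ⊕ Fin e₂ ≃ Fin e) (β : Fin v₁ ⊕ Fin v₂ ≃ Fin v) (Γ₁ : Graph n v₁ e₁)
  (Γ₂ : Graph n v₂ e₂)

theorem sum_powerset_disjSum {M : Type*} [AddCommMonoid M] (I : Finset (Fin e₁))
    (J : Finset (Fin e₂)) (g : Finset (Fin e) → M) :
    ∑ S ∈ ((I.disjSum J).map α.toEmbedding).powerset, g S =
      ∑ S ∈ I.powerset, ∑ T ∈ J.powerset, g ((S.disjSum T).map α.toEmbedding) := by
  rw [← Finset.sum_product']
  symm
  refine Finset.sum_bij (fun p _ => (p.1.disjSum p.2).map α.toEmbedding) ?_ ?_ ?_ ?_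
  · rintro ⟨S, T⟩ h
    rw [Finset.mem_product, Finset.mem_powerset, Finset.mem_powerset] at h
    rw [Finset.mem_powerset, Finset.map_subset_map]
    exact Finset.disjSum_mono h.1 h.2
  · rintro ⟨S, T⟩ _ ⟨S', T'⟩ _ h
    have h1 := Finset.map_injective _ h
    have h2 : S = S' := by
      ext i
      have := Finset.ext_iff.1 h1 (.inl i)
      simpa using this
    have h3 : T = T' := by
      ext i
      have := Finset.ext_iff.1 h1 (.inr i)
      simpa using this
    rw [h2, h3]
  · intro S hS
    obtain ⟨U, hU, rfl⟩ := Finset.subset_map_iff.1 (Finset.mem_powerset.1 hS)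
    refine ⟨(U.toLeft, U.toRight), ?_, ?_⟩
    · rw [Finset.mem_product, Finset.mem_powerset, Finset.mem_powerset]
      constructor
      · intro i hi
        simpa using hU (Finset.mem_toLeft.1 hi)
      · intro i hi
        simpa using hU (Finset.mem_toRight.1 hi)
    · rw [Finset.toLeft_disjSum_toRight]
  · exact fun _ _ => rfl

theorem isSound_of_mul (h : (mul α β Γ₁ Γ₂).IsSound) : Γ₂.IsSound := by
  refine ⟨fun i j hij => ?_, fun a => ?_⟩
  · have h1 : mul α β Γ₁ Γ₂ (α (.inr i)) = mul α β Γ₁ Γ₂ (α (.inr j)) := by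
      rw [mul_inr, mul_inr, hij]
    exact Sum.inr_injective (α.injective (h.1 h1))
  · have h1 := h.2 (β (.inr a))
    rwa [incident_mul_inr, Finset.card_map, Finset.card_disjSum, Finset.card_empty, zero_add] at h1

theorem not_isICG_mul (h₁ : 0 < e₁) (h₂ : 0 < e₂) : ¬ (mul α β Γ₁ Γ₂).IsICG := by
  intro h
  have key : ∀ i j, Relation.ReflTransGen (mul α β Γ₁ Γ₂).ShareInternal i j →
      ∀ k, i = α (.inl k) → ∃ k, j = α (.inl k) := by
    intro i j hij
    induction hij with
    | refl => exact fun k hk => ⟨k, hk⟩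
    | @tail j l _ hs ih =>
      intro k hk
      obtain ⟨k', rfl⟩ := ih k hk
      obtain ⟨a, ha, ha'⟩ := hs
      obtain ⟨l | l, rfl⟩ := α.surjective l
      · exact ⟨l, rfl⟩
      · exfalso
        rw [mul_inl, Sym2.mem_map] at ha
        rw [mul_inr, Sym2.mem_map] at ha'
        obtain ⟨x, -, hx⟩ := ha
        obtain ⟨y, -, hy⟩ := ha'
        rcases x with x | x
        · simp at hx
        · rcases y with y | y
          · simp at hy
          · rw [Sum.map_inr] at hx hy
            have := β.injective ((Sum.inr.inj hx).trans (Sum.inr.inj hy).symm)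
            simp at this
  obtain ⟨k, hk⟩ := key _ _ (h.connected (α (.inl ⟨0, h₁⟩)) (α (.inr ⟨0, h₂⟩))) _ rfl
  exact absurd (α.injective hk) (by simp)

theorem reachable_mul {y z : Vertex n v₂} (h : Γ₂.simple.Reachable y z) :
    (mul α β Γ₁ Γ₂).simple.Reachable (right β y) (right β z) := by
  obtain ⟨p⟩ := h
  induction p with
  | nil => rfl
  | cons hadj _ ih =>
    rw [simple, SimpleGraph.fromEdgeSet_adj] at hadj
    obtain ⟨⟨i, hi⟩, -⟩ := hadj
    refine (LTree.simple_reachable (f := α (.inr i)) ?_).trans ih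
    rw [mul_inr, hi, Sym2.map_mk]
    rfl

theorem reflTransGen_mul {i j : Fin e₂} (h : Relation.ReflTransGen Γ₂.ShareInternal i j) :
    Relation.ReflTransGen (mul α β Γ₁ Γ₂).ShareInternal (α (.inr i)) (α (.inr j)) := by
  refine Relation.ReflTransGen.lift (fun i => α (.inr i)) (fun i j => ?_) _ _ h
  rintro ⟨a, hi, hj⟩
  refine ⟨β (.inr a), ?_, ?_⟩
  · rw [mul_inr, Sym2.mem_map]; exact ⟨_, hi, rfl⟩
  · rw [mul_inr, Sym2.mem_map]; exact ⟨_, hj, rfl⟩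

theorem mul_not_isDiag (h : ∀ i, ¬ (Γ₂ i).IsDiag) (i : Fin e₂) :
    ¬ (mul α β Γ₁ Γ₂ (α (.inr i))).IsDiag := by
  have h1 := h i
  rw [mul_inr]
  induction hΓ : Γ₂ i using Sym2.ind with
  | _ y z =>
    rw [hΓ, Sym2.mk_isDiag_iff] at h1
    rw [Sym2.map_mk, Sym2.mk_isDiag_iff]
    exact fun h => h1 (right_injective β h)

variable {Γ₁ Γ₂}

/-- A splitting which moves edges of both factors to the new vertex connects the factors. -/
theorem isICG_split_mul (h₁ : Γ₁.IsICG) (h₂ : Γ₂.IsICG) {x : Vertex n v} {S : Finset (Fin e)}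
    (hS : S ⊆ (mul α β Γ₁ Γ₂).incident x) (hs : ((mul α β Γ₁ Γ₂).split x S).IsSound)
    {k₁ : Fin e₁} (hk₁ : α (.inl k₁) ∈ S) {k₂ : Fin e₂} (hk₂ : α (.inr k₂) ∈ S) :
    ((mul α β Γ₁ Γ₂).split x S).IsICG := by
  refine isICG_split (fun i => ?_) (fun a => ?_) hS hs fun i => ?_
  · obtain ⟨i | i, rfl⟩ := α.surjective i
    · rw [← mul_swap]
      exact mul_not_isDiag ((Equiv.sumComm _ _).trans α) ((Equiv.sumComm _ _).trans β) Γ₂ Γ₁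
        h₁.not_isDiag i
    · exact mul_not_isDiag α β Γ₁ Γ₂ h₂.not_isDiag i
  · obtain ⟨a | a, rfl⟩ := β.surjective a
    · obtain ⟨j, hj⟩ := h₁.reachable a
      rw [← mul_swap]
      exact ⟨j, reachable_mul ((Equiv.sumComm _ _).trans α) ((Equiv.sumComm _ _).trans β) Γ₂ Γ₁ hj⟩
    · obtain ⟨j, hj⟩ := h₂.reachable a
      exact ⟨j, reachable_mul α β Γ₁ Γ₂ hj⟩
  · obtain ⟨i | i, rfl⟩ := α.surjective i
    · refine ⟨_, hk₁, ?_⟩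
      rw [← mul_swap]
      exact reflTransGen_mul ((Equiv.sumComm _ _).trans α) ((Equiv.sumComm _ _).trans β) Γ₂ Γ₁
        (h₁.connected i k₁)
    · exact ⟨_, hk₂, reflTransGen_mul α β Γ₁ Γ₂ (h₂.connected i k₂)⟩

/-- A splitting which involves the second factor only does not connect the two factors. -/
theorem not_isICG_split_mul (h₁ : 0 < e₁) (x : Vertex n v₂) (S : Finset (Fin e₂)) :
    ¬ ((mul α β Γ₁ Γ₂).split (right β x) ((Finset.disjSum ∅ S).map α.toEmbedding)).IsICG := by
  rw [split_mul]
  exact not_isICG_mul _ _ _ _ h₁ (Nat.succ_pos _)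

theorem not_isICG_split_mul_left (h₂ : 0 < e₂) (x : Vertex n v₁) (S : Finset (Fin e₁)) :
    ¬ ((mul α β Γ₁ Γ₂).split (right ((Equiv.sumComm _ _).trans β) x)
      ((S.disjSum ∅).map α.toEmbedding)).IsICG := by
  have h := not_isICG_split_mul (Γ₂ := Γ₁) (Γ₁ := Γ₂) ((Equiv.sumComm _ _).trans α)
    ((Equiv.sumComm _ _).trans β) h₂ x S
  rw [mul_swap] at h
  convert h using 3
  ext i
  obtain ⟨i | i, rfl⟩ := α.surjective i <;> simp

end Graph

end KRV

namespace KRV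

open Ass

variable {K : Type*} [Field K] {n v e v₁ v₂ e₁ e₂ : ℕ}

namespace Graph

variable (α : Fin e₁ ⊕ Fin e₂ ≃ Fin e) (β : Fin v₁ ⊕ Fin v₂ ≃ Fin v) (Γ₁ : Graph n v₁ e₁)
  (Γ₂ : Graph n v₂ e₂)

theorem mul_relabel (σ₁ : Equiv.Perm (Fin e₁)) (σ₂ : Equiv.Perm (Fin e₂))
    (τ₁ : Equiv.Perm (Fin v₁)) (τ₂ : Equiv.Perm (Fin v₂)) :
    mul α β (Γ₁.relabel σ₁ τ₁) (Γ₂.relabel σ₂ τ₂) =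
      (mul α β Γ₁ Γ₂).relabel (α.permCongr (Equiv.sumCongr σ₁ σ₂))
        (β.permCongr (Equiv.sumCongr τ₁ τ₂)) := by
  funext i
  obtain ⟨i | i, rfl⟩ := α.surjective i
  · rw [mul_inl, relabel, relabel, Equiv.permCongr_apply, Equiv.symm_apply_apply,
      Equiv.sumCongr_apply, Sum.map_inl, mul_inl, Sym2.map_map, Sym2.map_map]
    refine Sym2.map_congr fun y _ => ?_
    rcases y with j | a <;> simp [Equiv.permCongr_apply]
  · rw [mul_inr, relabel, relabel, Equiv.permCongr_apply, Equiv.symm_apply_apply,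
      Equiv.sumCongr_apply, Sum.map_inr, mul_inr, Sym2.map_map, Sym2.map_map]
    refine Sym2.map_congr fun y _ => ?_
    rcases y with j | a <;> simp [Equiv.permCongr_apply]

theorem relabel_one (Γ : Graph n v e) : Γ.relabel 1 1 = Γ := by
  funext i
  have h3 : ⇑(Equiv.sumCongr (Equiv.refl (Fin n)) (1 : Equiv.Perm (Fin v))) = id := by
    funext x
    rcases x with x | x <;> rfl
  rw [relabel, h3, Sym2.map_id]
  rfl

theorem splitSum_mul_relabel_left (σ : Equiv.Perm (Fin e₁)) (τ : Equiv.Perm (Fin v₁)) :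
    splitSum K (mul α β (Γ₁.relabel σ τ) Γ₂) =
      (((Equiv.Perm.sign σ : ℤˣ) : ℤ) : K) • splitSum K (mul α β Γ₁ Γ₂) := by
  conv_lhs => rw [← relabel_one Γ₂, mul_relabel, splitSum_relabel, Equiv.Perm.sign_permCongr,
    Equiv.Perm.sign_sumCongr, Equiv.Perm.sign_one, mul_one]

theorem splitSum_mul_relabel_right (σ : Equiv.Perm (Fin e₂)) (τ : Equiv.Perm (Fin v₂)) :
    splitSum K (mul α β Γ₁ (Γ₂.relabel σ τ)) =
      (((Equiv.Perm.sign σ : ℤˣ) : ℤ) : K) • splitSum K (mul α β Γ₁ Γ₂) := by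
  conv_lhs => rw [← relabel_one Γ₁, mul_relabel, splitSum_relabel, Equiv.Perm.sign_permCongr,
    Equiv.Perm.sign_sumCongr, Equiv.Perm.sign_one, one_mul]

/-! ### The bracket -/

/-- The bracket of `ICG(n)`, up to signs: the part of the differential of the product of two graphs
which connects them. -/
noncomputable def bra (K : Type*) [Field K] (n : ℕ) (α : Fin e₁ ⊕ Fin e₂ ≃ Fin e)
    (β : Fin v₁ ⊕ Fin v₂ ≃ Fin v) :
    ICGPart K n v₁ e₁ →ₗ[K] ICGPart K n v₂ e₂ →ₗ[K] ICGPart K n (v + 1) (e + 1) :=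
  (relations K n v₁ e₁).liftQ (Finsupp.linearCombination K fun Γ₁ : ICGraph n v₁ e₁ =>
    (relations K n v₂ e₂).liftQ (Finsupp.linearCombination K fun Γ₂ : ICGraph n v₂ e₂ =>
      splitSum K (mul α β Γ₁.1 Γ₂.1)) <| by
        rw [relations, Submodule.span_le]
        rintro _ ⟨Γ, σ, τ, rfl⟩
        simp [splitSum_mul_relabel_right]) <| by
    rw [relations, Submodule.span_le]
    rintro _ ⟨Γ, σ, τ, rfl⟩
    rw [SetLike.mem_coe, LinearMap.mem_ker, map_sub, Finsupp.linearCombination_single,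
      Finsupp.linearCombination_single, one_smul, sub_eq_zero]
    refine Submodule.linearMap_qext _ (Finsupp.lhom_ext fun Γ₂ c => ?_)
    simp [splitSum_mul_relabel_left, smul_comm c]

variable {Γ₁ Γ₂}

theorem bra_cls (h₁ : Γ₁.IsICG) (h₂ : Γ₂.IsICG) :
    bra K n α β (cls K Γ₁) (cls K Γ₂) = splitSum K (mul α β Γ₁ Γ₂) := by
  rw [cls_of_isICG h₁, cls_of_isICG h₂, bra, Submodule.liftQ_apply,
    Finsupp.linearCombination_single, one_smul, Submodule.liftQ_apply,
    Finsupp.linearCombination_single, one_smul]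

theorem mk_single (Γ : ICGraph n v e) (c : K) :
    (Submodule.Quotient.mk (Finsupp.single Γ c) : ICGPart K n v e) = c • cls K Γ.1 := by
  rw [cls_of_isICG Γ.2, ← Submodule.Quotient.mk_smul, Finsupp.smul_single, smul_eq_mul, mul_one]

theorem span_cls : Submodule.span K (Set.range fun Γ : ICGraph n v e => cls K Γ.1) = ⊤ := by
  rw [eq_top_iff]
  rintro x -
  obtain ⟨x, rfl⟩ := Submodule.Quotient.mk_surjective _ x
  induction x using Finsupp.induction_linear with
  | zero => exact zero_mem _
  | add x y hx hy => exact add_mem hx hy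
  | single Γ c =>
    rw [mk_single]
    exact Submodule.smul_mem _ _ (Submodule.subset_span ⟨Γ, rfl⟩)

theorem linearMap_ext_cls {M : Type*} [AddCommGroup M] [Module K M] {f g : ICGPart K n v e →ₗ[K] M}
    (h : ∀ Γ : Graph n v e, Γ.IsICG → f (cls K Γ) = g (cls K Γ)) : f = g :=
  LinearMap.ext_on_range span_cls fun Γ => h Γ.1 Γ.2

theorem bra_swap (x : ICGPart K n v₁ e₁) (y : ICGPart K n v₂ e₂) :
    bra K n α β x y = bra K n ((Equiv.sumComm _ _).trans α) ((Equiv.sumComm _ _).trans β) y x := by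
  have h : bra K n α β =
      (bra K n ((Equiv.sumComm _ _).trans α) ((Equiv.sumComm _ _).trans β)).flip := by
    refine linearMap_ext_cls fun Γ₁ h₁ => linearMap_ext_cls fun Γ₂ h₂ => ?_
    rw [LinearMap.flip_apply, bra_cls _ _ h₁ h₂, bra_cls _ _ h₂ h₁, mul_swap]
  rw [h, LinearMap.flip_apply]

theorem map_disjSum_swap (S : Finset (Fin e₁)) (T : Finset (Fin e₂)) :
    (S.disjSum T).map α.toEmbedding =
      (T.disjSum S).map ((Equiv.sumComm _ _).trans α).toEmbedding := by
  ext i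
  obtain ⟨i | i, rfl⟩ := α.surjective i <;> simp

/-- Splitting the second factor before taking the bracket, expressed through splittings of the
product. -/
theorem bra_dPart [CharZero K] (h₁ : Γ₁.IsICG) (h₂ : Γ₂.IsICG) :
    bra K n (extendRight α) (extendRight β) (cls K Γ₁) (dPart K n v₂ e₂ (cls K Γ₂)) =
      ∑ x : Vertex n v₂, weight K x • ∑ S ∈ (Γ₂.incident x).powerset,
        splitSum K ((mul α β Γ₁ Γ₂).split (right β x) ((Finset.disjSum ∅ S).map α.toEmbedding)) := by
  rw [dPart_cls h₂, splitSum_eq, map_sum]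
  refine Finset.sum_congr rfl fun x _ => ?_
  rw [map_smul, map_sum]
  congr 1
  refine Finset.sum_congr rfl fun S hS => ?_
  rw [split_mul]
  by_cases h : (Γ₂.split x S).IsICG
  · rw [bra_cls _ _ h₁ h]
  · rw [cls_of_not_isICG h, map_zero, splitSum_eq_zero]
    exact fun hs => h (h₂.split (Finset.mem_powerset.1 hS) (isSound_of_mul _ _ _ _ hs))

/-- The splittings of a product, sorted by the factors which they involve. -/
theorem sum_split_mul [CharZero K] {M : Type*} [AddCommGroup M] [Module K M]
    (f : Graph n (v + 1) (e + 1) → M) (hf : ∀ Γ, ¬ Γ.IsSound → f Γ = 0) :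
    ∑ x, weight K x • ∑ S ∈ ((mul α β Γ₁ Γ₂).incident x).powerset, f ((mul α β Γ₁ Γ₂).split x S) =
      ∑ j : Fin n, ∑ S ∈ (Γ₁.incident (.inl j)).powerset with S.Nonempty,
        ∑ T ∈ (Γ₂.incident (.inl j)).powerset with T.Nonempty,
          f ((mul α β Γ₁ Γ₂).split (.inl j) ((S.disjSum T).map α.toEmbedding)) +
      (∑ x : Vertex n v₁, weight K x • ∑ S ∈ (Γ₁.incident x).powerset,
        f ((mul α β Γ₁ Γ₂).split (right ((Equiv.sumComm _ _).trans β) x)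
          ((S.disjSum ∅).map α.toEmbedding)) +
      ∑ x : Vertex n v₂, weight K x • ∑ S ∈ (Γ₂.incident x).powerset,
        f ((mul α β Γ₁ Γ₂).split (right β x) ((Finset.disjSum ∅ S).map α.toEmbedding))) := by
  have hint : ∀ a : Fin v₂, ∑ S ∈ ((mul α β Γ₁ Γ₂).incident (.inr (β (.inr a)))).powerset,
      f ((mul α β Γ₁ Γ₂).split (.inr (β (.inr a))) S) =
      ∑ S ∈ (Γ₂.incident (.inr a)).powerset, f ((mul α β Γ₁ Γ₂).split (right β (.inr a))
        ((Finset.disjSum ∅ S).map α.toEmbedding)) := by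
    intro a
    rw [incident_mul_inr, sum_powerset_disjSum, Finset.powerset_empty, Finset.sum_singleton]
    rfl
  have hint' : ∀ a : Fin v₁, ∑ S ∈ ((mul α β Γ₁ Γ₂).incident (.inr (β (.inl a)))).powerset,
      f ((mul α β Γ₁ Γ₂).split (.inr (β (.inl a))) S) =
      ∑ S ∈ (Γ₁.incident (.inr a)).powerset,
        f ((mul α β Γ₁ Γ₂).split (right ((Equiv.sumComm _ _).trans β) (.inr a))
          ((S.disjSum ∅).map α.toEmbedding)) := by
    intro a
    have h := incident_mul_inr ((Equiv.sumComm _ _).trans α) ((Equiv.sumComm _ _).trans β) Γ₂ Γ₁ a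
    rw [mul_swap, ← map_disjSum_swap] at h
    have h2 : (((Equiv.sumComm _ _).trans β) (.inr a)) = β (.inl a) := rfl
    rw [h2] at h
    rw [h, sum_powerset_disjSum]
    refine Finset.sum_congr rfl fun S _ => ?_
    rw [Finset.powerset_empty, Finset.sum_singleton]
    rfl
  have hempty : ∀ j : Fin n,
      f ((mul α β Γ₁ Γ₂).split (.inl j) ((Finset.disjSum ∅ ∅).map α.toEmbedding)) = 0 := by
    intro j
    refine hf _ fun hs => ?_
    have := hs.two_le_card (by simp)
    simp at this
  have hext : ∀ j : Fin n, ∑ S ∈ ((mul α β Γ₁ Γ₂).incident (.inl j)).powerset,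
      f ((mul α β Γ₁ Γ₂).split (.inl j) S) =
      ∑ S ∈ (Γ₁.incident (.inl j)).powerset with S.Nonempty,
        ∑ T ∈ (Γ₂.incident (.inl j)).powerset with T.Nonempty,
          f ((mul α β Γ₁ Γ₂).split (.inl j) ((S.disjSum T).map α.toEmbedding)) +
      (∑ S ∈ (Γ₁.incident (.inl j)).powerset,
        f ((mul α β Γ₁ Γ₂).split (.inl j) ((S.disjSum ∅).map α.toEmbedding)) +
      ∑ S ∈ (Γ₂.incident (.inl j)).powerset,
        f ((mul α β Γ₁ Γ₂).split (.inl j) ((Finset.disjSum ∅ S).map α.toEmbedding))) := by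
    intro j
    have hne : ∀ {m : ℕ} {N : Type _} [AddCommMonoid N] (I : Finset (Fin m))
        (g : Finset (Fin m) → N),
        ∑ S ∈ I.powerset, g S = ∑ S ∈ I.powerset with S.Nonempty, g S + g ∅ := by
      intro m N _ I g
      rw [← Finset.sum_filter_add_sum_filter_not I.powerset Finset.Nonempty]
      congr 1
      have : I.powerset.filter (fun S => ¬ S.Nonempty) = {∅} := by
        ext S
        simp only [Finset.mem_filter, Finset.mem_powerset, Finset.not_nonempty_iff_eq_empty,
          Finset.mem_singleton]
        exact ⟨fun h => h.2, fun h => ⟨by simp [h], h⟩⟩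
      rw [this, Finset.sum_singleton]
    rw [incident_mul_inl, sum_powerset_disjSum]
    rw [hne (Γ₁.incident (.inl j)), Finset.sum_congr rfl fun S _ => hne (Γ₂.incident (.inl j)) _,
      Finset.sum_add_distrib, add_assoc]
    congr 1
    congr 1
    rw [hne (Γ₁.incident (.inl j)), hempty, add_zero]
  simp only [Fintype.sum_sum_type (α₁ := Fin n)]
  rw [← Equiv.sum_comp β, Fintype.sum_sum_type (α₁ := Fin v₁)]
  simp only [hint, hint', weight, one_smul, hext, Finset.sum_add_distrib]
  simp only [right, Sum.map_inl, Sum.map_inr, id]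
  abel

end Graph

end KRV

namespace KRV

open Ass

variable {K : Type*} [Field K] {n v e v₁ v₂ e₁ e₂ : ℕ}

namespace Graph

variable (α : Fin e₁ ⊕ Fin e₂ ≃ Fin e) (β : Fin v₁ ⊕ Fin v₂ ≃ Fin v) {Γ₁ : Graph n v₁ e₁}
  {Γ₂ : Graph n v₂ e₂}

theorem dPart_cls_split_of_not_isSound {Γ : Graph n v e} (h : ¬ Γ.IsSound) :
    dPart K n v e (cls K Γ) = 0 := by
  rw [cls_of_not_isICG fun h' => h h'.isSound, map_zero]

/-- The part of `splitSum` of a product that involves both factors. -/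
theorem splitSum_mul [CharZero K] (h₁ : Γ₁.IsICG) (h₂ : Γ₂.IsICG) :
    splitSum K (mul α β Γ₁ Γ₂) =
      ∑ j : Fin n, ∑ S ∈ (Γ₁.incident (.inl j)).powerset with S.Nonempty,
        ∑ T ∈ (Γ₂.incident (.inl j)).powerset with T.Nonempty,
          cls K ((mul α β Γ₁ Γ₂).split (.inl j) ((S.disjSum T).map α.toEmbedding)) := by
  have h := sum_split_mul (K := K) α β (Γ₁ := Γ₁) (Γ₂ := Γ₂) (fun Γ => cls K Γ)
    fun Γ hΓ => cls_of_not_isICG fun h => hΓ h.isSound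
  rw [splitSum_eq, h]
  simp only [cls_of_not_isICG (not_isICG_split_mul α β h₁.nonempty _ _),
    cls_of_not_isICG (not_isICG_split_mul_left α β h₂.nonempty _ _)]
  simp

/-- The splittings of a product which connect its factors are those at external vertices, by sets
that contain edges of both factors. -/
theorem dPart_splitSum_mul [CharZero K] (h₁ : Γ₁.IsICG) (h₂ : Γ₂.IsICG) :
    dPart K n _ _ (splitSum K (mul α β Γ₁ Γ₂)) =
      ∑ j : Fin n, ∑ S ∈ (Γ₁.incident (.inl j)).powerset with S.Nonempty,
        ∑ T ∈ (Γ₂.incident (.inl j)).powerset with T.Nonempty,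
          splitSum K ((mul α β Γ₁ Γ₂).split (.inl j) ((S.disjSum T).map α.toEmbedding)) := by
  rw [splitSum_mul α β h₁ h₂, map_sum]
  refine Finset.sum_congr rfl fun j _ => ?_
  rw [map_sum]
  refine Finset.sum_congr rfl fun S hS => ?_
  rw [map_sum]
  refine Finset.sum_congr rfl fun T hT => ?_
  rw [Finset.mem_filter, Finset.mem_powerset] at hS hT
  obtain ⟨k₁, hk₁⟩ := hS.2
  obtain ⟨k₂, hk₂⟩ := hT.2
  by_cases hs : ((mul α β Γ₁ Γ₂).split (.inl j) ((S.disjSum T).map α.toEmbedding)).IsSound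
  · refine dPart_cls (isICG_split_mul α β h₁ h₂ (k₁ := k₁) (k₂ := k₂) ?_ hs ?_ ?_)
    · rw [incident_mul_inl, Finset.map_subset_map]
      exact Finset.disjSum_mono hS.1 hT.1
    · simpa using hk₁
    · simpa using hk₂
  · rw [splitSum_eq_zero hs, dPart_cls_split_of_not_isSound hs]

theorem sumComm_trans_extendLeft {p q r : ℕ} (γ : Fin p ⊕ Fin q ≃ Fin r) :
    (Equiv.sumComm _ _).trans (extendLeft γ) = extendRight ((Equiv.sumComm _ _).trans γ) := by
  ext i
  rcases i with i | i <;> rfl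

theorem bra_dPart_left [CharZero K] (h₁ : Γ₁.IsICG) (h₂ : Γ₂.IsICG) :
    bra K n (extendLeft α) (extendLeft β) (dPart K n v₁ e₁ (cls K Γ₁)) (cls K Γ₂) =
      ∑ x : Vertex n v₁, weight K x • ∑ S ∈ (Γ₁.incident x).powerset,
        splitSum K ((mul α β Γ₁ Γ₂).split (right ((Equiv.sumComm _ _).trans β) x)
          ((S.disjSum ∅).map α.toEmbedding)) := by
  have h := bra_dPart (K := K) ((Equiv.sumComm _ _).trans α) ((Equiv.sumComm _ _).trans β) h₂ h₁
  rw [bra_swap, sumComm_trans_extendLeft, sumComm_trans_extendLeft, h]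
  simp only [← map_disjSum_swap, mul_swap]

/-- The differential is a derivation of the bracket. -/
theorem dPart_bra [CharZero K] (x : ICGPart K n v₁ e₁) (y : ICGPart K n v₂ e₂) :
    dPart K n _ _ (bra K n α β x y) + (bra K n (extendLeft α) (extendLeft β) (dPart K n _ _ x) y +
      bra K n (extendRight α) (extendRight β) x (dPart K n _ _ y)) = 0 := by
  have h : (bra K n α β).compr₂ (dPart K n _ _) +
      ((bra K n (extendLeft α) (extendLeft β)).comp (dPart K n _ _) +
      (bra K n (extendRight α) (extendRight β)).compl₂ (dPart K n _ _)) = 0 := by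
    refine linearMap_ext_cls fun Γ₁ h₁ => linearMap_ext_cls fun Γ₂ h₂ => ?_
    have h0 := sum_splitSum_split (K := K) (mul α β Γ₁ Γ₂)
    rw [sum_split_mul (K := K) α β _ fun Γ hΓ => splitSum_eq_zero hΓ, ← bra_dPart α β h₁ h₂,
      ← bra_dPart_left α β h₁ h₂, ← dPart_splitSum_mul α β h₁ h₂, ← bra_cls α β h₁ h₂] at h0
    exact h0
  exact LinearMap.congr_fun (LinearMap.congr_fun h x) y

/-! ### The filtration by the number of internal loops -/

theorem sum_valence_split {Γ : Graph n v e} {x : Vertex n v} {S : Finset (Fin e)}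
    (hS : S ⊆ Γ.incident x) :
    ∑ a, ((Γ.split x S).incident (.inr a)).card =
      ∑ a, (Γ.incident (.inr a)).card + match x with
        | .inl _ => S.card + 1
        | .inr _ => 2 := by
  rw [Fin.sum_univ_castSucc]
  have hn : ((Γ.split x S).incident (.inr (Fin.last v))).card = S.card + 1 :=
    card_incident_split_new hS
  rw [hn]
  rcases x with j | b
  · have : ∀ a : Fin v, ((Γ.split (.inl j) S).incident (.inr a.castSucc)).card =
        (Γ.incident (.inr a)).card := fun a =>
      card_incident_split_old (x := .inl j) (z := .inr a) (by simp) S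
    simp only [this]
  · have h1 : ∀ a : Fin v, a ≠ b → ((Γ.split (.inr b) S).incident (.inr a.castSucc)).card =
        (Γ.incident (.inr a)).card := fun a ha =>
      card_incident_split_old (x := .inr b) (z := .inr a) (by simpa using ha) S
    have h2 : ((Γ.split (.inr b) S).incident (.inr b.castSucc)).card + S.card =
        (Γ.incident (.inr b)).card + 1 := card_incident_split_self Γ hS
    rw [← Finset.add_sum_erase _ _ (Finset.mem_univ b),
      ← Finset.add_sum_erase (a := b) _ (fun a => (Γ.incident (.inr a)).card) (Finset.mem_univ b),
      Finset.sum_congr rfl fun a ha => h1 a (Finset.mem_erase.1 ha).1]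
    simp only
    omega

theorem sum_valence_mul : ∑ a, ((mul α β Γ₁ Γ₂).incident (.inr a)).card =
    ∑ a, (Γ₁.incident (.inr a)).card + ∑ a, (Γ₂.incident (.inr a)).card := by
  rw [← Equiv.sum_comp β, Fintype.sum_sum_type]
  congr 1
  · refine Finset.sum_congr rfl fun a _ => ?_
    have h := incident_mul_inr ((Equiv.sumComm _ _).trans α) ((Equiv.sumComm _ _).trans β) Γ₂ Γ₁ a
    rw [mul_swap] at h
    exact (congrArg Finset.card h).trans (by simp)
  · refine Finset.sum_congr rfl fun a _ => ?_
    rw [incident_mul_inr]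
    simp

/-- Splitting an external vertex creates loops, splitting an internal one does not. -/
theorem loops_split {Γ : Graph n v e} (h : Γ.IsICG) {x : Vertex n v} {S : Finset (Fin e)}
    (hS : S ⊆ Γ.incident x) (hs : (Γ.split x S).IsICG) :
    (Γ.split x S).loops = Γ.loops + match x with
      | .inl _ => S.card - 1
      | .inr _ => 0 := by
  have h1 := hs.loops_add
  have h2 := h.loops_add
  have h3 := hs.isSound.two_le_card hS
  rw [sum_valence_split hS] at h1
  rcases x with j | b <;> simp only at h1 ⊢ <;> omega

theorem loops_split_mul (h₁ : Γ₁.IsICG) (h₂ : Γ₂.IsICG) {j : Fin n} {S : Finset (Fin e₁)}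
    {T : Finset (Fin e₂)} (hS : S ⊆ Γ₁.incident (.inl j)) (hT : T ⊆ Γ₂.incident (.inl j))
    (hs : ((mul α β Γ₁ Γ₂).split (.inl j) ((S.disjSum T).map α.toEmbedding)).IsICG) :
    ((mul α β Γ₁ Γ₂).split (.inl j) ((S.disjSum T).map α.toEmbedding)).loops + 2 =
      Γ₁.loops + Γ₂.loops + S.card + T.card := by
  have hST : (S.disjSum T).map α.toEmbedding ⊆ (mul α β Γ₁ Γ₂).incident (.inl j) := by
    rw [incident_mul_inl, Finset.map_subset_map]
    exact Finset.disjSum_mono hS hT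
  have h3 := hs.loops_add
  have h4 := h₁.loops_add
  have h5 := h₂.loops_add
  have he : e = e₁ + e₂ := by simpa using (Fintype.card_congr α).symm
  have hv : v = v₁ + v₂ := by simpa using (Fintype.card_congr β).symm
  have h6 := hs.isSound.two_le_card hST
  rw [sum_valence_split hST, sum_valence_mul] at h3
  simp only [Finset.card_map, Finset.card_disjSum] at h3 h6
  omega

theorem cls_mem_filtrationPart {p : ℕ} {Γ : Graph n v e} (h : Γ.IsICG → p ≤ Γ.loops) :
    cls K Γ ∈ filtrationPart K p n v e := by
  by_cases hΓ : Γ.IsICG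
  · exact Submodule.subset_span ⟨⟨Γ, hΓ⟩, h hΓ, rfl⟩
  · rw [cls_of_not_isICG hΓ]
    exact zero_mem _

/-- Joining two graphs at an external vertex does not destroy internal loops. -/
theorem bra_mem_filtrationPart [CharZero K] {p : ℕ} {x : ICGPart K n v₁ e₁}
    (hx : x ∈ filtrationPart K p n v₁ e₁) (y : ICGPart K n v₂ e₂) :
    bra K n α β x y ∈ filtrationPart K p n (v + 1) (e + 1) := by
  have hy : y ∈ Submodule.span K (Set.range fun Γ : ICGraph n v₂ e₂ => cls K Γ.1) := by
    rw [span_cls]; exact Submodule.mem_top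
  induction hx using Submodule.span_induction with
  | zero => rw [map_zero]; exact zero_mem _
  | add x x' _ _ hx hx' => rw [map_add]; exact add_mem hx hx'
  | smul c x _ hx => rw [map_smul]; exact Submodule.smul_mem _ _ hx
  | mem x hx =>
    obtain ⟨Γ₁, hp, rfl⟩ := hx
    induction hy using Submodule.span_induction with
    | zero => rw [map_zero]; exact zero_mem _
    | add x x' _ _ hx hx' => rw [map_add]; exact add_mem hx hx'
    | smul c x _ hx => rw [map_smul]; exact Submodule.smul_mem _ _ hx
    | mem y hy =>
      obtain ⟨Γ₂, rfl⟩ := hy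
      dsimp only
      rw [bra_cls α β Γ₁.2 Γ₂.2, splitSum_mul α β Γ₁.2 Γ₂.2]
      refine sum_mem fun j _ => sum_mem fun S hS => sum_mem fun T hT => ?_
      rw [Finset.mem_filter, Finset.mem_powerset] at hS hT
      refine cls_mem_filtrationPart fun hs => ?_
      have h1 := loops_split_mul α β Γ₁.2 Γ₂.2 hS.1 hT.1 hs
      have h2 := Finset.card_pos.2 hS.2
      have h3 := Finset.card_pos.2 hT.2
      omega

theorem bra_mem_filtrationPart_right [CharZero K] {p : ℕ} (x : ICGPart K n v₁ e₁)
    {y : ICGPart K n v₂ e₂} (hy : y ∈ filtrationPart K p n v₂ e₂) :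
    bra K n α β x y ∈ filtrationPart K p n (v + 1) (e + 1) := by
  rw [bra_swap]
  exact bra_mem_filtrationPart _ _ hy x

theorem filtrationPart_mono {p q : ℕ} (h : p ≤ q) :
    filtrationPart K q n v e ≤ filtrationPart K p n v e := by
  refine Submodule.span_mono ?_
  rintro _ ⟨Γ, hΓ, rfl⟩
  exact ⟨Γ, h.trans hΓ, rfl⟩

end Graph

end KRV

namespace KRV

open Ass

variable {K : Type*} [Field K] {n v e v₁ v₂ e₁ e₂ : ℕ}

/-! ### The Lie series of the tree part -/

namespace Graph

theorem IsICG.exists_external {Γ : Graph n v e} (h : Γ.IsICG) :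
    ∃ (i : Fin n) (r : Fin e), .inl i ∈ Γ r := by
  rcases Nat.eq_zero_or_pos v with hv | hv
  · subst hv
    obtain ⟨x, hx⟩ : ∃ x, x ∈ Γ ⟨0, h.nonempty⟩ := by
      induction Γ ⟨0, h.nonempty⟩ using Sym2.ind with
      | _ x y => exact ⟨x, Sym2.mem_mk_left _ _⟩
    rcases x with i | a
    · exact ⟨i, _, hx⟩
    · exact a.elim0
  · obtain ⟨i, ⟨p⟩⟩ := h.reachable ⟨0, hv⟩
    cases hp : p.reverse with
    | cons hadj q =>
      rw [simple, SimpleGraph.fromEdgeSet_adj] at hadj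
      obtain ⟨⟨r, hr⟩, -⟩ := hadj
      exact ⟨i, r, by rw [hr]; exact Sym2.mem_mk_left _ _⟩

theorem IsICG.loops_relabel {Γ : Graph n v e} (h : Γ.IsICG) (σ : Equiv.Perm (Fin e))
    (τ : Equiv.Perm (Fin v)) : (Γ.relabel σ τ).loops = Γ.loops := by
  have h1 := (h.relabel σ τ).loops_add
  have h2 := h.loops_add
  have h3 : ∑ a : Fin v, ((Γ.relabel σ τ).incident (.inr a)).card =
      ∑ a : Fin v, (Γ.incident (.inr a)).card := by
    rw [← Equiv.sum_comp τ]
    refine Finset.sum_congr rfl fun a _ => ?_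
    exact (congrArg Finset.card (incident_relabel σ τ Γ (.inr a))).trans (Finset.card_map _)
  omega

/-- A graph of degree `0` without internal loops. -/
def IsTreeGraph (Γ : Graph n v e) : Prop := Γ.IsICG ∧ e = 2 * v + 1 ∧ Γ.loops = 0

theorem IsTreeGraph.exists_treeAt {Γ : Graph n v e} (h : Γ.IsTreeGraph) {r : Fin e} {i : Fin n}
    (hr : r ∈ Γ.incident (.inl i)) : ∃ P, LTree.TreeAt Γ i P ∧ P.root = r :=
  h.1.exists_treeAt h.2.1 h.2.2 (mem_incident.1 hr)

theorem isTreeGraph_of_treeAt {Γ : Graph n v e} {i : Fin n} {P : LTree n v e}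
    (h : LTree.TreeAt Γ i P) (hΓ : Function.Injective Γ) : Γ.IsTreeGraph :=
  ⟨h.isICG hΓ, h.edges_eq, h.loops_eq_zero hΓ⟩

theorem IsTreeGraph.lieSeries_relabel {Γ : Graph n v e} (h : Γ.IsTreeGraph)
    (σ : Equiv.Perm (Fin e)) (τ : Equiv.Perm (Fin v)) (j : Fin n) :
    (Γ.relabel σ τ).lieSeries K j = (((Equiv.Perm.sign σ : ℤˣ) : ℤ) : K) • Γ.lieSeries K j := by
  obtain ⟨i, r, hr⟩ := h.1.exists_external
  obtain ⟨P, hP, -⟩ := h.exists_treeAt (mem_incident.2 hr)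
  exact hP.lieSeries_relabel σ τ j

theorem IsICG.isTreeGraph_relabel_iff {Γ : Graph n v e} (h : Γ.IsICG) (σ : Equiv.Perm (Fin e))
    (τ : Equiv.Perm (Fin v)) : (Γ.relabel σ τ).IsTreeGraph ↔ Γ.IsTreeGraph := by
  rw [IsTreeGraph, IsTreeGraph, h.loops_relabel, isICG_relabel_iff]

theorem IsTreeGraph.lieSeries_mem_lie {Γ : Graph n v e} (h : Γ.IsTreeGraph) (j : Fin n) :
    Γ.lieSeries K j ∈ lie K n := by
  rw [LTree.lieSeries_eq]
  refine sum_mem fun r hr => ?_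
  obtain ⟨P, hP, rfl⟩ := h.exists_treeAt hr
  rw [hP.rootTerm]
  exact (lie K n).smul_mem _ P.lw_mem_lie

theorem IsTreeGraph.lieSeries_apply {Γ : Graph n v e} (h : Γ.IsTreeGraph) (j : Fin n)
    {w : List (Fin n)} (hw : w.length ≠ v + 1) : Γ.lieSeries K j w = 0 := by
  rw [LTree.lieSeries_eq, Ass.sum_apply]
  refine Finset.sum_eq_zero fun r hr => ?_
  obtain ⟨P, hP, rfl⟩ := h.exists_treeAt hr
  rw [hP.rootTerm, Ass.smul_apply, P.lw_eq_zero_of_length w (by rwa [hP.verts_length]), mul_zero]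

/-- The Lie word of a tree does not contain its root linearly. -/
theorem IsTreeGraph.lieSeries_singleton {Γ : Graph n v e} (h : Γ.IsTreeGraph) (j : Fin n) :
    Γ.lieSeries K j [j] = 0 := by
  rw [LTree.lieSeries_eq, Ass.sum_apply]
  refine Finset.sum_eq_zero fun r hr => ?_
  obtain ⟨P, hP, rfl⟩ := h.exists_treeAt hr
  have h2 := hP.top_ne
  rw [hP.rootTerm, Ass.smul_apply]
  cases P with
  | leaf r k =>
    have : j ≠ k := fun hjk => h2 (by rw [hjk]; rfl)
    rw [LTree.lw, X, if_neg (by simpa using this), mul_zero]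
  | node r a s t =>
    rw [LTree.lw_eq_zero_of_length, mul_zero]
    simp [LTree.verts]

end Graph

open Classical in
/-- The linear extension of `Graph.lieSeries` on trees by zero on all other graphs. -/
noncomputable def treeSeries (K : Type*) [Field K] (n v e : ℕ) (i : Fin n) :
    ICGPart K n v e →ₗ[K] Ass K n :=
  (relations K n v e).liftQ (Finsupp.linearCombination K fun Γ : ICGraph n v e =>
    if Γ.1.IsTreeGraph then Γ.1.lieSeries K i else 0) <| by
      rw [relations, Submodule.span_le]
      rintro _ ⟨Γ, σ, τ, rfl⟩
      rw [SetLike.mem_coe, LinearMap.mem_ker, map_sub, Finsupp.linearCombination_single,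
        Finsupp.linearCombination_single, one_smul, sub_eq_zero, Γ.2.isTreeGraph_relabel_iff]
      split_ifs with h
      · exact h.lieSeries_relabel σ τ i
      · rw [smul_zero]

theorem treeSeries_cls {Γ : Graph n v e} (h : Γ.IsTreeGraph) (i : Fin n) :
    treeSeries K n v e i (cls K Γ) = Γ.lieSeries K i := by
  rw [Graph.cls_of_isICG h.1, treeSeries, Submodule.liftQ_apply, Finsupp.linearCombination_single,
    one_smul, if_pos h]

theorem treeSeries_cls_eq_zero {Γ : Graph n v e} (h : ¬ Γ.IsTreeGraph) (i : Fin n) :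
    treeSeries K n v e i (cls K Γ) = 0 := by
  by_cases hΓ : Γ.IsICG
  · rw [Graph.cls_of_isICG hΓ, treeSeries, Submodule.liftQ_apply,
      Finsupp.linearCombination_single, one_smul, if_neg h]
  · rw [Graph.cls_of_not_isICG hΓ, map_zero]

theorem treeSeries_cls_of_treeAt [CharZero K] {Γ : Graph n v e} {i : Fin n} {P : LTree n v e}
    (h : LTree.TreeAt Γ i P) (j : Fin n) :
    treeSeries K n v e j (cls K Γ) = Γ.lieSeries K j := by
  by_cases hΓ : Function.Injective Γ
  · exact treeSeries_cls (Graph.isTreeGraph_of_treeAt h hΓ) j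
  · rw [h.lieSeries_eq_zero hΓ, Graph.cls_of_not_isICG fun h' => hΓ h'.injective, map_zero]

theorem treeSeries_mem_filtrationPart {x : ICGPart K n v e} (hx : x ∈ filtrationPart K 1 n v e)
    (i : Fin n) : treeSeries K n v e i x = 0 := by
  induction hx using Submodule.span_induction with
  | zero => rw [map_zero]
  | add x y _ _ hx hy => rw [map_add, hx, hy, add_zero]
  | smul c x _ hx => rw [map_smul, hx, smul_zero]
  | mem x hx =>
    obtain ⟨Γ, h, rfl⟩ := hx
    exact treeSeries_cls_eq_zero (fun h' => by rw [h'.2.2] at h; omega) i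

theorem treeSeries_induction (p : Ass K n → Prop) (i : Fin n) (h0 : p 0)
    (hadd : ∀ f g, p f → p g → p (f + g)) (hsmul : ∀ (c : K) f, p f → p (c • f))
    (h : ∀ Γ : Graph n v e, Γ.IsTreeGraph → p (Γ.lieSeries K i)) (x : ICGPart K n v e) :
    p (treeSeries K n v e i x) := by
  have hx : x ∈ Submodule.span K (Set.range fun Γ : ICGraph n v e => cls K Γ.1) := by
    rw [Graph.span_cls]; exact Submodule.mem_top
  induction hx using Submodule.span_induction with
  | zero => rwa [map_zero]
  | add x y _ _ hx hy => rw [map_add]; exact hadd _ _ hx hy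
  | smul c x _ hx => rw [map_smul]; exact hsmul _ _ hx
  | mem x hx =>
    obtain ⟨Γ, rfl⟩ := hx
    by_cases hΓ : Γ.1.IsTreeGraph
    · dsimp only
      rw [treeSeries_cls hΓ]; exact h _ hΓ
    · dsimp only
      rwa [treeSeries_cls_eq_zero hΓ]

theorem treeSeries_mem_lie (x : ICGPart K n v e) (i : Fin n) :
    treeSeries K n v e i x ∈ lie K n :=
  treeSeries_induction _ i (zero_mem _) (fun _ _ => add_mem) (fun c _ => (lie K n).smul_mem c)
    (fun _ h => h.lieSeries_mem_lie i) x

theorem treeSeries_apply (x : ICGPart K n v e) (i : Fin n) {w : List (Fin n)}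
    (hw : w.length ≠ v + 1) : treeSeries K n v e i x w = 0 :=
  treeSeries_induction (fun f => f w = 0) i rfl
    (fun f g hf hg => by rw [Ass.add_apply, hf, hg, add_zero])
    (fun c f hf => by rw [Ass.smul_apply, hf, mul_zero]) (fun _ h => h.lieSeries_apply i hw) x

theorem treeSeries_singleton (x : ICGPart K n v e) (i : Fin n) :
    treeSeries K n v e i x [i] = 0 :=
  treeSeries_induction (fun f => f [i] = 0) i rfl
    (fun f g hf hg => by rw [Ass.add_apply, hf, hg, add_zero])
    (fun c f hf => by rw [Ass.smul_apply, hf, mul_zero]) (fun _ h => h.lieSeries_singleton i) x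

/-! ### The level sets in terms of classes -/

/-- The series with homogeneous components `treeSeries (x v)`, of degree `v + 1`. -/
noncomputable def totalSeries (x : ∀ v, ICGPart K n v (2 * v + 1)) (i : Fin n) : Ass K n := fun w =>
  match w.length with
  | 0 => 0
  | v + 1 => treeSeries K n v (2 * v + 1) i (x v) w

theorem totalSeries_nil (x : ∀ v, ICGPart K n v (2 * v + 1)) (i : Fin n) :
    totalSeries x i [] = 0 := rfl

theorem totalSeries_apply (x : ∀ v, ICGPart K n v (2 * v + 1)) (i : Fin n) {w : List (Fin n)}
    {v : ℕ} (hw : w.length = v + 1) :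
    totalSeries x i w = treeSeries K n v (2 * v + 1) i (x v) w := by
  rw [totalSeries]
  simp only [hw]

theorem totalSeries_mem_lie (x : ∀ v, ICGPart K n v (2 * v + 1)) (i : Fin n) :
    totalSeries x i ∈ lie K n := by
  intro m
  rcases m with - | v
  · have : homog 0 (totalSeries x i) = 0 := by
      ext w
      rw [homog_apply, Ass.zero_apply]
      split_ifs with hw
      · rw [List.length_eq_zero_iff.1 hw, totalSeries_nil]
      · rfl
    rw [this]
    exact zero_mem _
  · have : homog (v + 1) (totalSeries x i) =
        homog (v + 1) (treeSeries K n v (2 * v + 1) i (x v)) := by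
      ext w
      rw [homog_apply, homog_apply]
      split_ifs with hw
      · rw [totalSeries_apply x i hw]
      · rfl
    rw [this]
    exact treeSeries_mem_lie (x v) i (v + 1)

theorem totalSeries_singleton (x : ∀ v, ICGPart K n v (2 * v + 1)) (i : Fin n) :
    totalSeries x i [i] = 0 := by
  rw [totalSeries_apply x i (v := 0) rfl, treeSeries_singleton]

/-- An element of degree `0`, given by its components. -/
noncomputable def ofDegreeZero (x : ∀ v, ICGPart K n v (2 * v + 1)) : ICG K n := fun v e =>
  if h : e = 2 * v + 1 then h ▸ x v else 0

theorem ofDegreeZero_apply (x : ∀ v, ICGPart K n v (2 * v + 1)) (v : ℕ) :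
    ofDegreeZero x v (2 * v + 1) = x v := by
  rw [ofDegreeZero, dif_pos rfl]

theorem ofDegreeZero_of_ne (x : ∀ v, ICGPart K n v (2 * v + 1)) {v e : ℕ} (h : e ≠ 2 * v + 1) :
    ofDegreeZero x v e = 0 := by
  rw [ofDegreeZero, dif_neg h]

theorem Degree0Rep.lieSeries_eq {t : Degree0Rep K n} (ht : t.IsTree) (i : Fin n) :
    t.lieSeries i = totalSeries (fun v => Submodule.Quotient.mk (t v)) i := by
  ext w
  rw [Degree0Rep.lieSeries, totalSeries]
  cases w.length with
  | zero => rfl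
  | succ v =>
    simp only
    refine congrFun ?_ w
    rw [treeSeries, Submodule.liftQ_apply, Finsupp.linearCombination_apply, Finsupp.sum,
      Finsupp.sum]
    refine Finset.sum_congr rfl fun Γ hΓ => ?_
    rw [if_pos ⟨Γ.2, rfl, ht v Γ hΓ⟩]

open Classical in
/-- The tree part of an element of degree `0`. -/
theorem exists_isTreePartOf (x : ∀ v, ICGPart K n v (2 * v + 1)) :
    ∃ t : Degree0Rep K n, t.IsTreePartOf (ofDegreeZero x) := by
  choose s hs using fun v => Submodule.Quotient.mk_surjective _ (x v)
  refine ⟨fun v => (s v).filter fun Γ => Γ.1.loops = 0, fun v Γ hΓ => ?_, fun v => ?_⟩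
  · rw [Finsupp.support_filter, Finset.mem_filter] at hΓ
    exact hΓ.2
  · rw [ofDegreeZero_apply, ← hs v, ← Submodule.Quotient.mk_sub]
    have h1 := Finsupp.filter_add_filter_not (s v) fun Γ => Γ.1.loops = 0
    have h2 : s v - (s v).filter (fun Γ => Γ.1.loops = 0) =
        (s v).filter (fun Γ => ¬ Γ.1.loops = 0) := by
      nth_rewrite 1 [← h1]
      abel
    rw [h2, ← Finsupp.sum_single ((s v).filter _), Finsupp.sum]
    change (relations K n v (2 * v + 1)).mkQ _ ∈ _
    rw [map_sum]
    refine sum_mem fun Γ hΓ => ?_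
    rw [Finsupp.support_filter, Finset.mem_filter] at hΓ
    rw [Submodule.mkQ_apply, Graph.mk_single]
    exact Submodule.smul_mem _ _
      (Submodule.subset_span ⟨Γ, Nat.one_le_iff_ne_zero.2 hΓ.2, rfl⟩)

theorem Degree0Rep.IsTreePartOf.lieSeries_eq {t : Degree0Rep K n} {x : ICG K n}
    (h : t.IsTreePartOf x) (i : Fin n) :
    t.lieSeries i = totalSeries (fun v => x v (2 * v + 1)) i := by
  rw [Degree0Rep.lieSeries_eq h.1]
  ext w
  rw [totalSeries, totalSeries]
  cases w.length with
  | zero => rfl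
  | succ v =>
    have h1 := treeSeries_mem_filtrationPart (h.2 v) i
    rw [map_sub, sub_eq_zero] at h1
    simp only [h1]

/-- The level sets without reference to representatives of the tree part. -/
theorem mem_krvLevel_iff {k : ℕ} {u : sder K n} : u ∈ krvLevel K n k ↔
    ∃ x : ∀ v, ICGPart K n v (2 * v + 1),
      (∀ v, dPart K n v (2 * v + 1) (x v) ∈ filtrationPart K (k + 1) n (v + 1) (2 * v + 1 + 1)) ∧
      ∀ i, ((u.1 (lieX K i) : lie K n) : Ass K n) = ⁅(Ass.X i : Ass K n), totalSeries x i⁆ := by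
  constructor
  · rintro ⟨x, t, -, hd, ht, hu⟩
    refine ⟨fun v => x v (2 * v + 1), fun v => hd (v + 1) (2 * v + 1 + 1), fun i => ?_⟩
    rw [← ht.lieSeries_eq]
    exact hu i
  · rintro ⟨x, hd, hu⟩
    obtain ⟨t, ht⟩ := exists_isTreePartOf x
    refine ⟨ofDegreeZero x, t, fun v e hx => ?_, fun v e => ?_, ht, fun i => ?_⟩
    · have : e = 2 * v + 1 := by
        by_contra h
        exact hx (ofDegreeZero_of_ne x h)
      rw [this]
      push_cast
      ring
    · rcases v with - | v
      · exact zero_mem _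
      · rcases e with - | e
        · exact zero_mem _
        · change dPart K n v e (ofDegreeZero x v e) ∈ _
          by_cases h : e = 2 * v + 1
          · subst h
            rw [ofDegreeZero_apply]
            exact hd v
          · rw [ofDegreeZero_of_ne x h, map_zero]
            exact zero_mem _
    · rw [ht.lieSeries_eq, hu]
      congr 2
      funext v
      rw [ofDegreeZero_apply]

end KRV

namespace KRV

open Ass

variable {K : Type*} [Field K] {n v e v₁ v₂ e₁ e₂ : ℕ}

/-! ### The bracket of trees -/

/-- The linear map which produces the Lie series at the vertex `i` of a tree from its Lie word `c`
with respect to a root edge at the vertex `j`. -/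
def graft (K : Type*) [Field K] {n : ℕ} (i j : Fin n) : Ass K n →ₗ[K] Ass K n :=
  (if j = i then LinearMap.id else 0) +
    (adopL.flip (X j)).comp (antipode.comp (partialRightL i))

theorem graft_apply (i j : Fin n) (c : Ass K n) :
    graft K i j c = (if j = i then c else 0) + adop (antipode (partialRight i c)) (X j) := by
  rw [graft, LinearMap.add_apply]
  split_ifs <;> rfl

theorem graft_agree {i j : Fin n} {L : ℕ} {c c' : Ass K n} (h : AgreeTo L c c') :
    AgreeTo L (graft K i j c) (graft K i j c') := by
  rcases L with - | L
  · intro w hw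
    obtain rfl : w = [] := List.length_eq_zero_iff.1 (by omega)
    have h1 : ∀ f : Ass K n, adop f (X j) [] = 0 := fun f =>
      adop_vanish 0 f (X j) (X_nil j) (fun w hw => absurd hw (Nat.not_lt_zero _)) [] (by simp)
    rw [graft_apply, graft_apply, Ass.add_apply, Ass.add_apply, h1, h1]
    split_ifs
    · rw [h [] le_rfl]
    · rfl
  · intro w hw
    have h0 : ∀ f : Ass K n, (∀ w : List (Fin n), w.length < L + 2 → f w = 0) →
        graft K i j f w = 0 := by
      intro f hf
      rw [graft_apply, Ass.add_apply, adop_vanish (L + 1) _ (X j) (X_nil j) _ w (by omega),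
        add_zero]
      · split_ifs
        · exact hf w (by omega)
        · rfl
      · intro u hu
        rw [antipode_apply, partialRight, hf _ (by simp; omega), mul_zero]
    have h2 := h0 (c - c') fun w hw => by
      rw [Ass.sub_apply, h w (by omega), sub_self]
    rwa [map_sub, Ass.sub_apply, sub_eq_zero] at h2

/-- The bracket of derivations in terms of `graft`: like the bracket of trees, it joins the roots
`j` of both trees and lets `graft` transport the result to the vertex `i`. -/
theorem tupleBracket_eq {a b : Fin n → Ass K n} (ha : ∀ i, a i ∈ lie K n) (hb : ∀ i, b i ∈ lie K n)
    (i : Fin n) : tupleBracket a b i = ∑ j, graft K i j ⁅a j, b j⁆ := by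
  simp only [graft_apply, Finset.sum_add_distrib, Finset.sum_ite_eq', Finset.mem_univ, if_true,
    tupleBracket]
  congr 1
  rw [← Finset.sum_add_distrib]
  refine Finset.sum_congr rfl fun j _ => ?_
  rw [partialRight_lie (lie_nil (ha j)) (lie_nil (hb j)), map_sub, antipode_mul, antipode_mul,
    antipode_of_mem_lie (ha j), antipode_of_mem_lie (hb j), mul_neg, mul_neg, sub_neg_eq_add,
    adop_add_left, adop_neg_left, adop_mul, adop_mul, adop_of_mem_lie (ha j),
    adop_of_mem_lie (hb j), add_comm]
  congr 1
  rw [← adopL_apply, ← adopL_apply, ← map_neg, lie_skew]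

namespace LTree

/-- The Lie series of a tree at all external vertices are determined by its Lie word at one root. -/
theorem TreeAt.lieSeries_eq_graft {Γ : Graph n v e} {i : Fin n} {P : LTree n v e}
    (h : TreeAt Γ i P) (j : Fin n) :
    Γ.lieSeries K j = ((sgn P.edges : ℤ) : K) • graft K j i (P.lw K) := by
  rw [h.lieSeries, graft_apply]

/-- Relabelling of a tree whose root edge is attached to another vertex. -/
theorem Fits.map_root {v' e' : ℕ} {σ : Fin e → Fin e'} {τ : Fin v → Fin v'} {Γ : Graph n v e}
    {Γ' : Graph n v' e'} {y : Vertex n v} {y' : Vertex n v'} {P : LTree n v e} (h : P.Fits Γ y)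
    (hr : Γ' (σ P.root) = s(y', P.top.map id τ))
    (hΓ : ∀ f ∈ P.innerEdges, Γ' (σ f) = (Γ f).map (Sum.map id τ)) : (P.map σ τ).Fits Γ' y' := by
  cases P with
  | leaf r j => exact hr
  | node r a s t =>
    rw [innerEdges_node] at hΓ
    exact ⟨hr, h.2.1.map σ τ fun f hf => hΓ f (List.mem_append_left _ hf),
      h.2.2.map σ τ fun f hf => hΓ f (List.mem_append_right _ hf)⟩

variable (α : Fin e₁ ⊕ Fin e₂ ≃ Fin e) (β : Fin v₁ ⊕ Fin v₂ ≃ Fin v) {Γ₁ : Graph n v₁ e₁}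
  {Γ₂ : Graph n v₂ e₂} {j : Fin n} {P₁ : LTree n v₁ e₁} {P₂ : LTree n v₂ e₂}

/-- The tree obtained by joining two trees at an external vertex. -/
def join (P₁ : LTree n v₁ e₁) (P₂ : LTree n v₂ e₂) : LTree n (v + 1) (e + 1) :=
  node (Fin.last e) (Fin.last v)
    (P₁.map (fun i => (α (.inl i)).castSucc) fun a => (β (.inl a)).castSucc)
    (P₂.map (fun i => (α (.inr i)).castSucc) fun a => (β (.inr a)).castSucc)

theorem fits_split_mul (h₂ : TreeAt Γ₂ j P₂) (S : Finset (Fin e₁)) :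
    (P₂.map (fun i => (α (.inr i)).castSucc) fun a => (β (.inr a)).castSucc).Fits
      ((Graph.mul α β Γ₁ Γ₂).split (.inl j) ((S.disjSum {P₂.root}).map α.toEmbedding))
      (.inr (Fin.last v)) := by
  have hmem : ∀ f, α (.inr f) ∈ (S.disjSum {P₂.root}).map α.toEmbedding ↔ f = P₂.root := by
    intro f; simp
  have hold : ∀ y : Vertex n v₂, Graph.old (Sum.map id (fun a => β (.inr a)) y) =
      Sum.map id (fun a => (β (.inr a)).castSucc) y := by
    rintro (y | y) <;> rfl
  refine h₂.fits.map_root ?_ fun f hf => ?_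
  · rw [Graph.split_castSucc, Graph.mul_inr, Sym2.map_map, h₂.fits.root_eq, Sym2.map_mk]
    simp only [Function.comp, hmem, true_and]
    rw [if_pos (show Sum.map id _ (Sum.inl j) = Sum.inl j from rfl), if_neg, hold]
    · rfl
    · intro h
      have h3 := h₂.top_ne
      cases hP : P₂.top with
      | inl k => rw [hP] at h h3; exact h3 (congrArg Sum.inl (Sum.inl.inj h))
      | inr a => rw [hP] at h; cases h
  · have hne : f ≠ P₂.root := by
      rintro rfl
      have := h₂.edges_nodup
      rw [edges_eq, List.nodup_cons] at this
      exact this.1 hf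
    rw [Graph.split_castSucc, Graph.mul_inr, Sym2.map_map]
    refine Sym2.map_congr fun y _ => ?_
    simp only [Function.comp, hmem, hne, false_and, if_false, hold]

/-- If both factors are trees, splitting off one edge of each of them at `j` gives a tree again. -/
theorem TreeAt.split_mul (h₁ : TreeAt Γ₁ j P₁) (h₂ : TreeAt Γ₂ j P₂) :
    TreeAt ((Graph.mul α β Γ₁ Γ₂).split (.inl j)
      ((Finset.disjSum {P₁.root} {P₂.root}).map α.toEmbedding)) j (join α β P₁ P₂) where
  fits := by
    refine ⟨Graph.split_last _ _ _, ?_, fits_split_mul α β h₂ _⟩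
    rw [← Graph.mul_swap, Graph.map_disjSum_swap]
    exact fits_split_mul ((Equiv.sumComm _ _).trans α) ((Equiv.sumComm _ _).trans β) h₁ _
  top_ne := by simp [join, top]
  edges_nodup := by
    rw [join, edges_node, List.nodup_cons, List.nodup_append, edges_map, edges_map]
    refine ⟨?_, h₁.edges_nodup.map fun i k h => ?_, h₂.edges_nodup.map fun i k h => ?_, ?_⟩
    · simp [(Fin.castSucc_lt_last _).ne]
    · simpa using h
    · simpa using h
    · intro i hi k hk hik
      obtain ⟨i, -, rfl⟩ := List.mem_map.1 hi
      obtain ⟨k, -, rfl⟩ := List.mem_map.1 hk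
      simp at hik
  mem_edges f := by
    rw [join, edges_node, List.mem_cons, List.mem_append, edges_map, edges_map]
    induction f using Fin.lastCases with
    | last => exact Or.inl rfl
    | cast f =>
      right
      obtain ⟨f | f, rfl⟩ := α.surjective f
      · exact Or.inl (List.mem_map.2 ⟨f, h₁.mem_edges f, rfl⟩)
      · exact Or.inr (List.mem_map.2 ⟨f, h₂.mem_edges f, rfl⟩)
  verts_nodup := by
    rw [join, verts, List.nodup_cons, List.nodup_append, List.mem_append, not_or, verts_map,
      verts_map]
    refine ⟨⟨?_, ?_⟩, h₁.verts_nodup.map fun i k h => ?_, h₂.verts_nodup.map fun i k h => ?_, ?_⟩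
    · simp [(Fin.castSucc_lt_last _).ne]
    · simp [(Fin.castSucc_lt_last _).ne]
    · simpa using h
    · simpa using h
    · intro i hi k hk hik
      obtain ⟨i, -, rfl⟩ := List.mem_map.1 hi
      obtain ⟨k, -, rfl⟩ := List.mem_map.1 hk
      simp at hik
  mem_verts f := by
    rw [join, verts, List.mem_cons, List.mem_append, verts_map, verts_map]
    induction f using Fin.lastCases with
    | last => exact Or.inl rfl
    | cast f =>
      right
      obtain ⟨f | f, rfl⟩ := β.surjective f
      · exact Or.inl (List.mem_map.2 ⟨f, h₁.mem_verts f, rfl⟩)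
      · exact Or.inr (List.mem_map.2 ⟨f, h₂.mem_verts f, rfl⟩)

end LTree

/-- The numbering of a disjoint union which puts the first summand first. -/
def numbering {p q r : ℕ} (h : p + q = r) : Fin p ⊕ Fin q ≃ Fin r :=
  finSumFinEquiv.trans (finCongr h)

theorem LTree.sgn_join (he : e₁ + e₂ = e) (β : Fin v₁ ⊕ Fin v₂ ≃ Fin v) {Γ₁ : Graph n v₁ e₁}
    {Γ₂ : Graph n v₂ e₂} {j : Fin n} {P₁ : LTree n v₁ e₁} {P₂ : LTree n v₂ e₂}
    (h₁ : TreeAt Γ₁ j P₁) (h₂ : TreeAt Γ₂ j P₂) :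
    sgn (join (numbering he) β P₁ P₂).edges = sgn P₁.edges * sgn P₂.edges := by
  have h := (h₁.split_mul (numbering he) β h₂).edges_nodup
  rw [sgn_of_nodup h, sgn_of_nodup h₁.edges_nodup, sgn_of_nodup h₂.edges_nodup]
  rw [join, edges_node, edges_map, edges_map, listSign, List.countP_eq_length.2,
    listSign_append, listSign_map, listSign_map, Even.neg_one_pow, one_mul]
  · rw [List.length_append, List.length_map, List.length_map]
    exact P₁.odd_edges.add_odd P₂.odd_edges
  · intro i k hik
    rw [Fin.lt_def] at hik
    simp only [numbering, Fin.lt_def, Equiv.trans_apply, finSumFinEquiv_apply_right,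
      finCongr_apply, Fin.val_castSucc, Fin.val_cast, Fin.val_natAdd]
    omega
  · intro i k hik
    rw [Fin.lt_def] at hik
    simp only [numbering, Fin.lt_def, Equiv.trans_apply, finSumFinEquiv_apply_left,
      finCongr_apply, Fin.val_castSucc, Fin.val_cast, Fin.val_castAdd]
    omega
  · intro a ha b hb
    obtain ⟨i, -, rfl⟩ := List.mem_map.1 ha
    obtain ⟨k, -, rfl⟩ := List.mem_map.1 hb
    simp only [numbering, Fin.lt_def, Equiv.trans_apply, finSumFinEquiv_apply_left,
      finSumFinEquiv_apply_right, finCongr_apply, Fin.val_castSucc, Fin.val_cast,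
      Fin.val_castAdd, Fin.val_natAdd]
    omega
  · intro b hb
    rw [List.mem_append, List.mem_map, List.mem_map] at hb
    rcases hb with ⟨i, -, rfl⟩ | ⟨i, -, rfl⟩ <;> simp [Fin.castSucc_lt_last]

/-- The bracket of two trees corresponds to the bracket of derivations. -/
theorem treeSeries_bra_cls [CharZero K] (he : e₁ + e₂ = e) (hv : v₁ + v₂ = v)
    {Γ₁ : Graph n v₁ e₁} {Γ₂ : Graph n v₂ e₂} (h₁ : Γ₁.IsTreeGraph) (h₂ : Γ₂.IsTreeGraph)
    (i : Fin n) :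
    treeSeries K n (v + 1) (e + 1) i
        (Graph.bra K n (numbering he) (numbering hv) (cls K Γ₁) (cls K Γ₂)) =
      ∑ j, graft K i j ⁅Γ₁.lieSeries K j, Γ₂.lieSeries K j⁆ := by
  classical
  rw [Graph.bra_cls _ _ h₁.1 h₂.1, Graph.splitSum_mul _ _ h₁.1 h₂.1, map_sum]
  refine Finset.sum_congr rfl fun j _ => ?_
  set G := fun S T => (Graph.mul (numbering he) (numbering hv) Γ₁ Γ₂).split (.inl j)
    ((Finset.disjSum S T).map (numbering he).toEmbedding) with hG
  have hsing : ∀ {m : ℕ} {N : Type _} [AddCommMonoid N] (I : Finset (Fin m))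
      (g : Finset (Fin m) → N), (∀ S ⊆ I, 2 ≤ S.card → g S = 0) →
      ∑ S ∈ I.powerset with S.Nonempty, g S = ∑ r ∈ I, g {r} := by
    intro m N _ I g hg
    symm
    refine Finset.sum_of_injOn (fun r => {r}) (fun r _ s _ h => Finset.singleton_injective h) ?_ ?_ ?_
    · intro r hr
      simpa using hr
    · intro S hS hS'
      rw [Finset.mem_filter, Finset.mem_powerset] at hS
      refine hg S hS.1 ?_
      by_contra hc
      have h3 := Finset.card_pos.2 hS.2
      obtain ⟨r, rfl⟩ := Finset.card_eq_one.1 (by omega : S.card = 1)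
      exact hS' ⟨r, by simpa using hS.1, rfl⟩
    · exact fun _ _ => rfl
  have hzero : ∀ S ⊆ Γ₁.incident (.inl j), ∀ T ⊆ Γ₂.incident (.inl j), 0 < S.card → 0 < T.card →
      2 < S.card + T.card → treeSeries K n (v + 1) (e + 1) i (cls K (G S T)) = 0 := by
    intro S hS T hT h3 h4 h5
    refine treeSeries_cls_eq_zero (fun hs => ?_) i
    have h6 := Graph.loops_split_mul _ _ h₁.1 h₂.1 hS hT hs.1
    have h7 : (G S T).loops = 0 := hs.2.2
    rw [h₁.2.2, h₂.2.2] at h6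
    change (G S T).loops + 2 = _ at h6
    omega
  rw [map_sum, hsing]
  · rw [LTree.lieSeries_eq, LTree.lieSeries_eq]
    simp only [LieRing.of_associative_ring_bracket]
    rw [Finset.sum_mul_sum, Finset.sum_mul_sum, Finset.sum_comm (s := Γ₂.incident (.inl j)),
      ← Finset.sum_sub_distrib, map_sum]
    refine Finset.sum_congr rfl fun r hr => ?_
    rw [map_sum, hsing, ← Finset.sum_sub_distrib, map_sum]
    · refine Finset.sum_congr rfl fun s hs => ?_
      obtain ⟨P₁, hP₁, rfl⟩ := h₁.exists_treeAt hr
      obtain ⟨P₂, hP₂, rfl⟩ := h₂.exists_treeAt hs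
      have hj := hP₁.split_mul (numbering he) (numbering hv) hP₂
      rw [hP₁.rootTerm, hP₂.rootTerm, treeSeries_cls_of_treeAt hj, hj.lieSeries_eq_graft,
        LTree.sgn_join he _ hP₁ hP₂, ← map_smul]
      congr 1
      rw [LTree.join, LTree.lw, LTree.lw_map, LTree.lw_map,
        ← LieRing.of_associative_ring_bracket, smul_lie, lie_smul, smul_smul]
      push_cast
      rfl
    · intro T hT hc
      exact hzero {r} (by simpa using hr) T hT (by simp) (by omega) (by simp; omega)
  · intro S hS hc
    rw [map_sum]
    refine Finset.sum_eq_zero fun T hT => ?_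
    rw [Finset.mem_filter, Finset.mem_powerset] at hT
    have := Finset.card_pos.2 hT.2
    exact hzero S hS T hT.1 (by omega) this (by omega)

end KRV

namespace KRV

open Ass

variable {K : Type*} [Field K] {n v e v₁ v₂ : ℕ}

theorem Graph.IsICG.isTreeGraph {Γ : Graph n v (2 * v + 1)} (h : Γ.IsICG)
    (h' : ¬ Γ.IsTreeGraph) : 1 ≤ Γ.loops := by
  by_contra h2
  exact h' ⟨h, rfl, by omega⟩

/-- The commutator as a bilinear map. -/
def commutator : Ass K n →ₗ[K] Ass K n →ₗ[K] Ass K n :=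
  LinearMap.mul K (Ass K n) - (LinearMap.mul K (Ass K n)).flip

theorem commutator_apply (f g : Ass K n) : commutator f g = ⁅f, g⁆ := rfl

theorem treeSeries_bra [CharZero K] (he : 2 * v₁ + 1 + (2 * v₂ + 1) = e) (hv : v₁ + v₂ = v)
    (x : ICGPart K n v₁ (2 * v₁ + 1)) (y : ICGPart K n v₂ (2 * v₂ + 1)) (i : Fin n) :
    treeSeries K n (v + 1) (e + 1) i (Graph.bra K n (numbering he) (numbering hv) x y) =
      ∑ j, graft K i j ⁅treeSeries K n _ _ j x, treeSeries K n _ _ j y⁆ := by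
  have h : (Graph.bra K n (numbering he) (numbering hv)).compr₂ (treeSeries K n (v + 1) (e + 1) i) =
      ∑ j, (((commutator.comp (treeSeries K n _ _ j)).compl₂
        (treeSeries K n _ _ j)).compr₂ (graft K i j)) := by
    refine Graph.linearMap_ext_cls fun Γ₁ h₁ => Graph.linearMap_ext_cls fun Γ₂ h₂ => ?_
    simp only [LinearMap.compr₂_apply, LinearMap.sum_apply, LinearMap.compl₂_apply,
      LinearMap.comp_apply, commutator_apply]
    by_cases t₁ : Γ₁.IsTreeGraph
    · by_cases t₂ : Γ₂.IsTreeGraph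
      · rw [treeSeries_bra_cls he hv t₁ t₂]
        simp only [treeSeries_cls t₁, treeSeries_cls t₂]
      · simp only [treeSeries_cls_eq_zero t₂, lie_zero, map_zero, Finset.sum_const_zero]
        exact treeSeries_mem_filtrationPart (Graph.bra_mem_filtrationPart_right _ _ _
          (Graph.cls_mem_filtrationPart fun h => h.isTreeGraph t₂)) i
    · simp only [treeSeries_cls_eq_zero t₁, zero_lie, map_zero, Finset.sum_const_zero]
      exact treeSeries_mem_filtrationPart (Graph.bra_mem_filtrationPart _ _
        (Graph.cls_mem_filtrationPart fun h => h.isTreeGraph t₁) _) i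
  have h2 := LinearMap.congr_fun (LinearMap.congr_fun h x) y
  simpa [LinearMap.sum_apply, commutator_apply] using h2

/-- The bracket of two elements of degree `0`. -/
noncomputable def braZero (x y : ∀ v, ICGPart K n v (2 * v + 1)) : ∀ v, ICGPart K n v (2 * v + 1)
  | 0 => 0
  | v + 1 => ∑ p : Finset.HasAntidiagonal.antidiagonal v,
      Graph.bra K n (e := 2 * v + 2) (v := v)
        (numbering (by have := Finset.HasAntidiagonal.mem_antidiagonal.1 p.2; omega))
        (numbering (Finset.HasAntidiagonal.mem_antidiagonal.1 p.2)) (x p.1.1) (y p.1.2)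

theorem totalSeries_agree (x : ∀ v, ICGPart K n v (2 * v + 1)) (i : Fin n) (L : ℕ) :
    AgreeTo L (totalSeries x i) (∑ m ∈ Finset.range L, treeSeries K n m (2 * m + 1) i (x m)) := by
  intro w hw
  rw [Ass.sum_apply]
  rcases hl : w.length with - | v
  · rw [List.length_eq_zero_iff.1 hl, totalSeries_nil]
    exact (Finset.sum_eq_zero fun m _ => treeSeries_apply _ _ (by simp)).symm
  · rw [totalSeries_apply x i hl, Finset.sum_eq_single v]
    · exact fun m _ hm => treeSeries_apply _ _ (by omega)
    · exact fun h => absurd (Finset.mem_range.2 (by omega)) h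

/-- The tree part of the bracket is the bracket of derivations of the tree parts. -/
theorem totalSeries_braZero [CharZero K] (x y : ∀ v, ICGPart K n v (2 * v + 1)) (i : Fin n) :
    totalSeries (braZero x y) i = tupleBracket (totalSeries x) (totalSeries y) i := by
  rw [tupleBracket_eq (totalSeries_mem_lie x) (totalSeries_mem_lie y)]
  ext w
  have h1 : (∑ j, graft K i j ⁅totalSeries x j, totalSeries y j⁆ : Ass K n) w =
      ∑ p ∈ Finset.range w.length ×ˢ Finset.range w.length,
        treeSeries K n (p.1 + p.2 + 1) (2 * p.1 + 1 + (2 * p.2 + 1) + 1) i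
          (Graph.bra K n (numbering rfl) (numbering rfl) (x p.1) (y p.2)) w := by
    have h2 : ∀ j, graft K i j ⁅totalSeries x j, totalSeries y j⁆ w =
        (∑ p ∈ Finset.range w.length ×ˢ Finset.range w.length,
          graft K i j ⁅treeSeries K n p.1 (2 * p.1 + 1) j (x p.1),
            treeSeries K n p.2 (2 * p.2 + 1) j (y p.2)⁆ : Ass K n) w := by
      intro j
      rw [graft_agree ((totalSeries_agree x j w.length).lie (totalSeries_agree y j w.length)) w
        le_rfl, ← map_sum]
      simp only [LieRing.of_associative_ring_bracket]
      rw [Finset.sum_mul_sum, Finset.sum_mul_sum, Finset.sum_sub_distrib, Finset.sum_product,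
        Finset.sum_product_right]
    rw [Ass.sum_apply, Finset.sum_congr rfl fun j _ => h2 j, ← Ass.sum_apply, Finset.sum_comm,
      Ass.sum_apply]
    refine Finset.sum_congr rfl fun p _ => ?_
    rw [treeSeries_bra]
  rw [h1]
  rcases hl : w.length with - | v
  · rw [List.length_eq_zero_iff.1 hl, totalSeries_nil]
    simp
  · rw [totalSeries_apply _ i hl]
    rcases v with - | v
    · symm
      rw [braZero, map_zero]
      refine Finset.sum_eq_zero fun p _ => treeSeries_apply _ _ (by omega)
    · rw [braZero, map_sum, Ass.sum_apply]
      have h3 : ∀ p : Finset.HasAntidiagonal.antidiagonal v,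
          treeSeries K n (v + 1) (2 * (v + 1) + 1) i
            (Graph.bra K n (e := 2 * v + 2) (v := v)
              (numbering (by have := Finset.HasAntidiagonal.mem_antidiagonal.1 p.2; omega))
              (numbering (Finset.HasAntidiagonal.mem_antidiagonal.1 p.2)) (x p.1.1) (y p.1.2)) w =
          treeSeries K n (p.1.1 + p.1.2 + 1) (2 * p.1.1 + 1 + (2 * p.1.2 + 1) + 1) i
            (Graph.bra K n (numbering rfl) (numbering rfl) (x p.1.1) (y p.1.2)) w := by
        intro p
        exact congrFun ((treeSeries_bra (e := 2 * v + 2) _ _ _ _ i).trans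
          (treeSeries_bra rfl rfl _ _ i).symm) w
      rw [Finset.sum_congr rfl fun p _ => h3 p]
      rw [Finset.sum_coe_sort (Finset.HasAntidiagonal.antidiagonal v) fun p : ℕ × ℕ =>
        treeSeries K n (p.1 + p.2 + 1) (2 * p.1 + 1 + (2 * p.2 + 1) + 1) i
            (Graph.bra K n (numbering rfl) (numbering rfl) (x p.1) (y p.2)) w]
      refine Finset.sum_subset (fun p hp => ?_) fun p _ hp => treeSeries_apply _ _ fun h => hp ?_
      · have := Finset.HasAntidiagonal.mem_antidiagonal.1 hp
        rw [Finset.mem_product, Finset.mem_range, Finset.mem_range]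
        omega
      · rw [Finset.HasAntidiagonal.mem_antidiagonal]
        omega

/-- The bracket preserves the condition that defines the level sets, by `Graph.dPart_bra` and the
compatibility of the bracket with the filtration. -/
theorem dPart_braZero [CharZero K] {k : ℕ} {x y : ∀ v, ICGPart K n v (2 * v + 1)}
    (hx : ∀ v, dPart K n v (2 * v + 1) (x v) ∈ filtrationPart K k n (v + 1) (2 * v + 1 + 1))
    (hy : ∀ v, dPart K n v (2 * v + 1) (y v) ∈ filtrationPart K k n (v + 1) (2 * v + 1 + 1))
    (v : ℕ) :
    dPart K n v (2 * v + 1) (braZero x y v) ∈ filtrationPart K k n (v + 1) (2 * v + 1 + 1) := by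
  rcases v with - | v
  · rw [braZero, map_zero]
    exact zero_mem _
  · rw [braZero, map_sum]
    refine sum_mem fun p _ => ?_
    have h := Graph.dPart_bra (K := K) (n := n) (e := 2 * v + 2) (v := v)
        (numbering (by have := Finset.HasAntidiagonal.mem_antidiagonal.1 p.2; omega))
        (numbering (Finset.HasAntidiagonal.mem_antidiagonal.1 p.2)) (x p.1.1) (y p.1.2)
    refine (eq_neg_of_add_eq_zero_left h).symm ▸ neg_mem (add_mem ?_ ?_)
    · exact Graph.bra_mem_filtrationPart _ _ (hx _) _
    · exact Graph.bra_mem_filtrationPart_right _ _ _ (hy _)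

theorem totalSeries_add (x y : ∀ v, ICGPart K n v (2 * v + 1)) (i : Fin n) :
    totalSeries (fun v => x v + y v) i = totalSeries x i + totalSeries y i := by
  ext w
  rw [Ass.add_apply, totalSeries, totalSeries, totalSeries]
  cases w.length with
  | zero => simp
  | succ v => simp only [map_add, Ass.add_apply]

theorem totalSeries_smul (c : K) (x : ∀ v, ICGPart K n v (2 * v + 1)) (i : Fin n) :
    totalSeries (fun v => c • x v) i = c • totalSeries x i := by
  ext w
  rw [Ass.smul_apply, totalSeries, totalSeries]
  cases w.length with
  | zero => simp
  | succ v => simp only [map_smul, Ass.smul_apply]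

/-- The level sets are Lie subalgebras. -/
noncomputable def krvLevelSubalgebra (K : Type*) [Field K] [CharZero K] (n k : ℕ) :
    LieSubalgebra K (sder K n) where
  carrier := krvLevel K n k
  zero_mem' := by
    rw [mem_krvLevel_iff]
    refine ⟨fun _ => 0, fun v => by rw [map_zero]; exact zero_mem _, fun i => ?_⟩
    have h := totalSeries_smul (0 : K) (fun v => (0 : ICGPart K n v (2 * v + 1))) i
    simp only [smul_zero, zero_smul] at h
    rw [h, lie_zero]
    rfl
  add_mem' := by
    intro u u' hu hu'
    rw [mem_krvLevel_iff] at hu hu' ⊢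
    obtain ⟨x, hx, hxu⟩ := hu
    obtain ⟨y, hy, hyu⟩ := hu'
    refine ⟨fun v => x v + y v, fun v => by rw [map_add]; exact add_mem (hx v) (hy v), fun i => ?_⟩
    rw [totalSeries_add, lie_add, ← hxu, ← hyu]
    rfl
  smul_mem' := by
    intro c u hu
    rw [mem_krvLevel_iff] at hu ⊢
    obtain ⟨x, hx, hxu⟩ := hu
    refine ⟨fun v => c • x v, fun v => by rw [map_smul]; exact Submodule.smul_mem _ _ (hx v),
      fun i => ?_⟩
    rw [totalSeries_smul, lie_smul, ← hxu]
    rfl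
  lie_mem' := by
    intro u u' hu hu'
    change u ∈ krvLevel K n k at hu
    change u' ∈ krvLevel K n k at hu'
    rw [mem_krvLevel_iff] at hu hu' ⊢
    obtain ⟨x, hx, hxu⟩ := hu
    obtain ⟨y, hy, hyu⟩ := hu'
    refine ⟨braZero x y, dPart_braZero hx hy, fun i => ?_⟩
    rw [totalSeries_braZero]
    exact sder_bracket u u' (totalSeries_mem_lie x) (totalSeries_mem_lie y) hxu hyu i

theorem krvLevel_succ_subset (k : ℕ) : krvLevel K n (k + 1) ⊆ krvLevel K n k := by
  intro u hu
  rw [mem_krvLevel_iff] at hu ⊢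
  obtain ⟨x, hx, hxu⟩ := hu
  exact ⟨x, fun v => Graph.filtrationPart_mono (by omega) (hx v), hxu⟩


/-! ### Loops with hairs -/

/-- Two planar structures on the same tree differ by a sign that affects the Lie word and the order of
the edges in the same way. -/
theorem LTree.Reads.unique {Γ : Graph n v e} {y : Vertex n v} {P Q : LTree n v e}
    (hP : P.Reads Γ y) (hQ : Q.Reads Γ y) (h : P.root = Q.root) :
    ∃ ε : ℤ, ε * ε = 1 ∧ P.lw K = (ε : K) • Q.lw K ∧ SignRel ε P.edges Q.edges := by
  obtain ⟨T, ε, h1, h2, h3, h4⟩ := hP.readTree (K := K)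
    (k := P.verts.length + Q.verts.length + 1) (by omega)
  obtain ⟨T', δ, h1', h2', h3', h4'⟩ := hQ.readTree (K := K)
    (k := P.verts.length + Q.verts.length + 1) (by omega)
  have ht : P.top = Q.top := by
    have := hP.fits.root_eq
    rw [h, hQ.fits.root_eq] at this
    exact (Sym2.congr_right.1 this).symm
  rw [h, ht, h1'] at h1
  obtain rfl := Option.some.inj h1
  refine ⟨ε * δ, by linear_combination ε * ε * h2' + h2, ?_, (h4.symm h2).trans h4'⟩
  have : (ε : K) * ε = 1 := by rw [← Int.cast_mul, h2, Int.cast_one]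
  push_cast
  rw [mul_smul, ← h3', h3, smul_smul, this, one_smul]

/-- A chain of vertices with hairs: an entry `(c, a, h)` consists of an edge `c` that leads to the
internal vertex `a`, and a tree `h` which is attached to `a`. -/
abbrev HairyChain (n v e : ℕ) : Type := List (Fin e × Fin v × LTree n v e)

namespace HairyChain

/-- The edges of the chain and of the hairs. -/
def edges (L : HairyChain n v e) : List (Fin e) := L.flatMap fun q => q.1 :: q.2.2.edges

/-- The internal vertices of the chain and of the hairs. -/
def verts (L : HairyChain n v e) : List (Fin v) := L.flatMap fun q => q.2.1 :: q.2.2.verts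

/-- The product of the Lie words of the hairs. -/
def word (K : Type*) [Field K] (L : HairyChain n v e) : Ass K n :=
  (L.map fun q => q.2.2.lw K).prod

/-- The value of a chain that is closed up to a loop: the cyclic word of the hairs, antisymmetrized
with respect to reversing the direction of the loop. -/
noncomputable def value (K : Type*) [Field K] (L : HairyChain n v e) : Ass K n :=
  ((sgn (edges L) : ℤ) : K) • dihedralSum (word K L)

/-- The chain consists of edges of the graph `Γ` and leads from `y` to `z`. -/
def Fits (Γ : Graph n v e) : Vertex n v → HairyChain n v e → Vertex n v → Prop
  | y, [], z => y = z
  | y, (c, a, h) :: L, z => Γ c = s(y, .inr a) ∧ h.Fits Γ (.inr a) ∧ Fits Γ (.inr a) L z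

/-- The first edge of a chain, or `c` if the chain is empty. -/
def next (L : HairyChain n v e) (c : Fin e) : Fin e := ((L.map Prod.fst).head?).getD c

variable (c : Fin e) (a : Fin v) (h : LTree n v e) (L M : HairyChain n v e)

theorem edges_nil : edges ([] : HairyChain n v e) = [] := rfl

theorem edges_cons : edges ((c, a, h) :: L) = c :: (h.edges ++ edges L) := rfl

theorem edges_append : edges (L ++ M) = edges L ++ edges M := List.flatMap_append

theorem verts_cons : verts ((c, a, h) :: L) = a :: (h.verts ++ verts L) := rfl

theorem verts_append : verts (L ++ M) = verts L ++ verts M := List.flatMap_append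

theorem word_cons : word K ((c, a, h) :: L) = h.lw K * word K L := List.prod_cons

theorem word_append : word K (L ++ M) = word K L * word K M := by
  rw [word, List.map_append, List.prod_append]; rfl

theorem next_cons (c' : Fin e) : next ((c, a, h) :: L) c' = c := rfl

theorem next_append : next (L ++ M) c = next L (next M c) := by cases L <;> rfl

theorem even_edges : Even (edges L).length := by
  induction L with
  | nil => exact ⟨0, rfl⟩
  | cons q L ih =>
    obtain ⟨c, a, h⟩ := q
    rw [edges_cons, List.length_cons, List.length_append]
    exact (h.odd_edges.add_even ih).add_one

variable {c a h L M}
variable {Γ : Graph n v e} {y z : Vertex n v}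

theorem mem_edges_of_mem (hc : c ∈ L.map Prod.fst) : c ∈ edges L := by
  obtain ⟨q, hq, rfl⟩ := List.mem_map.1 hc
  exact List.mem_flatMap.2 ⟨q, hq, List.mem_cons_self⟩

theorem fits_append : Fits Γ y (L ++ M) z ↔ ∃ x, Fits Γ y L x ∧ Fits Γ x M z := by
  induction L generalizing y with
  | nil => simp [Fits]
  | cons q L ih =>
    obtain ⟨c, a, h⟩ := q
    simp only [List.cons_append, Fits, ih]
    aesop

theorem Fits.eq_next (hL : Fits Γ y L z) (ha : a ∉ verts L) {f : Fin e} (hf : f ∈ edges L)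
    (haf : .inr a ∈ Γ f) (c : Fin e) : f = next L c ∧ y = .inr a := by
  induction L generalizing y c with
  | nil => simp [edges] at hf
  | cons q L ih =>
    obtain ⟨c', a', h⟩ := q
    rw [verts_cons, List.mem_cons, List.mem_append, not_or, not_or] at ha
    rw [edges_cons, List.mem_cons, List.mem_append] at hf
    rcases hf with rfl | hf | hf
    · rw [hL.1, Sym2.mem_iff] at haf
      exact ⟨rfl, (haf.resolve_right fun h => ha.1 (Sum.inr.inj h)).symm⟩
    · exact absurd (Sum.inr.inj (hL.2.1.eq_root ha.2.1 hf haf).2).symm ha.1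
    · exact absurd (Sum.inr.inj (ih hL.2.2 ha.2.2 hf c).2).symm ha.1

theorem Fits.eq_start (hL : Fits Γ y L (.inr a)) (ha : a ∉ verts L) : y = .inr a := by
  induction L generalizing y with
  | nil => exact hL
  | cons q L ih =>
    obtain ⟨c', a', h'⟩ := q
    rw [verts_cons, List.mem_cons, List.mem_append, not_or, not_or] at ha
    exact absurd (Sum.inr.inj (ih hL.2.2 ha.2.2)).symm ha.1

/-- Relabelling of edges and internal vertices. -/
def relabel {v' e' : ℕ} (σ : Fin e → Fin e') (τ : Fin v → Fin v') (L : HairyChain n v e) :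
    HairyChain n v' e' := List.map (fun q => (σ q.1, τ q.2.1, q.2.2.map σ τ)) L

section

variable {v' e' : ℕ} (σ : Fin e → Fin e') (τ : Fin v → Fin v')

theorem edges_relabel : edges (relabel σ τ L) = (edges L).map σ := by
  simp [edges, relabel, List.map_flatMap, List.flatMap_map, LTree.edges_map]

theorem verts_relabel : verts (relabel σ τ L) = (verts L).map τ := by
  simp [verts, relabel, List.map_flatMap, List.flatMap_map, LTree.verts_map]

theorem word_relabel : word K (relabel σ τ L) = word K L := by
  simp only [word, relabel, List.map_map, Function.comp_def, LTree.lw_map]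

theorem Fits.relabel {Γ' : Graph n v' e'} (hL : Fits Γ y L z)
    (hΓ : ∀ f ∈ edges L, Γ' (σ f) = (Γ f).map (Sum.map id τ)) :
    Fits Γ' (y.map id τ) (relabel σ τ L) (z.map id τ) := by
  induction L generalizing y with
  | nil => exact congrArg _ hL
  | cons q L ih =>
    obtain ⟨c, a, h⟩ := q
    rw [edges_cons] at hΓ
    refine ⟨?_, hL.2.1.map σ τ fun f hf => hΓ f (by simp [hf]),
      ih hL.2.2 fun f hf => hΓ f (by simp [hf])⟩
    rw [hΓ c List.mem_cons_self, hL.1, Sym2.map_mk]; rfl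

end

/-- The graph `Γ` is a loop with hairs, read off along the loop, from the vertex `y` back to `y`. -/
structure LoopAt (Γ : Graph n v e) (y : Vertex n v) (L : HairyChain n v e) : Prop where
  fits : Fits Γ y L y
  edges_nodup : (edges L).Nodup
  mem_edges : ∀ f, f ∈ edges L
  verts_nodup : (verts L).Nodup
  mem_verts : ∀ a, a ∈ verts L

namespace LoopAt

theorem of_perm {L' : HairyChain n v e} (hL : LoopAt Γ y L) (h1 : Fits Γ z L' z)
    (h2 : (edges L').Perm (edges L)) (h3 : (verts L').Perm (verts L)) : LoopAt Γ z L' :=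
  ⟨h1, h2.nodup_iff.2 hL.edges_nodup, fun f => h2.mem_iff.2 (hL.mem_edges f),
    h3.nodup_iff.2 hL.verts_nodup, fun a => h3.mem_iff.2 (hL.mem_verts a)⟩

theorem rotate (hL : LoopAt Γ y (L ++ M)) : ∃ z, LoopAt Γ z (M ++ L) := by
  obtain ⟨x, h1, h2⟩ := fits_append.1 hL.fits
  refine ⟨x, hL.of_perm (fits_append.2 ⟨y, h2, h1⟩) ?_ ?_⟩
  · rw [edges_append, edges_append]; exact List.perm_append_comm
  · rw [verts_append, verts_append]; exact List.perm_append_comm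

theorem _root_.KRV.HairyChain.value_rotate : value K (L ++ M) = value K (M ++ L) := by
  rw [value, value, edges_append, edges_append, word_append, word_append, dihedralSum_mul_comm]
  have := (signRel_swap_of_even ((even_edges L).mul_right (edges M).length)).sgn_eq
  rw [this, one_mul]

theorem relabel (hL : LoopAt Γ y L) (σ : Equiv.Perm (Fin e)) (τ : Equiv.Perm (Fin v)) :
    LoopAt (Γ.relabel σ τ) (y.map id τ) (relabel σ.symm τ L) where
  fits := hL.fits.relabel σ.symm τ fun f _ => by
    unfold Graph.relabel
    rw [Equiv.apply_symm_apply]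
    rfl
  edges_nodup := by rw [edges_relabel]; exact hL.edges_nodup.map σ.symm.injective
  mem_edges f := by rw [edges_relabel]; exact List.mem_map.2 ⟨σ f, hL.mem_edges _, by simp⟩
  verts_nodup := by rw [verts_relabel]; exact hL.verts_nodup.map τ.injective
  mem_verts a := by rw [verts_relabel]; exact List.mem_map.2 ⟨τ.symm a, hL.mem_verts _, by simp⟩

theorem value_relabel (hL : ∀ f, f ∈ edges L) (σ : Equiv.Perm (Fin e)) {v' : ℕ}
    (τ : Fin v → Fin v') :
    value K (L.relabel σ τ) = ((Equiv.Perm.sign σ : ℤ) : K) • value K L := by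
  rw [value, value, edges_relabel, word_relabel, sgn_map_perm _ hL, smul_smul]
  push_cast
  rfl

/-- The vertices of the loop are trivalent. -/
theorem mem_iff (hL : LoopAt Γ y ((c, a, h) :: M)) (f : Fin e) :
    .inr a ∈ Γ f ↔ f = c ∨ f = h.root ∨ f = next M c := by
  have hv := hL.verts_nodup
  rw [verts_cons, List.nodup_cons, List.mem_append, not_or] at hv
  constructor
  · intro hf
    have := hL.mem_edges f
    rw [edges_cons, List.mem_cons, List.mem_append] at this
    rcases this with h1 | h1 | h1
    · exact Or.inl h1
    · exact Or.inr (Or.inl (hL.fits.2.1.eq_root hv.1.1 h1 hf).1)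
    · exact Or.inr (Or.inr (hL.fits.2.2.eq_next hv.1.2 h1 hf c).1)
  · have hc : .inr a ∈ Γ c := by rw [hL.fits.1]; simp
    rintro (rfl | rfl | rfl)
    · exact hc
    · rw [hL.fits.2.1.root_eq]; simp
    · cases M with
      | nil => exact hc
      | cons q M =>
        obtain ⟨c', a', h'⟩ := q
        rw [next_cons, hL.fits.2.2.1]; simp

theorem reads_hair (hL : LoopAt Γ y ((c, a, h) :: M)) : h.Reads Γ (.inr a) := by
  have hv := hL.verts_nodup
  have he := hL.edges_nodup
  rw [verts_cons, List.nodup_cons, List.mem_append, not_or, List.nodup_append] at hv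
  rw [edges_cons, List.nodup_cons, List.mem_append, not_or, List.nodup_append] at he
  have hne : ∀ b ∈ h.verts, a ≠ b := fun b hb hab => hv.1.1 (hab ▸ hb)
  refine hL.fits.2.1.reads hv.2.1 he.2.1 (fun b hb f hf hbf => ?_)
    fun b hb hab => hne b hb (Sum.inr.inj hab)
  have hyb : y ≠ .inr b := by
    rintro rfl
    exact hne b hb (Sum.inr.inj (hL.fits.2.2.eq_start fun hb' => hv.2.2.2 _ hb _ hb' rfl))
  have hcb : .inr b ∉ Γ c := by
    rw [hL.fits.1, Sym2.mem_iff]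
    rintro (h1 | h1)
    · exact hyb h1.symm
    · exact hne b hb (Sum.inr.inj h1).symm
  have := hL.mem_edges f
  rw [edges_cons, List.mem_cons, List.mem_append] at this
  rcases this with rfl | h1 | h1
  · exact hcb hbf
  · exact hf h1
  · exact hne b hb (Sum.inr.inj
      (hL.fits.2.2.eq_next (fun hb' => hv.2.2.2 _ hb _ hb' rfl) h1 hbf c).2)

theorem next_ne (hL : LoopAt Γ y ((c, a, h) :: M)) (hΓ : ∀ f, ¬ (Γ f).IsDiag) : next M c ≠ c := by
  cases M with
  | nil =>
    have := hL.fits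
    refine absurd ?_ (hΓ c)
    rw [this.1, Sym2.mk_isDiag_iff]
    exact this.2.2.symm
  | cons q M =>
    obtain ⟨c', a', h'⟩ := q
    rintro (rfl : c' = c)
    have := hL.edges_nodup
    rw [edges_cons, edges_cons] at this
    simp at this

/-- The edges of the loop cannot be the root of a tree that is read off the graph: at both ends of
an edge of the loop there is another edge of the loop, so the reading would never end. -/
theorem root_notMem (hL : LoopAt Γ y L) (hΓ : ∀ f, ¬ (Γ f).IsDiag) {x : Vertex n v}
    {P : LTree n v e} (hP : P.Reads Γ x) : P.root ∉ L.map Prod.fst := by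
  have key : ∀ c ∈ L.map Prod.fst, ∀ x ∈ Γ c, ∃ a, x = .inr a ∧
      ∃ c' ∈ L.map Prod.fst, c' ≠ c ∧ .inr a ∈ Γ c' := by
    intro c hc x hx
    obtain ⟨⟨c, a, h⟩, hq, rfl⟩ := List.mem_map.1 hc
    obtain ⟨A, B, rfl⟩ := List.append_of_mem hq
    obtain ⟨z, hz⟩ := hL.rotate
    rw [List.cons_append] at hz
    have h1 := hz.fits.1
    have hmem : ∀ q, q ∈ B ++ A → q.1 ∈ (A ++ (c, a, h) :: B).map Prod.fst := by
      intro q hq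
      simp only [List.mem_append] at hq
      refine List.mem_map_of_mem ?_
      simp only [List.mem_append, List.mem_cons]
      tauto
    have hne := hz.next_ne hΓ
    have hnd := hz.edges_nodup
    rw [edges_cons, List.nodup_cons, List.mem_append, not_or] at hnd
    rw [h1, Sym2.mem_iff] at hx
    rcases List.eq_nil_or_concat (B ++ A) with hBA | ⟨N, q, hN⟩
    · rw [hBA] at hne; exact absurd rfl hne
    rcases hx with rfl | rfl
    · obtain ⟨c', a', h'⟩ := q
      rw [List.concat_eq_append] at hN
      have h2 := hz.fits.2.2
      rw [hN, fits_append] at h2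
      obtain ⟨w, -, h3⟩ := h2
      refine ⟨a', h3.2.2.symm, c', hmem (c', a', h') (by rw [hN]; simp), ?_, by rw [h3.1]; simp⟩
      rintro rfl
      refine hnd.1.2 (mem_edges_of_mem ?_)
      rw [hN]; simp
    · refine ⟨a, rfl, next (B ++ A) c, ?_, hne, (hz.mem_iff _).2 (Or.inr (Or.inr rfl))⟩
      generalize hD : B ++ A = D at *
      cases D with
      | nil => exact absurd rfl hne
      | cons q D => exact hmem q List.mem_cons_self
  induction P generalizing x with
  | leaf r j =>
    intro hr
    obtain ⟨a, ha, -⟩ := key r hr (.inl j) (by rw [show Γ r = _ from hP]; simp)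
    cases ha
  | node r a s t hs ht =>
    intro hr
    obtain ⟨h1, h2, -, h4, h5⟩ := hP
    obtain ⟨b, hb, c', hc', hne, hbc⟩ := key r hr (.inr a) (by rw [h1]; simp)
    obtain rfl := Sum.inr.inj hb
    rcases (h2 c').1 hbc with rfl | rfl | rfl
    · exact hne rfl
    · exact hs h4 hc'
    · exact ht h5 hc'

theorem fst_ne_of_start {A : HairyChain n v e} (hL : LoopAt Γ y (A ++ (c, a, h) :: M))
    {q : Fin e × Fin v × LTree n v e} (hq : q ∈ M) : q.1 ≠ next A c := by
  intro hqc
  have h1 := hL.edges_nodup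
  rw [show A ++ (c, a, h) :: M = (A ++ [(c, a, h)]) ++ M by simp, edges_append,
    List.nodup_append] at h1
  refine h1.2.2 q.1 (mem_edges_of_mem ?_) q.1 (mem_edges_of_mem (List.mem_map_of_mem hq)) rfl
  rw [hqc]
  cases A <;> simp [next]

/-- Two readings of a graph as a loop which start in the same direction agree up to signs. -/
theorem unique_of_start {A A' M' : HairyChain n v e} {h' : LTree n v e} {y' : Vertex n v}
    (hL : LoopAt Γ y (A ++ (c, a, h) :: M)) (hL' : LoopAt Γ y' (A' ++ (c, a, h') :: M'))
    (hΓ : ∀ f, ¬ (Γ f).IsDiag) (hA : next A c = next A' c) :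
    ∃ ε : ℤ, ε * ε = 1 ∧ word K ((c, a, h) :: M) = (ε : K) • word K ((c, a, h') :: M') ∧
      SignRel ε (edges ((c, a, h) :: M)) (edges ((c, a, h') :: M')) := by
  have step : ∀ {A A' M M' : HairyChain n v e} {c : Fin e} {a : Fin v} {h h' : LTree n v e},
      LoopAt Γ y (A ++ (c, a, h) :: M) → LoopAt Γ y' (A' ++ (c, a, h') :: M') →
      next A c = next A' c → h.root = h'.root ∧ next M (next A c) = next M' (next A c) ∧
        h.Reads Γ (.inr a) ∧ h'.Reads Γ (.inr a) := by
    intro A A' M M' c a h h' hL hL' hA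
    obtain ⟨z, hz⟩ := hL.rotate
    obtain ⟨z', hz'⟩ := hL'.rotate
    rw [List.cons_append] at hz hz'
    have hmem : ∀ {D : HairyChain n v e} {k : LTree n v e},
        next D c ∈ ((c, a, k) :: D).map Prod.fst := by
      intro D k
      cases D <;> simp [next]
    have r1 := hz.root_notMem hΓ hz'.reads_hair
    have r2 := hz'.root_notMem hΓ hz.reads_hair
    have hr : h.root = h'.root := by
      rcases (hz'.mem_iff h.root).1 ((hz.mem_iff _).2 (Or.inr (Or.inl rfl))) with h1 | h1 | h1
      · exact absurd (by rw [h1]; simp) r2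
      · exact h1
      · exact absurd (by rw [h1]; exact hmem) r2
    have hn : next (M ++ A) c = next (M' ++ A') c := by
      rcases (hz'.mem_iff (next (M ++ A) c)).1
        ((hz.mem_iff _).2 (Or.inr (Or.inr rfl))) with h1 | h1 | h1
      · exact absurd h1 (hz.next_ne hΓ)
      · exact absurd (by rw [← h1]; exact hmem) r1
      · exact h1
    rw [next_append, next_append, ← hA] at hn
    exact ⟨hr, hn, hz.reads_hair, hz'.reads_hair⟩
  induction M generalizing A A' c a h h' M' with
  | nil =>
    obtain ⟨h1, h2, h3, h4⟩ := step hL hL' hA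
    obtain ⟨ε, e1, e2, e3⟩ := h3.unique (K := K) h4 h1
    cases M' with
    | nil =>
      refine ⟨ε, e1, by rw [word_cons, word_cons, e2, smul_mul_assoc], ?_⟩
      have := (e3.append (SignRel.refl [])).cons c
      rwa [mul_one] at this
    | cons q M' =>
      refine absurd ?_ (hL'.fst_ne_of_start (q := q) List.mem_cons_self)
      rw [← hA]; exact h2.symm
  | cons q M ih =>
    obtain ⟨h1, h2, h3, h4⟩ := step hL hL' hA
    obtain ⟨ε, e1, e2, e3⟩ := h3.unique (K := K) h4 h1
    cases M' with
    | nil => exact absurd h2 (hL.fst_ne_of_start (q := q) List.mem_cons_self)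
    | cons q' M' =>
      obtain ⟨c2, a2, k⟩ := q
      obtain ⟨c2', a2', k'⟩ := q'
      obtain rfl : c2 = c2' := h2
      obtain rfl : a2 = a2' := by
        obtain ⟨_, -, g1⟩ := fits_append.1 hL.fits
        obtain ⟨_, -, g2⟩ := fits_append.1 hL'.fits
        have := g1.2.2.1
        rw [g2.2.2.1] at this
        exact (Sum.inr.inj (Sym2.congr_right.1 this)).symm
      have hA2 : next (A ++ [(c, a, h)]) c2 = next (A' ++ [(c, a, h')]) c2 := by
        rw [next_append, next_append]; exact hA
      obtain ⟨δ, d1, d2, d3⟩ := ih (A := A ++ [(c, a, h)]) (A' := A' ++ [(c, a, h')])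
        (by simpa using hL) (by simpa using hL') hA2
      refine ⟨ε * δ, by linear_combination ε * ε * d1 + e1, ?_, (e3.append d3).cons c⟩
      rw [word_cons, word_cons c a h', e2, d2, smul_mul_smul_comm]
      push_cast
      rfl

end LoopAt

/-- The chain `(c, a, h) :: M`, traversed in the opposite direction. -/
def reverse (c : Fin e) : HairyChain n v e → Fin v → LTree n v e → HairyChain n v e
  | [], a, h => [(c, a, h)]
  | (c', a', h') :: M, a, h => reverse c M a' h' ++ [(c', a, h)]

theorem Fits.reverse (hM : Fits Γ (.inr a) M z) (hh : h.Fits Γ (.inr a)) {x : Vertex n v}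
    (hc : Γ c = s(x, z)) : Fits Γ x (reverse c M a h) (.inr a) := by
  induction M generalizing a h with
  | nil => exact ⟨by rw [hc, ← show _ = z from hM], hh, rfl⟩
  | cons q M ih =>
    obtain ⟨c', a', h'⟩ := q
    exact fits_append.2 ⟨.inr a', ih hM.2.2 hM.2.1, hM.1.trans Sym2.eq_swap, hh, rfl⟩

theorem verts_reverse_perm :
    (verts (reverse c M a h)).Perm (verts ((c, a, h) :: M)) := by
  induction M generalizing a h with
  | nil => exact List.Perm.refl _
  | cons q M ih =>
    obtain ⟨c', a', h'⟩ := q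
    rw [reverse, verts_append]
    refine (ih.append_right _).trans ?_
    rw [← verts_append, List.cons_append]
    exact (List.perm_append_comm (l₁ := (c, a', h') :: M) (l₂ := [(c', a, h)])).flatMap_right _

theorem edges_reverse_perm :
    (edges (reverse c M a h)).Perm (edges ((c, a, h) :: M)) := by
  induction M generalizing a h with
  | nil => exact List.Perm.refl _
  | cons q M ih =>
    obtain ⟨c', a', h'⟩ := q
    rw [reverse, edges_append]
    refine (ih.append_right _).trans ?_
    rw [edges_cons, edges_cons, edges_cons, edges_cons, edges_nil, List.append_nil]
    rw [List.perm_iff_count]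
    intro f
    simp only [List.count_append, List.count_cons]
    omega

theorem signRel_reverse : SignRel ((-1) ^ M.length) (edges (reverse c M a h))
    (edges ((c, a, h) :: M)) := by
  induction M generalizing a h with
  | nil => exact SignRel.refl _
  | cons q M ih =>
    obtain ⟨c', a', h'⟩ := q
    have h1 := signRel_swap_of_even (L := h'.edges ++ edges M) (M := c' :: h.edges)
      (Even.mul_left (by rw [List.length_cons]; exact h.odd_edges.add_one) _)
    have h2 := (signRel_swap_of_odd (L := [c']) (M := h.edges) odd_one h.odd_edges).append
      (SignRel.refl (h'.edges ++ edges M))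
    have h3 := (h1.trans h2).cons c
    rw [← List.cons_append] at h3
    have h4 := ((ih (a := a') (h := h')).append (SignRel.refl (c' :: h.edges))).trans h3
    rw [reverse, edges_append, List.length_cons, pow_succ]
    simpa [edges_cons, edges_nil] using h4

theorem word_reverse : word K (reverse c M a h) =
    (-1 : K) ^ (M.length + 1) • antipode (word K ((c, a, h) :: M)) := by
  induction M generalizing a h with
  | nil =>
    simp [reverse, word, antipode_of_mem_lie h.lw_mem_lie]
  | cons q M ih =>
    obtain ⟨c', a', h'⟩ := q
    rw [reverse, word_append, ih, word_cons, word_cons c a h, word_cons c' a' h']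
    simp only [word, List.map_cons, List.map_nil, List.prod_cons, List.prod_nil, mul_one]
    rw [antipode_mul _ (h'.lw K * _), antipode_of_mem_lie h.lw_mem_lie, List.length_cons,
      smul_mul_assoc, mul_neg, smul_neg, pow_succ _ (M.length + 1), mul_neg_one, neg_smul,
      neg_neg]

theorem value_reverse : value K (reverse c M a h) = value K ((c, a, h) :: M) := by
  rw [value, value, signRel_reverse.sgn_eq, word_reverse, map_smul, dihedralSum_antipode, smul_neg,
    smul_neg, smul_smul, ← neg_smul]
  congr 1
  push_cast
  rw [pow_succ]
  have : ((-1 : K) ^ M.length) * (-1) ^ M.length = 1 := by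
    rw [← mul_pow]; simp
  linear_combination ((sgn (edges ((c, a, h) :: M)) : ℤ) : K) * this

theorem exists_reverse_eq : ∃ a' h' M', reverse c M a h = (c, a', h') :: M' := by
  induction M generalizing a h with
  | nil => exact ⟨a, h, [], rfl⟩
  | cons q M ih =>
    obtain ⟨c', a', h'⟩ := q
    obtain ⟨b, k, N, hN⟩ := ih (a := a') (h := h')
    exact ⟨b, k, N ++ [(c', a, h)], by rw [reverse, hN]; rfl⟩

theorem _root_.KRV.LTree.Reads.exists_root_eq {P : LTree n v e} (hP : P.Reads Γ y) {f : Fin e}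
    (hf : f ∈ P.edges) : ∃ (Q : LTree n v e) (x : Vertex n v), Q.Reads Γ x ∧ Q.root = f := by
  induction P generalizing y with
  | leaf r j => exact ⟨_, _, hP, (List.mem_singleton.1 hf).symm⟩
  | node r a s t hs ht =>
    rw [LTree.edges_node, List.mem_cons, List.mem_append] at hf
    rcases hf with rfl | hf | hf
    · exact ⟨_, _, hP, rfl⟩
    · exact hs hP.2.2.2.1 hf
    · exact ht hP.2.2.2.2 hf

/-- The value of a loop depends only on the graph. -/
theorem LoopAt.value_eq {L' : HairyChain n v e} {y' : Vertex n v} (hL : LoopAt Γ y L)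
    (hL' : LoopAt Γ y' L') (hΓ : ∀ f, ¬ (Γ f).IsDiag) : value K L = value K L' := by
  have same : ∀ {c a h h' M M'} {y y' : Vertex n v}, LoopAt Γ y ((c, a, h) :: M) →
      LoopAt Γ y' ((c, a, h') :: M') → value K ((c, a, h) :: M) = value K ((c, a, h') :: M') := by
    intro c a h h' M M' y y' h1 h2
    obtain ⟨ε, e1, e2, e3⟩ := unique_of_start (K := K) (A := []) (A' := []) h1 h2 hΓ rfl
    rw [value, value, e3.sgn_eq, e2, map_smul, smul_smul]
    congr 1
    have : (ε : K) * ε = 1 := by rw [← Int.cast_mul, e1, Int.cast_one]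
    push_cast
    linear_combination ((sgn (edges ((c, a, h') :: M')) : ℤ) : K) * this
  cases L' with
  | nil =>
    cases L with
    | nil => rfl
    | cons q L => exact absurd (hL'.mem_edges q.1) (by simp [edges])
  | cons q' M' =>
    obtain ⟨c', a', h'⟩ := q'
    have hc : c' ∈ L.map Prod.fst := by
      have := hL.mem_edges c'
      obtain ⟨⟨c, a, h⟩, hq, h1⟩ := List.mem_flatMap.1 this
      rcases List.mem_cons.1 h1 with rfl | h1
      · exact List.mem_map_of_mem hq
      · obtain ⟨A, B, rfl⟩ := List.append_of_mem hq
        obtain ⟨z, hz⟩ := hL.rotate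
        obtain ⟨Q, x, hQ, rfl⟩ := hz.reads_hair.exists_root_eq h1
        exact absurd (by simp) (hL'.root_notMem hΓ hQ)
    obtain ⟨⟨c, a, h⟩, hq, rfl⟩ := List.mem_map.1 hc
    obtain ⟨A, B, rfl⟩ := List.append_of_mem hq
    obtain ⟨z, hz⟩ := hL.rotate
    rw [value_rotate]
    rw [List.cons_append] at hz ⊢
    have h1 := hz.fits.1
    rw [show Γ c = _ from hL'.fits.1, Sym2.eq_iff] at h1
    rcases h1 with h1 | h1
    · obtain rfl := Sum.inr.inj h1.2
      exact same hz hL'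
    · rw [← value_reverse]
      have hz' : LoopAt Γ (.inr a) (reverse c (B ++ A) a h) :=
        hz.of_perm (hz.fits.2.2.reverse hz.fits.2.1 (hz.fits.1.trans Sym2.eq_swap))
          edges_reverse_perm verts_reverse_perm
      obtain ⟨b, k, N, hN⟩ := exists_reverse_eq (c := c) (M := B ++ A) (a := a) (h := h)
      rw [hN] at hz' ⊢
      have h2 := hz'.fits.1
      rw [hL'.fits.1, h1.1] at h2
      obtain rfl := Sum.inr.inj (Sym2.congr_right.1 h2)
      exact same hz' hL'

end HairyChain


namespace Graph

/-! ### The value of a graph with one loop -/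

theorem relabel_symm (Γ : Graph n v e) (σ : Equiv.Perm (Fin e)) (τ : Equiv.Perm (Fin v)) :
    (Γ.relabel σ τ).relabel σ.symm τ.symm = Γ := by
  funext i
  unfold relabel
  rw [Sym2.map_map, Equiv.apply_symm_apply]
  conv_rhs => rw [← id_eq (Γ i), ← Sym2.map_id']
  congr 1
  funext y
  rcases y with y | y <;> simp

open Classical in
/-- The cyclic word of a graph that consists of a loop with hairs; it is zero for other graphs. -/
noncomputable def loopValue (K : Type*) [Field K] (Γ : Graph n v e) : Ass K n :=
  if h : ∃ y L, HairyChain.LoopAt Γ y L then HairyChain.value K h.choose_spec.choose else 0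

variable {Γ : Graph n v e}

theorem _root_.KRV.HairyChain.LoopAt.loopValue {y : Vertex n v} {L : HairyChain n v e}
    (hL : HairyChain.LoopAt Γ y L) (hΓ : ∀ f, ¬ (Γ f).IsDiag) :
    Γ.loopValue K = HairyChain.value K L := by
  have h : ∃ y L, HairyChain.LoopAt Γ y L := ⟨y, L, hL⟩
  rw [Graph.loopValue, dif_pos h]
  exact h.choose_spec.choose_spec.value_eq hL hΓ

theorem loopValue_relabel (hΓ : ∀ f, ¬ (Γ f).IsDiag) (σ : Equiv.Perm (Fin e))
    (τ : Equiv.Perm (Fin v)) :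
    (Γ.relabel σ τ).loopValue K = ((Equiv.Perm.sign σ : ℤ) : K) • Γ.loopValue K := by
  by_cases h : ∃ y L, HairyChain.LoopAt Γ y L
  · obtain ⟨y, L, hL⟩ := h
    rw [(hL.relabel σ τ).loopValue fun f hf => hΓ (σ f)
      ((Sym2.isDiag_map (vertexPerm n τ).injective).1 hf), hL.loopValue hΓ,
      HairyChain.LoopAt.value_relabel hL.mem_edges, Equiv.Perm.sign_symm]
  · have h' : ¬ ∃ y L, HairyChain.LoopAt (Γ.relabel σ τ) y L := by
      rintro ⟨y, L, hL⟩
      have := hL.relabel σ.symm τ.symm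
      rw [relabel_symm] at this
      exact h ⟨_, _, this⟩
    rw [loopValue, dif_neg h', loopValue, dif_neg h, smul_zero]

theorem loopValue_of_not_injective [CharZero K] (hΓ : ∀ f, ¬ (Γ f).IsDiag)
    (h : ¬ Function.Injective Γ) : Γ.loopValue K = 0 := by
  rw [Function.Injective] at h
  push Not at h
  obtain ⟨a, b, hab, hne⟩ := h
  have h2 := loopValue_relabel (K := K) hΓ (Equiv.swap a b) 1
  rw [relabel_swap hab, Equiv.Perm.sign_swap hne] at h2
  exact eq_zero_of_eq_neg (K := K) (by simpa using h2)

theorem split_not_isDiag (hΓ : ∀ f, ¬ (Γ f).IsDiag) (x : Vertex n v) (S : Finset (Fin e))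
    (f : Fin (e + 1)) : ¬ (Γ.split x S f).IsDiag := by
  induction f using Fin.lastCases with
  | last => rw [split_last, Sym2.mk_isDiag_iff]; exact old_ne_new x
  | cast i =>
    have := hΓ i
    rw [split_castSucc]
    generalize Γ i = p at this
    induction p using Sym2.ind with
    | h y z =>
      rw [Sym2.mk_isDiag_iff] at this
      rw [Sym2.map_mk, Sym2.mk_isDiag_iff]
      split_ifs with h1 h2 h2
      · exact absurd (h1.2.trans h2.2.symm) this
      · exact (old_ne_new z).symm
      · exact old_ne_new y
      · exact fun h => this (old_injective h)

/-- Exchanging the two vertices that arise from an internal vertex. -/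
theorem split_compl (Γ : Graph n v e) (a : Fin v) (S : Finset (Fin e)) :
    (Γ.split (.inr a) S).relabel 1 (Equiv.swap a.castSucc (Fin.last v)) =
      Γ.split (.inr a) (Γ.incident (.inr a) \ S) := by
  have h1 : vertexPerm n (Equiv.swap a.castSucc (Fin.last v)) (old (.inr a)) = new n v := by
    simp [vertexPerm, old, new]
  have h2 : vertexPerm n (Equiv.swap a.castSucc (Fin.last v)) (new n v) = old (.inr a) := by
    simp [vertexPerm, old, new]
  have h3 : ∀ y : Vertex n v, y ≠ .inr a →
      vertexPerm n (Equiv.swap a.castSucc (Fin.last v)) (old y) = old y := by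
    rintro (j | b) hb
    · rfl
    · simp only [vertexPerm, old, Equiv.sumCongr_apply, Sum.map_inr]
      rw [Equiv.swap_apply_of_ne_of_ne]
      · simpa using fun h => hb (congrArg Sum.inr h)
      · exact (Fin.castSucc_lt_last _).ne
  funext f
  change Sym2.map (vertexPerm n _) (Γ.split (.inr a) S f) = _
  induction f using Fin.lastCases with
  | last => rw [split_last, split_last, Sym2.map_mk, h1, h2, Sym2.eq_swap]
  | cast i =>
    rw [split_castSucc, split_castSucc, Sym2.map_map]
    refine Sym2.map_congr fun y hy => ?_
    simp only [Function.comp_apply, Finset.mem_sdiff, mem_incident]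
    by_cases hya : y = .inr a
    · subst hya
      by_cases hi : i ∈ S
      · simp [hi, h2]
      · simp [hi, hy, h1]
    · simp [hya, h3]

theorem split_castSucc_of_notMem {x : Vertex n v} {S : Finset (Fin e)} {i : Fin e} (hi : i ∉ S) :
    Γ.split x S i.castSucc = (Γ i).map old := by
  rw [split_castSucc]
  simp [hi]

theorem split_castSucc_of_mem {x y : Vertex n v} {S : Finset (Fin e)} {i : Fin e} (hi : i ∈ S)
    (h : Γ i = s(x, y)) (hy : y ≠ x) : Γ.split x S i.castSucc = s(new n v, old y) := by
  rw [split_castSucc, h, Sym2.map_mk]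
  simp [hi, hy]

end Graph

open KRV.Graph

/-- A tree in a graph, as a tree in the graph after a splitting. -/
abbrev LTree.lift (P : LTree n v e) : LTree n (v + 1) (e + 1) := P.map Fin.castSucc Fin.castSucc

/-- A chain in a graph, as a chain in the graph after a splitting. -/
abbrev HairyChain.lift (L : HairyChain n v e) : HairyChain n (v + 1) (e + 1) :=
  L.relabel Fin.castSucc Fin.castSucc

section

variable {Γ : Graph n v e} {x y z : Vertex n v} {U : Finset (Fin e)}

theorem LTree.Fits.lift {P : LTree n v e} (h : P.Fits Γ y) (hU : ∀ f ∈ P.edges, f ∉ U) :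
    P.lift.Fits (Γ.split x U) (old y) :=
  h.map _ _ fun f hf => split_castSucc_of_notMem (hU f hf)

theorem LTree.Fits.lift_new {P : LTree n v e} (h : P.Fits Γ x) (hr : P.root ∈ U) (hx : P.top ≠ x)
    (hU : ∀ f ∈ P.innerEdges, f ∉ U) : P.lift.Fits (Γ.split x U) (new n v) :=
  h.map_root (split_castSucc_of_mem hr h.root_eq hx)
    fun f hf => split_castSucc_of_notMem (hU f hf)

namespace HairyChain

theorem Fits.lift {L : HairyChain n v e} (h : Fits Γ y L z) (hU : ∀ f ∈ edges L, f ∉ U) :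
    Fits (Γ.split x U) (old y) L.lift (old z) :=
  h.relabel _ _ fun f hf => split_castSucc_of_notMem (hU f hf)

theorem Fits.lift_new {c : Fin e} {a : Fin v} {h : LTree n v e} {L : HairyChain n v e}
    (hL : Fits Γ x ((c, a, h) :: L) z) (hc : c ∈ U) (hx : .inr a ≠ x)
    (hU : ∀ f ∈ h.edges ++ edges L, f ∉ U) :
    Fits (Γ.split x U) (new n v) (HairyChain.lift ((c, a, h) :: L)) (old z) :=
  ⟨split_castSucc_of_mem hc hL.1 hx, hL.2.1.lift fun f hf => hU f (by simp [hf]),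
    hL.2.2.lift fun f hf => hU f (by simp [hf])⟩

end HairyChain

theorem LTree.top_ne_of_notMem {P : LTree n v e} {a : Fin v} (h : a ∉ P.verts) :
    P.top ≠ .inr a := by
  cases P with
  | leaf r j => simp [top]
  | node r b s t =>
    intro hab
    obtain rfl : b = a := Sum.inr.inj hab
    exact h (by simp [verts])

end

/-! ### The IHX relation -/

theorem mem_of_map_castSucc {m : ℕ} {E : List (Fin (m + 1))} {E' : List (Fin m)}
    (hE : E.Perm (Fin.last m :: E'.map Fin.castSucc)) (h1 : E'.Nodup) (h2 : ∀ f, f ∈ E') :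
    E.Nodup ∧ ∀ f, f ∈ E := by
  refine ⟨hE.nodup_iff.2 (List.nodup_cons.2 ⟨?_, h1.map (Fin.castSucc_injective m)⟩), fun f => ?_⟩
  · simp [(Fin.castSucc_lt_last _).ne]
  · rw [hE.mem_iff]
    induction f using Fin.lastCases with
    | last => simp
    | cast i => simp [h2]

/-- Inverse of `Fin.castSucc`, which sends the last element to `a`. -/
def contract {m : ℕ} (a : Fin m) : Fin (m + 1) → Fin m := Fin.lastCases a id

theorem contract_castSucc {m : ℕ} (a i : Fin m) : contract a i.castSucc = i := by simp [contract]

theorem contract_last {m : ℕ} (a : Fin m) : contract a (Fin.last m) = a := by simp [contract]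

theorem nodup_map_contract {m : ℕ} (a : Fin m) {E : List (Fin (m + 1))}
    (h1 : (Fin.last m :: E).Nodup) (h2 : ∀ f, f ∈ Fin.last m :: E) :
    (E.map (contract a)).Nodup ∧ ∀ f, f ∈ E.map (contract a) := by
  rw [List.nodup_cons] at h1
  constructor
  · refine List.Nodup.map_on (fun f hf g hg hfg => ?_) h1.2
    induction f using Fin.lastCases with
    | last => exact absurd hf h1.1
    | cast i =>
      induction g using Fin.lastCases with
      | last => exact absurd hg h1.1
      | cast j => rwa [contract_castSucc, contract_castSucc, ← Fin.castSucc_inj] at hfg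
  · intro f
    have := h2 f.castSucc
    rw [List.mem_cons] at this
    exact List.mem_map.2 ⟨f.castSucc, this.resolve_left (Fin.castSucc_lt_last _).ne,
      contract_castSucc a f⟩

/-- A splitting is undone by contracting the new edge. -/
theorem split_contract (Γ : Graph n v e) (a : Fin v) (U : Finset (Fin e)) (c : Fin e)
    {f : Fin (e + 1)} (hf : f ≠ Fin.last e) :
    Γ (contract c f) = (Γ.split (.inr a) U f).map (Sum.map id (contract a)) := by
  induction f using Fin.lastCases with
  | last => exact absurd rfl hf
  | cast i =>
    rw [contract_castSucc, split_castSucc, Sym2.map_map]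
    conv_lhs => rw [← id_eq (Γ i), ← Sym2.map_id']
    refine Sym2.map_congr fun y _ => ?_
    simp only [Function.comp_apply]
    split_ifs with h
    · rw [h.2]; simp [new, contract_last]
    · rcases y with j | b <;> simp [old, contract_castSucc]

/-- A loop with hairs, except that the vertex `a` on the loop has two hairs `S` and `T`. -/
structure QuadLoop (Γ : Graph n v e) (y : Vertex n v) (c : Fin e) (a : Fin v) (S T : LTree n v e)
    (B : HairyChain n v e) : Prop where
  edge_eq : Γ c = s(y, .inr a)
  fits_left : S.Fits Γ (.inr a)
  fits_right : T.Fits Γ (.inr a)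
  fits : HairyChain.Fits Γ (.inr a) B y
  edges_nodup : (c :: (S.edges ++ (T.edges ++ B.edges))).Nodup
  mem_edges : ∀ f, f ∈ c :: (S.edges ++ (T.edges ++ B.edges))
  verts_nodup : (a :: (S.verts ++ (T.verts ++ B.verts))).Nodup
  mem_verts : ∀ b, b ∈ a :: (S.verts ++ (T.verts ++ B.verts))

namespace QuadLoop

open HairyChain

variable {Γ : Graph n v e} {y : Vertex n v} {c : Fin e} {a : Fin v} {S T : LTree n v e}
  {B : HairyChain n v e}

theorem swap (h : QuadLoop Γ y c a S T B) : QuadLoop Γ y c a T S B := by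
  have h1 : (c :: (T.edges ++ (S.edges ++ B.edges))).Perm
      (c :: (S.edges ++ (T.edges ++ B.edges))) := by
    rw [← List.append_assoc, ← List.append_assoc S.edges]
    exact (List.perm_append_comm.append_right _).cons c
  have h2 : (a :: (T.verts ++ (S.verts ++ B.verts))).Perm
      (a :: (S.verts ++ (T.verts ++ B.verts))) := by
    rw [← List.append_assoc, ← List.append_assoc S.verts]
    exact (List.perm_append_comm.append_right _).cons a
  exact ⟨h.edge_eq, h.fits_right, h.fits_left, h.fits, h1.nodup_iff.2 h.edges_nodup,
    fun f => h1.mem_iff.2 (h.mem_edges f), h2.nodup_iff.2 h.verts_nodup,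
    fun b => h2.mem_iff.2 (h.mem_verts b)⟩

/-- Both hairs are moved to the new vertex. -/
theorem loopAt_node (h : QuadLoop Γ y c a S T B) :
    LoopAt (Γ.split (.inr a) {S.root, T.root}) (old y)
      ((c.castSucc, a.castSucc, .node (Fin.last e) (Fin.last v) S.lift T.lift) :: B.lift) := by
  have he := h.edges_nodup
  have hv := h.verts_nodup
  rw [LTree.edges_eq S, LTree.edges_eq T] at he
  simp only [List.nodup_cons, List.nodup_append, List.mem_append, List.mem_cons, not_or,
    List.cons_append] at he hv
  obtain ⟨E1, E2⟩ := mem_of_map_castSucc (E := HairyChain.edges ((c.castSucc, a.castSucc,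
    LTree.node (Fin.last e) (Fin.last v) S.lift T.lift) :: B.lift)) (by
      rw [edges_cons, LTree.edges_node, LTree.edges_map, LTree.edges_map, edges_relabel]
      simpa using List.Perm.swap _ _ _) h.edges_nodup h.mem_edges
  obtain ⟨V1, V2⟩ := mem_of_map_castSucc (E := HairyChain.verts ((c.castSucc, a.castSucc,
    LTree.node (Fin.last e) (Fin.last v) S.lift T.lift) :: B.lift)) (by
      rw [verts_cons, LTree.verts, LTree.verts_map, LTree.verts_map, verts_relabel]
      simpa using List.Perm.swap _ _ _) h.verts_nodup h.mem_verts
  refine ⟨⟨?_, ⟨split_last _ _ _, ?_, ?_⟩, ?_⟩, E1, E2, V1, V2⟩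
  · rw [split_castSucc_of_notMem, h.edge_eq]; · rfl
    grind
  · exact h.fits_left.lift_new (by simp) (LTree.top_ne_of_notMem (by tauto)) (by grind)
  · exact h.fits_right.lift_new (by simp) (LTree.top_ne_of_notMem (by tauto)) (by grind)
  · exact h.fits.lift (by grind)

/-- One hair and the rest of the loop are moved to the new vertex. -/
theorem loopAt_cons {d : Fin e} {b : Fin v} {A : LTree n v e}
    (h : QuadLoop Γ y c a S T ((d, b, A) :: B)) :
    LoopAt (Γ.split (.inr a) {T.root, d}) (old y)
      ((c.castSucc, a.castSucc, S.lift) :: (Fin.last e, Fin.last v, T.lift) ::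
        HairyChain.lift ((d, b, A) :: B)) := by
  have he := h.edges_nodup
  have hv := h.verts_nodup
  rw [LTree.edges_eq S, LTree.edges_eq T, edges_cons] at he
  rw [verts_cons] at hv
  simp only [List.nodup_cons, List.nodup_append, List.mem_append, List.mem_cons, not_or,
    List.cons_append] at he hv
  obtain ⟨E1, E2⟩ := mem_of_map_castSucc (E := HairyChain.edges ((c.castSucc, a.castSucc,
    S.lift) :: (Fin.last e, Fin.last v, T.lift) :: HairyChain.lift ((d, b, A) :: B))) (by
      rw [edges_cons, edges_cons, LTree.edges_map, LTree.edges_map, edges_relabel]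
      have := List.perm_middle (a := Fin.last e) (l₁ := c.castSucc :: S.edges.map Fin.castSucc)
        (l₂ := T.edges.map Fin.castSucc ++ (edges ((d, b, A) :: B)).map Fin.castSucc)
      simpa using this) h.edges_nodup h.mem_edges
  obtain ⟨V1, V2⟩ := mem_of_map_castSucc (E := HairyChain.verts ((c.castSucc, a.castSucc,
    S.lift) :: (Fin.last e, Fin.last v, T.lift) :: HairyChain.lift ((d, b, A) :: B))) (by
      rw [verts_cons, verts_cons, LTree.verts_map, LTree.verts_map, verts_relabel]
      have := List.perm_middle (a := Fin.last v) (l₁ := a.castSucc :: S.verts.map Fin.castSucc)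
        (l₂ := T.verts.map Fin.castSucc ++ (verts ((d, b, A) :: B)).map Fin.castSucc)
      simpa using this) h.verts_nodup h.mem_verts
  refine ⟨⟨?_, ?_, split_last _ _ _, ?_, ?_⟩, E1, E2, V1, V2⟩
  · rw [split_castSucc_of_notMem, h.edge_eq]; · rfl
    grind
  · exact h.fits_left.lift (by rw [LTree.edges_eq]; grind)
  · exact h.fits_right.lift_new (by simp) (LTree.top_ne_of_notMem (by tauto)) (by grind)
  · exact h.fits.lift_new (by simp) (by grind) (by grind)

end QuadLoop

/-- A tree at the end of a chain, as a tree. -/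
def HairyChain.plug : HairyChain n v e → LTree n v e → LTree n v e
  | [], Q => Q
  | (r, a, h) :: C, Q => .node r a (plug C Q) h

/-- A loop with hairs, except that the vertex `b` in one of the hairs has valence `4`: it is the
end of the chain `C` followed by the edge `p`, and there are trees `S`, `T` and `A` attached to it. -/
structure QuadHair (Γ : Graph n v e) (y z : Vertex n v) (c : Fin e) (a : Fin v)
    (C : HairyChain n v e) (p : Fin e) (b : Fin v) (S T A : LTree n v e) (B : HairyChain n v e) :
    Prop where
  edge_eq : Γ c = s(y, .inr a)
  fits_chain : HairyChain.Fits Γ (.inr a) C z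
  edge_eq' : Γ p = s(z, .inr b)
  fits₁ : S.Fits Γ (.inr b)
  fits₂ : T.Fits Γ (.inr b)
  fits₃ : A.Fits Γ (.inr b)
  fits : HairyChain.Fits Γ (.inr a) B y
  edges_nodup : (p :: (S.edges ++ (T.edges ++ (A.edges ++ (c :: (C.edges ++ B.edges)))))).Nodup
  mem_edges : ∀ f, f ∈ p :: (S.edges ++ (T.edges ++ (A.edges ++ (c :: (C.edges ++ B.edges)))))
  verts_nodup : (b :: (S.verts ++ (T.verts ++ (A.verts ++ (a :: (C.verts ++ B.verts)))))).Nodup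
  mem_verts : ∀ k, k ∈ b :: (S.verts ++ (T.verts ++ (A.verts ++ (a :: (C.verts ++ B.verts)))))

namespace HairyChain

variable {Γ : Graph n v e} {y z : Vertex n v} {Q : LTree n v e} {C : HairyChain n v e}

theorem fits_plug (hC : Fits Γ y C z) (hQ : Q.Fits Γ z) : (plug C Q).Fits Γ y := by
  induction C generalizing y with
  | nil => rwa [show y = z from hC]
  | cons q C ih =>
    obtain ⟨r, a, h⟩ := q
    exact ⟨hC.1, ih hC.2.2, hC.2.1⟩

theorem edges_plug_perm : (plug C Q).edges.Perm (Q.edges ++ edges C) := by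
  induction C with
  | nil => simp [plug, edges]
  | cons q C ih =>
    obtain ⟨r, a, h⟩ := q
    rw [plug, LTree.edges_node, edges_cons]
    refine ((ih.append_right _).cons r).trans ?_
    rw [List.perm_iff_count]
    intro f
    simp only [List.count_append, List.count_cons]
    omega

theorem verts_plug_perm : (plug C Q).verts.Perm (Q.verts ++ verts C) := by
  induction C with
  | nil => simp [plug, verts]
  | cons q C ih =>
    obtain ⟨r, a, h⟩ := q
    rw [plug, LTree.verts, verts_cons]
    refine ((ih.append_right _).cons a).trans ?_
    rw [List.perm_iff_count]
    intro f
    simp only [List.count_append, List.count_cons]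
    omega

theorem signRel_plug {Q' : LTree n v e} (h : SignRel 1 Q'.edges Q.edges) :
    SignRel 1 (plug C Q').edges (plug C Q).edges := by
  induction C with
  | nil => exact h
  | cons q C ih =>
    obtain ⟨r, a, h'⟩ := q
    exact (ih.append (SignRel.refl h'.edges)).cons r

/-- The Lie word of `plug C Q` as a function of the Lie word of `Q`. -/
def plugLie (K : Type*) [Field K] : HairyChain n v e → Ass K n →ₗ[K] Ass K n
  | [] => LinearMap.id
  | (_, _, h) :: C => -(LieAlgebra.ad K (Ass K n) (h.lw K)) ∘ₗ plugLie K C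

theorem lw_plug : (plug C Q).lw K = plugLie K C (Q.lw K) := by
  induction C with
  | nil => rfl
  | cons q C ih =>
    obtain ⟨r, a, h⟩ := q
    rw [plug, LTree.lw, ih, plugLie]
    simp

end HairyChain

namespace QuadHair

open HairyChain

variable {Γ : Graph n v e} {y z : Vertex n v} {c p : Fin e} {a b : Fin v} {S T A : LTree n v e}
  {B C : HairyChain n v e}

theorem rotate (h : QuadHair Γ y z c a C p b S T A B) : QuadHair Γ y z c a C p b T A S B := by
  have h1 : (p :: (T.edges ++ (A.edges ++ (S.edges ++ (c :: (C.edges ++ B.edges)))))).Perm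
      (p :: (S.edges ++ (T.edges ++ (A.edges ++ (c :: (C.edges ++ B.edges)))))) := by
    rw [List.perm_iff_count]; intro f; simp only [List.count_append, List.count_cons]; omega
  have h2 : (b :: (T.verts ++ (A.verts ++ (S.verts ++ (a :: (C.verts ++ B.verts)))))).Perm
      (b :: (S.verts ++ (T.verts ++ (A.verts ++ (a :: (C.verts ++ B.verts)))))) := by
    rw [List.perm_iff_count]; intro f; simp only [List.count_append, List.count_cons]; omega
  exact ⟨h.edge_eq, h.fits_chain, h.edge_eq', h.fits₂, h.fits₃, h.fits₁, h.fits,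
    h1.nodup_iff.2 h.edges_nodup, fun f => h1.mem_iff.2 (h.mem_edges f),
    h2.nodup_iff.2 h.verts_nodup, fun b => h2.mem_iff.2 (h.mem_verts b)⟩

/-- The trees `S` and `T` are moved to the new vertex. -/
theorem loopAt (h : QuadHair Γ y z c a C p b S T A B) :
    LoopAt (Γ.split (.inr b) {S.root, T.root}) (old y)
      ((c.castSucc, a.castSucc, plug C.lift (.node p.castSucc b.castSucc
        (.node (Fin.last e) (Fin.last v) S.lift T.lift) A.lift)) :: B.lift) := by
  have he := h.edges_nodup
  have hv := h.verts_nodup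
  rw [LTree.edges_eq S, LTree.edges_eq T] at he
  simp only [List.nodup_cons, List.nodup_append, List.mem_append, List.mem_cons, not_or,
    List.cons_append] at he hv
  obtain ⟨E1, E2⟩ := mem_of_map_castSucc (E := HairyChain.edges ((c.castSucc, a.castSucc,
    plug C.lift (.node p.castSucc b.castSucc (.node (Fin.last e) (Fin.last v) S.lift T.lift)
      A.lift)) :: B.lift)) (by
      rw [edges_cons]
      refine ((edges_plug_perm.append_right _).cons _).trans ?_
      rw [LTree.edges_node, LTree.edges_node, LTree.edges_map, LTree.edges_map, LTree.edges_map,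
        edges_relabel, edges_relabel, List.perm_iff_count]
      intro f
      simp only [List.map_cons, List.map_append, List.count_append, List.count_cons]
      omega) h.edges_nodup h.mem_edges
  obtain ⟨V1, V2⟩ := mem_of_map_castSucc (E := HairyChain.verts ((c.castSucc, a.castSucc,
    plug C.lift (.node p.castSucc b.castSucc (.node (Fin.last e) (Fin.last v) S.lift T.lift)
      A.lift)) :: B.lift)) (by
      rw [verts_cons]
      refine ((verts_plug_perm.append_right _).cons _).trans ?_
      rw [LTree.verts, LTree.verts, LTree.verts_map, LTree.verts_map, LTree.verts_map,
        verts_relabel, verts_relabel, List.perm_iff_count]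
      intro f
      simp only [List.map_cons, List.map_append, List.count_append, List.count_cons]
      omega) h.verts_nodup h.mem_verts
  refine ⟨⟨?_, fits_plug (z := old z) (h.fits_chain.lift ?_)
    ⟨?_, ⟨split_last _ _ _, ?_, ?_⟩, ?_⟩, h.fits.lift ?_⟩, E1, E2, V1, V2⟩
  · rw [split_castSucc_of_notMem, h.edge_eq]; · rfl
    grind
  · grind
  · rw [split_castSucc_of_notMem, h.edge_eq']; · rfl
    grind
  · exact h.fits₁.lift_new (by simp) (LTree.top_ne_of_notMem (by tauto)) (by grind)
  · exact h.fits₂.lift_new (by simp) (LTree.top_ne_of_notMem (by tauto)) (by grind)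
  · exact h.fits₃.lift (by grind)
  · grind

end QuadHair

theorem sum_powerset_card_two {M : Type*} [AddCommMonoid M] {p q r s : Fin e} (h1 : p ≠ q)
    (h2 : p ≠ r) (h3 : p ≠ s) (h4 : q ≠ r) (h5 : q ≠ s) (h6 : r ≠ s)
    (F : Finset (Fin e) → M) :
    ∑ U ∈ ({p, q, r, s} : Finset (Fin e)).powerset with U.card = 2, F U =
      (F {p, q} + F {p, r} + F {p, s}) + (F {r, s} + F {q, s} + F {q, r}) := by
  have hs : ({s} : Finset (Fin e)).powerset = {∅, {s}} := by
    ext t; simp [Finset.subset_singleton_iff]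
  rw [Finset.sum_filter]
  simp [Finset.sum_powerset_insert, Finset.card_insert_of_notMem, *]
  abel

theorem sum_powerset_card_two_of_compl {M : Type*} [AddCommMonoid M] {p q r s : Fin e} (h1 : p ≠ q)
    (h2 : p ≠ r) (h3 : p ≠ s) (h4 : q ≠ r) (h5 : q ≠ s) (h6 : r ≠ s) {I : Finset (Fin e)}
    (hI : I = {p, q, r, s}) {F : Finset (Fin e) → M} (hF : ∀ U ⊆ I, F (I \ U) = F U) :
    ∑ U ∈ I.powerset with U.card = 2, F U = 2 • (F {q, r} + F {r, s} + F {q, s}) := by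
  have e1 : I \ {p, q} = {r, s} := by subst hI; ext f; simp; grind
  have e2 : I \ {p, r} = {q, s} := by subst hI; ext f; simp; grind
  have e3 : I \ {p, s} = {q, r} := by subst hI; ext f; simp; grind
  subst hI
  rw [sum_powerset_card_two h1 h2 h3 h4 h5 h6, ← hF {p, q} (by grind), ← hF {p, r} (by grind),
    ← hF {p, s} (by grind), e1, e2, e3, two_nsmul]
  abel

section

variable {M : Type*} [AddCommGroup M] [Module K M] (Φ : Ass K n →ₗ[K] M)

namespace HairyChain

/-- The Jacobi identity at the root of a hair: the two vertices on the loop in either order, with `Φ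
(⁅s, t⁆ w) = Φ (s t w) - Φ (t s w)`. -/
theorem ihx_loop (c f : Fin e) (a a' b b' : Fin v) (S T : LTree n v e) (L : HairyChain n v e) :
    ((sgn (edges ((c, a, .node f b S T) :: L)) : ℤ) : K) •
      Φ (word K ((c, a, .node f b S T) :: L)) +
    ((sgn (edges ((c, a, S) :: (f, b', T) :: L)) : ℤ) : K) • Φ (word K ((c, a, S) :: (f, b', T) :: L)) +
    ((sgn (edges ((c, a', T) :: (f, b', S) :: L)) : ℤ) : K) •
      Φ (word K ((c, a', T) :: (f, b', S) :: L)) = 0 := by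
  have key : ∀ P : LTree n v e, SignRel (-1) (P.edges ++ [f]) (f :: P.edges) := fun P =>
    signRel_swap_of_odd P.odd_edges odd_one
  have h1 : sgn (edges ((c, a, S) :: (f, b', T) :: L)) =
      -sgn (edges ((c, a, .node f b S T) :: L)) := by
    have := (((key S).append (SignRel.refl (T.edges ++ edges L))).cons c).sgn_eq
    simpa [edges_cons, LTree.edges_node] using this
  have h2 : sgn (edges ((c, a', T) :: (f, b', S) :: L)) =
      sgn (edges ((c, a, .node f b S T) :: L)) := by
    have h3 := (((key T).append (SignRel.refl (S.edges ++ edges L))).cons c).sgn_eq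
    have h4 := (((signRel_swap_of_odd T.odd_edges S.odd_edges).append
      (SignRel.refl (edges L))).cons f |>.cons c).sgn_eq
    simp only [edges_cons, LTree.edges_node, List.append_assoc, List.cons_append, List.nil_append,
      mul_one] at h3 h4 ⊢
    rw [h3, h4]; ring
  rw [h1, h2]
  simp only [word_cons, LTree.lw, LieRing.of_associative_ring_bracket, sub_mul, mul_assoc, map_sub]
  push_cast
  module

/-- The Jacobi identity inside a hair. -/
theorem ihx_hair (c p f : Fin e) (a b k : Fin v) (S T A : LTree n v e)
    (C L : HairyChain n v e) :
    ((sgn (edges ((c, a, plug C (.node p b (.node f k S T) A)) :: L)) : ℤ) : K) •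
      Φ (word K ((c, a, plug C (.node p b (.node f k S T) A)) :: L)) +
    ((sgn (edges ((c, a, plug C (.node p b (.node f k T A) S)) :: L)) : ℤ) : K) •
      Φ (word K ((c, a, plug C (.node p b (.node f k T A) S)) :: L)) +
    ((sgn (edges ((c, a, plug C (.node p b (.node f k A S) T)) :: L)) : ℤ) : K) •
      Φ (word K ((c, a, plug C (.node p b (.node f k A S) T)) :: L)) = 0 := by
  have h1 : ∀ S T A : LTree n v e,
      sgn (edges ((c, a, plug C (.node p b (.node f k T A) S)) :: L)) =
        sgn (edges ((c, a, plug C (.node p b (.node f k S T) A)) :: L)) := by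
    intro S T A
    have h2 := (signRel_swap_of_even (L := T.edges ++ A.edges) (M := S.edges) (by
      rw [List.length_append]; exact (T.odd_edges.add_odd A.odd_edges).mul_right _)).cons f |>.cons p
    have h3 : SignRel 1 (LTree.node p b (.node f k T A) S).edges
        (LTree.node p b (.node f k S T) A).edges := by
      simpa [LTree.edges_node] using h2
    have h4 := (((signRel_plug (C := C) h3).append (SignRel.refl (edges L))).cons c).sgn_eq
    simpa [edges_cons] using h4
  rw [h1 S T A, h1 T A S |>.trans (h1 S T A), ← smul_add, ← smul_add, ← map_add, ← map_add]
  simp only [word_cons, lw_plug, ← add_mul, ← map_add, LTree.lw]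
  have h6 : ⁅⁅S.lw K, T.lw K⁆, A.lw K⁆ + ⁅⁅T.lw K, A.lw K⁆, S.lw K⁆ + ⁅⁅A.lw K, S.lw K⁆, T.lw K⁆ =
      0 := by
    simp only [LieRing.of_associative_ring_bracket]
    noncomm_ring
  rw [h6, map_zero, zero_mul, map_zero, smul_zero]

end HairyChain

end

namespace QuadLoop

open HairyChain

variable {Γ : Graph n v e} {y : Vertex n v} {c d : Fin e} {a b : Fin v} {S T A : LTree n v e}
  {B : HairyChain n v e}

theorem incident_eq (h : QuadLoop Γ y c a S T ((d, b, A) :: B)) :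
    Γ.incident (.inr a) = {c, S.root, T.root, d} := by
  have hv := h.verts_nodup
  simp only [List.nodup_cons, List.mem_append, not_or] at hv
  ext f
  simp only [mem_incident, Finset.mem_insert, Finset.mem_singleton]
  constructor
  · intro hf
    have := h.mem_edges f
    simp only [List.mem_cons, List.mem_append] at this
    rcases this with h1 | h1 | h1 | h1
    · exact Or.inl h1
    · exact Or.inr (Or.inl (h.fits_left.eq_root hv.1.1 h1 hf).1)
    · exact Or.inr (Or.inr (Or.inl (h.fits_right.eq_root hv.1.2.1 h1 hf).1))
    · exact Or.inr (Or.inr (Or.inr (h.fits.eq_next hv.1.2.2 h1 hf c).1))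
  · rintro (rfl | rfl | rfl | rfl)
    · rw [h.edge_eq]; simp
    · rw [h.fits_left.root_eq]; simp
    · rw [h.fits_right.root_eq]; simp
    · rw [h.fits.1]; simp

theorem sum_eq {M : Type*} [AddCommMonoid M] (h : QuadLoop Γ y c a S T ((d, b, A) :: B))
    {F : Finset (Fin e) → M}
    (hF : ∀ U ⊆ Γ.incident (.inr a), F (Γ.incident (.inr a) \ U) = F U) :
    ∑ U ∈ (Γ.incident (.inr a)).powerset with U.card = 2, F U =
      2 • (F {S.root, T.root} + F {T.root, d} + F {S.root, d}) := by
  have he := h.edges_nodup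
  rw [LTree.edges_eq S, LTree.edges_eq T, edges_cons] at he
  simp only [List.nodup_cons, List.nodup_append, List.mem_append, List.mem_cons, not_or,
    List.cons_append] at he
  exact sum_powerset_card_two_of_compl (by grind) (by grind) (by grind) (by grind) (by grind)
    (by grind) h.incident_eq hF

end QuadLoop

namespace QuadHair

open HairyChain

variable {Γ : Graph n v e} {y z : Vertex n v} {c p : Fin e} {a b : Fin v} {S T A : LTree n v e}
  {B C : HairyChain n v e}

theorem incident_eq (h : QuadHair Γ y z c a C p b S T A B) :
    Γ.incident (.inr b) = {p, S.root, T.root, A.root} := by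
  have hv := h.verts_nodup
  simp only [List.nodup_cons, List.mem_append, List.mem_cons, not_or] at hv
  obtain ⟨⟨hS, hT, hA, hba, hC, hB⟩, -⟩ := hv
  have hab : (.inr a : Vertex n v) ≠ .inr b := fun h => hba (Sum.inr.inj h).symm
  ext f
  simp only [mem_incident, Finset.mem_insert, Finset.mem_singleton]
  constructor
  · intro hf
    have := h.mem_edges f
    simp only [List.mem_cons, List.mem_append] at this
    rcases this with h1 | h1 | h1 | h1 | rfl | h1 | h1
    · exact Or.inl h1
    · exact Or.inr (Or.inl (h.fits₁.eq_root hS h1 hf).1)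
    · exact Or.inr (Or.inr (Or.inl (h.fits₂.eq_root hT h1 hf).1))
    · exact Or.inr (Or.inr (Or.inr (h.fits₃.eq_root hA h1 hf).1))
    · rw [h.edge_eq, Sym2.mem_iff] at hf
      rcases hf with rfl | hf
      · exact absurd (h.fits.eq_start hB) hab
      · exact absurd hf.symm hab
    · exact absurd (h.fits_chain.eq_next hC h1 hf f).2 hab
    · exact absurd (h.fits.eq_next hB h1 hf f).2 hab
  · rintro (rfl | rfl | rfl | rfl)
    · rw [h.edge_eq']; simp
    · rw [h.fits₁.root_eq]; simp
    · rw [h.fits₂.root_eq]; simp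
    · rw [h.fits₃.root_eq]; simp

theorem sum_eq {M : Type*} [AddCommMonoid M] (h : QuadHair Γ y z c a C p b S T A B)
    {F : Finset (Fin e) → M}
    (hF : ∀ U ⊆ Γ.incident (.inr b), F (Γ.incident (.inr b) \ U) = F U) :
    ∑ U ∈ (Γ.incident (.inr b)).powerset with U.card = 2, F U =
      2 • (F {S.root, T.root} + F {T.root, A.root} + F {A.root, S.root}) := by
  have he := h.edges_nodup
  rw [LTree.edges_eq S, LTree.edges_eq T, LTree.edges_eq A] at he
  simp only [List.nodup_cons, List.nodup_append, List.mem_append, List.mem_cons, not_or,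
    List.cons_append] at he
  rw [Finset.pair_comm A.root]
  exact sum_powerset_card_two_of_compl (by grind) (by grind) (by grind) (by grind) (by grind)
    (by grind) h.incident_eq hF

end QuadHair

namespace Graph

variable {Γ : Graph n v e}

theorem loopValue_split_compl (hΓ : ∀ f, ¬ (Γ f).IsDiag) (a : Fin v) (U : Finset (Fin e)) :
    (Γ.split (.inr a) (Γ.incident (.inr a) \ U)).loopValue K =
      (Γ.split (.inr a) U).loopValue K := by
  rw [← split_compl Γ a U, loopValue_relabel (split_not_isDiag hΓ _ _), Equiv.Perm.sign_one]
  simp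

theorem cls_split_compl (a : Fin v) (U : Finset (Fin e)) :
    cls K (Γ.split (.inr a) (Γ.incident (.inr a) \ U)) =
      cls K (Γ.split (.inr a) U) := by
  rw [← split_compl Γ a U, cls_relabel, Equiv.Perm.sign_one]
  simp

end Graph

/-- The three resolutions of a vertex of valence `4` on the loop, each of which arises from two
complementary sets of edges. -/
theorem QuadLoop.sum_loopValue {Γ : Graph n v e} (hΓ : ∀ f, ¬ (Γ f).IsDiag) {y : Vertex n v}
    {c : Fin e} {a : Fin v} {S T : LTree n v e} {B : HairyChain n v e}
    (h : QuadLoop Γ y c a S T B) :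
    ∑ U ∈ (Γ.incident (.inr a)).powerset with U.card = 2, (Γ.split (.inr a) U).loopValue K = 0 := by
  cases B with
  | nil =>
    refine absurd ?_ (hΓ c)
    rw [h.edge_eq, Sym2.mk_isDiag_iff]
    exact (show _ = y from h.fits).symm
  | cons q B =>
    obtain ⟨d, b, A⟩ := q
    have hd := fun U => split_not_isDiag hΓ (.inr a) U
    rw [h.sum_eq fun U _ => loopValue_split_compl hΓ a U, h.loopAt_node.loopValue (hd _),
      h.loopAt_cons.loopValue (hd _), h.swap.loopAt_cons.loopValue (hd _), HairyChain.value,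
      HairyChain.value, HairyChain.value, HairyChain.ihx_loop, smul_zero]

/-- The three resolutions of a vertex of valence `4` in a hair, each of which arises from two
complementary sets of edges. -/
theorem QuadHair.sum_loopValue {Γ : Graph n v e} (hΓ : ∀ f, ¬ (Γ f).IsDiag) {y z : Vertex n v}
    {c p : Fin e} {a b : Fin v} {S T A : LTree n v e} {B C : HairyChain n v e}
    (h : QuadHair Γ y z c a C p b S T A B) :
    ∑ U ∈ (Γ.incident (.inr b)).powerset with U.card = 2, (Γ.split (.inr b) U).loopValue K = 0 := by
  have hd := fun U => split_not_isDiag hΓ (.inr b) U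
  rw [h.sum_eq fun U _ => loopValue_split_compl hΓ b U, h.loopAt.loopValue (hd _),
    h.rotate.loopAt.loopValue (hd _), h.rotate.rotate.loopAt.loopValue (hd _), HairyChain.value,
    HairyChain.value, HairyChain.value, HairyChain.ihx_hair, smul_zero]

/-! ### Contraction of an edge of a loop with hairs -/

section

variable {Γ : Graph n v e} {a : Fin v} {U : Finset (Fin e)} {y z : Vertex n (v + 1)}

theorem LTree.Fits.contract {P : LTree n (v + 1) (e + 1)} (h : P.Fits (Γ.split (.inr a) U) y)
    (c : Fin e) (hP : Fin.last e ∉ P.edges) :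
    (P.map (contract c) (contract a)).Fits Γ (y.map id (contract a)) :=
  h.map _ _ fun _ hf => split_contract Γ a U c fun h => hP (h ▸ hf)

theorem HairyChain.Fits.contract {L : HairyChain n (v + 1) (e + 1)}
    (h : Fits (Γ.split (.inr a) U) y L z) (c : Fin e) (hL : Fin.last e ∉ L.edges) :
    Fits Γ (y.map id (contract a)) (L.relabel (contract c) (contract a))
      (z.map id (contract a)) :=
  h.relabel _ _ fun _ hf => split_contract Γ a U c fun h => hL (h ▸ hf)

theorem contract_ends {k b : Fin (v + 1)}
    (h : Γ.split (.inr a) U (Fin.last e) = s(.inr k, .inr b)) :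
    contract a k = a ∧ contract a b = a ∧ [k, b].Perm [Fin.last v, a.castSucc] := by
  rw [split_last, Sym2.eq_iff] at h
  rcases h with h | h
  · obtain rfl : a.castSucc = k := Sum.inr.inj h.1
    obtain rfl : Fin.last v = b := Sum.inr.inj h.2
    exact ⟨contract_castSucc _ _, contract_last _, List.Perm.swap _ _ _⟩
  · obtain rfl : a.castSucc = b := Sum.inr.inj h.1
    obtain rfl : Fin.last v = k := Sum.inr.inj h.2
    exact ⟨contract_last _, contract_castSucc _ _, List.Perm.refl _⟩

/-- Contraction of an edge with one end on the loop. -/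
theorem QuadLoop.of_split {c : Fin (e + 1)} {k b : Fin (v + 1)} {S T : LTree n (v + 1) (e + 1)}
    {B : HairyChain n (v + 1) (e + 1)}
    (hf : Γ.split (.inr a) U (Fin.last e) = s(.inr k, .inr b))
    (h1 : Γ.split (.inr a) U c = s(y, .inr k)) {s t u : Fin (v + 1)} (hs : s = k ∨ s = b)
    (ht : t = k ∨ t = b) (hu : u = k ∨ u = b) (hS : S.Fits (Γ.split (.inr a) U) (.inr s))
    (hT : T.Fits (Γ.split (.inr a) U) (.inr t)) (hB : HairyChain.Fits (Γ.split (.inr a) U) (.inr u) B y)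
    {L : HairyChain n (v + 1) (e + 1)} {w : Vertex n (v + 1)}
    (hL : HairyChain.LoopAt (Γ.split (.inr a) U) w L)
    (pe : (Fin.last e :: c :: (S.edges ++ (T.edges ++ B.edges))).Perm L.edges)
    (pv : (k :: b :: (S.verts ++ (T.verts ++ B.verts))).Perm L.verts) :
    ∃ y c S T B, QuadLoop Γ y c a S T B := by
  have e1 := pe.nodup_iff.2 hL.edges_nodup
  have e2 := fun f => pe.mem_iff.2 (hL.mem_edges f)
  have v1 := pv.nodup_iff.2 hL.verts_nodup
  have v2 := fun f => pv.mem_iff.2 (hL.mem_verts f)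
  obtain ⟨c, rfl⟩ := Fin.exists_castSucc_eq.2 (show c ≠ Fin.last e by rintro rfl; simp at e1)
  obtain ⟨hk, hb, hp⟩ := contract_ends hf
  have he := e1
  simp only [List.nodup_cons, List.mem_append, List.mem_cons, not_or] at he
  have hp2 := hp.append_right (S.verts ++ (T.verts ++ B.verts))
  obtain ⟨E1, E2⟩ := nodup_map_contract c e1 e2
  obtain ⟨V1, V2⟩ := nodup_map_contract a (hp2.nodup_iff.1 v1) fun f => hp2.mem_iff.1 (v2 f)
  have hv : ∀ w, w = k ∨ w = b → (Sum.inr w : Vertex n (v + 1)).map id (contract a) = .inr a := by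
    rintro w (rfl | rfl)
    · exact congrArg _ hk
    · exact congrArg _ hb
  refine ⟨y.map id (contract a), c, S.map (contract c) (contract a), T.map (contract c) (contract a),
    B.relabel (contract c) (contract a), ?_, hv s hs ▸ hS.contract c he.1.2.1,
    hv t ht ▸ hT.contract c he.1.2.2.1, hv u hu ▸ hB.contract c he.1.2.2.2, ?_, ?_, ?_, ?_⟩
  · have := split_contract Γ a U c (f := c.castSucc) (Fin.castSucc_lt_last _).ne
    rw [contract_castSucc, h1, Sym2.map_mk] at this
    rw [this]
    exact congrArg _ (hv k (Or.inl rfl))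
  · simpa [LTree.edges_map, HairyChain.edges_relabel, contract_castSucc] using E1
  · simpa [LTree.edges_map, HairyChain.edges_relabel, contract_castSucc] using E2
  · simpa [LTree.verts_map, HairyChain.verts_relabel, contract_castSucc] using V1
  · simpa [LTree.verts_map, HairyChain.verts_relabel, contract_castSucc] using V2

/-- Contraction of an edge inside a hair. -/
theorem QuadHair.of_split {c p : Fin (e + 1)} {x k b : Fin (v + 1)}
    {S T A : LTree n (v + 1) (e + 1)} {C B : HairyChain n (v + 1) (e + 1)}
    (hf : Γ.split (.inr a) U (Fin.last e) = s(.inr k, .inr b))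
    (h1 : Γ.split (.inr a) U c = s(y, .inr x))
    (hC : HairyChain.Fits (Γ.split (.inr a) U) (.inr x) C z)
    (h2 : Γ.split (.inr a) U p = s(z, .inr k))
    (hS : S.Fits (Γ.split (.inr a) U) (.inr b)) (hT : T.Fits (Γ.split (.inr a) U) (.inr b))
    (hA : A.Fits (Γ.split (.inr a) U) (.inr k))
    (hB : HairyChain.Fits (Γ.split (.inr a) U) (.inr x) B y)
    {L : HairyChain n (v + 1) (e + 1)} {w : Vertex n (v + 1)}
    (hL : HairyChain.LoopAt (Γ.split (.inr a) U) w L)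
    (pe : (Fin.last e :: p ::
      (S.edges ++ (T.edges ++ (A.edges ++ (c :: (C.edges ++ B.edges)))))).Perm L.edges)
    (pv : (k :: b ::
      (S.verts ++ (T.verts ++ (A.verts ++ (x :: (C.verts ++ B.verts)))))).Perm L.verts) :
    ∃ y z c x C p S T A B, QuadHair Γ y z c x C p a S T A B := by
  have e1 := pe.nodup_iff.2 hL.edges_nodup
  have e2 := fun f => pe.mem_iff.2 (hL.mem_edges f)
  have v1 := pv.nodup_iff.2 hL.verts_nodup
  have v2 := fun f => pv.mem_iff.2 (hL.mem_verts f)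
  obtain ⟨c, rfl⟩ := Fin.exists_castSucc_eq.2 (show c ≠ Fin.last e by rintro rfl; simp at e1)
  obtain ⟨p, rfl⟩ := Fin.exists_castSucc_eq.2 (show p ≠ Fin.last e by rintro rfl; simp at e1)
  obtain ⟨hk, hb, hp⟩ := contract_ends hf
  have he := e1
  simp only [List.nodup_cons, List.mem_append, List.mem_cons, not_or] at he
  have hp2 := hp.append_right (S.verts ++ (T.verts ++ (A.verts ++ (x :: (C.verts ++ B.verts)))))
  obtain ⟨E1, E2⟩ := nodup_map_contract c e1 e2
  obtain ⟨V1, V2⟩ := nodup_map_contract a (hp2.nodup_iff.1 v1) fun f => hp2.mem_iff.1 (v2 f)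
  have hk' : (Sum.inr k : Vertex n (v + 1)).map id (contract a) = .inr a := congrArg _ hk
  have hb' : (Sum.inr b : Vertex n (v + 1)).map id (contract a) = .inr a := congrArg _ hb
  have key := fun i : Fin e => split_contract Γ a U c (f := i.castSucc) (Fin.castSucc_lt_last _).ne
  simp only [contract_castSucc] at key
  refine ⟨y.map id (contract a), z.map id (contract a), c, contract a x,
    C.relabel (contract c) (contract a), p, S.map (contract c) (contract a),
    T.map (contract c) (contract a), A.map (contract c) (contract a),
    B.relabel (contract c) (contract a), (key c).trans ?_, hC.contract c (by tauto),
    (key p).trans ?_, hb' ▸ hS.contract c (by tauto), hb' ▸ hT.contract c (by tauto),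
    hk' ▸ hA.contract c (by tauto), hB.contract c (by tauto), ?_, ?_, ?_, ?_⟩
  · rw [h1]; rfl
  · rw [h2, Sym2.map_mk]; exact congrArg _ hk'
  · simpa [LTree.edges_map, HairyChain.edges_relabel, contract_castSucc] using E1
  · simpa [LTree.edges_map, HairyChain.edges_relabel, contract_castSucc] using E2
  · simpa [LTree.verts_map, HairyChain.verts_relabel, contract_castSucc] using V1
  · simpa [LTree.verts_map, HairyChain.verts_relabel, contract_castSucc] using V2

/-- An edge inside a tree which joins two internal vertices `k` and `b`, together with its
neighbours: the edge `p` towards the root, the tree `A` at `k`, and the trees `S` and `T` at `b`. -/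
theorem LTree.Fits.exists_chain {G : Graph n v e} {y : Vertex n v} {h : LTree n v e}
    (hh : h.Fits G y) {f : Fin e} (hf : f ∈ h.innerEdges) (hfi : ∀ j, .inl j ∉ G f) :
    ∃ (C : HairyChain n v e) (p : Fin e) (k b : Fin v) (S T A : LTree n v e) (z : Vertex n v),
      HairyChain.Fits G y C z ∧ G p = s(z, .inr k) ∧ G f = s(.inr k, .inr b) ∧
      S.Fits G (.inr b) ∧ T.Fits G (.inr b) ∧ A.Fits G (.inr k) ∧
      h.edges.Perm (f :: p :: (S.edges ++ (T.edges ++ (A.edges ++ C.edges)))) ∧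
      h.verts.Perm (k :: b :: (S.verts ++ (T.verts ++ (A.verts ++ C.verts)))) := by
  induction h generalizing y with
  | leaf r j => simp [innerEdges] at hf
  | node r a s t ihs iht =>
    have root : ∀ s t : LTree n v e, s.Fits G (.inr a) → t.Fits G (.inr a) → f = s.root →
        ∃ (C : HairyChain n v e) (p : Fin e) (k b : Fin v) (S T A : LTree n v e) (z : Vertex n v),
        HairyChain.Fits G y C z ∧ G p = s(z, .inr k) ∧ G f = s(.inr k, .inr b) ∧
        S.Fits G (.inr b) ∧ T.Fits G (.inr b) ∧ A.Fits G (.inr k) ∧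
        (r :: (s.edges ++ t.edges)).Perm
          (f :: p :: (S.edges ++ (T.edges ++ (A.edges ++ C.edges)))) ∧
        (a :: (s.verts ++ t.verts)).Perm
          (k :: b :: (S.verts ++ (T.verts ++ (A.verts ++ C.verts)))) := by
      intro s t hs ht hfs
      cases s with
      | leaf r' j =>
        obtain rfl : f = r' := hfs
        exact absurd (by rw [show G f = _ from hs]; simp) (hfi j)
      | node r' b S T =>
        obtain rfl : f = r' := hfs
        refine ⟨[], r, a, b, S, T, t, y, rfl, hh.1, hs.1, hs.2.1, hs.2.2, ht, ?_, ?_⟩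
        · simpa [edges_node, HairyChain.edges_nil] using List.Perm.swap _ _ _
        · simp [verts, HairyChain.verts]
    have deep : ∀ s t : LTree n v e, t.Fits G (.inr a) →
        (∃ (C : HairyChain n v e) (p : Fin e) (k b : Fin v) (S T A : LTree n v e)
          (z : Vertex n v), HairyChain.Fits G (.inr a) C z ∧ G p = s(z, .inr k) ∧
          G f = s(.inr k, .inr b) ∧ S.Fits G (.inr b) ∧ T.Fits G (.inr b) ∧ A.Fits G (.inr k) ∧
          s.edges.Perm (f :: p :: (S.edges ++ (T.edges ++ (A.edges ++ C.edges)))) ∧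
          s.verts.Perm (k :: b :: (S.verts ++ (T.verts ++ (A.verts ++ C.verts))))) →
        ∃ (C : HairyChain n v e) (p : Fin e) (k b : Fin v) (S T A : LTree n v e) (z : Vertex n v),
        HairyChain.Fits G y C z ∧ G p = s(z, .inr k) ∧ G f = s(.inr k, .inr b) ∧
        S.Fits G (.inr b) ∧ T.Fits G (.inr b) ∧ A.Fits G (.inr k) ∧
        (r :: (s.edges ++ t.edges)).Perm
          (f :: p :: (S.edges ++ (T.edges ++ (A.edges ++ C.edges)))) ∧
        (a :: (s.verts ++ t.verts)).Perm
          (k :: b :: (S.verts ++ (T.verts ++ (A.verts ++ C.verts)))) := by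
      rintro s t ht ⟨C, p, k, b, S, T, A, z, g1, g2, g3, g4, g5, g6, g7, g8⟩
      refine ⟨(r, a, t) :: C, p, k, b, S, T, A, z, ⟨hh.1, ht, g1⟩, g2, g3, g4, g5, g6, ?_, ?_⟩
      · refine ((g7.append_right _).cons r).trans ?_
        rw [HairyChain.edges_cons, List.perm_iff_count]
        intro f
        simp only [List.count_append, List.count_cons]
        omega
      · refine ((g8.append_right _).cons a).trans ?_
        rw [HairyChain.verts_cons, List.perm_iff_count]
        intro f
        simp only [List.count_append, List.count_cons]
        omega
    rw [innerEdges_node, List.mem_append, edges_eq, edges_eq, List.mem_cons, List.mem_cons] at hf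
    have swap_edges : (r :: (t.edges ++ s.edges)).Perm (r :: (s.edges ++ t.edges)) :=
      List.perm_append_comm.cons r
    have swap_verts : (a :: (t.verts ++ s.verts)).Perm (a :: (s.verts ++ t.verts)) :=
      List.perm_append_comm.cons a
    rw [edges_node, verts]
    rcases hf with (hf | hf) | (hf | hf)
    · exact root s t hh.2.1 hh.2.2 hf
    · exact deep s t hh.2.2 (ihs hh.2.1 hf)
    · obtain ⟨C, p, k, b, S, T, A, z, g1, g2, g3, g4, g5, g6, g7, g8⟩ :=
        root t s hh.2.2 hh.2.1 hf
      exact ⟨C, p, k, b, S, T, A, z, g1, g2, g3, g4, g5, g6, swap_edges.symm.trans g7,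
        swap_verts.symm.trans g8⟩
    · obtain ⟨C, p, k, b, S, T, A, z, g1, g2, g3, g4, g5, g6, g7, g8⟩ :=
        deep t s hh.2.1 (iht hh.2.2 hf)
      exact ⟨C, p, k, b, S, T, A, z, g1, g2, g3, g4, g5, g6, swap_edges.symm.trans g7,
        swap_verts.symm.trans g8⟩

/-- The IHX relation for the cyclic words of graphs with one loop. -/
theorem sum_loopValue_split (hΓ : ∀ f, ¬ (Γ f).IsDiag) :
    ∑ U ∈ (Γ.incident (.inr a)).powerset with U.card = 2, (Γ.split (.inr a) U).loopValue K = 0 := by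
  by_cases hex : ∃ U y L, HairyChain.LoopAt (Γ.split (.inr a) U) y L
  swap
  · refine Finset.sum_eq_zero fun U _ => ?_
    rw [Graph.loopValue, dif_neg fun ⟨y, L, h⟩ => hex ⟨U, y, L, h⟩]
  obtain ⟨U, y, L, hL⟩ := hex
  have hd := split_not_isDiag hΓ (.inr a) U
  suffices h : (∃ y c S T B, QuadLoop Γ y c a S T B) ∨
      ∃ y z c x C p S T A B, QuadHair Γ y z c x C p a S T A B by
    rcases h with ⟨y, c, S, T, B, h⟩ | ⟨y, z, c, x, C, p, S, T, A, B, h⟩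
    · exact h.sum_loopValue hΓ
    · exact h.sum_loopValue hΓ
  have hfi : ∀ j, .inl j ∉ Γ.split (.inr a) U (Fin.last e) := by
    intro j
    rw [split_last]
    simp [old, new]
  obtain ⟨⟨c, x, h⟩, hq, hf⟩ := List.mem_flatMap.1 (hL.mem_edges (Fin.last e))
  obtain ⟨A, B, rfl⟩ := List.append_of_mem hq
  obtain ⟨y, hL⟩ := hL.rotate
  rw [List.cons_append] at hL
  generalize B ++ A = B at hL
  rcases List.mem_cons.1 hf with rfl | hf
  · left
    rcases List.eq_nil_or_concat B with rfl | ⟨N, ⟨c', x', S⟩, rfl⟩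
    · exact absurd rfl (hL.next_ne hd)
    rw [List.concat_eq_append, ← List.cons_append] at hL
    obtain ⟨w, hL⟩ := hL.rotate
    have h1 := hL.fits
    refine QuadLoop.of_split h1.2.2.1 h1.1 (Or.inl rfl) (Or.inr rfl) (Or.inr rfl) h1.2.1 h1.2.2.2.1
      h1.2.2.2.2 hL ?_ ?_
    · rw [List.singleton_append, HairyChain.edges_cons, HairyChain.edges_cons, List.perm_iff_count]
      intro f
      simp only [List.count_append, List.count_cons]
      omega
    · rw [List.singleton_append, HairyChain.verts_cons, HairyChain.verts_cons, List.perm_iff_count]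
      intro f
      simp only [List.count_append, List.count_cons]
      omega
  · rw [LTree.edges_eq, List.mem_cons] at hf
    rcases hf with hf | hf
    · left
      have h1 := hL.fits
      cases h with
      | leaf r j => exact absurd (by rw [hf, h1.2.1.root_eq]; simp [LTree.top]) (hfi j)
      | node r b S T =>
        obtain rfl : Fin.last e = r := hf
        have h2 := h1.2.1
        refine QuadLoop.of_split h2.1 h1.1 (Or.inr rfl) (Or.inr rfl) (Or.inl rfl) h2.2.1 h2.2.2
          h1.2.2 hL ?_ ?_
        · rw [HairyChain.edges_cons, LTree.edges_node, List.perm_iff_count]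
          intro f
          simp only [List.count_append, List.count_cons]
          omega
        · rw [HairyChain.verts_cons, LTree.verts, List.perm_iff_count]
          intro f
          simp only [List.count_append, List.count_cons]
          omega
    · right
      obtain ⟨C, p, k, b, S, T, A, z, g1, g2, g3, g4, g5, g6, g7, g8⟩ :=
        hL.fits.2.1.exists_chain hf hfi
      refine QuadHair.of_split g3 hL.fits.1 g1 g2 g4 g5 g6 hL.fits.2.2 hL ?_ ?_
      · rw [HairyChain.edges_cons]
        refine List.Perm.trans ?_ ((g7.symm.append_right _).cons c)
        rw [List.perm_iff_count]
        intro f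
        simp only [List.count_append, List.count_cons]
        omega
      · rw [HairyChain.verts_cons]
        refine List.Perm.trans ?_ ((g8.symm.append_right _).cons x)
        rw [List.perm_iff_count]
        intro f
        simp only [List.count_append, List.count_cons]
        omega

end


namespace Graph

/-! ### The differential modulo two loops -/

variable {Γ : Graph n v e} {M : Type*} [AddCommGroup M] [Module K M]

/-- The number of loops after splitting an external vertex, by counting ends of edges. -/
theorem loops_split_external (he : e = 2 * v + 1) {j : Fin n} {S : Finset (Fin e)}
    (hS : S ⊆ Γ.incident (.inl j)) (hs : (Γ.split (.inl j) S).IsICG) :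
    (Γ.split (.inl j) S).loops + 3 * v + 1 = S.card + ∑ a, (Γ.incident (.inr a)).card := by
  have h1 := hs.loops_add
  rw [sum_valence_split hS] at h1
  simp only at h1
  omega

theorem cls_split_eq_zero {a : Fin v} (ha : (Γ.incident (.inr a)).card < 4) {S : Finset (Fin e)}
    (hS : S ⊆ Γ.incident (.inr a)) : cls K (Γ.split (.inr a) S) = 0 := by
  refine cls_of_not_isICG fun h => ?_
  have h1 := h.isSound.two_le_card hS
  have h2 := h.trivalent a.castSucc
  have h3 := card_incident_split_self Γ hS
  change 3 ≤ ((Γ.split (.inr a) S).incident (old (.inr a))).card at h2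
  omega

/-- Modulo two loops, the differential of a trivalent tree creates a loop at an external vertex. -/
theorem splitSum_of_tree (Ψ : ICGPart K n (v + 1) (e + 1) →ₗ[K] M)
    (hΨ : ∀ y ∈ filtrationPart K 2 n (v + 1) (e + 1), Ψ y = 0) (he : e = 2 * v + 1)
    (hv : ∀ a, (Γ.incident (.inr a)).card = 3) :
    Ψ (splitSum K Γ) = ∑ j, ∑ S ∈ (Γ.incident (.inl j)).powerset with S.card = 2,
      Ψ (cls K (Γ.split (.inl j) S)) := by
  rw [splitSum, map_add, map_smul, map_sum, map_sum,
    Finset.sum_eq_zero (s := (Finset.univ : Finset (Fin v))), smul_zero, add_zero]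
  · refine Finset.sum_congr rfl fun j _ => ?_
    rw [map_sum, Finset.sum_filter]
    refine Finset.sum_congr rfl fun S hS => ?_
    rw [Finset.mem_powerset] at hS
    split_ifs with h
    · rfl
    · refine hΨ _ (cls_mem_filtrationPart fun hs => ?_)
      have h1 := loops_split_external he hS hs
      have h2 := hs.isSound.two_le_card hS
      simp only [hv, Finset.sum_const, Finset.card_univ, Fintype.card_fin, smul_eq_mul] at h1
      omega
  · intro a _
    rw [map_sum]
    refine Finset.sum_eq_zero fun S hS => ?_
    rw [cls_split_eq_zero (by rw [hv]; omega) (Finset.mem_powerset.1 hS), map_zero]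

/-- Modulo two loops, the differential of a graph with one loop and one vertex `a` of valence `4`
resolves this vertex. -/
theorem splitSum_of_quad (Ψ : ICGPart K n (v + 1) (e + 1) →ₗ[K] M)
    (hΨ : ∀ y ∈ filtrationPart K 2 n (v + 1) (e + 1), Ψ y = 0) (he : e = 2 * v + 1) {a : Fin v}
    (ha : (Γ.incident (.inr a)).card = 4) (hv : ∀ b ≠ a, (Γ.incident (.inr b)).card = 3) :
    Ψ (splitSum K Γ) = (1 / 2 : K) • ∑ U ∈ (Γ.incident (.inr a)).powerset with U.card = 2,
      Ψ (cls K (Γ.split (.inr a) U)) := by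
  have hsum : ∑ b, (Γ.incident (.inr b)).card = 3 * v + 1 := by
    have h1 : ∀ b, (Γ.incident (.inr b)).card = 3 + if b = a then 1 else 0 := by
      intro b
      split_ifs with h
      · rw [h, ha]
      · rw [hv b h]
    simp only [h1, Finset.sum_add_distrib]
    simp [mul_comm]
  rw [splitSum, map_add, map_smul, map_sum, map_sum,
    Finset.sum_eq_zero (s := (Finset.univ : Finset (Fin n))), zero_add]
  · congr 1
    rw [Finset.sum_eq_single_of_mem a (Finset.mem_univ a), map_sum, Finset.sum_filter]
    · refine Finset.sum_congr rfl fun S hS => ?_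
      rw [Finset.mem_powerset] at hS
      split_ifs with h
      · rfl
      · rw [cls_of_not_isICG fun hs => h ?_, map_zero]
        have h1 := hs.isSound.two_le_card hS
        have h2 := hs.trivalent a.castSucc
        have h3 := card_incident_split_self Γ hS
        change 3 ≤ ((Γ.split (.inr a) S).incident (old (.inr a))).card at h2
        omega
    · intro b _ hb
      rw [map_sum]
      refine Finset.sum_eq_zero fun S hS => ?_
      rw [cls_split_eq_zero (by rw [hv b hb]; omega) (Finset.mem_powerset.1 hS), map_zero]
  · intro j _
    rw [map_sum]
    refine Finset.sum_eq_zero fun S hS => hΨ _ (cls_mem_filtrationPart fun hs => ?_)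
    rw [Finset.mem_powerset] at hS
    have h1 := loops_split_external he hS hs
    have h2 := hs.isSound.two_le_card hS
    omega

end Graph

open KRV.Graph

theorem HairyChain.length_edges (L : HairyChain n v e) :
    L.edges.length = 2 * L.verts.length := by
  induction L with
  | nil => rfl
  | cons q L ih =>
    obtain ⟨c, a, h⟩ := q
    rw [edges_cons, verts_cons, List.length_cons, List.length_append, h.edges_length, ih,
      List.length_cons, List.length_append]
    ring

theorem length_of_nodup {m : ℕ} {L : List (Fin m)} (h1 : L.Nodup) (h2 : ∀ f, f ∈ L) :
    L.length = m := by
  have := List.toFinset_card_of_nodup h1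
  rw [← this, show L.toFinset = Finset.univ by ext f; simp [h2], Finset.card_univ,
    Fintype.card_fin]

namespace HairyChain.LoopAt

variable {Γ : Graph n v e} {y : Vertex n v} {L : HairyChain n v e}

theorem edges_eq (hL : LoopAt Γ y L) : e = 2 * v := by
  have := L.length_edges
  rwa [length_of_nodup hL.edges_nodup hL.mem_edges,
    length_of_nodup hL.verts_nodup hL.mem_verts] at this

theorem valence_le (hL : LoopAt Γ y L) (a : Fin v) : (Γ.incident (.inr a)).card ≤ 3 := by
  obtain ⟨⟨c, x, h⟩, hq, ha⟩ := List.mem_flatMap.1 (hL.mem_verts a)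
  obtain ⟨A, B, rfl⟩ := List.append_of_mem hq
  obtain ⟨z, hL⟩ := hL.rotate
  rw [List.cons_append] at hL
  rcases List.mem_cons.1 ha with rfl | ha
  · refine (Finset.card_le_card (t := {c, h.root, next (B ++ A) c}) fun f hf => ?_).trans
      Finset.card_le_three
    simpa using (hL.mem_iff f).1 (mem_incident.1 hf)
  · exact (hL.reads_hair.valence ha).le

theorem loops_le (hL : LoopAt Γ y L) (hΓ : Γ.IsICG) : Γ.loops ≤ 1 := by
  have h1 := hΓ.loops_add
  have h2 : ∑ a, (Γ.incident (.inr a)).card ≤ ∑ _a : Fin v, 3 :=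
    Finset.sum_le_sum fun a _ => hL.valence_le a
  have h3 := hL.edges_eq
  simp at h2
  omega

end HairyChain.LoopAt

/-- The cyclic word of a graph with one loop, as a linear map. -/
noncomputable def loopMap (K : Type*) [Field K] (n v e : ℕ) : ICGPart K n v e →ₗ[K] Ass K n :=
  (relations K n v e).liftQ (Finsupp.linearCombination K fun Γ : ICGraph n v e =>
    Γ.1.loopValue K) <| by
      rw [relations, Submodule.span_le]
      rintro _ ⟨Γ, σ, τ, rfl⟩
      rw [SetLike.mem_coe, LinearMap.mem_ker, map_sub, Finsupp.linearCombination_single,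
        Finsupp.linearCombination_single, one_smul, sub_eq_zero]
      exact loopValue_relabel Γ.2.not_isDiag σ τ

theorem loopMap_cls [CharZero K] {Γ : Graph n v e} (hd : ∀ f, ¬ (Γ f).IsDiag)
    (h : Function.Injective Γ → Γ.IsICG) : loopMap K n v e (cls K Γ) = Γ.loopValue K := by
  by_cases hΓ : Function.Injective Γ
  · rw [cls_of_isICG (h hΓ), loopMap, Submodule.liftQ_apply, Finsupp.linearCombination_single,
      one_smul]
  · rw [cls_of_not_isICG fun h => hΓ h.injective, map_zero, loopValue_of_not_injective hd hΓ]

theorem loopMap_of_mem_filtrationPart [CharZero K] {x : ICGPart K n v e}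
    (hx : x ∈ filtrationPart K 2 n v e) : loopMap K n v e x = 0 := by
  induction hx using Submodule.span_induction with
  | zero => rw [map_zero]
  | add x y _ _ hx hy => rw [map_add, hx, hy, add_zero]
  | smul c x _ hx => rw [map_smul, hx, smul_zero]
  | mem x hx =>
    obtain ⟨Γ, h, rfl⟩ := hx
    rw [loopMap_cls Γ.2.not_isDiag fun _ => Γ.2, loopValue, dif_neg]
    rintro ⟨y, L, hL⟩
    have := hL.loops_le Γ.2
    omega

theorem loopMap_cls_split [CharZero K] {Γ : Graph n v e} (h : Γ.IsICG) {x : Vertex n v}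
    {S : Finset (Fin e)} (hS : S ⊆ Γ.incident x) (h2 : S.card = 2)
    (hx : ∀ a, x = .inr a → 4 ≤ (Γ.incident (.inr a)).card) :
    loopMap K n _ _ (cls K (Γ.split x S)) = (Γ.split x S).loopValue K := by
  refine loopMap_cls (split_not_isDiag h.not_isDiag x S) fun hi => h.split hS ⟨hi, fun b => ?_⟩
  induction b using Fin.lastCases with
  | last =>
    have := card_incident_split_new hS
    rw [new] at this
    omega
  | cast b =>
    change 3 ≤ ((Γ.split x S).incident (old (.inr b))).card
    by_cases hb : .inr b = x
    · subst hb
      have := card_incident_split_self Γ hS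
      have := hx b rfl
      omega
    · rw [card_incident_split_old hb]
      exact h.trivalent b

/-- The linear map `loopMap` vanishes on the boundaries of graphs with loops. -/
theorem loopMap_dPart_of_loops [CharZero K] {Γ : Graph n v e} (h : Γ.IsICG) (he : e = 2 * v + 1)
    (hl : 1 ≤ Γ.loops) : loopMap K n _ _ (dPart K n v e (cls K Γ)) = 0 := by
  rw [dPart_cls h]
  rcases Nat.lt_or_ge 1 Γ.loops with hl2 | hl2
  · rw [splitSum_eq, map_sum]
    refine Finset.sum_eq_zero fun x _ => ?_
    rw [map_smul, map_sum, Finset.sum_eq_zero, smul_zero]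
    intro S hS
    refine loopMap_of_mem_filtrationPart (cls_mem_filtrationPart fun hs => ?_)
    have := loops_split h (Finset.mem_powerset.1 hS) hs
    omega
  · have hval := h.loops_add
    have hsum : ∑ a, ((Γ.incident (.inr a)).card - 3) = 1 := by
      have h1 : ∑ a, (Γ.incident (.inr a)).card =
          ∑ a, ((Γ.incident (.inr a)).card - 3) + ∑ _a : Fin v, 3 := by
        rw [← Finset.sum_add_distrib]
        exact Finset.sum_congr rfl fun a _ => (Nat.sub_add_cancel (h.trivalent a)).symm
      simp only [Finset.sum_const, Finset.card_univ, Fintype.card_fin, smul_eq_mul] at h1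
      omega
    obtain ⟨a, ha, hb⟩ : ∃ a, (Γ.incident (.inr a)).card - 3 = 1 ∧
        ∀ b ≠ a, (Γ.incident (.inr b)).card - 3 = 0 := by
      obtain ⟨a, -, ha⟩ := Finset.exists_ne_zero_of_sum_ne_zero (hsum.trans_ne one_ne_zero)
      rw [← Finset.add_sum_erase _ _ (Finset.mem_univ a)] at hsum
      refine ⟨a, by omega, fun b hb => ?_⟩
      exact (Finset.sum_eq_zero_iff.1 (by omega :
        ∑ b ∈ Finset.univ.erase a, ((Γ.incident (.inr b)).card - 3) = 0)) b (by simp [hb])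
    have ha4 : (Γ.incident (.inr a)).card = 4 := by omega
    rw [splitSum_of_quad _ (fun y => loopMap_of_mem_filtrationPart) he ha4 fun b hne => by
      have := hb b hne; have := h.trivalent b; omega]
    rw [Finset.sum_congr rfl fun U hU => loopMap_cls_split h
      (Finset.mem_powerset.1 (Finset.mem_filter.1 hU).1) (Finset.mem_filter.1 hU).2 (by
        rintro b hb; obtain rfl := Sum.inr.inj hb; exact ha4.ge),
      sum_loopValue_split h.not_isDiag, smul_zero]

end KRV

namespace KRV

open Ass KRV.Graph

variable {K : Type*} [Field K] {n v e : ℕ}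

/-! ### Loops at the external vertices of a tree -/

namespace LTree

/-- The paths from the root of a tree to its leaves with label `j`: the chain of nodes with their
hairs, the edge that leads to the leaf, and the sign that compares planar structures. -/
def spines (j : Fin n) : LTree n v e → List (HairyChain n v e × Fin e × ℤ)
  | leaf r k => if k = j then [([], r, 1)] else []
  | node r a s t =>
    (s.spines j).map (fun q => ((r, a, t) :: q.1, q.2.1, -q.2.2)) ++
      (t.spines j).map fun q => ((r, a, s) :: q.1, q.2.1, q.2.2)

variable {j : Fin n} {P : LTree n v e}

theorem spines_map_edge : (P.spines j).map (fun q => q.2.1) = P.leafEdges j := by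
  induction P with
  | leaf r k => rw [spines, leafEdges]; split_ifs <;> rfl
  | node r a s t hs ht => simp [spines, leafEdges, ← hs, ← ht, Function.comp_def]

/-- `∂_j` of an iterated bracket is the signed sum over the leaves with label `j` of the product of
the Lie words along the path to the leaf. -/
theorem partialRight_lw : partialRight j (P.lw K) =
    ((P.spines j).map fun q => (q.2.2 : K) • q.1.word K).sum := by
  have key : ∀ (p : Ass K n) (l : List (HairyChain n v e × Fin e × ℤ)),
      p * (l.map fun q => (q.2.2 : K) • q.1.word K).sum =
        (l.map fun q => (q.2.2 : K) • (p * q.1.word K)).sum := by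
    intro p l
    induction l with
    | nil => simp
    | cons q l ih => simp [mul_add, ih]
  induction P with
  | leaf r k =>
    rw [lw, partialRight_X, spines]
    by_cases h : k = j
    · simp [h, HairyChain.word]
    · simp [h, Ne.symm h]
  | node r a s t hs ht =>
    rw [lw, partialRight_lie (lie_nil s.lw_mem_lie) (lie_nil t.lw_mem_lie), hs, ht, key, key,
      spines, List.map_append, List.sum_append, sub_eq_neg_add, ← neg_one_smul K (List.sum _),
      List.smul_sum]
    simp only [List.map_map, Function.comp_def, HairyChain.word_cons, smul_smul]
    push_cast
    simp

theorem spines_props {C : HairyChain n v e} {f : Fin e} {ε : ℤ} (h : (C, f, ε) ∈ P.spines j) :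
    ε * ε = 1 ∧ SignRel ε (C.edges ++ [f]) P.edges ∧ (C.edges ++ [f]).Perm P.edges ∧
      C.verts.Perm P.verts ∧ (P.top ≠ .inl j → C ≠ []) ∧ HairyChain.next C f = P.root ∧
      ∀ (Γ : Graph n v e) y, P.Fits Γ y → ∃ z, HairyChain.Fits Γ y C z ∧ Γ f = s(z, .inl j) := by
  induction P generalizing C f ε with
  | leaf r k =>
    rw [spines] at h
    split_ifs at h with hk
    · obtain ⟨rfl, rfl, rfl⟩ : C = [] ∧ f = r ∧ ε = 1 := by simpa using h
      subst hk
      exact ⟨rfl, SignRel.refl _, List.Perm.refl _, List.Perm.refl _, fun h => absurd rfl h, rfl,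
        fun Γ y hy => ⟨y, rfl, hy⟩⟩
    · simp at h
  | node r a s t hs ht =>
    rw [spines, List.mem_append, List.mem_map, List.mem_map] at h
    rcases h with ⟨⟨C, f, ε⟩, hq, hC⟩ | ⟨⟨C, f, ε⟩, hq, hC⟩
    · obtain ⟨rfl, rfl, rfl⟩ := by simpa using hC
      obtain ⟨h1, h2, h3, h4, -, -, h5⟩ := hs hq
      refine ⟨by linear_combination h1, ?_, ?_, ?_, fun _ => by simp, rfl,
        fun Γ y hy => ?_⟩
      · have h6 := (((SignRel.refl t.edges).append h2).trans
          (signRel_swap_of_odd t.odd_edges s.odd_edges)).cons r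
        simpa [HairyChain.edges_cons, edges_node] using h6
      · rw [HairyChain.edges_cons, edges_node, List.cons_append, List.append_assoc]
        exact ((h3.append_left _).trans List.perm_append_comm).cons r
      · rw [HairyChain.verts_cons, verts]
        exact ((h4.append_left _).trans List.perm_append_comm).cons a
      · obtain ⟨z, h6, h7⟩ := h5 Γ _ hy.2.1
        exact ⟨z, ⟨hy.1, hy.2.2, h6⟩, h7⟩
    · obtain ⟨rfl, rfl, rfl⟩ := by simpa using hC
      obtain ⟨h1, h2, h3, h4, -, -, h5⟩ := ht hq
      refine ⟨h1, ?_, ?_, ?_, fun _ => by simp, rfl, fun Γ y hy => ?_⟩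
      · have h6 := ((SignRel.refl s.edges).append h2).cons r
        simpa [HairyChain.edges_cons, edges_node] using h6
      · rw [HairyChain.edges_cons, edges_node, List.cons_append, List.append_assoc]
        exact (h3.append_left _).cons r
      · rw [HairyChain.verts_cons, verts]
        exact (h4.append_left _).cons a
      · obtain ⟨z, h6, h7⟩ := h5 Γ _ hy.2.2
        exact ⟨z, ⟨hy.1, hy.2.1, h6⟩, h7⟩

end LTree

theorem HairyChain.Fits.exists_end {Γ : Graph n v e} {y z : Vertex n v} {L : HairyChain n v e}
    (h : Fits Γ y L z) (hL : L ≠ []) : ∃ b, z = .inr b := by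
  rcases List.eq_nil_or_concat L with rfl | ⟨N, ⟨c, b, k⟩, rfl⟩
  · exact absurd rfl hL
  · rw [List.concat_eq_append, fits_append] at h
    obtain ⟨_, -, h⟩ := h
    exact ⟨b, h.2.2.symm⟩

theorem sgn_map_castSucc_append_last (L : List (Fin e)) :
    sgn (L.map Fin.castSucc ++ [Fin.last e]) = sgn L := by
  have h : ∀ a ∈ L.map Fin.castSucc, ∀ b ∈ [Fin.last e], a < b := by
    intro a ha b hb
    obtain ⟨a, -, rfl⟩ := List.mem_map.1 ha
    rw [List.mem_singleton.1 hb]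
    exact Fin.castSucc_lt_last a
  have hn : (L.map Fin.castSucc ++ [Fin.last e]).Nodup ↔ L.Nodup := by
    rw [List.nodup_append, List.nodup_map_iff (Fin.castSucc_injective e)]
    exact ⟨fun h => h.1, fun h' => ⟨h', List.nodup_singleton _, fun a ha b hb => (h a ha b hb).ne⟩⟩
  unfold sgn
  rw [listSign_append h, listSign_map fun _ _ h => Fin.castSucc_lt_castSucc_iff.2 h]
  simp [hn, listSign]

/-- Splitting off two edges of a tree at the external vertex `j` creates a loop, which consists of
the path between the two edges; there is one hair more, with label `j`. -/
theorem LTree.TreeAt.loopAt_split {Γ : Graph n v e} {j : Fin n} {P : LTree n v e}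
    (h : TreeAt Γ j P) {C : HairyChain n v e} {f : Fin e} {ε : ℤ} (hC : (C, f, ε) ∈ P.spines j) :
    HairyChain.LoopAt (Γ.split (.inl j) {P.root, f}) (new n v)
      (C.lift ++ [(f.castSucc, Fin.last v, .leaf (Fin.last e) j)]) := by
  obtain ⟨-, -, h3, h4, h5, h6, h7⟩ := spines_props hC
  obtain ⟨z, hz, hf⟩ := h7 Γ _ h.fits
  have hne := h5 h.top_ne
  obtain ⟨b, rfl⟩ := hz.exists_end hne
  have hnd := h3.nodup_iff.2 h.edges_nodup
  obtain ⟨E1, E2⟩ := mem_of_map_castSucc (E := HairyChain.edges (C.lift ++ [(f.castSucc,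
    Fin.last v, LTree.leaf (Fin.last e) j)])) (by
      rw [HairyChain.edges_append, HairyChain.edges_relabel]
      refine List.Perm.trans ?_ (List.perm_append_singleton (Fin.last e)
        ((C.edges ++ [f]).map Fin.castSucc))
      simp [HairyChain.edges, LTree.edges_leaf]) hnd
        fun f => h3.mem_iff.2 (h.mem_edges f)
  obtain ⟨V1, V2⟩ := mem_of_map_castSucc (E := HairyChain.verts (C.lift ++ [(f.castSucc,
    Fin.last v, LTree.leaf (Fin.last e) j)])) (by
      rw [HairyChain.verts_append, HairyChain.verts_relabel]
      refine List.Perm.trans ?_ (List.perm_append_singleton (Fin.last v)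
        (C.verts.map Fin.castSucc))
      simp [HairyChain.verts, LTree.verts]) (h4.nodup_iff.2 h.verts_nodup)
        fun f => h4.mem_iff.2 (h.mem_verts f)
  refine ⟨HairyChain.fits_append.2 ⟨old (.inr b), ?_, ?_, ?_, rfl⟩, E1, E2, V1, V2⟩
  · cases C with
    | nil => exact absurd rfl hne
    | cons q C =>
      obtain ⟨c, a, k⟩ := q
      obtain rfl : c = P.root := h6
      rw [HairyChain.edges_cons] at hnd
      refine hz.lift_new (by simp) (by simp) fun g hg => ?_
      simp only [List.cons_append, List.nodup_cons, List.nodup_append, List.mem_append,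
        List.mem_singleton, not_or] at hnd hg
      grind
  · rw [split_castSucc_of_mem (y := .inr b) (by simp) (hf.trans Sym2.eq_swap) (by simp),
      Sym2.eq_swap]
    rfl
  · exact (split_last _ _ _).trans Sym2.eq_swap

/-- Closing the path from the root to a leaf with label `j` up to a loop turns the term of
`partialRight_lw` into the corresponding term of the divergence. -/
theorem LTree.value_spine {j : Fin n} {P : LTree n v e}
    {M : Type*} [AddCommGroup M] [Module K M] (Φ : Ass K n →ₗ[K] M)
    (hΦ : ∀ f g, Φ (f * g) = Φ (g * f))
    {C : HairyChain n v e} {f : Fin e} {ε : ℤ} (hC : (C, f, ε) ∈ P.spines j) :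
    ((sgn (HairyChain.edges (C.lift ++ [(f.castSucc, Fin.last v, .leaf (Fin.last e) j)])) : ℤ) : K) •
      Φ (HairyChain.word K (C.lift ++ [(f.castSucc, Fin.last v, .leaf (Fin.last e) j)])) =
    ((sgn P.edges : ℤ) : K) • Φ (X j * ((ε : K) • C.word K)) := by
  obtain ⟨h1, h2, -⟩ := spines_props hC
  have h3 : HairyChain.edges (C.lift ++ [(f.castSucc, Fin.last v, LTree.leaf (Fin.last e) j)]) =
      (C.edges ++ [f]).map Fin.castSucc ++ [Fin.last e] := by
    rw [HairyChain.edges_append, HairyChain.edges_relabel]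
    simp [HairyChain.edges, LTree.edges_leaf]
  rw [h3, sgn_map_castSucc_append_last, h2.sgn_eq, HairyChain.word_append,
    HairyChain.word_relabel, hΦ, mul_smul_comm, map_smul, smul_smul]
  simp only [HairyChain.word, List.map_cons, List.map_nil, List.prod_cons, List.prod_nil, mul_one,
    LTree.lw]
  push_cast
  rw [mul_comm]

theorem sum_sum_pair {M : Type*} [AddCommGroup M] (I : Finset (Fin e))
    (F : Finset (Fin e) → M) :
    ∑ r ∈ I, ∑ f ∈ I.erase r, F {r, f} = 2 • ∑ S ∈ I.powerset with S.card = 2, F S := by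
  have h1 : 2 • ∑ S ∈ I.powerset with S.card = 2, F S =
      ∑ S ∈ I.powerset with S.card = 2, ∑ _r ∈ S, F S := by
    rw [Finset.smul_sum]
    refine Finset.sum_congr rfl fun S hS => ?_
    rw [Finset.sum_const, (Finset.mem_filter.1 hS).2]
  rw [h1, Finset.sum_comm' (t' := I)
    (s' := fun r => {S ∈ I.powerset | S.card = 2 ∧ r ∈ S}) (by
      intro S r
      simp only [Finset.mem_filter, Finset.mem_powerset]
      constructor
      · rintro ⟨⟨h1, h2⟩, h3⟩; exact ⟨⟨h1, h2, h3⟩, h1 h3⟩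
      · rintro ⟨⟨h1, h2, h3⟩, -⟩; exact ⟨⟨h1, h2⟩, h3⟩)]
  refine Finset.sum_congr rfl fun r hr => Finset.sum_bij (fun f _ => {r, f}) ?_ ?_ ?_ ?_
  · intro f hf
    rw [Finset.mem_erase] at hf
    rw [Finset.mem_filter, Finset.mem_powerset, Finset.card_pair hf.1.symm]
    exact ⟨by grind, rfl, by simp⟩
  · intro f hf g hg hfg
    rw [Finset.mem_erase] at hf hg
    have : f ∈ ({r, g} : Finset (Fin e)) := by rw [← hfg]; simp
    grind
  · intro S hS
    simp only [Finset.mem_filter, Finset.mem_powerset] at hS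
    obtain ⟨f, hf⟩ := Finset.card_eq_one.1
      (show (S.erase r).card = 1 by rw [Finset.card_erase_of_mem hS.2.2, hS.2.1])
    have hf' : f ∈ S.erase r := by rw [hf]; simp
    rw [Finset.mem_erase] at hf'
    exact ⟨f, Finset.mem_erase.2 ⟨hf'.1, hS.1 hf'.2⟩, by
      rw [← hf, Finset.insert_erase hS.2.2]⟩
  · intros; rfl

/-- If the value of a graph with one loop is given by a trace `Φ`, then joining the edges of a tree
at the external vertices pairwise to loops gives half the value of the divergence. -/
theorem sum_split_pair_eq [CharZero K] {Γ : Graph n v e} (h : Γ.IsTreeGraph) {M : Type*}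
    [AddCommGroup M] [Module K M] (Φ : Ass K n →ₗ[K] M) (hΦ : ∀ f g, Φ (f * g) = Φ (g * f))
    (F : Fin n → Finset (Fin e) → M)
    (hF : ∀ j, ∀ S ⊆ Γ.incident (.inl j), S.card = 2 → ∀ y L,
      HairyChain.LoopAt (Γ.split (.inl j) S) y L →
      F j S = ((sgn L.edges : ℤ) : K) • Φ (L.word K)) :
    ∑ j, ∑ S ∈ (Γ.incident (.inl j)).powerset with S.card = 2, F j S =
      (1 / 2 : K) • Φ (divergenceSeries fun j => Γ.lieSeries K j) := by
  rw [divergenceSeries, map_sum, Finset.smul_sum]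
  refine Finset.sum_congr rfl fun j _ => ?_
  have key : ∑ r ∈ Γ.incident (.inl j), ∑ f ∈ (Γ.incident (.inl j)).erase r, F j {r, f} =
      Φ (X j * partialRight j (Γ.lieSeries K j)) := by
    rw [LTree.lieSeries_eq, ← partialRightL_apply, map_sum, Finset.mul_sum, map_sum]
    refine Finset.sum_congr rfl fun r hr => ?_
    obtain ⟨P, hP, rfl⟩ := h.exists_treeAt hr
    have hnd := hP.edges_nodup.sublist (LTree.leafEdges_sublist j P)
    have hinc : (Γ.incident (.inl j)).erase P.root = (P.leafEdges j).toFinset := by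
      rw [hP.incident_eq, Finset.erase_insert (by simpa using hP.root_notMem_leafEdges)]
    rw [hinc, List.sum_toFinset _ hnd, ← LTree.spines_map_edge, List.map_map, hP.rootTerm, map_smul,
      partialRightL_apply, LTree.partialRight_lw, mul_smul_comm, map_smul]
    have h2 : ∀ l : List (HairyChain n v e × Fin e × ℤ), (∀ q ∈ l, q ∈ P.spines j) →
        (l.map ((F j {P.root, ·}) ∘ fun q => q.2.1)).sum = ((sgn P.edges : ℤ) : K) •
          Φ (X j * (l.map fun q => (q.2.2 : K) • q.1.word K).sum) := by
      intro l hl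
      induction l with
      | nil => simp
      | cons q l ih =>
        rw [List.map_cons, List.sum_cons, List.map_cons, List.sum_cons, mul_add, map_add, smul_add,
          ih fun q hq => hl q (List.mem_cons_of_mem _ hq)]
        congr 1
        have hq := hl q List.mem_cons_self
        have hmem : q.2.1 ∈ (Γ.incident (.inl j)).erase P.root := by
          rw [hinc, List.mem_toFinset, ← LTree.spines_map_edge]
          exact List.mem_map_of_mem hq
        rw [Finset.mem_erase] at hmem
        rw [← LTree.value_spine Φ hΦ hq]
        exact hF j _ (by grind) (Finset.card_pair hmem.1.symm) _ _ (hP.loopAt_split hq)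
    exact h2 _ fun _ h => h
  rw [← key, sum_sum_pair, ← Nat.cast_smul_eq_nsmul K, smul_smul]
  norm_num

end KRV

namespace KRV

open Ass KRV.Graph

variable {K : Type*} [Field K] {n v e : ℕ}

/-! ### Elements of the first level have divergence zero -/

/-- The divergence of the tuple of Lie series of a combination of trees, as a series. -/
noncomputable def treeDivergence (K : Type*) [Field K] (n v e : ℕ) : ICGPart K n v e →ₗ[K] Ass K n :=
  ∑ j, LinearMap.mulLeft K (X j) ∘ₗ partialRightL j ∘ₗ treeSeries K n v e j

theorem treeDivergence_apply (y : ICGPart K n v e) :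
    treeDivergence K n v e y = divergenceSeries fun j => treeSeries K n v e j y := by
  rw [treeDivergence, LinearMap.sum_apply]
  rfl

/-- For any trace `Φ` that computes, via `Ψ`, the classes of graphs with one loop, the differential
of a combination of trees is half its divergence. -/
theorem dPart_tree_eq [CharZero K] {M : Type*} [AddCommGroup M] [Module K M]
    (Φ : Ass K n →ₗ[K] M) (hΦ : ∀ f g, Φ (f * g) = Φ (g * f))
    (Ψ : ICGPart K n (v + 1) (e + 1) →ₗ[K] M)
    (hΨ : ∀ y ∈ filtrationPart K 2 n (v + 1) (e + 1), Ψ y = 0)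
    (h : ∀ (Γ : Graph n (v + 1) (e + 1)) (y) (L : HairyChain n (v + 1) (e + 1)),
      (∀ f, ¬ (Γ f).IsDiag) → (Function.Injective Γ → Γ.IsICG) → HairyChain.LoopAt Γ y L →
      Ψ (cls K Γ) = ((sgn L.edges : ℤ) : K) • Φ (L.word K))
    {Γ : Graph n v e} (hΓ : Γ.IsTreeGraph) :
    Ψ (dPart K n v e (cls K Γ)) = (1 / 2 : K) • Φ (treeDivergence K n v e (cls K Γ)) := by
  have hv : ∀ a, (Γ.incident (.inr a)).card = 3 := by
    obtain ⟨i, r, hr⟩ := hΓ.1.exists_external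
    obtain ⟨P, hP, -⟩ := hΓ.exists_treeAt (mem_incident.2 hr)
    exact fun a => hP.reads.valence (hP.mem_verts a)
  rw [dPart_cls hΓ.1, splitSum_of_tree Ψ hΨ hΓ.2.1 hv, treeDivergence_apply]
  simp only [treeSeries_cls hΓ]
  refine sum_split_pair_eq hΓ Φ hΦ _ fun j S hS h2 y L hL => ?_
  refine h _ y L (split_not_isDiag hΓ.1.not_isDiag _ _) (fun hi => hΓ.1.split hS ⟨hi, ?_⟩) hL
  intro b
  induction b using Fin.lastCases with
  | last =>
    have := card_incident_split_new hS
    rw [new] at this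
    omega
  | cast b =>
    change 3 ≤ ((Γ.split (.inl j) S).incident (old (.inr b))).card
    rw [card_incident_split_old (by simp)]
    exact (hv b).ge

/-- The extension of `dPart_tree_eq` to all elements, if the boundaries of graphs with loops are
killed. -/
theorem dPart_eq [CharZero K] {M : Type*} [AddCommGroup M] [Module K M]
    (Φ : Ass K n →ₗ[K] M) (hΦ : ∀ f g, Φ (f * g) = Φ (g * f))
    (Ψ : ICGPart K n (v + 1) (e + 1) →ₗ[K] M)
    (hΨ : ∀ y ∈ filtrationPart K 2 n (v + 1) (e + 1), Ψ y = 0)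
    (hd : ∀ Γ : Graph n v e, Γ.IsICG → 1 ≤ Γ.loops → Ψ (dPart K n v e (cls K Γ)) = 0)
    (h : ∀ (Γ : Graph n (v + 1) (e + 1)) (y) (L : HairyChain n (v + 1) (e + 1)),
      (∀ f, ¬ (Γ f).IsDiag) → (Function.Injective Γ → Γ.IsICG) → HairyChain.LoopAt Γ y L →
      Ψ (cls K Γ) = ((sgn L.edges : ℤ) : K) • Φ (L.word K))
    (he : e = 2 * v + 1) (y : ICGPart K n v e) :
    Ψ (dPart K n v e y) = (1 / 2 : K) • Φ (treeDivergence K n v e y) := by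
  suffices H : Ψ ∘ₗ dPart K n v e = (1 / 2 : K) • (Φ ∘ₗ treeDivergence K n v e) from
    LinearMap.congr_fun H y
  refine linearMap_ext_cls fun Γ hΓ => ?_
  rw [LinearMap.comp_apply, LinearMap.smul_apply, LinearMap.comp_apply]
  by_cases hl : Γ.loops = 0
  · exact dPart_tree_eq Φ hΦ Ψ hΨ h ⟨hΓ, he, hl⟩
  · rw [hd Γ hΓ (by omega), treeDivergence_apply]
    simp only [treeSeries_cls_eq_zero fun h => hl h.2.2]
    have : divergenceSeries (fun _ => (0 : Ass K n)) = 0 := by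
      rw [divergenceSeries]
      refine Finset.sum_eq_zero fun j _ => ?_
      rw [← partialRightL_apply, map_zero, mul_zero]
    rw [this, map_zero, smul_zero]

/-- The antisymmetrized cyclic word of the one-loop part of a boundary is half the divergence. -/
theorem loopMap_dPart [CharZero K] (y : ICGPart K n v (2 * v + 1)) :
    loopMap K n _ _ (dPart K n v _ y) =
      (1 / 2 : K) • dihedralSum (treeDivergence K n v (2 * v + 1) y) :=
  dPart_eq dihedralSum dihedralSum_mul_comm _ (fun _ => loopMap_of_mem_filtrationPart)
    (fun _ hΓ => loopMap_dPart_of_loops hΓ rfl)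
    (fun Γ y L hd hi hL => by rw [loopMap_cls hd hi, hL.loopValue hd]; rfl) rfl y

theorem divergenceSeries_congr {a b : Fin n → Ass K n} {m : ℕ}
    (h : ∀ j w, w.length = m → a j w = b j w) {w : List (Fin n)} (hw : w.length = m) :
    divergenceSeries a w = divergenceSeries b w := by
  rw [divergenceSeries, divergenceSeries, Ass.sum_apply, Ass.sum_apply]
  refine Finset.sum_congr rfl fun j _ => ?_
  cases w with
  | nil => rw [X_mul_nil, X_mul_nil]
  | cons i w =>
    rw [X_mul_cons, X_mul_cons]
    split_ifs
    · rw [partialRight_apply, partialRight_apply, h _ _ (by simpa using hw)]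
    · rfl

theorem dihedralSum_congr {f g : Ass K n} {m : ℕ} (h : ∀ w, w.length = m → f w = g w)
    {w : List (Fin n)} (hw : w.length = m) : dihedralSum f w = dihedralSum g w := by
  rw [dihedralSum_apply, dihedralSum_apply, Ass.sub_apply, Ass.sub_apply]
  simp only [cycSum_apply, antipode_apply]
  congr 1 <;> refine Finset.sum_congr rfl fun k _ => ?_
  · rw [h _ (by simpa using hw)]
  · rw [h _ (by simpa using hw)]

/-- Only the antisymmetrized divergence can be read off the differential; for special derivations it
is twice the divergence, by `dihedralSum_divergenceSeries`. -/
theorem krvLevel_one_subset [CharZero K] : krvLevel K n 1 ⊆ krv K n := by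
  intro u hu
  obtain ⟨x, hx, hu⟩ := mem_krvLevel_iff.1 hu
  have hlie := totalSeries_mem_lie x
  have hdiv : dihedralSum (divergenceSeries (totalSeries x)) = 0 := by
    ext w
    rcases hw : w.length with - | v
    · rw [List.length_eq_zero_iff.1 hw]
      simp [dihedralSum_apply, Ass.sub_apply, cycSum_apply, Ass.zero_apply]
    · have h1 := loopMap_dPart (x v)
      rw [loopMap_of_mem_filtrationPart (hx v), treeDivergence_apply] at h1
      have h2 := (smul_eq_zero.1 h1.symm).resolve_left (by norm_num)
      rw [← h2]
      exact dihedralSum_congr (fun w hw => divergenceSeries_congr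
        (fun j w hw => totalSeries_apply x j hw) hw) hw
  rw [dihedralSum_divergenceSeries hlie (sum_X_lie_eq_zero u _ hu)] at hdiv
  refine ⟨fun i => ⟨totalSeries x i, hlie i⟩, fun i => Subtype.ext (hu i), fun i =>
    totalSeries_singleton x i, ?_⟩
  rw [divergence_eq_zero_iff]
  exact (smul_eq_zero.1 hdiv).resolve_left two_ne_zero

end KRV

namespace KRV

open Ass KRV.Graph

variable {K : Type*} [Field K] {n v e : ℕ}

/-! ### Graphs with one loop modulo boundaries -/

namespace Graph

variable {Γ : Graph n v e}

/-- A graph is admissible if it is sound and splitting one of its vertices may lead to an admissible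
graph. -/
theorem IsSound.isICG_of_split (h : Γ.IsSound) {a : Fin v} (U : Finset (Fin e)) {c : Fin e}
    (hc : .inr a ∈ Γ c) (hU : (Γ.split (.inr a) U).IsICG) : Γ.IsICG := by
  -- the new edge is contracted; in a chain of edges, it is replaced by the edge `c`
  have key : ∀ (f : Fin (e + 1)) (y : Vertex n (v + 1)), y ∈ Γ.split (.inr a) U f →
      y.map id (contract a) ∈ Γ (contract c f) := by
    intro f y hy
    by_cases hf : f = Fin.last e
    · subst hf
      rw [contract_last]
      rw [split_last, Sym2.mem_iff] at hy
      rcases hy with rfl | rfl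
      · simpa [old, contract_castSucc] using hc
      · simpa [new, contract_last] using hc
    · rw [split_contract Γ a U c hf]
      exact Sym2.mem_map.2 ⟨y, hy, rfl⟩
  refine ⟨h.1, fun i hi => ?_, h.2, fun b => ?_, (Nat.zero_le _).trans_lt c.2, fun i j => ?_⟩
  · refine hU.not_isDiag i.castSucc ?_
    rw [split_castSucc]
    generalize Γ i = p at hi
    induction p using Sym2.ind with
    | h y z =>
      obtain rfl : y = z := hi
      exact rfl
  · obtain ⟨j, hj⟩ := hU.reachable b.castSucc
    refine ⟨j, ?_⟩
    have : ∀ y z : Vertex n (v + 1), (Γ.split (.inr a) U).simple.Reachable y z →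
        Γ.simple.Reachable (y.map id (contract a)) (z.map id (contract a)) := by
      rintro y z ⟨p⟩
      induction p with
      | nil => exact .refl _
      | @cons y z w hyz _ ih =>
        refine .trans ?_ ih
        rw [simple, SimpleGraph.fromEdgeSet_adj] at hyz
        obtain ⟨⟨f, hf⟩, -⟩ := hyz
        by_cases hne : y.map id (contract a) = z.map id (contract a)
        · rw [hne]
        · refine SimpleGraph.Adj.reachable ?_
          rw [simple, SimpleGraph.fromEdgeSet_adj]
          refine ⟨⟨contract c f, ?_⟩, hne⟩
          exact (Sym2.mem_and_mem_iff hne).1 ⟨key f y (by simp [hf]), key f z (by simp [hf])⟩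
    simpa [contract_castSucc] using this _ _ hj
  · have := Relation.ReflTransGen.lift (p := Γ.ShareInternal) (contract c) (fun f g (hfg : ShareInternal _ f g) => ?_)
      _ _ (hU.connected i.castSucc j.castSucc)
    · simpa [Function.onFun, contract_castSucc] using this
    · obtain ⟨b, hf, hg⟩ := hfg
      exact ⟨contract a b, key f _ hf, key g _ hg⟩

/-- Modulo boundaries of graphs with loops and modulo two loops, the resolutions of a vertex of
valence `4` add up to zero. -/
theorem sum_cls_split_eq_zero [CharZero K] {M : Type*} [AddCommGroup M] [Module K M]
    (Ψ : ICGPart K n (v + 1) (e + 1) →ₗ[K] M)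
    (hΨ : ∀ y ∈ filtrationPart K 2 n (v + 1) (e + 1), Ψ y = 0)
    (hd : ∀ Γ : Graph n v e, Γ.IsICG → 1 ≤ Γ.loops → Ψ (dPart K n v e (cls K Γ)) = 0)
    (he : e = 2 * v + 1) {a : Fin v} (ha : (Γ.incident (.inr a)).card = 4)
    (hv : ∀ b ≠ a, (Γ.incident (.inr b)).card ≤ 3) :
    ∑ U ∈ (Γ.incident (.inr a)).powerset with U.card = 2, Ψ (cls K (Γ.split (.inr a) U)) = 0 := by
  by_cases hex : ∃ U, (Γ.split (.inr a) U).IsICG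
  swap
  · refine Finset.sum_eq_zero fun U _ => ?_
    rw [cls_of_not_isICG fun h => hex ⟨U, h⟩, map_zero]
  obtain ⟨U, hU⟩ := hex
  have hv3 : ∀ b ≠ a, (Γ.incident (.inr b)).card = 3 := by
    intro b hb
    have h1 := hU.trivalent b.castSucc
    have h2 := card_incident_split_old (Γ := Γ) (x := .inr a) (z := .inr b) (by simpa using hb) U
    change 3 ≤ ((Γ.split (.inr a) U).incident (old (.inr b))).card at h1
    exact le_antisymm (hv b hb) (h2 ▸ h1)
  have h1 := splitSum_of_quad Ψ hΨ he ha hv3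
  suffices h2 : Ψ (splitSum K Γ) = 0 from
    (smul_eq_zero.1 (h1.symm.trans h2)).resolve_left (by norm_num)
  by_cases hs : Γ.IsSound
  swap
  · rw [splitSum_eq_zero hs, map_zero]
  obtain ⟨c, hc⟩ := Finset.card_pos.1 (by omega : 0 < (Γ.incident (.inr a)).card)
  have hΓ := hs.isICG_of_split U (mem_incident.1 hc) hU
  rw [← dPart_cls hΓ]
  refine hd Γ hΓ ?_
  have h3 := hΓ.loops_add
  rw [← Finset.add_sum_erase _ _ (Finset.mem_univ a), ha,
    Finset.sum_congr rfl fun b hb => hv3 b (Finset.ne_of_mem_erase hb)] at h3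
  simp at h3
  have := a.2
  omega

end Graph

/-! #### The graph of a loop -/

theorem LTree.Fits.graph_eq {Γ Γ' : Graph n v e} {y : Vertex n v} {P : LTree n v e}
    (h : P.Fits Γ y) (h' : P.Fits Γ' y) {f : Fin e} (hf : f ∈ P.edges) : Γ f = Γ' f := by
  induction P generalizing y with
  | leaf r j =>
    obtain rfl : f = r := by simpa [edges_leaf] using hf
    exact h.trans (Eq.symm h')
  | node r a s t hs ht =>
    rw [edges_node, List.mem_cons, List.mem_append] at hf
    rcases hf with rfl | hf | hf
    · exact h.1.trans h'.1.symm
    · exact hs h.2.1 h'.2.1 hf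
    · exact ht h.2.2 h'.2.2 hf

namespace HairyChain

variable {Γ Γ' : Graph n v e} {y y' z z' : Vertex n v} {L : HairyChain n v e}

theorem Fits.end_eq (h : Fits Γ y L z) (h' : Fits Γ' y' L z') (hL : L ≠ []) : z = z' := by
  rcases List.eq_nil_or_concat L with rfl | ⟨N, ⟨c, b, k⟩, rfl⟩
  · exact absurd rfl hL
  · rw [List.concat_eq_append, fits_append] at h h'
    obtain ⟨_, -, h⟩ := h
    obtain ⟨_, -, h'⟩ := h'
    exact Eq.trans h.2.2.symm h'.2.2

theorem Fits.graph_eq (h : Fits Γ y L z) (h' : Fits Γ' y L z') {f : Fin e} (hf : f ∈ edges L) :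
    Γ f = Γ' f := by
  induction L generalizing y with
  | nil => simp [edges_nil] at hf
  | cons q L ih =>
    obtain ⟨c, a, k⟩ := q
    rw [edges_cons, List.mem_cons, List.mem_append] at hf
    rcases hf with rfl | hf | hf
    · exact h.1.trans h'.1.symm
    · exact h.2.1.graph_eq h'.2.1 hf
    · exact ih h.2.2 h'.2.2 hf

/-- A chain which is closed up to a loop determines the graph. -/
theorem LoopAt.graph_eq (h : LoopAt Γ y L) (h' : LoopAt Γ' y' L) : Γ = Γ' := by
  funext f
  have hL : L ≠ [] := by
    rintro rfl
    exact List.not_mem_nil (h.mem_edges f)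
  obtain rfl := h.fits.end_eq h'.fits hL
  exact h.fits.graph_eq h'.fits (h.mem_edges f)

end HairyChain

theorem LTree.lift_map_contract (c : Fin e) (a : Fin v) {P : LTree n (v + 1) (e + 1)}
    (h1 : Fin.last e ∉ P.edges) (h2 : Fin.last v ∉ P.verts) :
    (P.map (contract c) (contract a)).lift = P := by
  have key : ∀ {m : ℕ} (a : Fin m) {i : Fin (m + 1)}, Fin.last m ≠ i →
      (contract a i).castSucc = i := by
    intro m a i hi
    obtain ⟨i, rfl⟩ := Fin.exists_castSucc_eq.2 hi.symm
    rw [contract_castSucc]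
  induction P with
  | leaf r j => simp only [lift, map, key c (by simpa [edges_leaf] using h1)]
  | node r b s t hs ht =>
    simp only [edges_node, verts, List.mem_cons, List.mem_append, not_or] at h1 h2
    have hs' := hs h1.2.1 h2.2.1
    have ht' := ht h1.2.2 h2.2.2
    simp only [lift, map] at hs' ht' ⊢
    rw [key c h1.1, key a h2.1, hs', ht']

theorem HairyChain.lift_relabel_contract (c : Fin e) (a : Fin v)
    {L : HairyChain n (v + 1) (e + 1)} (h1 : Fin.last e ∉ edges L) (h2 : Fin.last v ∉ verts L) :
    HairyChain.lift (L.relabel (contract c) (contract a)) = L := by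
  induction L with
  | nil => rfl
  | cons q L ih =>
    obtain ⟨d, b, h⟩ := q
    simp only [edges_cons, verts_cons, List.mem_cons, List.mem_append, not_or] at h1 h2
    obtain ⟨d, rfl⟩ := Fin.exists_castSucc_eq.2 (Ne.symm h1.1)
    obtain ⟨b, rfl⟩ := Fin.exists_castSucc_eq.2 (Ne.symm h2.1)
    have h3 := LTree.lift_map_contract c a h1.2.1 h2.2.1
    have h4 := ih h1.2.2 h2.2.2
    simp only [HairyChain.lift, LTree.lift, relabel, List.map_cons, contract_castSucc] at h3 h4 ⊢
    rw [h3, h4]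

/-- A loop one of whose hairs begins with a node arises by splitting a vertex with two hairs. -/
theorem HairyChain.LoopAt.exists_quadLoop {Γ : Graph n (v + 1) (e + 1)} {y : Vertex n (v + 1)}
    {c : Fin (e + 1)} {a : Fin (v + 1)} {S T : LTree n (v + 1) (e + 1)}
    {B : HairyChain n (v + 1) (e + 1)}
    (h : LoopAt Γ y ((c, a, .node (Fin.last e) (Fin.last v) S T) :: B)) :
    ∃ (Γ₀ : Graph n v e) (y₀ : Vertex n v) (c₀ : Fin e) (a₀ : Fin v) (S₀ T₀ : LTree n v e)
      (B₀ : HairyChain n v e), QuadLoop Γ₀ y₀ c₀ a₀ S₀ T₀ B₀ ∧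
      Γ = Γ₀.split (.inr a₀) {S₀.root, T₀.root} ∧ c = c₀.castSucc ∧ a = a₀.castSucc ∧
      S = S₀.lift ∧ T = T₀.lift ∧ B = HairyChain.lift B₀ := by
  have he := h.edges_nodup
  have hv := h.verts_nodup
  have he' := h.mem_edges
  have hv' := h.mem_verts
  simp only [edges_cons, verts_cons, LTree.edges_node, LTree.verts, List.cons_append,
    List.append_assoc] at he hv he' hv'
  have e1 := (List.Perm.swap c (Fin.last e) _).nodup_iff.2 he
  have v1 := (List.Perm.swap a (Fin.last v) _).nodup_iff.2 hv
  have e2 := fun f => (List.Perm.swap c (Fin.last e) _).mem_iff.2 (he' f)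
  have v2 := fun f => (List.Perm.swap a (Fin.last v) _).mem_iff.2 (hv' f)
  obtain ⟨c, rfl⟩ := Fin.exists_castSucc_eq.2 (show c ≠ Fin.last e by rintro rfl; simp at e1)
  obtain ⟨a, rfl⟩ := Fin.exists_castSucc_eq.2 (show a ≠ Fin.last v by rintro rfl; simp at v1)
  obtain ⟨E1, E2⟩ := nodup_map_contract c e1 e2
  obtain ⟨V1, V2⟩ := nodup_map_contract a v1 v2
  have e3 := (List.nodup_cons.1 e1).1
  have v3 := (List.nodup_cons.1 v1).1
  simp only [List.mem_cons, List.mem_append, not_or] at e3 v3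
  let Γ₀ : Graph n v e := fun i => (Γ i.castSucc).map (Sum.map id (contract a))
  have key : ∀ f ≠ Fin.last e, Γ₀ (contract c f) = (Γ f).map (Sum.map id (contract a)) := by
    intro f hf
    obtain ⟨f, rfl⟩ := Fin.exists_castSucc_eq.2 hf
    rw [contract_castSucc]
  have hq : QuadLoop Γ₀ (y.map id (contract a)) c a (S.map (contract c) (contract a))
      (T.map (contract c) (contract a)) (B.relabel (contract c) (contract a)) := by
    obtain ⟨h1, ⟨-, h2, h3⟩, h4⟩ := h.fits
    have h5 := fun (h : Fin.last e ∉ S.edges) => h2.map (contract c) (contract a)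
      fun f hf => key f fun hfe => h (hfe ▸ hf)
    have h6 := fun (h : Fin.last e ∉ T.edges) => h3.map (contract c) (contract a)
      fun f hf => key f fun hfe => h (hfe ▸ hf)
    have h7 := fun (h : Fin.last e ∉ edges B) => h4.relabel (contract c) (contract a)
      fun f hf => key f fun hfe => h (hfe ▸ hf)
    simp only [Sum.map_inr, contract_last, contract_castSucc] at h5 h6 h7
    refine ⟨?_, h5 e3.2.1, h6 e3.2.2.1, h7 e3.2.2.2, ?_, ?_, ?_, ?_⟩
    · change (Γ c.castSucc).map _ = _
      rw [h1, Sym2.map_mk, Sum.map_inr, contract_castSucc]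
    · simpa [LTree.edges_map, edges_relabel, contract_castSucc] using E1
    · simpa [LTree.edges_map, edges_relabel, contract_castSucc] using E2
    · simpa [LTree.verts_map, verts_relabel, contract_castSucc] using V1
    · simpa [LTree.verts_map, verts_relabel, contract_castSucc] using V2
  have hS := LTree.lift_map_contract c a e3.2.1 v3.2.1
  have hT := LTree.lift_map_contract c a e3.2.2.1 v3.2.2.1
  have hB := HairyChain.lift_relabel_contract c a e3.2.2.2 v3.2.2.2
  have hl := hq.loopAt_node
  rw [hS, hT, hB] at hl
  exact ⟨Γ₀, _, c, a, _, _, _, hq, h.graph_eq hl, rfl, rfl, hS.symm, hT.symm, hB.symm⟩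

end KRV

namespace KRV

open Ass KRV.Graph

variable {K : Type*} [Field K] {n v e : ℕ}

/-! ### The graph of a cyclic word -/

namespace HairyChain

/-- A chain of vertices with single edges as hairs. An entry `(c, a, r, j)` is a hair `r` that joins
`a` and the external vertex `j`. -/
def leafy (D : List (Fin e × Fin v × Fin e × Fin n)) : HairyChain n v e :=
  List.map (fun q => (q.1, q.2.1, .leaf q.2.2.1 q.2.2.2)) D

/-- The labels of the hairs. -/
def labels (D : List (Fin e × Fin v × Fin e × Fin n)) : List (Fin n) := D.map fun q => q.2.2.2

theorem word_leafy_apply (D : List (Fin e × Fin v × Fin e × Fin n)) (w : List (Fin n)) :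
    word K (leafy D) w = if w = labels D then 1 else 0 := by
  induction D generalizing w with
  | nil => rfl
  | cons q D ih =>
    obtain ⟨c, a, r, j⟩ := q
    change (X j * word K (leafy D) : Ass K n) w = _
    cases w with
    | nil => rw [X_mul_nil]; simp [labels]
    | cons i w =>
      rw [X_mul_cons, ih]
      simp only [labels, List.map_cons, List.cons.injEq]
      split_ifs <;> simp_all

theorem leafy_append (D D' : List (Fin e × Fin v × Fin e × Fin n)) :
    leafy (D ++ D') = leafy D ++ leafy D' := List.map_append

theorem labels_append (D D' : List (Fin e × Fin v × Fin e × Fin n)) :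
    labels (D ++ D') = labels D ++ labels D' := List.map_append

theorem relabel_leafy {v' e' : ℕ} {σ : Fin e → Fin e'} {τ : Fin v → Fin v'}
    {D : List (Fin e × Fin v × Fin e × Fin n)} {D' : List (Fin e' × Fin v' × Fin e' × Fin n)}
    (h1 : (edges (leafy D)).map σ = edges (leafy D')) (h2 : (verts (leafy D)).map τ = verts (leafy D'))
    (h3 : labels D = labels D') : (leafy D).relabel σ τ = leafy D' := by
  induction D generalizing D' with
  | nil =>
    cases D' with
    | nil => rfl
    | cons q D' => simp [labels] at h3
  | cons q D ih =>
    cases D' with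
    | nil => simp [labels] at h3
    | cons q' D' =>
      obtain ⟨c, a, r, j⟩ := q
      obtain ⟨c', a', r', j'⟩ := q'
      simp only [leafy, labels, List.map_cons, edges_cons, verts_cons, LTree.edges_leaf, LTree.verts,
        List.cons_append, List.nil_append, List.cons.injEq] at h1 h2 h3
      have := ih h1.2.2 h2.2 h3.2
      simp only [leafy, relabel, List.map_cons, LTree.map] at this ⊢
      rw [this, h1.1, h1.2.1, h2.1, h3.1]

/-- Two lists of all elements without repetitions differ by a permutation. -/
theorem exists_perm_map_eq {m : ℕ} {E E' : List (Fin m)} (h1 : E.Nodup) (h2 : ∀ f, f ∈ E)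
    (h1' : E'.Nodup) (h2' : ∀ f, f ∈ E') : ∃ σ : Equiv.Perm (Fin m), E.map σ = E' := by
  have hl := (length_of_nodup h1 h2).trans (length_of_nodup h1' h2').symm
  refine ⟨(h1.getEquivOfForallMemList E h2).symm.trans
    ((finCongr hl).trans (h1'.getEquivOfForallMemList E' h2')), ?_⟩
  refine List.ext_getElem (by simpa using hl) fun i hi hi' => ?_
  rw [List.getElem_map]
  have : (h1.getEquivOfForallMemList E h2).symm E[i] = ⟨i, by simpa using hi⟩ := by
    rw [Equiv.symm_apply_eq]; rfl
  rw [Equiv.trans_apply, this]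
  rfl

/-- A loop with single edges as hairs is determined by the labels of the hairs. -/
theorem LoopAt.cls_leafy {Γ Γ' : Graph n v e} {y y' : Vertex n v}
    {D D' : List (Fin e × Fin v × Fin e × Fin n)} (h : LoopAt Γ y (leafy D))
    (h' : LoopAt Γ' y' (leafy D')) (hD : labels D = labels D') :
    ((sgn (edges (leafy D)) : ℤ) : K) • cls K Γ = ((sgn (edges (leafy D')) : ℤ) : K) • cls K Γ' := by
  obtain ⟨σ, hσ⟩ := exists_perm_map_eq h.edges_nodup h.mem_edges h'.edges_nodup h'.mem_edges
  obtain ⟨τ, hτ⟩ := exists_perm_map_eq h.verts_nodup h.mem_verts h'.verts_nodup h'.mem_verts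
  have h1 := h.relabel σ.symm τ
  rw [Equiv.symm_symm, relabel_leafy hσ hτ hD] at h1
  rw [← h1.graph_eq h', cls_relabel, ← hσ, sgn_map_perm σ h.mem_edges, smul_smul, Equiv.Perm.sign_symm]
  congr 1
  have : ((Equiv.Perm.sign σ : ℤ) : K) * ((Equiv.Perm.sign σ : ℤ) : K) = 1 := by
    rw [← Int.cast_mul, ← Units.val_mul, Int.units_mul_self, Units.val_one, Int.cast_one]
  push_cast
  linear_combination (-(sgn (edges (leafy D)) : K)) * this

open Classical in
/-- The class of the graph that consists of a loop with single edges as hairs, which end in the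
letters of the word `w`. -/
noncomputable def wordClass (K : Type*) [Field K] (v e : ℕ) (w : List (Fin n)) : ICGPart K n v e :=
  if h : ∃ (Γ : Graph n v e) (y : Vertex n v) (D : List (Fin e × Fin v × Fin e × Fin n)),
    LoopAt Γ y (leafy D) ∧ labels D = w
  then ((sgn (edges (leafy h.choose_spec.choose_spec.choose)) : ℤ) : K) • cls K h.choose else 0

theorem LoopAt.wordClass {Γ : Graph n v e} {y : Vertex n v}
    {D : List (Fin e × Fin v × Fin e × Fin n)} (h : LoopAt Γ y (leafy D)) :
    wordClass K v e (labels D) = ((sgn (edges (leafy D)) : ℤ) : K) • cls K Γ := by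
  have H : ∃ (Γ : Graph n v e) (y : Vertex n v) (D' : List (Fin e × Fin v × Fin e × Fin n)),
    LoopAt Γ y (leafy D') ∧ labels D' = labels D := ⟨Γ, y, D, h, rfl⟩
  rw [HairyChain.wordClass, dif_pos H]
  exact H.choose_spec.choose_spec.choose_spec.1.cls_leafy h
    H.choose_spec.choose_spec.choose_spec.2

/-- The class of a loop does not depend on the vertex at which reading it begins: two edges belong
to every vertex, so moving a block of them is even. -/
theorem wordClass_append (w w' : List (Fin n)) :
    wordClass K v e (w ++ w') = wordClass K v e (w' ++ w) := by
  have key : ∀ w w' : List (Fin n), (∃ (Γ : Graph n v e) (y : Vertex n v)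
      (D : List (Fin e × Fin v × Fin e × Fin n)), LoopAt Γ y (leafy D) ∧ labels D = w ++ w') →
      wordClass K v e (w ++ w') = wordClass K v e (w' ++ w) ∧
      ∃ (Γ : Graph n v e) (y : Vertex n v) (D : List (Fin e × Fin v × Fin e × Fin n)),
        LoopAt Γ y (leafy D) ∧ labels D = w' ++ w := by
    rintro w w' ⟨Γ, y, D, h, hD⟩
    obtain ⟨A, B, rfl, rfl, rfl⟩ := List.map_eq_append_iff.1 hD
    rw [leafy_append] at h
    obtain ⟨z, hz⟩ := h.rotate
    rw [← leafy_append] at h hz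
    have h1 := h.wordClass (K := K)
    have h2 := hz.wordClass (K := K)
    rw [labels_append] at h1 h2
    refine ⟨h1.trans (Eq.trans ?_ h2.symm), Γ, z, _, hz, labels_append _ _⟩
    rw [leafy_append, leafy_append, edges_append, edges_append,
      (signRel_swap_of_even ((even_edges (leafy A)).mul_right _)).sgn_eq, one_mul]
  by_cases h : ∃ (Γ : Graph n v e) (y : Vertex n v)
      (D : List (Fin e × Fin v × Fin e × Fin n)), LoopAt Γ y (leafy D) ∧ labels D = w ++ w'
  · exact (key w w' h).1
  · rw [wordClass, dif_neg h, wordClass, dif_neg fun h' => h (key w' w h').2]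

theorem wordClass_rotate (w : List (Fin n)) (i : ℕ) :
    wordClass K v e (w.rotate i) = wordClass K v e w := by
  induction i with
  | zero => rw [List.rotate_zero]
  | succ i ih =>
    rw [← List.rotate_rotate, ← ih]
    cases w.rotate i with
    | nil => rfl
    | cons a u =>
      rw [List.rotate_cons_succ, List.rotate_zero, wordClass_append]
      rfl

variable {M : Type*} [AddCommGroup M] [Module K M] (Ψ : ICGPart K n v e →ₗ[K] M)

noncomputable instance : Fintype {w : List (Fin n) // w.length = v} :=
  inferInstanceAs (Fintype (List.Vector (Fin n) v))

/-- The linear extension of `wordClass`, to the homogeneous part of degree `v`. -/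
noncomputable def wordMap : Ass K n →ₗ[K] M where
  toFun f := ∑ w : {w : List (Fin n) // w.length = v}, f w.1 • Ψ (wordClass K v e w.1)
  map_add' f g := by simp only [Ass.add_apply, add_smul, Finset.sum_add_distrib]
  map_smul' c f := by simp only [Ass.smul_apply, mul_smul, Finset.smul_sum, RingHom.id_apply]

theorem wordMap_apply (f : Ass K n) :
    wordMap Ψ f = ∑ w : {w : List (Fin n) // w.length = v}, f w.1 • Ψ (wordClass K v e w.1) := rfl

/-- The map `wordMap` factors over cyclic words. -/
theorem smul_wordMap (f : Ass K n) : (v : K) • wordMap Ψ f =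
    ∑ w : {w : List (Fin n) // w.length = v}, cycSum f w.1 • Ψ (wordClass K v e w.1) := by
  have key : ∀ i : ℕ, wordMap Ψ f =
      ∑ w : {w : List (Fin n) // w.length = v}, f (w.1.rotate i) • Ψ (wordClass K v e w.1) := by
    intro i
    let r : {w : List (Fin n) // w.length = v} → {w : List (Fin n) // w.length = v} := fun w =>
      ⟨w.1.rotate i, by rw [List.length_rotate]; exact w.2⟩
    have hr : Function.Bijective r := Finite.injective_iff_bijective.1 fun w w' h =>
      Subtype.ext (List.rotate_injective i (congrArg Subtype.val h))
    rw [wordMap_apply, ← hr.sum_comp]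
    exact Finset.sum_congr rfl fun w _ => by rw [wordClass_rotate]
  have h2 : ∀ w : {w : List (Fin n) // w.length = v}, cycSum f w.1 • Ψ (wordClass K v e w.1) =
      ∑ i ∈ Finset.range v, f (w.1.rotate i) • Ψ (wordClass K v e w.1) := by
    intro w
    rw [cycSum_apply, Finset.sum_smul, w.2]
  rw [Finset.sum_congr rfl fun w _ => h2 w, Finset.sum_comm,
    Finset.sum_congr rfl fun i _ => (key i).symm, Finset.sum_const, Finset.card_range,
    Nat.cast_smul_eq_nsmul]

theorem wordMap_eq_zero [CharZero K] (hv : v ≠ 0) {f : Ass K n}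
    (hf : ∀ w, w.length = v → cycSum f w = 0) : wordMap Ψ f = 0 := by
  refine (smul_eq_zero.1 ((smul_wordMap Ψ f).trans (Finset.sum_eq_zero fun w _ => ?_))).resolve_left
    (Nat.cast_ne_zero.2 hv)
  rw [hf _ w.2, zero_smul]

theorem wordMap_mul_comm [CharZero K] (hv : v ≠ 0) (f g : Ass K n) :
    wordMap Ψ (f * g) = wordMap Ψ (g * f) := by
  rw [← sub_eq_zero, ← map_sub]
  refine wordMap_eq_zero Ψ hv fun w _ => ?_
  rw [map_sub, cycSum_mul_comm, sub_self, Ass.zero_apply]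

theorem length_verts_leafy (D : List (Fin e × Fin v × Fin e × Fin n)) :
    (verts (leafy D)).length = (labels D).length := by
  induction D with
  | nil => rfl
  | cons q D ih =>
    obtain ⟨c, a, r, j⟩ := q
    change (verts ((c, a, .leaf r j) :: leafy D)).length = (j :: labels D).length
    rw [verts_cons, LTree.verts, List.nil_append, List.length_cons, ih, List.length_cons]

theorem LoopAt.wordMap_leafy {Γ : Graph n v e} {y : Vertex n v}
    {D : List (Fin e × Fin v × Fin e × Fin n)} (h : LoopAt Γ y (leafy D)) :
    wordMap Ψ (word K (leafy D)) = ((sgn (edges (leafy D)) : ℤ) : K) • Ψ (cls K Γ) := by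
  have hl : (labels D).length = v := by
    rw [← length_verts_leafy, length_of_nodup h.verts_nodup h.mem_verts]
  rw [wordMap_apply, Finset.sum_eq_single (⟨labels D, hl⟩ : {w : List (Fin n) // w.length = v})]
  · rw [word_leafy_apply, if_pos rfl, one_smul, h.wordClass, map_smul]
  · intro w _ hw
    rw [word_leafy_apply, if_neg fun h => hw (Subtype.ext h), zero_smul]
  · exact fun h => absurd (Finset.mem_univ _) h

/-- A chain of hairs either has single edges as hairs only, or one of the hairs begins with a
node. -/
theorem exists_leafy_or_node (L : HairyChain n v e) : (∃ D, L = leafy D) ∨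
    ∃ A B c a f b S T, L = A ++ (c, a, .node f b S T) :: B := by
  induction L with
  | nil => exact Or.inl ⟨[], rfl⟩
  | cons q L ih =>
    obtain ⟨c, a, h⟩ := q
    cases h with
    | node f b S T => exact Or.inr ⟨[], L, c, a, f, b, S, T, rfl⟩
    | leaf r j =>
      rcases ih with ⟨D, rfl⟩ | ⟨A, B, c', a', f, b, S, T, rfl⟩
      · exact Or.inl ⟨(c, a, r, j) :: D, rfl⟩
      · exact Or.inr ⟨_ :: A, B, c', a', f, b, S, T, rfl⟩

theorem length_le_verts (L : HairyChain n v e) : L.length ≤ (verts L).length := by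
  induction L with
  | nil => exact le_rfl
  | cons q L ih =>
    obtain ⟨c, a, h⟩ := q
    rw [verts_cons, List.length_cons, List.length_cons, List.length_append]
    omega

end HairyChain

open HairyChain in
/-- Modulo boundaries of graphs with loops and modulo two loops, a graph with one loop is determined
by its cyclic word: hairs which begin with a node are resolved by means of the IHX relation. -/
theorem HairyChain.LoopAt.map_cls_eq [CharZero K] {M : Type*} [AddCommGroup M] [Module K M]
    (Ψ : ICGPart K n (v + 1) (e + 1) →ₗ[K] M)
    (hΨ : ∀ y ∈ filtrationPart K 2 n (v + 1) (e + 1), Ψ y = 0)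
    (hd : ∀ Γ : Graph n v e, Γ.IsICG → 1 ≤ Γ.loops → Ψ (dPart K n v e (cls K Γ)) = 0)
    {Γ : Graph n (v + 1) (e + 1)} {y : Vertex n (v + 1)} {L : HairyChain n (v + 1) (e + 1)}
    (h : LoopAt Γ y L) :
    Ψ (cls K Γ) = ((sgn (edges L) : ℤ) : K) • wordMap Ψ (word K L) := by
  have hΦ := wordMap_mul_comm Ψ v.succ_ne_zero
  induction hm : v + 1 - L.length using Nat.strong_induction_on generalizing Γ y L with
  | _ m ih =>
  rcases exists_leafy_or_node L with ⟨D, rfl⟩ | ⟨A, B, c, a, f, b, S, T, rfl⟩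
  · have hsq : ((sgn (edges (leafy D)) : ℤ) : K) * ((sgn (edges (leafy D)) : ℤ) : K) = 1 := by
      rw [← Int.cast_mul, sgn_of_nodup h.edges_nodup, LTree.listSign_mul_self, Int.cast_one]
    rw [h.wordMap_leafy, smul_smul, hsq, one_smul]
  -- the hair that begins with a node becomes the first one, and the node and its root the last ones
  obtain ⟨z, hz⟩ := h.rotate
  rw [List.cons_append] at hz
  have hlen : (A ++ (c, a, LTree.node f b S T) :: B).length = (B ++ A).length + 1 := by
    simp only [List.length_append, List.length_cons]; omega
  rw [hlen] at hm
  rw [edges_append, word_append, hΦ, ← word_append, List.cons_append,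
    (signRel_swap_of_even ((even_edges A).mul_right _)).sgn_eq, one_mul, ← edges_append,
    List.cons_append]
  clear h hlen
  generalize B ++ A = B at hz hm
  clear A y
  have h := hz.relabel (Equiv.swap f (Fin.last e)) (Equiv.swap b (Fin.last v))
  suffices H : Ψ (cls K (Γ.relabel (Equiv.swap f (Fin.last e)) (Equiv.swap b (Fin.last v)))) =
      ((sgn (edges (HairyChain.relabel (Equiv.swap f (Fin.last e)).symm
        (Equiv.swap b (Fin.last v)) ((c, a, .node f b S T) :: B))) : ℤ) : K) •
      wordMap Ψ (word K (HairyChain.relabel (Equiv.swap f (Fin.last e)).symm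
        (Equiv.swap b (Fin.last v)) ((c, a, .node f b S T) :: B))) by
    rw [edges_relabel, sgn_map_perm _ hz.mem_edges, word_relabel, cls_relabel, map_smul,
      Equiv.Perm.sign_symm, Int.cast_mul, mul_smul] at H
    exact smul_right_injective M (Int.cast_ne_zero.2 (Units.ne_zero _)) H
  have hlen : (HairyChain.relabel (Equiv.swap f (Fin.last e)).symm
      (Equiv.swap b (Fin.last v)) B).length = B.length := List.length_map _
  rw [← hlen] at hm
  simp only [HairyChain.relabel, List.map_cons, LTree.map, Equiv.symm_swap,
    Equiv.swap_apply_left] at h hm ⊢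
  generalize Γ.relabel (Equiv.swap f (Fin.last e)) (Equiv.swap b (Fin.last v)) = Γ at h ⊢
  obtain ⟨Γ₀, y₀, c₀, a₀, S₀, T₀, B₀, hq, rfl, hc, ha, hS, hT, hB⟩ := h.exists_quadLoop
  rw [hc, ha, hS, hT, hB] at h ⊢
  rw [hB] at hm
  clear hc ha hS hT hB hz hlen
  cases B₀ with
  | nil =>
    -- the loop consists of a single edge, and the word is a commutator
    rw [cls_of_not_isICG fun hi => hi.not_isDiag c₀.castSucc ?_, map_zero, word_cons]
    · rw [show word K (HairyChain.lift ([] : HairyChain n v e)) = 1 from rfl, mul_one, LTree.lw,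
        LieRing.of_associative_ring_bracket, map_sub, hΦ, sub_self, smul_zero]
    · rw [h.fits.1, Sym2.mk_isDiag_iff]
      exact Eq.symm h.fits.2.2
  | cons q B₀ =>
    obtain ⟨d, b', A'⟩ := q
    have hcard : (Γ₀.incident (.inr a₀)).card = 4 := by
      have he := hq.edges_nodup
      rw [LTree.edges_eq S₀, LTree.edges_eq T₀, edges_cons] at he
      simp only [List.nodup_cons, List.nodup_append, List.mem_append, List.mem_cons, not_or,
        List.cons_append] at he
      rw [hq.incident_eq, Finset.card_insert_of_notMem, Finset.card_insert_of_notMem,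
        Finset.card_pair] <;> grind
    have hval : ∀ b ≠ a₀, (Γ₀.incident (.inr b)).card ≤ 3 := by
      intro b hb
      rw [← card_incident_split_old (x := .inr a₀) (by simpa using hb) {S₀.root, T₀.root}]
      exact h.valence_le b.castSucc
    have he : e = 2 * v + 1 := by have := h.edges_eq; omega
    have h0 := sum_cls_split_eq_zero Ψ hΨ hd he hcard hval
    rw [hq.sum_eq fun U _ => by rw [cls_split_compl a₀ U]] at h0
    rw [← Nat.cast_smul_eq_nsmul K] at h0
    replace h0 := (smul_eq_zero.1 h0).resolve_left (Nat.cast_ne_zero.2 two_ne_zero)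
    have hlt : ∀ {Γ : Graph n (v + 1) (e + 1)} {y : Vertex n (v + 1)}
        {p q : Fin (e + 1) × Fin (v + 1) × LTree n (v + 1) (e + 1)},
        LoopAt Γ y (p :: q :: HairyChain.lift ((d, b', A') :: B₀)) →
        v + 1 - (p :: q :: HairyChain.lift ((d, b', A') :: B₀)).length < m := by
      intro Γ y p q hL
      have h3 := length_le_verts (p :: q :: HairyChain.lift ((d, b', A') :: B₀))
      rw [length_of_nodup hL.verts_nodup hL.mem_verts] at h3
      simp only [List.length_cons] at h3 hm ⊢
      omega
    rw [ih _ (hlt hq.loopAt_cons) hq.loopAt_cons rfl,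
      ih _ (hlt hq.swap.loopAt_cons) hq.swap.loopAt_cons rfl] at h0
    have h1 := ihx_loop (wordMap Ψ) c₀.castSucc (Fin.last e) a₀.castSucc a₀.castSucc (Fin.last v)
      (Fin.last v) S₀.lift T₀.lift (HairyChain.lift ((d, b', A') :: B₀))
    rw [← h1] at h0
    exact add_right_cancel (add_right_cancel h0)

end KRV

namespace KRV

open Ass KRV.Graph

variable {K : Type*} [Field K] {n v e : ℕ}

/-! ### Every special derivation comes from trees -/

theorem LTree.exists_fits (P : LTree n v e) (h : P.edges.Nodup) (y : Vertex n v) :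
    ∃ Γ : Graph n v e, P.Fits Γ y := by
  induction P generalizing y with
  | leaf r j => exact ⟨fun _ => s(y, .inl j), rfl⟩
  | node r a s t hs ht =>
    rw [edges_node, List.nodup_cons, List.mem_append, not_or, List.nodup_append] at h
    obtain ⟨Γ, h1⟩ := hs h.2.1 (.inr a)
    obtain ⟨Γ', h2⟩ := ht h.2.2.1 (.inr a)
    refine ⟨fun f => if f = r then s(y, .inr a) else if f ∈ s.edges then Γ f else Γ' f,
      if_pos rfl, h1.congr fun f hf => ?_, h2.congr fun f hf => ?_⟩
    · rw [if_neg fun h' : f = r => h.1.1 (h' ▸ hf), if_pos hf]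
    · rw [if_neg fun h' : f = r => h.1.2 (h' ▸ hf), if_neg fun h' => h.2.2.2 f h' f hf rfl]

/-- The span of the Lie words of the binary trees with `v` nodes. -/
def treeWords (K : Type*) [Field K] (n v : ℕ) : Submodule K (Ass K n) :=
  Submodule.span K {f | ∃ P : LTree n v (2 * v + 1), P.edges.Nodup ∧ (∀ f, f ∈ P.edges) ∧
    P.verts.Nodup ∧ (∀ a, a ∈ P.verts) ∧ P.lw K = f}

theorem X_mem_treeWords (j : Fin n) : (X j : Ass K n) ∈ treeWords K n 0 :=
  Submodule.subset_span ⟨.leaf 0 j, List.nodup_singleton _, fun f =>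
    List.mem_singleton.2 (Subsingleton.elim (α := Fin 1) f 0), List.nodup_nil, fun a => a.elim0, rfl⟩

theorem lie_X_mem_treeWords (j : Fin n) {f : Ass K n} (hf : f ∈ treeWords K n v) :
    ⁅(X j : Ass K n), f⁆ ∈ treeWords K n (v + 1) := by
  induction hf using Submodule.span_induction with
  | zero => rw [lie_zero]; exact zero_mem _
  | add f g _ _ hf hg => rw [lie_add]; exact add_mem hf hg
  | smul c f _ hf => rw [lie_smul]; exact Submodule.smul_mem _ _ hf
  | mem f hf =>
    obtain ⟨P, h1, h2, h3, h4, rfl⟩ := hf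
    have e1 := mem_of_map_castSucc (List.Perm.refl _) h1 h2
    obtain ⟨E1, E2⟩ := mem_of_map_castSucc (List.Perm.refl _) e1.1 e1.2
    obtain ⟨V1, V2⟩ := mem_of_map_castSucc (List.Perm.refl _) h3 h4
    let Q : LTree n (v + 1) (2 * v + 1 + 1 + 1) := .node (Fin.last _) (Fin.last _)
      (.leaf (Fin.last _).castSucc j) (P.map (fun f => f.castSucc.castSucc) Fin.castSucc)
    have hE : Q.edges = Fin.last _ :: (Fin.last _ :: P.edges.map Fin.castSucc).map Fin.castSucc := by
      simp [Q, LTree.edges_node, LTree.edges_leaf, LTree.edges_map, Function.comp_def]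
    have hV : Q.verts = Fin.last _ :: P.verts.map Fin.castSucc := by
      simp [Q, LTree.verts, LTree.verts_map]
    rw [← hE] at E1 E2
    rw [← hV] at V1 V2
    exact Submodule.subset_span ⟨Q, E1, E2, V1, V2, by rw [LTree.lw, LTree.lw, LTree.lw_map]⟩

theorem adop_mem_treeWords {f : Ass K n} (hf : ∀ w, w.length ≠ v → f w = 0) (j : Fin n) :
    adop f (X j) ∈ treeWords K n v := by
  induction v generalizing f with
  | zero =>
    have : f = f [] • 1 := by
      ext w
      rw [Ass.smul_apply, one_apply]
      split_ifs with h
      · rw [h, mul_one]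
      · rw [hf w (by simpa using h), mul_zero]
    rw [this, adop_smul_left, adop_one]
    exact Submodule.smul_mem _ _ (X_mem_treeWords j)
  | succ v ih =>
    rw [adop_expand, hf [] (by simp), zero_smul, zero_add]
    refine sum_mem fun i _ => lie_X_mem_treeWords i (ih fun w hw => ?_)
    rw [shift_apply]
    exact hf _ (by simpa using hw)

/-- By the Euler relation every homogeneous Lie series is a combination of iterated brackets of
letters. -/
theorem mem_treeWords [CharZero K] {f : Ass K n} (hl : f ∈ lie K n)
    (hf : ∀ w, w.length ≠ v + 1 → f w = 0) : f ∈ treeWords K n v := by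
  have h : ((v : K) + 1) • f = ∑ j, adop (partialRight j f) (X j) := by
    rw [← euler_of_mem_lie hl]
    ext w
    rw [Ass.smul_apply, euler_apply]
    by_cases hw : w.length = v + 1
    · rw [hw]; push_cast; rfl
    · rw [hf w hw, mul_zero, mul_zero]
  rw [← Submodule.smul_mem_iff _ (Nat.cast_add_one_ne_zero (R := K) v), h]
  refine sum_mem fun j _ => adop_mem_treeWords (fun w hw => ?_) j
  rw [partialRight_apply]
  exact hf _ (by simpa using hw)

/-- Trees with root at `i` realize all Lie polynomials, except that a single edge cannot join `i`
with itself. -/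
theorem exists_treeSeries_eq_graft [CharZero K] (i : Fin n) {c : Ass K n} (hl : c ∈ lie K n)
    (hc : ∀ w, w.length ≠ v + 1 → c w = 0) (hi : c [i] = 0) :
    ∃ y : ICGPart K n v (2 * v + 1), ∀ j, treeSeries K n v _ j y = graft K j i c := by
  have hadd : ∀ f g : Ass K n,
      (∃ y : ICGPart K n v (2 * v + 1), ∀ j, treeSeries K n v _ j y = graft K j i f) →
      (∃ y : ICGPart K n v (2 * v + 1), ∀ j, treeSeries K n v _ j y = graft K j i g) →
      ∃ y : ICGPart K n v (2 * v + 1), ∀ j, treeSeries K n v _ j y = graft K j i (f + g) := by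
    rintro f g ⟨y, hy⟩ ⟨z, hz⟩
    exact ⟨y + z, fun j => by rw [map_add, map_add, hy, hz]⟩
  have hsmul : ∀ (b : K) (f : Ass K n),
      (∃ y : ICGPart K n v (2 * v + 1), ∀ j, treeSeries K n v _ j y = graft K j i f) →
      ∃ y : ICGPart K n v (2 * v + 1), ∀ j, treeSeries K n v _ j y = graft K j i (b • f) := by
    rintro b f ⟨y, hy⟩
    exact ⟨b • y, fun j => by rw [map_smul, map_smul, hy]⟩
  have hzero : ∃ y : ICGPart K n v (2 * v + 1), ∀ j, treeSeries K n v _ j y = graft K j i 0 :=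
    ⟨0, fun j => by rw [map_zero, map_zero]⟩
  have htree : ∀ P : LTree n v (2 * v + 1), P.edges.Nodup → (∀ f, f ∈ P.edges) →
      P.verts.Nodup → (∀ a, a ∈ P.verts) → P.top ≠ .inl i →
      ∃ y : ICGPart K n v (2 * v + 1), ∀ j, treeSeries K n v _ j y = graft K j i (P.lw K) := by
    intro P h1 h2 h3 h4 h5
    obtain ⟨Γ, hΓ⟩ := P.exists_fits h1 (.inl i)
    have hP : LTree.TreeAt Γ i P := ⟨hΓ, h5, h1, h2, h3, h4⟩
    refine ⟨((sgn P.edges : ℤ) : K) • cls K Γ, fun j => ?_⟩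
    rw [map_smul, treeSeries_cls_of_treeAt hP, hP.lieSeries_eq_graft, smul_smul, ← Int.cast_mul,
      sgn_of_nodup h1, LTree.listSign_mul_self, Int.cast_one, one_smul]
  cases v with
  | zero =>
    have : c = ∑ j, c [j] • X j := by
      ext w
      rw [Ass.sum_apply]
      simp only [Ass.smul_apply, X]
      match w with
      | [] => simp [lie_nil hl]
      | [k] => simp
      | k :: l :: w => rw [hc _ (by simp)]; simp
    rw [this]
    refine Finset.sum_induction _ _ hadd hzero fun j _ => ?_
    by_cases hj : j = i
    · rw [hj, hi, zero_smul]
      exact hzero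
    · refine hsmul _ _ (htree (.leaf 0 j) (List.nodup_singleton _) (fun f =>
        List.mem_singleton.2 (Subsingleton.elim (α := Fin 1) f 0)) List.nodup_nil
        (fun a => a.elim0) ?_)
      exact fun h => hj (Sum.inl.inj h)
  | succ v =>
    have hmem := mem_treeWords hl hc
    clear hl hc hi
    induction hmem using Submodule.span_induction with
    | zero => exact hzero
    | add f g _ _ hf hg => exact hadd f g hf hg
    | smul b f _ hf => exact hsmul b f hf
    | mem f hf =>
      obtain ⟨P, h1, h2, h3, h4, rfl⟩ := hf
      refine htree P h1 h2 h3 h4 ?_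
      cases P with
      | leaf r j => exact absurd (h4 0) List.not_mem_nil
      | node r a s t => exact Sum.inr_ne_inl

/-- The sum over all trees, with all external vertices in turn as roots, counts every tree once for
each of its `v + 2` external ends. -/
theorem exists_treeSeries_eq [CharZero K] {a : Fin n → Ass K n} (ha : ∀ i, a i ∈ lie K n)
    (h : ∑ i, ⁅(X i : Ass K n), a i⁆ = 0) (hv : ∀ i w, w.length ≠ v + 1 → a i w = 0)
    (hi : ∀ i, a i [i] = 0) :
    ∃ y : ICGPart K n v (2 * v + 1), ∀ j, treeSeries K n v _ j y = a j := by
  choose y hy using fun i => exists_treeSeries_eq_graft i (ha i) (hv i) (hi i)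
  refine ⟨((v : K) + 2)⁻¹ • ∑ i, y i, fun j => ?_⟩
  have hsum : ∑ i, graft K j i (a i) = ((v : K) + 2) • a j := by
    have h1 : ∀ i, graft K j i (a i) =
        (if i = j then a i else 0) + adop (partialRight i (a j)) (X i) := by
      intro i
      rw [graft_apply, partialRight_eq_antipode ha h i j, antipode_antipode]
    rw [Finset.sum_congr rfl fun i _ => h1 i, Finset.sum_add_distrib, ← euler_of_mem_lie (ha j),
      Finset.sum_ite_eq' Finset.univ j, if_pos (Finset.mem_univ j)]
    ext w
    rw [Ass.add_apply, Ass.smul_apply, euler_apply]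
    by_cases hw : w.length = v + 1
    · rw [hw]; push_cast; ring
    · rw [hv j w hw]; ring
  have hne : (v : K) + 2 ≠ 0 := by exact_mod_cast (v + 1).succ_ne_zero
  rw [map_smul, map_sum, Finset.sum_congr rfl fun i _ => hy i j, hsum, smul_smul,
    inv_mul_cancel₀ hne, one_smul]

theorem homog_lie_X (m : ℕ) (i : Fin n) (f : Ass K n) :
    homog (m + 1) ⁅(X i : Ass K n), f⁆ = ⁅(X i : Ass K n), homog m f⁆ := by
  have h : ∀ p : ℕ, homog p (X i : Ass K n) = if p = 1 then X i else 0 := by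
    intro p
    ext w
    by_cases hw : w = [i]
    · subst hw
      by_cases hp : p = 1
      · simp [homog_apply, hp]
      · simp [homog_apply, hp, Ne.symm hp, Ass.zero_apply]
    · by_cases hp : p = 1 <;> simp [homog_apply, X, hw, hp, Ass.zero_apply]
  rw [homog_lie, Finset.sum_eq_single (1, m)]
  · rw [h, if_pos rfl]
  · rintro ⟨p, q⟩ hpq hne
    rw [Finset.HasAntidiagonal.mem_antidiagonal] at hpq
    rw [h, if_neg, zero_lie]
    rintro rfl
    exact hne (by simp only [Prod.mk.injEq, true_and]; omega)
  · exact fun hn => absurd (Finset.HasAntidiagonal.mem_antidiagonal.2 (add_comm _ _)) hn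

/-! ### Special derivations without divergence belong to the first level -/

/-- If a combination of trees has divergence zero, its boundary can be cancelled, modulo two loops,
by the boundary of graphs with loops. -/
theorem exists_dPart_sub_mem [CharZero K] (y : ICGPart K n v (2 * v + 1))
    (hy : ∀ w, w.length = v + 1 → cycSum (treeDivergence K n v _ y) w = 0) :
    ∃ z ∈ filtrationPart K 1 n v (2 * v + 1),
      dPart K n v _ (y - z) ∈ filtrationPart K 2 n (v + 1) (2 * v + 1 + 1) := by
  set N := (filtrationPart K 1 n v (2 * v + 1)).map (dPart K n v (2 * v + 1)) ⊔
    filtrationPart K 2 n (v + 1) (2 * v + 1 + 1) with hN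
  have h1 : ∀ x ∈ filtrationPart K 2 n (v + 1) (2 * v + 1 + 1), N.mkQ x = 0 := fun x hx =>
    (Submodule.Quotient.mk_eq_zero N).2 (Submodule.mem_sup_right hx)
  have h2 : ∀ Γ : Graph n v (2 * v + 1), Γ.IsICG → 1 ≤ Γ.loops →
      N.mkQ (dPart K n v _ (cls K Γ)) = 0 := fun Γ _ hl =>
    (Submodule.Quotient.mk_eq_zero N).2 (Submodule.mem_sup_left
      (Submodule.mem_map_of_mem (cls_mem_filtrationPart fun _ => hl)))
  have h3 := dPart_eq (HairyChain.wordMap N.mkQ)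
    (HairyChain.wordMap_mul_comm N.mkQ v.succ_ne_zero) N.mkQ h1 h2
    (fun Γ x L _ _ hL => hL.map_cls_eq N.mkQ h1 h2) rfl y
  rw [HairyChain.wordMap_eq_zero N.mkQ v.succ_ne_zero hy, smul_zero] at h3
  have h4 : dPart K n v _ y ∈ N := (Submodule.Quotient.mk_eq_zero N).1 h3
  obtain ⟨_, ⟨z, hz, rfl⟩, x, hx, h5⟩ := Submodule.mem_sup.1 h4
  refine ⟨z, hz, ?_⟩
  rw [map_sub, ← h5, add_sub_cancel_left]
  exact hx

/-- The trees are corrected degree by degree by graphs with loops, which do not affect the tree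
part. -/
theorem krv_subset_krvLevel_one [CharZero K] : krv K n ⊆ krvLevel K n 1 := by
  rintro u ⟨a, hu, hi, hdiv⟩
  rw [divergence_eq_zero_iff] at hdiv
  have hu' : ∀ i, (u.1 (lieX K i) : Ass K n) = ⁅(X i : Ass K n), (a i : Ass K n)⁆ :=
    fun i => congrArg Subtype.val (hu i)
  have hsum := sum_X_lie_eq_zero u _ hu'
  have hx : ∀ v, ∃ x : ICGPart K n v (2 * v + 1),
      ∀ j, treeSeries K n v _ j x = homog (v + 1) (a j : Ass K n) := by
    intro v
    refine exists_treeSeries_eq (fun i => liePolynomials_le_lie ((a i).2 (v + 1))) ?_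
      (fun i w hw => if_neg hw) fun i => ?_
    · have h := congrArg (homog (v + 1 + 1)) hsum
      rw [map_sum, map_zero] at h
      rw [← h]
      exact Finset.sum_congr rfl fun i _ => (homog_lie_X (v + 1) i _).symm
    · rw [homog_apply, hi, ite_self]
  choose x hx using hx
  have hz : ∀ v, ∃ z ∈ filtrationPart K 1 n v (2 * v + 1),
      dPart K n v _ (x v - z) ∈ filtrationPart K 2 n (v + 1) (2 * v + 1 + 1) := by
    intro v
    refine exists_dPart_sub_mem (x v) fun w hw => ?_
    have h : cycSum (divergenceSeries fun j => (a j : Ass K n)) w = 0 := by rw [hdiv]; rfl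
    refine Eq.trans ?_ h
    rw [treeDivergence_apply, cycSum_apply, cycSum_apply]
    refine Finset.sum_congr rfl fun k _ => divergenceSeries_congr (m := v + 1) (fun j w hw => ?_)
      (by rw [List.length_rotate, hw])
    rw [hx, homog_apply, if_pos hw]
  choose z hz hd using hz
  refine mem_krvLevel_iff.2 ⟨fun v => x v - z v, hd, fun i => ?_⟩
  rw [hu']
  congr 1
  ext w
  rcases hw : w.length with - | v
  · rw [List.length_eq_zero_iff.1 hw, totalSeries_nil, lie_nil (a i).2]
  · rw [totalSeries_apply _ i hw, map_sub, treeSeries_mem_filtrationPart (hz v), sub_zero, hx,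
      homog_apply, if_pos hw]

end KRV

theorem mainTheorem4 (K : Type*) [Field K] [CharZero K] (n : ℕ) :
    (∀ k : ℕ, 1 ≤ k → ∃ L : LieSubalgebra K (KRV.sder K n),
      (L : Set (KRV.sder K n)) = KRV.krvLevel K n k) ∧
    KRV.krvLevel K n 1 = KRV.krv K n ∧
    (∀ k : ℕ, 1 ≤ k → KRV.krvLevel K n (k + 1) ⊆ KRV.krvLevel K n k) :=
  ⟨fun k _ => ⟨KRV.krvLevelSubalgebra K n k, rfl⟩,
    KRV.krvLevel_one_subset.antisymm KRV.krv_subset_krvLevel_one,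
    fun k _ => KRV.krvLevel_succ_subset k⟩
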